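/- Let $k$ be a field of characteristic $0$ and let $q\in k^\times$ be not a root of unity. Put $[n]=\dfrac{q^n-(-q)^{-n}}{q+q^{-1}}$ for $n\in\mathbb Z$ and $\delta=-[2]=-(q-q^{-1})$. A superspace is a $\mathbb Z/2$-graded $k$-vector space; supercategories are enriched in superspaces, tensor products of maps follow the sign rule $(f\otimes g)(v\otimes w)=(-1)^{|g||v|}f(v)\otimes g(w)$, and monoidal supercategories satisfy the super interchange law $(f\otimes g)\circ(h\otimes l)=(-1)^{|g||h|}(f\circ h)\otimes(g\circ l)$. Monoidal superfunctors are strong, with even coherence isomorphisms, and equality of monoidal superfunctors includes equality of these isomorphisms. **The category $\mathcal{STL}(\delta)$.** This is the strict monoidal supercategory generated by one object, whose $n$-th tensor power is written $n$ (so the unit object is $0$), and two odd morphisms $\mathrm{cup}\colon 0\to 2$ and $\mathrm{cap}\colon 2\to 0$, subject to $$(\mathrm{cap}\otimes \mathrm{id}_1)\circ(\mathrm{id}_1\otimes\mathrm{cup})=\mathrm{id}_1,\qquad(\mathrm{id}_1\otimes\mathrm{cap})\circ(\mathrm{cup}\otimes \mathrm{id}_1)=-\mathrm{id}_1,\qquad\mathrm{cap}\circ\mathrm{cup}=\delta\,\mathrm{id}_0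 .$$ **The category $\mathcal C$.** Let $U=\dot U_q(\mathfrak{osp}_{1|2})$ be the locally unital superalgebra with even distinguished orthogonal idempotents $1_n$ ($n\in\mathbb Z$) and odd generators $E_n\in 1_{n+2}U1_n$, $F_n\in 1_{n-2}U1_n$, subject to the relations $E_{n-2}F_n+F_{n+2}E_n=[n]1_n$. Let $\mathcal C$ be the supercategory of finite-dimensional left $U$-supermodules $M$ with $M=\bigoplus_n 1_nM$, with all (even and odd) $U$-supermodule homomorphisms as morphisms. It is a monoidal supercategory: $U$ acts on $M\otimes N$ through $$\Delta(1_n)=\sum_{a+b=n}1_a\otimes1_b,\quad \Delta(E_n)=\sum_{a+b=n}\bigl(E_a\otimes1_b+q^{-a}1_a\otimes E_b\bigr),\quad \Delta(F_n)=\sum_{a+b=n}\bigl((-1)^a1_a\otimes F_b+q^bF_a\otimes1_b\bigr)$$ (on each vector only finitely many terms act by nonzero operators), and on the unit object $k$ by $1_n\mapsto\delta_{n,0}$, $E_n,F_n\mapsto0$. Let $\nu\colon\mathcal C\to\mathcal{SV}ec$ be the forgetful monoidal superfunctor to superspaces. Let $V=V(1)\in\mathcal C$ have the basis $v_1$ (even),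 $v_{-1}$ (odd), with $1_iv_i=v_i$, $E_{-1}v_{-1}=v_1$, $F_1v_1=v_{-1}$, and all other $1_n,E_n,F_n$ acting on these basis vectors by zero. **The functor $G$.** Let $G\colon\mathcal{STL}(\delta)\to\mathcal{SV}ec$ be the monoidal superfunctor with $G(n)=V^{\otimes n}$ (underlying superspaces), with $$G(\mathrm{cup})\colon 1\mapsto v_{-1}\otimes v_1-q\,v_1\otimes v_{-1},$$ $$G(\mathrm{cap})\colon v_1\otimes v_{-1}\mapsto1,\quad v_{-1}\otimes v_1\mapsto q^{-1},\quad v_1\otimes v_1\mapsto 0,\quad v_{-1}\otimes v_{-1}\mapsto0,$$ and with the canonical coherence isomorphisms $k\cong G(0)$ and $V^{\otimes m}\otimes V^{\otimes n}\cong V^{\otimes(m+n)}$. **Envelopes.** For a supercategory or monoidal supercategory $\mathcal A$, let $\underline{\mathcal A}$ be its underlying category, with the same objects and only the even morphisms. The $\Pi$-envelope $\mathcal A_\Pi$ has objects $\Pi^aX$ ($X\in\mathcal A$, $a\in\mathbb Z/2$) and $\mathrm{Hom}(\Pi^aX,\Pi^bY)=\mathrm{Hom}_{\mathcal A}(X,Y)$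 with parity shifted by $a+b$ (write $f_a^b$ for the morphism given by $f$); it contains $\mathcal A$ through $X\mapsto\Pi^0X$, and it is again monoidal, with $\Pi^aX\otimes\Pi^bY=\Pi^{a+b}(X\otimes Y)$ and $f_a^b\otimes g_c^d=(-1)^{a|g|+|f|d+ad+ac}(f\otimes g)_{a+c}^{b+d}$, where $|f|,|g|$ are the parities in $\mathcal A$. Let $\mathrm{SKar}(\mathcal A)$ be the idempotent completion of the additive envelope of $\underline{\mathcal A_\Pi}$, a monoidal category. **Theorem.** (1) There is a unique monoidal superfunctor $F\colon\mathcal{STL}(\delta)\to\mathcal C$ such that $F(1)=V(1)$ and $G=\nu\circ F$. (2) $F$ induces a monoidal equivalence $\tilde F\colon\mathrm{SKar}(\mathcal{STL}(\delta))\to\underline{\mathcal C}$. That is, $F$ extends, up to even monoidal isomorphism, to a monoidal superfunctor $F'\colon\mathcal{STL}(\delta)_\Pi\to\mathcal C$, and the monoidal functor $\underline{F'}\colon\underline{\mathcal{STL}(\delta)_\Pi}\to\underline{\mathcal C}$ extends, up to monoidal natural isomorphism, to an additive monoidal functor $\tilde F\colon\mathrm{SKar}(\mathcal{STL}(\delta))\to\underline{\mathcal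 C}$ that is an equivalence of categories. -/

import Mathlib

open CategoryTheory MonoidalCategory

universe u v v' v'' w w' w''

/-! ## Superspaces -/

/-- The sign `(-1)^a` for a parity `a`, as a scalar. -/
def superSign (k : Type u) [Field k] (a : ZMod 2) : k := if a = 0 then 1 else -1

/-- A `ℤ/2`-grading `M = M₀ ⊕ M₁` on a vector space. -/
@[ext]
structure SuperGrading (k : Type u) [Field k] (M : Type v) [AddCommGroup M] [Module k M] where
  part : ZMod 2 → Submodule k M
  isCompl : IsCompl (part 0) (part 1)

section Sign

variable {k : Type u} [Field k]

@[simp] theorem superSign_zero : superSign k 0 = 1 := if_pos rfl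
@[simp] theorem superSign_one : superSign k 1 = -1 := if_neg (by decide)

theorem zmod2_cases (a : ZMod 2) : a = 0 ∨ a = 1 := by
  revert a; decide

theorem zmod2_add_self (a : ZMod 2) : a + a = 0 := by
  revert a; decide

theorem superSign_add (a b : ZMod 2) : superSign k (a + b) = superSign k a * superSign k b := by
  have h : (1 + 1 : ZMod 2) = 0 := by decide
  rcases zmod2_cases a with rfl | rfl <;> rcases zmod2_cases b with rfl | rfl <;> simp [h]

theorem envelope_sign_identity {R : Type*} [CommRing R] (h2 : (2 : R) = 0)
    (a b c d d' p r s t : R) :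
    a * s + (r + a + b) * d + a * d + a * c + (b * (p + d + d') + t * d' + b * d' + b * d) +
        (p + d + d') * (r + a + b) =
      p * r + (a * (s + (p + d + d')) + (r + a + b + t) * d' + a * d' + a * c) := by
  grind

end Sign

namespace SuperGrading

variable {k : Type u} [Field k] {M : Type v} [AddCommGroup M] [Module k M] (G : SuperGrading k M)

/-- The projection of `M` onto its homogeneous part of parity `p`. -/
noncomputable def proj (p : ZMod 2) : M →ₗ[k] M :=
  if p = 0 then Submodule.projection (G.part 0) (G.part 1) G.isCompl else Submodule.projection (G.part 1) (G.part 0) G.isCompl.symm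

theorem proj_zero : G.proj 0 = Submodule.projection (G.part 0) (G.part 1) G.isCompl := if_pos rfl
theorem proj_one : G.proj 1 = Submodule.projection (G.part 1) (G.part 0) G.isCompl.symm := if_neg (by decide)

theorem proj_mem (p : ZMod 2) (m : M) : G.proj p m ∈ G.part p := by
  rcases zmod2_cases p with rfl | rfl
  · rw [proj_zero]; exact Submodule.projection_apply_mem _ _
  · rw [proj_one]; exact Submodule.projection_apply_mem _ _

theorem proj_add_proj (m : M) : G.proj 0 m + G.proj 1 m = m := by
  rw [proj_zero, proj_one]
  exact Submodule.projection_add_projection_eq_self _ _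

theorem proj_of_mem {p : ZMod 2} {m : M} (h : m ∈ G.part p) : G.proj p m = m := by
  rcases zmod2_cases p with rfl | rfl
  · rw [proj_zero]; exact (Submodule.projection_eq_self_iff _ _).2 h
  · rw [proj_one]; exact (Submodule.projection_eq_self_iff _ _).2 h

theorem proj_of_mem_ne {p r : ZMod 2} {m : M} (h : m ∈ G.part p) (hr : r ≠ p) :
    G.proj r m = 0 := by
  have h1 := G.proj_add_proj m
  rcases zmod2_cases p with rfl | rfl <;> rcases zmod2_cases r with rfl | rfl
  · exact absurd rfl hr
  · rw [G.proj_of_mem h] at h1; simpa using h1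
  · rw [G.proj_of_mem h] at h1; simpa using h1
  · exact absurd rfl hr

theorem proj_of_mem' {p : ZMod 2} (r : ZMod 2) {m : M} (h : m ∈ G.part p) :
    G.proj r m = if r = p then m else 0 := by
  split_ifs with hr
  · subst hr; exact G.proj_of_mem h
  · exact G.proj_of_mem_ne h hr

/-- To prove an additive property of all vectors, it is enough to treat homogeneous ones. -/
theorem induction {C : M → Prop} (hom : ∀ p, ∀ m ∈ G.part p, C m)
    (add : ∀ m n, C m → C n → C (m + n)) (m : M) : C m := by
  rw [← G.proj_add_proj m]
  exact add _ _ (hom _ _ (G.proj_mem _ _)) (hom _ _ (G.proj_mem _ _))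

/-- A constructor for gradings, from the parts and the projections onto them. -/
def ofProj (part : ZMod 2 → Submodule k M) (Q : ZMod 2 → M →ₗ[k] M)
    (mem : ∀ p m, Q p m ∈ part p) (sum : ∀ m, Q 0 m + Q 1 m = m)
    (zero : ∀ p m, m ∈ part p → Q (p + 1) m = 0) : SuperGrading k M where
  part := part
  isCompl := by
    constructor
    · rw [Submodule.disjoint_def]
      intro m h0 h1
      have e1 := zero 0 m h0
      have e0 := zero 1 m h1
      rw [show (1 + 1 : ZMod 2) = 0 by decide] at e0
      rw [zero_add] at e1
      rw [← sum m, e0, e1, add_zero]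
    · rw [codisjoint_iff, eq_top_iff]
      intro m _
      rw [← sum m]
      exact Submodule.add_mem_sup (mem 0 m) (mem 1 m)

end SuperGrading

/-! ## Supercategories and monoidal supercategories -/

/-- A supercategory: a `k`-linear category all of whose morphism spaces are superspaces, in such
a way that composition is even. -/
class Supercategory (k : Type u) [Field k] (A : Type w) [Category.{v} A] [Preadditive A]
    [Linear k A] where
  gr : ∀ X Y : A, SuperGrading k (X ⟶ Y)
  id_mem : ∀ X : A, 𝟙 X ∈ (gr X X).part 0
  comp_mem : ∀ {X Y Z : A} {p r : ZMod 2} {f : X ⟶ Y} {g : Y ⟶ Z},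
    f ∈ (gr X Y).part p → g ∈ (gr Y Z).part r → f ≫ g ∈ (gr X Z).part (p + r)

/-- `HomParity k p f` says that the morphism `f` of a supercategory is homogeneous of parity
`p`. -/
def HomParity (k : Type u) [Field k] {A : Type w} [Category.{v} A] [Preadditive A]
    [Linear k A] [Supercategory k A] (p : ZMod 2) {X Y : A} (f : X ⟶ Y) : Prop :=
  f ∈ (Supercategory.gr (k := k) X Y).part p

/-- A monoidal supercategory. The tensor product is a superfunctor `A ⊠ A ⥤ A`: it is bilinear
and even on morphisms, preserves identities, and satisfies the super interchange law. The coherence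
maps are even and natural, and satisfy the pentagon and triangle axioms. (In diagrammatic
order, `h ≫ f` is `f ∘ h`.) -/
class MonoidalSupercategory (k : Type u) [Field k] (A : Type w) [Category.{v} A] [Preadditive A]
    [Linear k A] [Supercategory k A] [MonoidalCategoryStruct A] : Prop where
  add_tensor : ∀ {X₁ Y₁ X₂ Y₂ : A} (f f' : X₁ ⟶ Y₁) (g : X₂ ⟶ Y₂),
    (f + f') ⊗ₘ g = f ⊗ₘ g + f' ⊗ₘ g
  tensor_add : ∀ {X₁ Y₁ X₂ Y₂ : A} (f : X₁ ⟶ Y₁) (g g' : X₂ ⟶ Y₂),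
    f ⊗ₘ (g + g') = f ⊗ₘ g + f ⊗ₘ g'
  smul_tensor : ∀ {X₁ Y₁ X₂ Y₂ : A} (c : k) (f : X₁ ⟶ Y₁) (g : X₂ ⟶ Y₂),
    (c • f) ⊗ₘ g = c • (f ⊗ₘ g)
  tensor_smul : ∀ {X₁ Y₁ X₂ Y₂ : A} (c : k) (f : X₁ ⟶ Y₁) (g : X₂ ⟶ Y₂),
    f ⊗ₘ (c • g) = c • (f ⊗ₘ g)
  tensor_parity : ∀ {X₁ Y₁ X₂ Y₂ : A} {p r : ZMod 2} {f : X₁ ⟶ Y₁} {g : X₂ ⟶ Y₂},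
    HomParity k p f → HomParity k r g → HomParity k (p + r) (f ⊗ₘ g)
  id_tensor_id : ∀ X Y : A, 𝟙 X ⊗ₘ 𝟙 Y = 𝟙 (X ⊗ Y)
  interchange : ∀ {X₁ Y₁ Z₁ X₂ Y₂ Z₂ : A} {p r : ZMod 2}
    (h : X₁ ⟶ Y₁) (l : X₂ ⟶ Y₂) (f : Y₁ ⟶ Z₁) (g : Y₂ ⟶ Z₂),
    HomParity k p g → HomParity k r h →
    (h ⊗ₘ l) ≫ (f ⊗ₘ g) = superSign k (p * r) • ((h ≫ f) ⊗ₘ (l ≫ g))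
  whiskerLeft_eq : ∀ (X : A) {Y Z : A} (f : Y ⟶ Z), X ◁ f = 𝟙 X ⊗ₘ f
  whiskerRight_eq : ∀ {X Y : A} (f : X ⟶ Y) (Z : A), f ▷ Z = f ⊗ₘ 𝟙 Z
  associator_even : ∀ X Y Z : A, HomParity k 0 (α_ X Y Z).hom
  associator_inv_even : ∀ X Y Z : A, HomParity k 0 (α_ X Y Z).inv
  leftUnitor_even : ∀ X : A, HomParity k 0 (λ_ X).hom
  leftUnitor_inv_even : ∀ X : A, HomParity k 0 (λ_ X).inv
  rightUnitor_even : ∀ X : A, HomParity k 0 (ρ_ X).hom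
  rightUnitor_inv_even : ∀ X : A, HomParity k 0 (ρ_ X).inv
  associator_natural : ∀ {X₁ X₂ X₃ Y₁ Y₂ Y₃ : A} (f₁ : X₁ ⟶ Y₁) (f₂ : X₂ ⟶ Y₂) (f₃ : X₃ ⟶ Y₃),
    ((f₁ ⊗ₘ f₂) ⊗ₘ f₃) ≫ (α_ Y₁ Y₂ Y₃).hom = (α_ X₁ X₂ X₃).hom ≫ (f₁ ⊗ₘ (f₂ ⊗ₘ f₃))
  leftUnitor_natural : ∀ {X Y : A} (f : X ⟶ Y),
    (𝟙 (𝟙_ A) ⊗ₘ f) ≫ (λ_ Y).hom = (λ_ X).hom ≫ f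
  rightUnitor_natural : ∀ {X Y : A} (f : X ⟶ Y),
    (f ⊗ₘ 𝟙 (𝟙_ A)) ≫ (ρ_ Y).hom = (ρ_ X).hom ≫ f
  pentagon : ∀ W X Y Z : A,
    ((α_ W X Y).hom ⊗ₘ 𝟙 Z) ≫ (α_ W (X ⊗ Y) Z).hom ≫ (𝟙 W ⊗ₘ (α_ X Y Z).hom) =
      (α_ (W ⊗ X) Y Z).hom ≫ (α_ W X (Y ⊗ Z)).hom
  triangle : ∀ X Y : A,
    (α_ X (𝟙_ A) Y).hom ≫ (𝟙 X ⊗ₘ (λ_ Y).hom) = (ρ_ X).hom ⊗ₘ 𝟙 Y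

section Functors

variable (k : Type u) [Field k]
variable (A : Type w) [Category.{v} A] [Preadditive A] [Linear k A] [Supercategory k A]
  [MonoidalCategoryStruct A]
variable (B : Type w') [Category.{v'} B] [Preadditive B] [Linear k B] [Supercategory k B]
  [MonoidalCategoryStruct B]

/-- A (strong) monoidal superfunctor: a functor which is linear and even on morphism spaces,
together with even natural coherence isomorphisms `μ` and `ε`. -/
@[ext]
structure MonoidalSuperfunctor extends A ⥤ B where
  map_add : ∀ {X Y : A} (f g : X ⟶ Y), map (f + g) = map f + map g
  map_smul : ∀ {X Y : A} (c : k) (f : X ⟶ Y), map (c • f) = c • map f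
  map_parity : ∀ {X Y : A} {p : ZMod 2} {f : X ⟶ Y}, HomParity k p f → HomParity k p (map f)
  μ : ∀ X Y : A, obj X ⊗ obj Y ≅ obj (X ⊗ Y)
  ε : 𝟙_ B ≅ obj (𝟙_ A)
  μ_even : ∀ X Y : A, HomParity k 0 (μ X Y).hom
  μ_inv_even : ∀ X Y : A, HomParity k 0 (μ X Y).inv
  ε_even : HomParity k 0 ε.hom
  ε_inv_even : HomParity k 0 ε.inv
  μ_natural : ∀ {X₁ Y₁ X₂ Y₂ : A} (f : X₁ ⟶ Y₁) (g : X₂ ⟶ Y₂),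
    (map f ⊗ₘ map g) ≫ (μ Y₁ Y₂).hom = (μ X₁ X₂).hom ≫ map (f ⊗ₘ g)
  associativity : ∀ X Y Z : A,
    ((μ X Y).hom ⊗ₘ 𝟙 (obj Z)) ≫ (μ (X ⊗ Y) Z).hom ≫ map (α_ X Y Z).hom =
      (α_ (obj X) (obj Y) (obj Z)).hom ≫ (𝟙 (obj X) ⊗ₘ (μ Y Z).hom) ≫ (μ X (Y ⊗ Z)).hom
  left_unitality : ∀ X : A,
    (λ_ (obj X)).hom = (ε.hom ⊗ₘ 𝟙 (obj X)) ≫ (μ (𝟙_ A) X).hom ≫ map (λ_ X).hom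
  right_unitality : ∀ X : A,
    (ρ_ (obj X)).hom = (𝟙 (obj X) ⊗ₘ ε.hom) ≫ (μ X (𝟙_ A)).hom ≫ map (ρ_ X).hom

variable {k A B}

/-- `F` and `G` are isomorphic via a monoidal natural isomorphism: an even
supernatural isomorphism compatible with the coherence maps. -/
def MonoidalSuperfunctor.IsoTo (F G : MonoidalSuperfunctor k A B) : Prop :=
  ∃ x : ∀ X : A, F.obj X ≅ G.obj X,
    (∀ X, HomParity k 0 (x X).hom) ∧
    (∀ {X Y : A} (f : X ⟶ Y), F.map f ≫ (x Y).hom = (x X).hom ≫ G.map f) ∧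
    (∀ X Y : A, (F.μ X Y).hom ≫ (x (X ⊗ Y)).hom =
      ((x X).hom ⊗ₘ (x Y).hom) ≫ (G.μ X Y).hom) ∧
    F.ε.hom ≫ (x (𝟙_ A)).hom = G.ε.hom

end Functors

section Even

variable {k : Type u} [Field k]
variable {A : Type w} [Category.{v} A] [Preadditive A] [Linear k A] [Supercategory k A]

theorem HomParity.id (X : A) : HomParity k 0 (𝟙 X) := Supercategory.id_mem X

theorem HomParity.cast {X Y : A} {p r : ZMod 2} {f : X ⟶ Y} (h : HomParity k p f) (e : p = r) :
    HomParity k r f := e ▸ h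

theorem HomParity.comp {p r : ZMod 2} {X Y Z : A} {f : X ⟶ Y} {g : Y ⟶ Z}
    (hf : HomParity k p f) (hg : HomParity k r g) : HomParity k (p + r) (f ≫ g) :=
  Supercategory.comp_mem hf hg

theorem HomParity.comp0 {X Y Z : A} {f : X ⟶ Y} {g : Y ⟶ Z}
    (hf : HomParity k 0 f) (hg : HomParity k 0 g) : HomParity k 0 (f ≫ g) := by
  simpa using hf.comp hg

variable [MonoidalCategoryStruct A] [MonoidalSupercategory k A]

theorem HomParity.tensor0 {X₁ Y₁ X₂ Y₂ : A} {f : X₁ ⟶ Y₁} {g : X₂ ⟶ Y₂}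
    (hf : HomParity k 0 f) (hg : HomParity k 0 g) : HomParity k 0 (f ⊗ₘ g) := by
  simpa using MonoidalSupercategory.tensor_parity hf hg

theorem tensor_comp_of_left {X₁ Y₁ Z₁ X₂ Y₂ Z₂ : A}
    {h : X₁ ⟶ Y₁} (l : X₂ ⟶ Y₂) (f : Y₁ ⟶ Z₁) (g : Y₂ ⟶ Z₂) (hh : HomParity k 0 h) :
    (h ⊗ₘ l) ≫ (f ⊗ₘ g) = (h ≫ f) ⊗ₘ (l ≫ g) := by
  revert g
  refine (Supercategory.gr (k := k) Y₂ Z₂).induction ?_ ?_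
  · intro p g hg
    rw [MonoidalSupercategory.interchange (k := k) h l f g hg hh]; simp
  · intro g g' e e'
    rw [MonoidalSupercategory.tensor_add k, Preadditive.comp_add, e, e', Preadditive.comp_add,
      MonoidalSupercategory.tensor_add k]

theorem tensor_comp_of_right {X₁ Y₁ Z₁ X₂ Y₂ Z₂ : A}
    (h : X₁ ⟶ Y₁) (l : X₂ ⟶ Y₂) (f : Y₁ ⟶ Z₁) {g : Y₂ ⟶ Z₂} (hg : HomParity k 0 g) :
    (h ⊗ₘ l) ≫ (f ⊗ₘ g) = (h ≫ f) ⊗ₘ (l ≫ g) := by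
  revert h
  refine (Supercategory.gr (k := k) X₁ Y₁).induction ?_ ?_
  · intro p h hh
    rw [MonoidalSupercategory.interchange (k := k) h l f g hg hh]; simp
  · intro g g' e e'
    rw [MonoidalSupercategory.add_tensor k, Preadditive.add_comp, e, e', Preadditive.add_comp,
      MonoidalSupercategory.add_tensor k]

theorem zero_tensorHom (k : Type u) [Field k] {A : Type w} [Category.{v} A] [Preadditive A]
    [Linear k A] [Supercategory k A] [MonoidalCategoryStruct A] [MonoidalSupercategory k A]
    {X Y X' Y' : A} (g : X' ⟶ Y') : (0 : X ⟶ Y) ⊗ₘ g = 0 := by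
  have := MonoidalSupercategory.smul_tensor (0 : k) (0 : X ⟶ Y) g
  rw [zero_smul, zero_smul] at this
  exact this

theorem tensorHom_zero (k : Type u) [Field k] {A : Type w} [Category.{v} A] [Preadditive A]
    [Linear k A] [Supercategory k A] [MonoidalCategoryStruct A] [MonoidalSupercategory k A]
    {X Y X' Y' : A} (f : X ⟶ Y) : f ⊗ₘ (0 : X' ⟶ Y') = 0 := by
  have := MonoidalSupercategory.tensor_smul (0 : k) f (0 : X' ⟶ Y')
  rw [zero_smul, zero_smul] at this
  exact this

end Even

section Comp

variable {k : Type u} [Field k]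
variable {A : Type w} [Category.{v} A] [Preadditive A] [Linear k A] [Supercategory k A]
  [MonoidalCategoryStruct A]
variable {B : Type w'} [Category.{v'} B] [Preadditive B] [Linear k B] [Supercategory k B]
  [MonoidalCategoryStruct B]
variable {C : Type w''} [Category.{v''} C] [Preadditive C] [Linear k C] [Supercategory k C]
  [MonoidalCategoryStruct C] [MonoidalSupercategory k C]

/-- Composition of monoidal superfunctors: `F.comp H` is "`H ∘ F`". -/
def MonoidalSuperfunctor.comp (F : MonoidalSuperfunctor k A B) (H : MonoidalSuperfunctor k B C) :
    MonoidalSuperfunctor k A C where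
  toFunctor := F.toFunctor ⋙ H.toFunctor
  map_add f g := by simp [F.map_add, H.map_add]
  map_smul c f := by simp [F.map_smul, H.map_smul]
  map_parity h := H.map_parity (F.map_parity h)
  μ X Y := H.μ (F.obj X) (F.obj Y) ≪≫ H.mapIso (F.μ X Y)
  ε := H.ε ≪≫ H.mapIso F.ε
  μ_even X Y := (H.μ_even _ _).comp0 (H.map_parity (F.μ_even _ _))
  μ_inv_even X Y := (H.map_parity (F.μ_inv_even _ _)).comp0 (H.μ_inv_even _ _)
  ε_even := H.ε_even.comp0 (H.map_parity F.ε_even)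
  ε_inv_even := (H.map_parity F.ε_inv_even).comp0 H.ε_inv_even
  μ_natural f g := by
    simp only [Functor.comp_map, Iso.trans_hom, Functor.mapIso_hom, Category.assoc]
    rw [← Category.assoc, H.μ_natural, Category.assoc, ← H.map_comp, F.μ_natural, H.map_comp]
  associativity X Y Z := by
    simp only [Functor.comp_map, Functor.comp_obj, Iso.trans_hom, Functor.mapIso_hom,
      Category.assoc]
    have e1 : ((H.μ (F.obj X) (F.obj Y)).hom ≫ H.map (F.μ X Y).hom) ⊗ₘ 𝟙 (H.obj (F.obj Z)) =
        ((H.μ (F.obj X) (F.obj Y)).hom ⊗ₘ 𝟙 _) ≫ (H.map (F.μ X Y).hom ⊗ₘ H.map (𝟙 (F.obj Z))) := by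
      rw [tensor_comp_of_left (k := k) _ _ _ (H.μ_even _ _)]; simp
    have e2 : 𝟙 (H.obj (F.obj X)) ⊗ₘ ((H.μ (F.obj Y) (F.obj Z)).hom ≫ H.map (F.μ Y Z).hom) =
        (𝟙 _ ⊗ₘ (H.μ (F.obj Y) (F.obj Z)).hom) ≫ (H.map (𝟙 (F.obj X)) ⊗ₘ H.map (F.μ Y Z).hom) := by
      rw [tensor_comp_of_left (k := k) _ _ _ (HomParity.id _)]; simp
    rw [e1, e2]
    simp only [Category.assoc]
    rw [← Category.assoc (H.map _ ⊗ₘ H.map _), H.μ_natural, ← Category.assoc (H.map _ ⊗ₘ H.map _),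
      H.μ_natural]
    simp only [Category.assoc]
    rw [← H.map_comp, ← H.map_comp, F.associativity, H.map_comp, H.map_comp]
    rw [← Category.assoc (H.μ _ _).hom, ← Category.assoc (_ ⊗ₘ _), H.associativity]
    simp only [Category.assoc]
  left_unitality X := by
    simp only [Functor.comp_map, Functor.comp_obj, Iso.trans_hom, Functor.mapIso_hom,
      Category.assoc]
    have e1 : (H.ε.hom ≫ H.map F.ε.hom) ⊗ₘ 𝟙 (H.obj (F.obj X)) =
        (H.ε.hom ⊗ₘ 𝟙 _) ≫ (H.map F.ε.hom ⊗ₘ H.map (𝟙 (F.obj X))) := by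
      rw [tensor_comp_of_left (k := k) _ _ _ H.ε_even]; simp
    rw [e1]
    simp only [Category.assoc]
    rw [← Category.assoc (H.map _ ⊗ₘ H.map _), H.μ_natural, H.left_unitality, F.left_unitality]
    simp
  right_unitality X := by
    simp only [Functor.comp_map, Functor.comp_obj, Iso.trans_hom, Functor.mapIso_hom,
      Category.assoc]
    have e1 : 𝟙 (H.obj (F.obj X)) ⊗ₘ (H.ε.hom ≫ H.map F.ε.hom) =
        (𝟙 _ ⊗ₘ H.ε.hom) ≫ (H.map (𝟙 (F.obj X)) ⊗ₘ H.map F.ε.hom) := by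
      rw [tensor_comp_of_left (k := k) _ _ _ (HomParity.id _)]; simp
    rw [e1]
    simp only [Category.assoc]
    rw [← Category.assoc (H.map _ ⊗ₘ H.map _), H.μ_natural, H.right_unitality, F.right_unitality]
    simp

end Comp

/-! ## The underlying monoidal category -/

/-- The underlying category of a supercategory: the same objects, but only the even morphisms. -/
structure Underlying (k : Type u) (A : Type w) where
  of : A

namespace Underlying

section Cat

variable {k : Type u} [Field k]
variable {A : Type w} [Category.{v} A] [Preadditive A] [Linear k A] [Supercategory k A]

instance : Category.{v} (Underlying k A) where
  Hom X Y := ((Supercategory.gr (k := k) X.of Y.of).part 0 : Submodule k (X.of ⟶ Y.of))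
  id X := ⟨𝟙 X.of, HomParity.id _⟩
  comp f g := ⟨f.1 ≫ g.1, HomParity.comp0 f.2 g.2⟩

/-- The even morphism underlying a morphism of the underlying category. -/
def val {X Y : Underlying k A} (f : X ⟶ Y) : X.of ⟶ Y.of := f.1

/-- An even morphism, as a morphism of the underlying category. -/
def mk' {X Y : Underlying k A} (f : X.of ⟶ Y.of) (hf : HomParity k 0 f) : X ⟶ Y := ⟨f, hf⟩

@[simp] theorem val_mk' {X Y : Underlying k A} (f : X.of ⟶ Y.of) (hf : HomParity k 0 f) :
    val (mk' f hf : X ⟶ Y) = f := rfl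

theorem val_even {X Y : Underlying k A} (f : X ⟶ Y) : HomParity k 0 (val f) := f.2

@[ext] theorem hom_ext {X Y : Underlying k A} {f g : X ⟶ Y} (h : val f = val g) : f = g :=
  Subtype.ext h

@[simp] theorem val_id (X : Underlying k A) : val (𝟙 X) = 𝟙 X.of := rfl
@[simp] theorem val_comp {X Y Z : Underlying k A} (f : X ⟶ Y) (g : Y ⟶ Z) :
    val (f ≫ g) = val f ≫ val g := rfl

instance : Preadditive (Underlying k A) where
  homGroup X Y := inferInstanceAs
    (AddCommGroup ((Supercategory.gr (k := k) X.of Y.of).part 0 : Submodule k (X.of ⟶ Y.of)))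
  add_comp _ _ _ _ _ _ := Subtype.ext (Preadditive.add_comp _ _ _ _ _ _)
  comp_add _ _ _ _ _ _ := Subtype.ext (Preadditive.comp_add _ _ _ _ _ _)

@[simp] theorem val_add {X Y : Underlying k A} (f g : X ⟶ Y) : val (f + g) = val f + val g := rfl
@[simp] theorem val_zero {X Y : Underlying k A} : val (0 : X ⟶ Y) = 0 := rfl

/-- An isomorphism all of whose data is even, as an isomorphism of the underlying category. -/
@[simps]
def mkIso {X Y : Underlying k A} (e : X.of ≅ Y.of) (h : HomParity k 0 e.hom)
    (h' : HomParity k 0 e.inv) : X ≅ Y where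
  hom := mk' e.hom h
  inv := mk' e.inv h'
  hom_inv_id := by ext; simp
  inv_hom_id := by ext; simp

end Cat

section Monoidal

variable {k : Type u} [Field k]
variable {A : Type w} [Category.{v} A] [Preadditive A] [Linear k A] [Supercategory k A]
  [MonoidalCategoryStruct A] [MonoidalSupercategory k A]

open MonoidalSupercategory

instance : MonoidalCategoryStruct (Underlying k A) where
  tensorObj X Y := ⟨X.of ⊗ Y.of⟩
  tensorHom f g := mk' (val f ⊗ₘ val g) (HomParity.tensor0 (val_even f) (val_even g))
  whiskerLeft X _ _ f := mk' (𝟙 X.of ⊗ₘ val f) (HomParity.tensor0 (HomParity.id _) (val_even f))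
  whiskerRight f Y := mk' (val f ⊗ₘ 𝟙 Y.of) (HomParity.tensor0 (val_even f) (HomParity.id _))
  tensorUnit := ⟨𝟙_ A⟩
  associator X Y Z := mkIso (α_ X.of Y.of Z.of) (associator_even _ _ _) (associator_inv_even _ _ _)
  leftUnitor X := mkIso (λ_ X.of) (leftUnitor_even _) (leftUnitor_inv_even _)
  rightUnitor X := mkIso (ρ_ X.of) (rightUnitor_even _) (rightUnitor_inv_even _)

theorem val_tensorHom {X Y X' Y' : Underlying k A} (f : X ⟶ Y) (g : X' ⟶ Y') :
    val (f ⊗ₘ g) = val f ⊗ₘ val g := rfl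
theorem val_whiskerLeft (X : Underlying k A) {Y Y' : Underlying k A} (g : Y ⟶ Y') :
    val (X ◁ g) = 𝟙 X.of ⊗ₘ val g := rfl
theorem val_whiskerRight {X X' : Underlying k A} (g : X ⟶ X') (Y : Underlying k A) :
    val (g ▷ Y) = val g ⊗ₘ 𝟙 Y.of := rfl
theorem val_associator_hom (X Y Z : Underlying k A) :
    val (α_ X Y Z).hom = (α_ X.of Y.of Z.of).hom := rfl
theorem val_associator_inv (X Y Z : Underlying k A) :
    val (α_ X Y Z).inv = (α_ X.of Y.of Z.of).inv := rfl
theorem val_leftUnitor_hom (X : Underlying k A) : val (λ_ X).hom = (λ_ X.of).hom := rfl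
theorem val_leftUnitor_inv (X : Underlying k A) : val (λ_ X).inv = (λ_ X.of).inv := rfl
theorem val_rightUnitor_hom (X : Underlying k A) : val (ρ_ X).hom = (ρ_ X.of).hom := rfl
theorem val_rightUnitor_inv (X : Underlying k A) : val (ρ_ X).inv = (ρ_ X.of).inv := rfl

/-- The monoidal structure on the underlying category. -/
instance : MonoidalCategory (Underlying k A) :=
  MonoidalCategory.ofTensorHom
    (id_tensorHom_id := fun X Y => hom_ext (id_tensor_id k X.of Y.of))
    (id_tensorHom := fun _ _ _ _ => rfl)
    (tensorHom_id := fun _ _ => rfl)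
    (tensorHom_comp_tensorHom := fun f _ _ _ =>
      hom_ext (tensor_comp_of_left (k := k) _ _ _ (val_even f)))
    (associator_naturality := fun _ _ _ => hom_ext (associator_natural k _ _ _))
    (leftUnitor_naturality := fun _ => hom_ext (leftUnitor_natural k _))
    (rightUnitor_naturality := fun _ => hom_ext (rightUnitor_natural k _))
    (pentagon := fun _ _ _ _ => hom_ext (pentagon k _ _ _ _))
    (triangle := fun _ _ => hom_ext (triangle k _ _))

instance : MonoidalPreadditive (Underlying k A) where
  whiskerLeft_add f g := hom_ext (tensor_add k _ _ _)
  add_whiskerRight f g := hom_ext (add_tensor k _ _ _)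
  whiskerLeft_zero {X Y Z} := hom_ext (by
    have := tensor_smul (0 : k) (𝟙 X.of) (0 : Y.of ⟶ Z.of)
    rw [zero_smul, zero_smul] at this
    exact this)
  zero_whiskerRight {X Y Z} := hom_ext (by
    have := smul_tensor (0 : k) (0 : Y.of ⟶ Z.of) (𝟙 X.of)
    rw [zero_smul, zero_smul] at this
    exact this)

end Monoidal

end Underlying

namespace MonoidalSuperfunctor

variable {k : Type u} [Field k]
variable {A : Type w} [Category.{v} A] [Preadditive A] [Linear k A] [Supercategory k A]
  [MonoidalCategoryStruct A]
variable {B : Type w'} [Category.{v'} B] [Preadditive B] [Linear k B] [Supercategory k B]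
  [MonoidalCategoryStruct B]

/-- The restriction of a (monoidal) superfunctor to the underlying categories. -/
@[simps]
def underlying (F : MonoidalSuperfunctor k A B) : Underlying k A ⥤ Underlying k B where
  obj X := ⟨F.obj X.of⟩
  map f := Underlying.mk' (F.map (Underlying.val f)) (F.map_parity (Underlying.val_even f))
  map_id X := Underlying.hom_ext (F.map_id X.of)
  map_comp f g := Underlying.hom_ext (F.map_comp (Underlying.val f) (Underlying.val g))

variable [MonoidalSupercategory k A] [MonoidalSupercategory k B]

instance (F : MonoidalSuperfunctor k A B) : F.underlying.Monoidal :=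
  Functor.CoreMonoidal.toMonoidal
    { εIso := Underlying.mkIso F.ε F.ε_even F.ε_inv_even
      μIso := fun X Y => Underlying.mkIso (F.μ X.of Y.of) (F.μ_even _ _) (F.μ_inv_even _ _)
      μIso_hom_natural_left := fun f X' => Underlying.hom_ext (by
        have := F.μ_natural (Underlying.val f) (𝟙 X'.of)
        rw [F.map_id] at this
        exact this)
      μIso_hom_natural_right := fun X' f => Underlying.hom_ext (by
        have := F.μ_natural (𝟙 X'.of) (Underlying.val f)
        rw [F.map_id] at this
        exact this)
      associativity := fun X Y Z => Underlying.hom_ext (F.associativity X.of Y.of Z.of)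
      left_unitality := fun X => Underlying.hom_ext (F.left_unitality X.of)
      right_unitality := fun X => Underlying.hom_ext (F.right_unitality X.of) }

end MonoidalSuperfunctor

/-! ## The `Π`-envelope -/

/-- Objects `Π^a X` of the `Π`-envelope of a supercategory. -/
structure PiEnv (k : Type u) (A : Type w) where
  base : A
  par : ZMod 2

namespace PiEnv

section Cat

variable {k : Type u} {A : Type w} [Category.{v} A]

/-- A morphism `Π^a X ⟶ Π^b Y` is a morphism `f : X ⟶ Y`, denoted `f_a^b`; the composition is that
of `A`. -/
instance : Category.{v} (PiEnv k A) where
  Hom X Y := X.base ⟶ Y.base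
  id X := 𝟙 X.base
  comp {X Y Z} f g := CategoryStruct.comp (obj := A) (X := X.base) (Y := Y.base) (Z := Z.base) f g
  id_comp {X Y} f := Category.id_comp (obj := A) (X := X.base) (Y := Y.base) f
  comp_id {X Y} f := Category.comp_id (obj := A) (X := X.base) (Y := Y.base) f
  assoc {X Y Z T} f g h := Category.assoc (obj := A) (W := X.base) (X := Y.base) (Y := Z.base)
    (Z := T.base) f g h

/-- The morphism of `A` underlying a morphism of the `Π`-envelope. -/
def val {X Y : PiEnv k A} (f : X ⟶ Y) : X.base ⟶ Y.base := f

/-- The morphism `f_a^b`. -/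
def mk' {X Y : PiEnv k A} (f : X.base ⟶ Y.base) : X ⟶ Y := f

@[simp] theorem val_mk' {X Y : PiEnv k A} (f : X.base ⟶ Y.base) : val (mk' f : X ⟶ Y) = f := rfl
@[simp] theorem val_id (X : PiEnv k A) : val (𝟙 X) = 𝟙 X.base := rfl
@[simp] theorem val_comp {X Y Z : PiEnv k A} (f : X ⟶ Y) (g : Y ⟶ Z) :
    val (f ≫ g) = val f ≫ val g := rfl

theorem hom_ext {X Y : PiEnv k A} {f g : X ⟶ Y} (h : val f = val g) : f = g := h

/-- An isomorphism `X ≅ Y` of `A`, as an isomorphism `Π^a X ≅ Π^b Y`. -/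
@[simps]
def mkIso {X Y : PiEnv k A} (e : X.base ≅ Y.base) : X ≅ Y where
  hom := mk' e.hom
  inv := mk' e.inv
  hom_inv_id := hom_ext e.hom_inv_id
  inv_hom_id := hom_ext e.inv_hom_id

variable [Preadditive A]

instance : Preadditive (PiEnv k A) where
  homGroup X Y := inferInstanceAs (AddCommGroup (X.base ⟶ Y.base))
  add_comp X Y Z f g h := Preadditive.add_comp X.base Y.base Z.base f g h
  comp_add X Y Z f g h := Preadditive.comp_add X.base Y.base Z.base f g h

@[simp] theorem val_add {X Y : PiEnv k A} (f g : X ⟶ Y) : val (f + g) = val f + val g := rfl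
@[simp] theorem val_zero {X Y : PiEnv k A} : val (0 : X ⟶ Y) = 0 := rfl

variable [Field k] [Linear k A]

instance : Linear k (PiEnv k A) where
  homModule X Y := inferInstanceAs (Module k (X.base ⟶ Y.base))
  smul_comp X Y Z r f g := Linear.smul_comp X.base Y.base Z.base r f g
  comp_smul X Y Z f r g := Linear.comp_smul X.base Y.base Z.base f r g

@[simp] theorem val_smul {X Y : PiEnv k A} (c : k) (f : X ⟶ Y) : val (c • f) = c • val f := rfl

variable [Supercategory k A]

/-- The morphism `f_a^b` has parity `a + b + |f|`. -/
instance : Supercategory k (PiEnv k A) where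
  gr X Y :=
    { part := fun p => (Supercategory.gr (k := k) X.base Y.base).part (p + X.par + Y.par)
      isCompl := by
        have h := (Supercategory.gr (k := k) X.base Y.base).isCompl
        rw [zero_add, add_assoc]
        rcases zmod2_cases (X.par + Y.par) with e | e <;> rw [e]
        · exact h
        · exact h.symm }
  id_mem X := by
    change 𝟙 X.base ∈ (Supercategory.gr (k := k) X.base X.base).part (0 + X.par + X.par)
    rw [zero_add, zmod2_add_self]
    exact Supercategory.id_mem _
  comp_mem {X Y Z p r f g} hf hg := by
    change val f ≫ val g ∈
      (Supercategory.gr (k := k) X.base Z.base).part (p + r + X.par + Z.par)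
    have : p + r + X.par + Z.par = (p + X.par + Y.par) + (r + Y.par + Z.par) := by
      linear_combination (-1 : ZMod 2) * zmod2_add_self Y.par
    rw [this]
    exact Supercategory.comp_mem hf hg

theorem homParity_iff {X Y : PiEnv k A} {p : ZMod 2} {f : X ⟶ Y} :
    HomParity k p f ↔ HomParity k (p + X.par + Y.par) (val f) := Iff.rfl

theorem homParity_iff' {X Y : PiEnv k A} {p : ZMod 2} {f : X ⟶ Y} :
    HomParity k (p + X.par + Y.par) f ↔ HomParity k p (val f) := by
  rw [homParity_iff, show p + X.par + Y.par + X.par + Y.par = p by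
    linear_combination zmod2_add_self X.par + zmod2_add_self Y.par]

/-- To prove an additive property of morphisms of the `Π`-envelope, it is enough to treat those
which are homogeneous in the original supercategory. -/
theorem hom_induction {X Y : PiEnv k A} {C : (X ⟶ Y) → Prop}
    (hom : ∀ p f, HomParity k p (val f) → C f)
    (add : ∀ f g, C f → C g → C (f + g)) (f : X ⟶ Y) : C f :=
  (Supercategory.gr (k := k) X.base Y.base).induction (C := fun g => C (mk' g))
    (fun p m hm => hom p (mk' m) hm) (fun m n hm hn => add (mk' m) (mk' n) hm hn) f

theorem val_even_iso {X Y : PiEnv k A} {e : X.base ⟶ Y.base} (h : HomParity k 0 e)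
    (hp : X.par + Y.par = 0) : HomParity k 0 (mk' e : X ⟶ Y) := by
  rw [homParity_iff, zero_add, hp]; exact h

theorem homParity_val {X Y : PiEnv k A} {p : ZMod 2} {f : X ⟶ Y} (h : HomParity k p f) :
    HomParity k (p + X.par + Y.par) (val f) := h

end Cat

section Monoidal

variable {k : Type u} [Field k]
variable {A : Type w} [Category.{v} A] [Preadditive A] [Linear k A] [Supercategory k A]
  [MonoidalCategoryStruct A]

/-- The tensor product of morphisms in the `Π`-envelope: on homogeneous `f` and `g`,
`f_a^b ⊗ g_c^d = (-1)^(a|g| + |f|d + ad + ac) (f ⊗ g)_{a+c}^{b+d}`. -/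
noncomputable def tensor {X₁ Y₁ X₂ Y₂ : PiEnv k A} (f : X₁ ⟶ Y₁) (g : X₂ ⟶ Y₂) :
    X₁.base ⊗ X₂.base ⟶ Y₁.base ⊗ Y₂.base :=
  ∑ p : ZMod 2, ∑ r : ZMod 2,
    superSign k (X₁.par * r + p * Y₂.par + X₁.par * Y₂.par + X₁.par * X₂.par) •
      ((Supercategory.gr (k := k) X₁.base Y₁.base).proj p (val f) ⊗ₘ
        (Supercategory.gr (k := k) X₂.base Y₂.base).proj r (val g))

noncomputable instance : MonoidalCategoryStruct (PiEnv k A) where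
  tensorObj X Y := ⟨X.base ⊗ Y.base, X.par + Y.par⟩
  tensorHom f g := mk' (tensor f g)
  whiskerLeft X _ _ f := mk' (tensor (𝟙 X) f)
  whiskerRight f Y := mk' (tensor f (𝟙 Y))
  tensorUnit := ⟨𝟙_ A, 0⟩
  associator X Y Z := mkIso (α_ X.base Y.base Z.base)
  leftUnitor X := mkIso (λ_ X.base)
  rightUnitor X := mkIso (ρ_ X.base)

theorem val_tensorHom {X Y X' Y' : PiEnv k A} (f : X ⟶ Y) (g : X' ⟶ Y') :
    val (f ⊗ₘ g) = tensor f g := rfl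
theorem val_associator_hom (X Y Z : PiEnv k A) :
    val (α_ X Y Z).hom = (α_ X.base Y.base Z.base).hom := rfl
theorem val_leftUnitor_hom (X : PiEnv k A) : val (λ_ X).hom = (λ_ X.base).hom := rfl
theorem val_rightUnitor_hom (X : PiEnv k A) : val (ρ_ X).hom = (ρ_ X.base).hom := rfl

variable [MonoidalSupercategory k A]

open MonoidalSupercategory

theorem tensor_eq {X₁ Y₁ X₂ Y₂ : PiEnv k A} {f : X₁ ⟶ Y₁} {g : X₂ ⟶ Y₂} {p r : ZMod 2}
    (hf : HomParity k p (val f)) (hg : HomParity k r (val g)) :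
    tensor f g = superSign k (X₁.par * r + p * Y₂.par + X₁.par * Y₂.par + X₁.par * X₂.par) •
      (val f ⊗ₘ val g) := by
  unfold tensor
  rw [Finset.sum_eq_single p, Finset.sum_eq_single r]
  · rw [SuperGrading.proj_of_mem _ hf, SuperGrading.proj_of_mem _ hg]
  · intro b _ hb
    rw [SuperGrading.proj_of_mem_ne _ hg hb, tensorHom_zero k, smul_zero]
  · intro h; exact absurd (Finset.mem_univ _) h
  · intro b _ hb
    refine Finset.sum_eq_zero fun r _ => ?_
    rw [SuperGrading.proj_of_mem_ne _ hf hb, zero_tensorHom k, smul_zero]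
  · intro h; exact absurd (Finset.mem_univ _) h

theorem val_tensor_eq {X₁ Y₁ X₂ Y₂ : PiEnv k A} {f : X₁ ⟶ Y₁} {g : X₂ ⟶ Y₂} {p r : ZMod 2}
    (hf : HomParity k p (val f)) (hg : HomParity k r (val g)) :
    val (f ⊗ₘ g) = superSign k (X₁.par * r + p * Y₂.par + X₁.par * Y₂.par + X₁.par * X₂.par) •
      (val f ⊗ₘ val g) := tensor_eq hf hg

theorem add_tensor' {X₁ Y₁ X₂ Y₂ : PiEnv k A} (f f' : X₁ ⟶ Y₁) (g : X₂ ⟶ Y₂) :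
    (f + f') ⊗ₘ g = f ⊗ₘ g + f' ⊗ₘ g := by
  apply hom_ext
  simp only [val_add, val_tensorHom, tensor, map_add, MonoidalSupercategory.add_tensor k,
    smul_add, Finset.sum_add_distrib]

theorem tensor_add' {X₁ Y₁ X₂ Y₂ : PiEnv k A} (f : X₁ ⟶ Y₁) (g g' : X₂ ⟶ Y₂) :
    f ⊗ₘ (g + g') = f ⊗ₘ g + f ⊗ₘ g' := by
  apply hom_ext
  simp only [val_add, val_tensorHom, tensor, map_add, MonoidalSupercategory.tensor_add k,
    smul_add, Finset.sum_add_distrib]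

noncomputable instance : MonoidalSupercategory k (PiEnv k A) where
  add_tensor := add_tensor'
  tensor_add := tensor_add'
  smul_tensor c f g := by
    apply hom_ext
    simp only [val_smul, val_tensorHom, tensor, map_smul, MonoidalSupercategory.smul_tensor,
      smul_comm c, Finset.smul_sum]
  tensor_smul c f g := by
    apply hom_ext
    simp only [val_smul, val_tensorHom, tensor, map_smul, MonoidalSupercategory.tensor_smul,
      smul_comm c, Finset.smul_sum]
  tensor_parity {X₁ Y₁ X₂ Y₂ p r f g} hf hg := by
    rw [homParity_iff, val_tensor_eq hf hg]
    refine Submodule.smul_mem _ _ (HomParity.cast (tensor_parity (homParity_val hf)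
      (homParity_val hg)) ?_)
    change _ = p + r + (X₁.par + X₂.par) + (Y₁.par + Y₂.par)
    ring
  id_tensor_id X Y := by
    apply hom_ext
    rw [val_tensor_eq (f := 𝟙 X) (g := 𝟙 Y) (HomParity.id (k := k) X.base)
      (HomParity.id (k := k) Y.base)]
    simp only [val_id, MonoidalSupercategory.id_tensor_id k]
    rw [show X.par * 0 + 0 * Y.par + X.par * Y.par + X.par * Y.par = 0 by
      linear_combination X.par * zmod2_add_self Y.par, superSign_zero, one_smul]
    rfl
  interchange {X₁ Y₁ Z₁ X₂ Y₂ Z₂ p r} h l f g hg hh := by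
    revert l
    refine hom_induction ?_ ?_
    swap
    · intro l l' e e'
      rw [tensor_add', Preadditive.add_comp, e, e', Preadditive.add_comp, tensor_add', smul_add]
    intro s l hl
    revert f
    refine hom_induction ?_ ?_
    swap
    · intro f f' e e'
      rw [add_tensor', Preadditive.comp_add, e, e', Preadditive.comp_add, add_tensor', smul_add]
    intro t f hf
    apply hom_ext
    rw [val_comp, val_smul, val_tensor_eq (homParity_val hh) hl, val_tensor_eq hf (homParity_val hg),
      val_tensor_eq (f := h ≫ f) (g := l ≫ g) ((homParity_val hh).comp hf)
        (hl.comp (homParity_val hg)), val_comp, val_comp,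
      Linear.smul_comp, Linear.comp_smul,
      MonoidalSupercategory.interchange _ _ _ _ (homParity_val hg) (homParity_val hh),
      smul_smul, smul_smul, smul_smul, ← superSign_add, ← superSign_add, ← superSign_add]
    congr 2
    have h2 : (2 : ZMod 2) = 0 := by decide
    exact envelope_sign_identity h2 _ _ _ _ _ _ _ _ _
  whiskerLeft_eq _ _ _ _ := rfl
  whiskerRight_eq _ _ := rfl
  associator_even X Y Z := val_even_iso (associator_even _ _ _) (by
    change X.par + Y.par + Z.par + (X.par + (Y.par + Z.par)) = 0
    rw [← add_assoc X.par]; exact zmod2_add_self _)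
  associator_inv_even X Y Z := val_even_iso (associator_inv_even _ _ _) (by
    change X.par + (Y.par + Z.par) + (X.par + Y.par + Z.par) = 0
    rw [← add_assoc X.par]; exact zmod2_add_self _)
  leftUnitor_even X := val_even_iso (leftUnitor_even _) (by
    change 0 + X.par + X.par = 0
    rw [zero_add]; exact zmod2_add_self _)
  leftUnitor_inv_even X := val_even_iso (leftUnitor_inv_even _) (by
    change X.par + (0 + X.par) = 0
    rw [zero_add]; exact zmod2_add_self _)
  rightUnitor_even X := val_even_iso (rightUnitor_even _) (by
    change X.par + 0 + X.par = 0
    rw [add_zero]; exact zmod2_add_self _)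
  rightUnitor_inv_even X := val_even_iso (rightUnitor_inv_even _) (by
    change X.par + (X.par + 0) = 0
    rw [add_zero]; exact zmod2_add_self _)
  associator_natural {X₁ X₂ X₃ Y₁ Y₂ Y₃} f g h := by
    revert f
    refine hom_induction ?_ ?_
    swap
    · intro f f' e e'
      rw [add_tensor', add_tensor', Preadditive.add_comp, e, e', add_tensor', Preadditive.comp_add]
    intro p f hf
    revert g
    refine hom_induction ?_ ?_
    swap
    · intro f f' e e'
      rw [tensor_add', add_tensor', Preadditive.add_comp, e, e', add_tensor', tensor_add',
        Preadditive.comp_add]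
    intro r g hg
    revert h
    refine hom_induction ?_ ?_
    swap
    · intro f f' e e'
      rw [tensor_add', Preadditive.add_comp, e, e', tensor_add', tensor_add',
        Preadditive.comp_add]
    intro s h hh
    apply hom_ext
    have hfg : HomParity k (p + r) (val (f ⊗ₘ g)) := by
      rw [val_tensor_eq hf hg]; exact Submodule.smul_mem _ _ (tensor_parity hf hg)
    have hgh : HomParity k (r + s) (val (g ⊗ₘ h)) := by
      rw [val_tensor_eq hg hh]; exact Submodule.smul_mem _ _ (tensor_parity hg hh)
    rw [val_comp, val_comp, val_tensor_eq hfg hh, val_tensor_eq hf hgh, val_tensor_eq hf hg,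
      val_tensor_eq hg hh, val_associator_hom, val_associator_hom,
      MonoidalSupercategory.smul_tensor, MonoidalSupercategory.tensor_smul,
      smul_smul, smul_smul, Linear.smul_comp, Linear.comp_smul,
      MonoidalSupercategory.associator_natural k, ← superSign_add, ← superSign_add]
    congr 2
    change (X₁.par + X₂.par) * s + (p + r) * Y₃.par + (X₁.par + X₂.par) * Y₃.par +
        (X₁.par + X₂.par) * X₃.par + _ =
      X₁.par * (r + s) + p * (Y₂.par + Y₃.par) + X₁.par * (Y₂.par + Y₃.par) +
        X₁.par * (X₂.par + X₃.par) + _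
    ring
  leftUnitor_natural {X Y} f := by
    revert f
    refine hom_induction ?_ ?_
    swap
    · intro f f' e e'
      rw [tensor_add', Preadditive.add_comp, e, e', Preadditive.comp_add]
    intro p f hf
    apply hom_ext
    rw [val_comp, val_tensor_eq (f := 𝟙 (𝟙_ (PiEnv k A))) (HomParity.id (k := k) (𝟙_ A)) hf]
    change (superSign k (0 * p + 0 * Y.par + 0 * Y.par + 0 * X.par) • (𝟙 (𝟙_ A) ⊗ₘ val f)) ≫
      (λ_ Y.base).hom = (λ_ X.base).hom ≫ val f
    simp [MonoidalSupercategory.leftUnitor_natural k]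
  rightUnitor_natural {X Y} f := by
    revert f
    refine hom_induction ?_ ?_
    swap
    · intro f f' e e'
      rw [add_tensor', Preadditive.add_comp, e, e', Preadditive.comp_add]
    intro p f hf
    apply hom_ext
    rw [val_comp, val_tensor_eq (g := 𝟙 (𝟙_ (PiEnv k A))) hf (HomParity.id (k := k) (𝟙_ A))]
    change (superSign k (X.par * 0 + p * 0 + X.par * 0 + X.par * 0) • (val f ⊗ₘ 𝟙 (𝟙_ A))) ≫
      (ρ_ Y.base).hom = (ρ_ X.base).hom ≫ val f
    simp [MonoidalSupercategory.rightUnitor_natural k]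
  pentagon W X Y Z := by
    apply hom_ext
    have e1 := val_tensor_eq (f := (α_ W X Y).hom) (g := 𝟙 Z) (associator_even (k := k) _ _ _)
      (HomParity.id (k := k) _)
    have e2 := val_tensor_eq (f := 𝟙 W) (g := (α_ X Y Z).hom) (HomParity.id (k := k) _)
      (associator_even (k := k) _ _ _)
    rw [val_comp, val_comp, val_comp, e1, e2]
    have h1 : ∀ a b c : ZMod 2, a * 0 + 0 * b + a * c + a * c = 0 := by decide
    have h2 : W.par * 0 + 0 * (X.par + (Y.par + Z.par)) + W.par * (X.par + (Y.par + Z.par)) +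
        W.par * (X.par + Y.par + Z.par) = 0 := by
      rw [← add_assoc X.par]; exact h1 _ _ _
    erw [h1, h2]
    simp only [superSign_zero, one_smul]
    exact MonoidalSupercategory.pentagon k W.base X.base Y.base Z.base
  triangle X Y := by
    apply hom_ext
    have e1 := val_tensor_eq (f := (ρ_ X).hom) (g := 𝟙 Y) (rightUnitor_even (k := k) _)
      (HomParity.id (k := k) _)
    have e2 := val_tensor_eq (f := 𝟙 X) (g := (λ_ Y).hom) (HomParity.id (k := k) _)
      (leftUnitor_even (k := k) _)
    rw [val_comp, e1, e2]
    have h1 : ∀ a b c : ZMod 2, a * 0 + 0 * b + a * c + a * c = 0 := by decide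
    have h2 : X.par * 0 + 0 * Y.par + X.par * Y.par + X.par * (0 + Y.par) = 0 := by
      rw [zero_add]; exact h1 _ _ _
    erw [h1, h2]
    simp only [superSign_zero, one_smul]
    exact MonoidalSupercategory.triangle k X.base Y.base

/-- The canonical inclusion of a monoidal supercategory into its `Π`-envelope, `X ↦ Π^0 X`. -/
noncomputable def incl (k : Type u) [Field k] (A : Type w) [Category.{v} A] [Preadditive A]
    [Linear k A] [Supercategory k A] [MonoidalCategoryStruct A] [MonoidalSupercategory k A] :
    MonoidalSuperfunctor k A (PiEnv k A) where
  obj X := ⟨X, 0⟩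
  map f := mk' f
  map_id _ := rfl
  map_comp _ _ := rfl
  map_add _ _ := rfl
  map_smul _ _ := rfl
  map_parity {X Y p f} h := by
    rw [homParity_iff]
    change HomParity k (p + 0 + 0) f
    simpa using h
  μ X Y := mkIso (Iso.refl _)
  ε := mkIso (Iso.refl _)
  μ_even _ _ := val_even_iso (HomParity.id _) (by change (0 + 0 + 0 : ZMod 2) = 0; simp)
  μ_inv_even _ _ := val_even_iso (HomParity.id _) (by change (0 + (0 + 0) : ZMod 2) = 0; simp)
  ε_even := val_even_iso (HomParity.id _) (by change (0 + 0 : ZMod 2) = 0; simp)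
  ε_inv_even := val_even_iso (HomParity.id _) (by change (0 + 0 : ZMod 2) = 0; simp)
  μ_natural {X₁ Y₁ X₂ Y₂} f g := by
    apply hom_ext
    change tensor (X₁ := ⟨X₁, 0⟩) (Y₁ := ⟨Y₁, 0⟩) (X₂ := ⟨X₂, 0⟩) (Y₂ := ⟨Y₂, 0⟩)
      (mk' f) (mk' g) ≫ 𝟙 _ = 𝟙 _ ≫ (f ⊗ₘ g)
    rw [Category.comp_id, Category.id_comp]
    revert f
    refine (Supercategory.gr (k := k) X₁ Y₁).induction ?_ ?_
    swap
    · intro f f' e e'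
      rw [MonoidalSupercategory.add_tensor k, ← e, ← e']
      exact add_tensor' (X₁ := ⟨X₁, 0⟩) (Y₁ := ⟨Y₁, 0⟩) (X₂ := ⟨X₂, 0⟩) (Y₂ := ⟨Y₂, 0⟩)
        (mk' f) (mk' f') (mk' g)
    intro p f hf
    revert g
    refine (Supercategory.gr (k := k) X₂ Y₂).induction ?_ ?_
    swap
    · intro g g' e e'
      rw [MonoidalSupercategory.tensor_add k, ← e, ← e']
      exact tensor_add' (X₁ := ⟨X₁, 0⟩) (Y₁ := ⟨Y₁, 0⟩) (X₂ := ⟨X₂, 0⟩) (Y₂ := ⟨Y₂, 0⟩)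
        (mk' f) (mk' g) (mk' g')
    intro r g hg
    rw [tensor_eq (X₁ := ⟨X₁, 0⟩) (Y₁ := ⟨Y₁, 0⟩) (X₂ := ⟨X₂, 0⟩) (Y₂ := ⟨Y₂, 0⟩)
      (f := mk' f) (g := mk' g) (p := p) (r := r) hf hg]
    simp
  associativity X Y Z := by
    have h := MonoidalSupercategory.id_tensor_id k (A := PiEnv k A)
    have e1 := h ⟨X ⊗ Y, 0⟩ ⟨Z, 0⟩
    have e2 := h ⟨X, 0⟩ ⟨Y ⊗ Z, 0⟩
    change val (𝟙 (⟨X ⊗ Y, 0⟩ : PiEnv k A) ⊗ₘ 𝟙 (⟨Z, 0⟩ : PiEnv k A)) ≫ 𝟙 ((X ⊗ Y) ⊗ Z) ≫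
      (α_ X Y Z).hom = (α_ X Y Z).hom ≫
        val (𝟙 (⟨X, 0⟩ : PiEnv k A) ⊗ₘ 𝟙 (⟨Y ⊗ Z, 0⟩ : PiEnv k A)) ≫ 𝟙 (X ⊗ (Y ⊗ Z))
    rw [e1, e2]
    exact (Category.id_comp _).trans ((Category.id_comp _).trans
      ((Category.comp_id _).symm.trans (congrArg _ (Category.comp_id _).symm)))
  left_unitality X := by
    have e1 := MonoidalSupercategory.id_tensor_id k (A := PiEnv k A) ⟨𝟙_ A, 0⟩ ⟨X, 0⟩
    change (λ_ X).hom = val (𝟙 (⟨𝟙_ A, 0⟩ : PiEnv k A) ⊗ₘ 𝟙 (⟨X, 0⟩ : PiEnv k A)) ≫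
      𝟙 (𝟙_ A ⊗ X) ≫ (λ_ X).hom
    rw [e1]
    exact ((Category.id_comp _).trans (Category.id_comp _)).symm
  right_unitality X := by
    have e1 := MonoidalSupercategory.id_tensor_id k (A := PiEnv k A) ⟨X, 0⟩ ⟨𝟙_ A, 0⟩
    change (ρ_ X).hom = val (𝟙 (⟨X, 0⟩ : PiEnv k A) ⊗ₘ 𝟙 (⟨𝟙_ A, 0⟩ : PiEnv k A)) ≫
      𝟙 (X ⊗ 𝟙_ A) ≫ (ρ_ X).hom
    rw [e1]
    exact ((Category.id_comp _).trans (Category.id_comp _)).symm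

end Monoidal

end PiEnv

/-! ## Monoidal structures on the additive envelope and on the Karoubi envelope -/

namespace MatMonoidal

noncomputable section

variable {C : Type w} [Category.{v} C] [Preadditive C]

open scoped Classical in
/-- The matrix of a map `e` of index sets, with (at most) one nonzero entry `φ i` in each row. -/
def reindexHom {M N : Mat_ C} (e : M.ι → N.ι) (φ : ∀ i, M.X i ⟶ N.X (e i)) : M ⟶ N :=
  fun i j => if h : e i = j then φ i ≫ eqToHom (congrArg N.X h) else 0

theorem reindexHom_apply {M N : Mat_ C} (e : M.ι → N.ι) (φ : ∀ i, M.X i ⟶ N.X (e i)) (i : M.ι) :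
    reindexHom e φ i (e i) = φ i := by simp [reindexHom]

theorem reindexHom_apply_ne {M N : Mat_ C} (e : M.ι → N.ι) (φ : ∀ i, M.X i ⟶ N.X (e i))
    (i : M.ι) (j : N.ι) (h : e i ≠ j) : reindexHom e φ i j = 0 := by simp [reindexHom, h]

theorem reindexHom_comp_apply {M N K : Mat_ C} (e : M.ι → N.ι) (φ : ∀ i, M.X i ⟶ N.X (e i))
    (g : N ⟶ K) (i : M.ι) (j : K.ι) : (reindexHom e φ ≫ g) i j = φ i ≫ g (e i) j := by
  rw [Mat_.comp_apply, Finset.sum_eq_single (e i)]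
  · rw [reindexHom_apply]
  · intro b _ hb
    rw [reindexHom_apply_ne e φ i b hb.symm, Limits.zero_comp]
  · intro h; exact absurd (Finset.mem_univ _) h

theorem comp_reindexHom_apply {M N K : Mat_ C} (e : N.ι → K.ι) (he : Function.Injective e)
    (φ : ∀ i, N.X i ⟶ K.X (e i)) (g : M ⟶ N) (i : M.ι) (j : N.ι) :
    (g ≫ reindexHom e φ) i (e j) = g i j ≫ φ j := by
  rw [Mat_.comp_apply, Finset.sum_eq_single j]
  · rw [reindexHom_apply]
  · intro b _ hb
    rw [reindexHom_apply_ne e φ b (e j) (fun h => hb (he h)), Limits.comp_zero]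
  · intro h; exact absurd (Finset.mem_univ _) h

theorem reindexHom_comp {M N K : Mat_ C} (e : M.ι → N.ι) (φ : ∀ i, M.X i ⟶ N.X (e i))
    (e' : N.ι → K.ι) (φ' : ∀ i, N.X i ⟶ K.X (e' i)) :
    reindexHom e φ ≫ reindexHom e' φ' = reindexHom (fun i => e' (e i)) (fun i => φ i ≫ φ' (e i)) := by
  ext i j
  rw [reindexHom_comp_apply]
  by_cases h : e' (e i) = j
  · subst h
    rw [reindexHom_apply, reindexHom_apply (fun i => e' (e i))]
  · rw [reindexHom_apply_ne e' φ' _ _ h, reindexHom_apply_ne (fun i => e' (e i)) _ _ _ h,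
      Limits.comp_zero]

theorem reindexHom_id (M : Mat_ C) : reindexHom (fun i => i) (fun i => 𝟙 (M.X i)) = 𝟙 M := by
  ext i j
  by_cases h : i = j
  · subst h
    rw [reindexHom_apply (fun i => i), Mat_.id_apply_self]
  · rw [reindexHom_apply_ne (fun i => i) _ _ _ h, Mat_.id_apply_of_ne _ _ _ h]

/-- The isomorphism of tuples given by a bijection of the index sets and isomorphisms of the
components. -/
@[simps]
def reindexIso {M N : Mat_ C} (e : M.ι → N.ι) (e' : N.ι → M.ι) (h : ∀ i, e' (e i) = i)
    (h' : ∀ j, e (e' j) = j) (φ : ∀ i, M.X i ≅ N.X (e i)) : M ≅ N where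
  hom := reindexHom e (fun i => (φ i).hom)
  inv := reindexHom e' (fun j => eqToHom (congrArg N.X (h' j).symm) ≫ (φ (e' j)).inv)
  hom_inv_id := by
    rw [reindexHom_comp]
    ext i j
    by_cases hij : i = j
    · subst hij
      have key : ∀ (a : N.ι) (ha : e i = a) (b : M.ι) (hb : b = i) (hab : a = e b),
          (φ i).hom ≫ eqToHom (congrArg N.X ha) ≫ eqToHom (congrArg N.X hab) ≫ (φ b).inv ≫
            eqToHom (congrArg M.X hb) = 𝟙 _ := by
        intro a ha b hb hab
        subst hb; subst ha; simp
      rw [Mat_.id_apply_self]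
      simp only [reindexHom, h i, dif_pos]
      have := key (e i) rfl (e' (e i)) (h i) (h' _).symm
      simpa using this
    · rw [Mat_.id_apply_of_ne _ _ _ hij, reindexHom_apply_ne]
      rw [h i]; exact hij
  inv_hom_id := by
    rw [reindexHom_comp]
    ext i j
    by_cases hij : i = j
    · subst hij
      rw [Mat_.id_apply_self]
      simp [reindexHom, h' i]
    · rw [Mat_.id_apply_of_ne _ _ _ hij, reindexHom_apply_ne]
      rw [h' i]; exact hij

variable [MonoidalCategory C]

/-- The tensor product of two matrices of morphisms (their Kronecker product). -/
def tensor {M M' N N' : Mat_ C} (f : M ⟶ M') (g : N ⟶ N') :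
    (⟨M.ι × N.ι, fun p => M.X p.1 ⊗ N.X p.2⟩ : Mat_ C) ⟶
      ⟨M'.ι × N'.ι, fun p => M'.X p.1 ⊗ N'.X p.2⟩ :=
  fun p q => f p.1 q.1 ⊗ₘ g p.2 q.2

instance : MonoidalCategoryStruct (Mat_ C) where
  tensorObj M N := ⟨M.ι × N.ι, fun p => M.X p.1 ⊗ N.X p.2⟩
  tensorHom f g := tensor f g
  whiskerLeft M _ _ g := tensor (𝟙 M) g
  whiskerRight f N := tensor f (𝟙 N)
  tensorUnit := ⟨PUnit, fun _ => 𝟙_ C⟩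
  associator M N K := reindexIso (M := ⟨(M.ι × N.ι) × K.ι, fun p => (M.X p.1.1 ⊗ N.X p.1.2) ⊗ K.X p.2⟩)
    (N := ⟨M.ι × (N.ι × K.ι), fun p => M.X p.1 ⊗ (N.X p.2.1 ⊗ K.X p.2.2)⟩)
    (fun p => (p.1.1, (p.1.2, p.2))) (fun p => ((p.1, p.2.1), p.2.2)) (fun _ => rfl) (fun _ => rfl)
    (fun p => α_ (M.X p.1.1) (N.X p.1.2) (K.X p.2))
  leftUnitor M := reindexIso (M := ⟨PUnit × M.ι, fun p => 𝟙_ C ⊗ M.X p.2⟩) (N := M)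
    (fun p => p.2) (fun i => (PUnit.unit, i)) (fun _ => rfl) (fun _ => rfl) (fun p => λ_ (M.X p.2))
  rightUnitor M := reindexIso (M := ⟨M.ι × PUnit, fun p => M.X p.1 ⊗ 𝟙_ C⟩) (N := M)
    (fun p => p.1) (fun i => (i, PUnit.unit)) (fun _ => rfl) (fun _ => rfl) (fun p => ρ_ (M.X p.1))

theorem associator_hom_def (M N K : Mat_ C) : (α_ M N K).hom =
    reindexHom (M := (M ⊗ N) ⊗ K) (N := M ⊗ (N ⊗ K)) (fun p => (p.1.1, (p.1.2, p.2)))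
      (fun p => (α_ (M.X p.1.1) (N.X p.1.2) (K.X p.2)).hom) := rfl

theorem leftUnitor_hom_def (M : Mat_ C) : (λ_ M).hom =
    reindexHom (M := 𝟙_ (Mat_ C) ⊗ M) (N := M) (fun p => p.2) (fun p => (λ_ (M.X p.2)).hom) := rfl

theorem rightUnitor_hom_def (M : Mat_ C) : (ρ_ M).hom =
    reindexHom (M := M ⊗ 𝟙_ (Mat_ C)) (N := M) (fun p => p.1) (fun p => (ρ_ (M.X p.1)).hom) := rfl

theorem tensorHom_apply {M M' N N' : Mat_ C} (f : M ⟶ M') (g : N ⟶ N') (p : M.ι × N.ι)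
    (q : M'.ι × N'.ι) : (f ⊗ₘ g : M ⊗ N ⟶ M' ⊗ N') p q = f p.1 q.1 ⊗ₘ g p.2 q.2 := rfl

variable [MonoidalPreadditive C]

theorem reindexHom_tensor {M M' N N' : Mat_ C} (e : M.ι → M'.ι) (φ : ∀ i, M.X i ⟶ M'.X (e i))
    (e' : N.ι → N'.ι) (φ' : ∀ i, N.X i ⟶ N'.X (e' i)) :
    (reindexHom e φ ⊗ₘ reindexHom e' φ' : M ⊗ N ⟶ M' ⊗ N') =
      reindexHom (M := M ⊗ N) (N := M' ⊗ N') (fun p => (e p.1, e' p.2))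
        (fun p => φ p.1 ⊗ₘ φ' p.2) := by
  ext p q
  rw [tensorHom_apply]
  by_cases h : (e p.1, e' p.2) = q
  · subst h
    rw [reindexHom_apply (M := M ⊗ N) (N := M' ⊗ N') (fun p => (e p.1, e' p.2))]
    rw [reindexHom_apply, reindexHom_apply]
  · rw [reindexHom_apply_ne (M := M ⊗ N) (N := M' ⊗ N') (fun p => (e p.1, e' p.2)) _ _ _ h]
    by_cases h1 : e p.1 = q.1
    · rw [reindexHom_apply_ne e' φ' p.2 q.2 (fun h2 => h (Prod.ext h1 h2)),
        MonoidalPreadditive.tensor_zero]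
    · rw [reindexHom_apply_ne e φ p.1 q.1 h1, MonoidalPreadditive.zero_tensor]

theorem sum_tensor_sum {ι κ : Type*} [Fintype ι] [Fintype κ] {X Y X' Y' : C}
    (f : ι → (X ⟶ Y)) (g : κ → (X' ⟶ Y')) :
    (∑ i, f i) ⊗ₘ (∑ j, g j) = ∑ p : ι × κ, f p.1 ⊗ₘ g p.2 := by
  rw [Fintype.sum_prod_type]
  simp only [MonoidalCategory.tensorHom_def, sum_whiskerRight, whiskerLeft_sum, Preadditive.sum_comp,
    Preadditive.comp_sum]
  exact Finset.sum_comm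

instance : MonoidalCategory (Mat_ C) :=
  MonoidalCategory.ofTensorHom
    (id_tensorHom_id := fun M N => by
      rw [← reindexHom_id M, ← reindexHom_id N, reindexHom_tensor, ← reindexHom_id (M ⊗ N)]
      congr 1
      funext p
      exact id_tensorHom_id _ _)
    (id_tensorHom := fun _ _ _ _ => rfl)
    (tensorHom_id := fun _ _ => rfl)
    (tensorHom_comp_tensorHom := fun {M₁ N₁ K₁ M₂ N₂ K₂} f f' g g' => by
      ext p q
      rw [tensorHom_apply, Mat_.comp_apply, Mat_.comp_apply, Mat_.comp_apply, sum_tensor_sum]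
      refine Finset.sum_congr rfl fun r _ => ?_
      rw [tensorHom_apply, tensorHom_apply]
      exact tensorHom_comp_tensorHom _ _ _ _)
    (associator_naturality := fun {M₁ M₂ M₃ N₁ N₂ N₃} f g h => by
      ext p ⟨q₁, q₂, q₃⟩
      rw [associator_hom_def, associator_hom_def, reindexHom_comp_apply]
      have := comp_reindexHom_apply (M := (M₁ ⊗ M₂) ⊗ M₃) (N := (N₁ ⊗ N₂) ⊗ N₃)
        (K := N₁ ⊗ (N₂ ⊗ N₃)) (fun p => (p.1.1, (p.1.2, p.2)))
        (fun a b hab => by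
          obtain ⟨⟨a1, a2⟩, a3⟩ := a
          obtain ⟨⟨b1, b2⟩, b3⟩ := b
          simp only [Prod.mk.injEq] at hab
          obtain ⟨rfl, rfl, rfl⟩ := hab
          rfl) (fun p => (α_ (N₁.X p.1.1) (N₂.X p.1.2) (N₃.X p.2)).hom)
        ((f ⊗ₘ g) ⊗ₘ h) p ((q₁, q₂), q₃)
      rw [this]
      exact associator_naturality _ _ _)
    (leftUnitor_naturality := fun {M N} f => by
      ext p q
      rw [leftUnitor_hom_def, leftUnitor_hom_def, reindexHom_comp_apply]
      have := comp_reindexHom_apply (M := 𝟙_ (Mat_ C) ⊗ M) (N := 𝟙_ (Mat_ C) ⊗ N)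
        (K := N) (fun p => p.2)
        (fun a b hab => Prod.ext (Subsingleton.elim (α := PUnit) _ _) hab)
        (fun p => (λ_ (N.X p.2)).hom) (𝟙 _ ⊗ₘ f) p (PUnit.unit, q)
      rw [this, tensorHom_apply]
      have e : (𝟙 (𝟙_ (Mat_ C)) : 𝟙_ (Mat_ C) ⟶ 𝟙_ (Mat_ C)) p.1 PUnit.unit = 𝟙 (𝟙_ C) :=
        Mat_.id_apply_self _ _
      rw [e]
      exact (by simp : (𝟙 (𝟙_ C) ⊗ₘ f p.2 q) ≫ (λ_ (N.X q)).hom = (λ_ (M.X p.2)).hom ≫ f p.2 q))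
    (rightUnitor_naturality := fun {M N} f => by
      ext p q
      rw [rightUnitor_hom_def, rightUnitor_hom_def, reindexHom_comp_apply]
      have := comp_reindexHom_apply (M := M ⊗ 𝟙_ (Mat_ C)) (N := N ⊗ 𝟙_ (Mat_ C))
        (K := N) (fun p => p.1)
        (fun a b hab => Prod.ext hab (Subsingleton.elim (α := PUnit) _ _))
        (fun p => (ρ_ (N.X p.1)).hom) (f ⊗ₘ 𝟙 _) p (q, PUnit.unit)
      rw [this, tensorHom_apply]
      have e : (𝟙 (𝟙_ (Mat_ C)) : 𝟙_ (Mat_ C) ⟶ 𝟙_ (Mat_ C)) p.2 PUnit.unit = 𝟙 (𝟙_ C) :=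
        Mat_.id_apply_self _ _
      rw [e]
      exact (by simp : (f p.1 q ⊗ₘ 𝟙 (𝟙_ C)) ≫ (ρ_ (N.X q)).hom = (ρ_ (M.X p.1)).hom ≫ f p.1 q))
    (pentagon := fun W X Y Z => by
      rw [← reindexHom_id Z, ← reindexHom_id W]
      simp only [associator_hom_def]
      rw [reindexHom_tensor, reindexHom_tensor, reindexHom_comp, reindexHom_comp, reindexHom_comp]
      congr 1
      funext p
      exact (by simp :
        ((α_ (W.X p.1.1.1) (X.X p.1.1.2) (Y.X p.1.2)).hom ⊗ₘ 𝟙 (Z.X p.2)) ≫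
          (α_ (W.X p.1.1.1) (X.X p.1.1.2 ⊗ Y.X p.1.2) (Z.X p.2)).hom ≫
            (𝟙 (W.X p.1.1.1) ⊗ₘ (α_ (X.X p.1.1.2) (Y.X p.1.2) (Z.X p.2)).hom) =
          (α_ (W.X p.1.1.1 ⊗ X.X p.1.1.2) (Y.X p.1.2) (Z.X p.2)).hom ≫
            (α_ (W.X p.1.1.1) (X.X p.1.1.2) (Y.X p.1.2 ⊗ Z.X p.2)).hom))
    (triangle := fun X Y => by
      rw [← reindexHom_id X, ← reindexHom_id Y]
      simp only [associator_hom_def, leftUnitor_hom_def, rightUnitor_hom_def]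
      rw [reindexHom_tensor, reindexHom_tensor, reindexHom_comp]
      congr 1
      funext p
      exact (by simp :
        (α_ (X.X p.1.1) (𝟙_ C) (Y.X p.2)).hom ≫ (𝟙 (X.X p.1.1) ⊗ₘ (λ_ (Y.X p.2)).hom) =
          (ρ_ (X.X p.1.1)).hom ⊗ₘ 𝟙 (Y.X p.2)))

theorem embedding_map_eq {X Y : C} (f : X ⟶ Y) : (Mat_.embedding C).map f =
    reindexHom (M := (Mat_.embedding C).obj X) (N := (Mat_.embedding C).obj Y) (fun i => i)
      (fun _ => f) := by
  ext i j
  exact (reindexHom_apply (M := (Mat_.embedding C).obj X) (N := (Mat_.embedding C).obj Y)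
    (fun i => i) (fun _ => f) i).symm

/-- The comparison isomorphism between tensor products of tuples of length one. -/
def embeddingμ (X Y : C) : (Mat_.embedding C).obj X ⊗ (Mat_.embedding C).obj Y ≅
    (Mat_.embedding C).obj (X ⊗ Y) :=
  reindexIso (M := (Mat_.embedding C).obj X ⊗ (Mat_.embedding C).obj Y)
    (N := (Mat_.embedding C).obj (X ⊗ Y)) (fun _ => PUnit.unit)
    (fun _ => (PUnit.unit, PUnit.unit)) (fun _ => rfl) (fun _ => rfl)
    (fun _ => Iso.refl (X ⊗ Y))

theorem embeddingμ_hom (X Y : C) : (embeddingμ X Y).hom =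
    reindexHom (M := (Mat_.embedding C).obj X ⊗ (Mat_.embedding C).obj Y)
      (N := (Mat_.embedding C).obj (X ⊗ Y)) (fun _ => PUnit.unit) (fun _ => 𝟙 (X ⊗ Y)) := rfl

/-- The embedding of a preadditive monoidal category in its additive envelope is monoidal. -/
instance : (Mat_.embedding C).Monoidal :=
  Functor.CoreMonoidal.toMonoidal
    { εIso := Iso.refl _
      μIso := embeddingμ
      μIso_hom_natural_left := fun {X Y} f X' => by
        rw [← tensorHom_id, embeddingμ_hom, embeddingμ_hom, embedding_map_eq, embedding_map_eq,
          ← reindexHom_id]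
        erw [reindexHom_tensor, reindexHom_comp, reindexHom_comp]
        congr 1
        funext p
        exact (by simp : (f ⊗ₘ 𝟙 X') ≫ 𝟙 (Y ⊗ X') = 𝟙 (X ⊗ X') ≫ f ▷ X')
      μIso_hom_natural_right := fun {X Y} X' f => by
        rw [← id_tensorHom, embeddingμ_hom, embeddingμ_hom, embedding_map_eq, embedding_map_eq,
          ← reindexHom_id]
        erw [reindexHom_tensor, reindexHom_comp, reindexHom_comp]
        congr 1
        funext p
        exact (by simp : (𝟙 X' ⊗ₘ f) ≫ 𝟙 (X' ⊗ Y) = 𝟙 (X' ⊗ X) ≫ X' ◁ f)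
      associativity := fun X Y Z => by
        rw [← tensorHom_id, ← id_tensorHom, embeddingμ_hom, embeddingμ_hom, embeddingμ_hom,
          embeddingμ_hom, embedding_map_eq, ← reindexHom_id, ← reindexHom_id, associator_hom_def]
        erw [reindexHom_tensor, reindexHom_tensor, reindexHom_comp, reindexHom_comp,
          reindexHom_comp, reindexHom_comp]
        congr 1
        funext p
        exact (by simp :
          (𝟙 (X ⊗ Y) ⊗ₘ 𝟙 Z) ≫ 𝟙 ((X ⊗ Y) ⊗ Z) ≫ (α_ X Y Z).hom =
            (α_ X Y Z).hom ≫ (𝟙 X ⊗ₘ 𝟙 (Y ⊗ Z)) ≫ 𝟙 (X ⊗ (Y ⊗ Z)))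
      left_unitality := fun X => by
        rw [← tensorHom_id, Iso.refl_hom]
        erw [id_tensorHom_id, Category.id_comp]
        rw [embeddingμ_hom, embedding_map_eq, leftUnitor_hom_def]
        erw [reindexHom_comp]
        congr 1
        funext p
        exact (Category.id_comp _).symm
      right_unitality := fun X => by
        rw [← id_tensorHom, Iso.refl_hom]
        erw [id_tensorHom_id, Category.id_comp]
        rw [embeddingμ_hom, embedding_map_eq, rightUnitor_hom_def]
        erw [reindexHom_comp]
        congr 1
        funext p
        exact (Category.id_comp _).symm }

end

end MatMonoidal

namespace KaroubiMonoidal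

open Idempotents

noncomputable section

variable {C : Type w} [Category.{v} C] [MonoidalCategory C]

/-- The tensor product of two objects of the Karoubi envelope. -/
def tensorObj (P Q : Karoubi C) : Karoubi C :=
  ⟨P.X ⊗ Q.X, P.p ⊗ₘ Q.p, by rw [tensorHom_comp_tensorHom, P.idem, Q.idem]⟩

/-- An isomorphism of `C` compatible with given idempotents, as an isomorphism of the Karoubi
envelope. -/
def mkIso {P Q : Karoubi C} (e : P.X ≅ Q.X) (h : P.p ≫ e.hom = e.hom ≫ Q.p) : P ≅ Q where
  hom := ⟨P.p ≫ e.hom, by rw [h, Category.assoc, Q.idem, ← h, ← Category.assoc, P.idem]⟩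
  inv := ⟨Q.p ≫ e.inv, by
    have h' : Q.p ≫ e.inv = e.inv ≫ P.p := by
      rw [Iso.comp_inv_eq, Category.assoc, h, Iso.inv_hom_id_assoc]
    rw [h', Category.assoc, P.idem, ← h', ← Category.assoc, Q.idem]⟩
  hom_inv_id := by
    have h' : Q.p ≫ e.inv = e.inv ≫ P.p := by
      rw [Iso.comp_inv_eq, Category.assoc, h, Iso.inv_hom_id_assoc]
    ext
    rw [Karoubi.comp_f, Karoubi.id_f]
    simp only [Category.assoc]
    rw [h', Iso.hom_inv_id_assoc, P.idem]
  inv_hom_id := by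
    ext
    rw [Karoubi.comp_f, Karoubi.id_f]
    simp only [Category.assoc]
    rw [h, Iso.inv_hom_id_assoc, Q.idem]

instance : MonoidalCategoryStruct (Karoubi C) where
  tensorObj := tensorObj
  tensorHom f g := ⟨f.f ⊗ₘ g.f, by
    simp only [tensorObj, tensorHom_comp_tensorHom, Karoubi.p_comp, Karoubi.comp_p]⟩
  whiskerLeft P _ _ f := ⟨P.p ⊗ₘ f.f, by
    simp only [tensorObj, tensorHom_comp_tensorHom, Karoubi.p_comp, Karoubi.comp_p,
      Karoubi.idem]⟩
  whiskerRight f Q := ⟨f.f ⊗ₘ Q.p, by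
    simp only [tensorObj, tensorHom_comp_tensorHom, Karoubi.p_comp, Karoubi.comp_p,
      Karoubi.idem]⟩
  tensorUnit := ⟨𝟙_ C, 𝟙 _, by simp⟩
  associator P Q R := mkIso (P := tensorObj (tensorObj P Q) R) (Q := tensorObj P (tensorObj Q R))
    (α_ P.X Q.X R.X) (associator_naturality _ _ _)
  leftUnitor P := mkIso (P := tensorObj ⟨𝟙_ C, 𝟙 _, by simp⟩ P) (λ_ P.X) (by
    simp [tensorObj])
  rightUnitor P := mkIso (P := tensorObj P ⟨𝟙_ C, 𝟙 _, by simp⟩) (ρ_ P.X) (by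
    simp [tensorObj])

theorem tensorHom_f {P Q P' Q' : Karoubi C} (f : P ⟶ Q) (g : P' ⟶ Q') :
    (f ⊗ₘ g).f = f.f ⊗ₘ g.f := rfl
theorem associator_f (P Q R : Karoubi C) :
    (α_ P Q R).hom.f = ((P.p ⊗ₘ Q.p) ⊗ₘ R.p) ≫ (α_ P.X Q.X R.X).hom := rfl
theorem leftUnitor_f (P : Karoubi C) : (λ_ P).hom.f = (𝟙 (𝟙_ C) ⊗ₘ P.p) ≫ (λ_ P.X).hom := rfl
theorem rightUnitor_f (P : Karoubi C) : (ρ_ P).hom.f = (P.p ⊗ₘ 𝟙 (𝟙_ C)) ≫ (ρ_ P.X).hom := rfl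
theorem unit_p : (𝟙_ (Karoubi C)).p = 𝟙 (𝟙_ C) := rfl

section Aux

variable {X X' Y Y' Z Z' W : C}

theorem associator_natural_aux {p : X ⟶ X} {q : Y ⟶ Y} {r : Z ⟶ Z} {p' : X' ⟶ X'} {q' : Y' ⟶ Y'}
    {r' : Z' ⟶ Z'} {f : X ⟶ X'} {g : Y ⟶ Y'} {h : Z ⟶ Z'} (hp : p ≫ f = f) (hq : q ≫ g = g)
    (hr : r ≫ h = h) (hp' : f ≫ p' = f) (hq' : g ≫ q' = g) (hr' : h ≫ r' = h) :
    ((f ⊗ₘ g) ⊗ₘ h) ≫ ((p' ⊗ₘ q') ⊗ₘ r') ≫ (α_ X' Y' Z').hom =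
      (((p ⊗ₘ q) ⊗ₘ r) ≫ (α_ X Y Z).hom) ≫ (f ⊗ₘ (g ⊗ₘ h)) := by
  rw [Category.assoc, ← associator_naturality, ← Category.assoc, ← Category.assoc,
    tensorHom_comp_tensorHom, tensorHom_comp_tensorHom, tensorHom_comp_tensorHom,
    tensorHom_comp_tensorHom, hp, hq, hr, hp', hq', hr']

theorem leftUnitor_natural_aux {p : X ⟶ X} {p' : X' ⟶ X'} {f : X ⟶ X'} (hp : p ≫ f = f)
    (hp' : f ≫ p' = f) : (𝟙 (𝟙_ C) ⊗ₘ f) ≫ (𝟙 (𝟙_ C) ⊗ₘ p') ≫ (λ_ X').hom =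
      ((𝟙 (𝟙_ C) ⊗ₘ p) ≫ (λ_ X).hom) ≫ f := by
  rw [← Category.assoc, tensorHom_comp_tensorHom, hp']
  simp only [id_tensorHom, leftUnitor_naturality, Category.assoc, Category.comp_id, hp]

theorem rightUnitor_natural_aux {p : X ⟶ X} {p' : X' ⟶ X'} {f : X ⟶ X'} (hp : p ≫ f = f)
    (hp' : f ≫ p' = f) : (f ⊗ₘ 𝟙 (𝟙_ C)) ≫ (p' ⊗ₘ 𝟙 (𝟙_ C)) ≫ (ρ_ X').hom =
      ((p ⊗ₘ 𝟙 (𝟙_ C)) ≫ (ρ_ X).hom) ≫ f := by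
  rw [← Category.assoc, tensorHom_comp_tensorHom, hp']
  simp only [tensorHom_id, rightUnitor_naturality, Category.assoc, Category.comp_id, hp]

theorem pentagon_aux {w : W ⟶ W} {x : X ⟶ X} {y : Y ⟶ Y} {z : Z ⟶ Z} (hw : w ≫ w = w)
    (hx : x ≫ x = x) (hy : y ≫ y = y) (hz : z ≫ z = z) :
    ((((w ⊗ₘ x) ⊗ₘ y) ≫ (α_ W X Y).hom) ⊗ₘ z) ≫
        (((w ⊗ₘ (x ⊗ₘ y)) ⊗ₘ z) ≫ (α_ W (X ⊗ Y) Z).hom) ≫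
          (w ⊗ₘ (((x ⊗ₘ y) ⊗ₘ z) ≫ (α_ X Y Z).hom)) =
      ((((w ⊗ₘ x) ⊗ₘ y) ⊗ₘ z) ≫ (α_ (W ⊗ X) Y Z).hom) ≫
        (((w ⊗ₘ x) ⊗ₘ (y ⊗ₘ z)) ≫ (α_ W X (Y ⊗ Z)).hom) := by
  have e1 : ((((w ⊗ₘ x) ⊗ₘ y) ≫ (α_ W X Y).hom) ⊗ₘ z) =
      (((w ⊗ₘ x) ⊗ₘ y) ⊗ₘ z) ≫ ((α_ W X Y).hom ⊗ₘ 𝟙 Z) := by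
    rw [tensorHom_comp_tensorHom, Category.comp_id]
  have e2 : (w ⊗ₘ (((x ⊗ₘ y) ⊗ₘ z) ≫ (α_ X Y Z).hom)) =
      (w ⊗ₘ ((x ⊗ₘ y) ⊗ₘ z)) ≫ (𝟙 W ⊗ₘ (α_ X Y Z).hom) := by
    rw [tensorHom_comp_tensorHom, Category.comp_id]
  have i1 : ∀ {A B : C} {a : A ⟶ A} {b : B ⟶ B}, a ≫ a = a → b ≫ b = b →
      (a ⊗ₘ b) ≫ (a ⊗ₘ b) = a ⊗ₘ b := by
    intro A B a b ha hb
    rw [tensorHom_comp_tensorHom, ha, hb]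
  have t : (((w ⊗ₘ x) ⊗ₘ y) ⊗ₘ z) ≫ (((w ⊗ₘ x) ⊗ₘ y) ⊗ₘ z) = ((w ⊗ₘ x) ⊗ₘ y) ⊗ₘ z :=
    i1 (i1 (i1 hw hx) hy) hz
  have m1 : ((α_ W X Y).hom ⊗ₘ 𝟙 Z) ≫ ((w ⊗ₘ (x ⊗ₘ y)) ⊗ₘ z) =
      (((w ⊗ₘ x) ⊗ₘ y) ⊗ₘ z) ≫ ((α_ W X Y).hom ⊗ₘ 𝟙 Z) := by
    rw [tensorHom_comp_tensorHom, tensorHom_comp_tensorHom, ← associator_naturality,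
      Category.id_comp, Category.comp_id]
  have p := MonoidalCategory.pentagon W X Y Z
  rw [← tensorHom_id, ← id_tensorHom] at p
  rw [e1, e2]
  simp only [Category.assoc]
  rw [← associator_naturality_assoc, reassoc_of% m1, reassoc_of% m1, reassoc_of% t,
    reassoc_of% t, p, ← associator_naturality_assoc, reassoc_of% t]

theorem triangle_aux {x : X ⟶ X} {y : Y ⟶ Y} (hx : x ≫ x = x) (hy : y ≫ y = y) :
    (((x ⊗ₘ 𝟙 (𝟙_ C)) ⊗ₘ y) ≫ (α_ X (𝟙_ C) Y).hom) ≫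
        (x ⊗ₘ ((𝟙 (𝟙_ C) ⊗ₘ y) ≫ (λ_ Y).hom)) = ((x ⊗ₘ 𝟙 (𝟙_ C)) ≫ (ρ_ X).hom) ⊗ₘ y := by
  have e1 : x ⊗ₘ ((𝟙 (𝟙_ C) ⊗ₘ y) ≫ (λ_ Y).hom) =
      (x ⊗ₘ (𝟙 (𝟙_ C) ⊗ₘ y)) ≫ (𝟙 X ⊗ₘ (λ_ Y).hom) := by
    rw [tensorHom_comp_tensorHom, Category.comp_id]
  have e2 : ((x ⊗ₘ 𝟙 (𝟙_ C)) ≫ (ρ_ X).hom) ⊗ₘ y =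
      ((x ⊗ₘ 𝟙 (𝟙_ C)) ⊗ₘ y) ≫ ((ρ_ X).hom ⊗ₘ 𝟙 Y) := by
    rw [tensorHom_comp_tensorHom, Category.comp_id]
  have t : ((x ⊗ₘ 𝟙 (𝟙_ C)) ⊗ₘ y) ≫ ((x ⊗ₘ 𝟙 (𝟙_ C)) ⊗ₘ y) = (x ⊗ₘ 𝟙 (𝟙_ C)) ⊗ₘ y := by
    rw [tensorHom_comp_tensorHom, tensorHom_comp_tensorHom, hx, hy, Category.comp_id]
  have p := MonoidalCategory.triangle X Y
  rw [← tensorHom_id, ← id_tensorHom] at p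
  rw [e1, e2, Category.assoc, ← associator_naturality_assoc, p, reassoc_of% t]

end Aux

instance : MonoidalCategory (Karoubi C) :=
  MonoidalCategory.ofTensorHom
    (id_tensorHom_id := fun _ _ => rfl)
    (id_tensorHom := fun _ _ _ _ => rfl)
    (tensorHom_id := fun _ _ => rfl)
    (tensorHom_comp_tensorHom := fun _ _ _ _ => Karoubi.hom_ext _ _
      (tensorHom_comp_tensorHom _ _ _ _))
    (associator_naturality := fun f g h => Karoubi.hom_ext _ _
      (associator_natural_aux (Karoubi.p_comp f) (Karoubi.p_comp g) (Karoubi.p_comp h)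
        (Karoubi.comp_p f) (Karoubi.comp_p g) (Karoubi.comp_p h)))
    (leftUnitor_naturality := fun f => Karoubi.hom_ext _ _
      (leftUnitor_natural_aux (Karoubi.p_comp f) (Karoubi.comp_p f)))
    (rightUnitor_naturality := fun f => Karoubi.hom_ext _ _
      (rightUnitor_natural_aux (Karoubi.p_comp f) (Karoubi.comp_p f)))
    (pentagon := fun W X Y Z => Karoubi.hom_ext _ _
      (pentagon_aux W.idem X.idem Y.idem Z.idem))
    (triangle := fun X Y => Karoubi.hom_ext _ _ (triangle_aux X.idem Y.idem))

/-- The embedding of a monoidal category in its Karoubi envelope is monoidal. -/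
instance : (toKaroubi C).Monoidal :=
  Functor.CoreMonoidal.toMonoidal
    { εIso := Iso.refl _
      μIso := fun X Y => mkIso (P := tensorObj ((toKaroubi C).obj X) ((toKaroubi C).obj Y))
        (Q := (toKaroubi C).obj (X ⊗ Y)) (Iso.refl (X ⊗ Y)) (by simp [tensorObj])
      μIso_hom_natural_left := fun {X Y} f X' => Karoubi.hom_ext _ _ (by
        exact (by simp : (f ⊗ₘ 𝟙 X') ≫ (𝟙 Y ⊗ₘ 𝟙 X') ≫ 𝟙 (Y ⊗ X') =
          ((𝟙 X ⊗ₘ 𝟙 X') ≫ 𝟙 (X ⊗ X')) ≫ f ▷ X'))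
      μIso_hom_natural_right := fun {X Y} X' f => Karoubi.hom_ext _ _ (by
        exact (by simp : (𝟙 X' ⊗ₘ f) ≫ (𝟙 X' ⊗ₘ 𝟙 Y) ≫ 𝟙 (X' ⊗ Y) =
          ((𝟙 X' ⊗ₘ 𝟙 X) ≫ 𝟙 (X' ⊗ X)) ≫ X' ◁ f))
      associativity := fun X Y Z => Karoubi.hom_ext _ _ (by
        exact (by simp : (((𝟙 X ⊗ₘ 𝟙 Y) ≫ 𝟙 (X ⊗ Y)) ⊗ₘ 𝟙 Z) ≫
            ((𝟙 (X ⊗ Y) ⊗ₘ 𝟙 Z) ≫ 𝟙 ((X ⊗ Y) ⊗ Z)) ≫ (α_ X Y Z).hom =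
          (((𝟙 X ⊗ₘ 𝟙 Y) ⊗ₘ 𝟙 Z) ≫ (α_ X Y Z).hom) ≫
            (𝟙 X ⊗ₘ ((𝟙 Y ⊗ₘ 𝟙 Z) ≫ 𝟙 (Y ⊗ Z))) ≫ ((𝟙 X ⊗ₘ 𝟙 (Y ⊗ Z)) ≫ 𝟙 (X ⊗ (Y ⊗ Z)))))
      left_unitality := fun X => Karoubi.hom_ext _ _ (by
        exact (by simp : (𝟙 (𝟙_ C) ⊗ₘ 𝟙 X) ≫ (λ_ X).hom =
          (𝟙 (𝟙_ C) ⊗ₘ 𝟙 X) ≫ ((𝟙 (𝟙_ C) ⊗ₘ 𝟙 X) ≫ 𝟙 (𝟙_ C ⊗ X)) ≫ (λ_ X).hom))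
      right_unitality := fun X => Karoubi.hom_ext _ _ (by
        exact (by simp : (𝟙 X ⊗ₘ 𝟙 (𝟙_ C)) ≫ (ρ_ X).hom =
          (𝟙 X ⊗ₘ 𝟙 (𝟙_ C)) ≫ ((𝟙 X ⊗ₘ 𝟙 (𝟙_ C)) ≫ 𝟙 (X ⊗ 𝟙_ C)) ≫ (ρ_ X).hom)) }

end

end KaroubiMonoidal

/-- The super Karoubi envelope of a monoidal supercategory: the additive Karoubi envelope (the
idempotent completion of the additive envelope) of the underlying category of its `Π`-envelope. -/
abbrev SKar (k : Type u) [Field k] (A : Type w) [Category.{v} A] [Preadditive A]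
    [Linear k A] [Supercategory k A] :=
  Idempotents.Karoubi (Mat_ (Underlying k (PiEnv k A)))

/-- The canonical functor to the super Karoubi envelope. -/
noncomputable abbrev toSKar (k : Type u) [Field k] (A : Type w) [Category.{v} A] [Preadditive A]
    [Linear k A] [Supercategory k A] :
    Underlying k (PiEnv k A) ⥤ SKar k A :=
  Mat_.embedding _ ⋙ Idempotents.toKaroubi _

/-! ## Superspaces: homomorphisms and tensor products -/

open scoped TensorProduct

namespace SuperGrading

section Hom

variable {k : Type u} [Field k] {M : Type v} [AddCommGroup M] [Module k M]
  {N : Type v'} [AddCommGroup N] [Module k N]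

theorem part_mem_cast {G : SuperGrading k M} {p r : ZMod 2} {m : M} (h : m ∈ G.part p)
    (e : p = r) : m ∈ G.part r := e ▸ h

/-- The grading on the space of all linear maps: `f` has parity `p` if it maps vectors of parity
`a` to vectors of parity `a + p`. -/
noncomputable def hom (G : SuperGrading k M) (H : SuperGrading k N) :
    SuperGrading k (M →ₗ[k] N) :=
  ofProj
    (fun p =>
      { carrier := {f | ∀ a, ∀ m ∈ G.part a, f m ∈ H.part (a + p)}
        add_mem' := fun hf hg a m hm => add_mem (hf a m hm) (hg a m hm)
        zero_mem' := fun _ _ _ => zero_mem _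
        smul_mem' := fun c _ hf a m hm => Submodule.smul_mem _ c (hf a m hm) })
    (fun p =>
      { toFun := fun f => H.proj p ∘ₗ f ∘ₗ G.proj 0 + H.proj (p + 1) ∘ₗ f ∘ₗ G.proj 1
        map_add' := fun f g => by ext m; simp; abel
        map_smul' := fun c f => by ext m; simp })
    (by
      intro p f a m hm
      have e : (1 + 1 : ZMod 2) = 0 := by decide
      rcases zmod2_cases a with rfl | rfl
      · simpa [G.proj_of_mem' _ hm] using H.proj_mem p (f m)
      · simpa [G.proj_of_mem' _ hm, add_comm] using H.proj_mem (p + 1) (f m))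
    (by
      intro f
      ext m
      have e : (1 + 1 : ZMod 2) = 0 := by decide
      conv_rhs => rw [← G.proj_add_proj m, map_add, ← H.proj_add_proj (f (G.proj 0 m)),
        ← H.proj_add_proj (f (G.proj 1 m))]
      simp [e]
      abel)
    (by
      intro p f hf
      ext m
      have h0 : f (G.proj 0 m) ∈ H.part (0 + p) := hf 0 _ (G.proj_mem 0 m)
      have h1 : f (G.proj 1 m) ∈ H.part (1 + p) := hf 1 _ (G.proj_mem 1 m)
      have e0 : p + 1 ≠ 0 + p := (by decide : ∀ p : ZMod 2, p + 1 ≠ 0 + p) p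
      have e1 : p + 1 + 1 ≠ 1 + p := (by decide : ∀ p : ZMod 2, p + 1 + 1 ≠ 1 + p) p
      simp [H.proj_of_mem_ne h0 e0, H.proj_of_mem_ne h1 e1])

theorem mem_hom {G : SuperGrading k M} {H : SuperGrading k N} {p : ZMod 2} {f : M →ₗ[k] N} :
    f ∈ (G.hom H).part p ↔ ∀ a, ∀ m ∈ G.part a, f m ∈ H.part (a + p) := Iff.rfl

theorem id_mem_hom (G : SuperGrading k M) : LinearMap.id ∈ (G.hom G).part 0 :=
  mem_hom.2 fun a m hm => by simpa using hm

/-- To prove an equality of linear maps, it is enough to evaluate on homogeneous vectors. -/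
theorem linearMap_ext (G : SuperGrading k M) {f g : M →ₗ[k] N}
    (h : ∀ p, ∀ m ∈ G.part p, f m = g m) : f = g := by
  ext m
  refine G.induction (C := fun m => f m = g m) h ?_ m
  intro m n hm hn
  rw [map_add, map_add, hm, hn]

variable {P : Type w} [AddCommGroup P] [Module k P]

theorem comp_mem_hom {G : SuperGrading k M} {H : SuperGrading k N} {K : SuperGrading k P}
    {p r : ZMod 2} {f : M →ₗ[k] N} {g : N →ₗ[k] P} (hf : f ∈ (G.hom H).part p)
    (hg : g ∈ (H.hom K).part r) : g ∘ₗ f ∈ (G.hom K).part (p + r) :=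
  mem_hom.2 fun a m hm => by
    rw [← add_assoc]
    exact hg _ _ (hf a m hm)

/-- The tensor product of two superspaces. -/
noncomputable def tensor (G : SuperGrading k M) (H : SuperGrading k N) :
    SuperGrading k (M ⊗[k] N) :=
  ofProj
    (fun p => Submodule.span k {x | ∃ a b : ZMod 2, a + b = p ∧
      ∃ m ∈ G.part a, ∃ n ∈ H.part b, m ⊗ₜ[k] n = x})
    (fun p => TensorProduct.map (G.proj 0) (H.proj p) + TensorProduct.map (G.proj 1) (H.proj (p + 1)))
    (by
      intro p x
      have e : 1 + (p + 1) = p := by revert p; decide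
      induction x with
      | zero => rw [map_zero]; exact zero_mem _
      | add x y hx hy => rw [map_add]; exact add_mem hx hy
      | tmul m n =>
        simp only [LinearMap.add_apply, TensorProduct.map_tmul]
        exact add_mem
          (Submodule.subset_span ⟨0, p, zero_add p, _, G.proj_mem _ _, _, H.proj_mem _ _, rfl⟩)
          (Submodule.subset_span ⟨1, p + 1, e, _, G.proj_mem _ _, _, H.proj_mem _ _, rfl⟩))
    (by
      intro x
      have e : (1 + 1 : ZMod 2) = 0 := by decide
      induction x with
      | zero => simp
      | add x y hx hy =>
        rw [map_add, map_add, add_add_add_comm, hx, hy]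
      | tmul m n =>
        conv_rhs => rw [← G.proj_add_proj m, ← H.proj_add_proj n]
        simp [e, TensorProduct.add_tmul, TensorProduct.tmul_add]
        abel)
    (by
      intro p x hx
      induction hx using Submodule.span_induction with
      | zero => simp
      | add x y _ _ hx hy => rw [map_add, hx, hy, add_zero]
      | smul c x _ hx => rw [map_smul, hx, smul_zero]
      | mem x hx =>
        obtain ⟨a, b, rfl, m, hm, n, hn, rfl⟩ := hx
        have e0 : ¬ (1 = (0 : ZMod 2)) := by decide
        have e1 : ¬ (0 = (1 : ZMod 2)) := by decide
        rcases zmod2_cases a with rfl | rfl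
        · have e2 : ¬ (0 + b + 1 = b) := (by decide : ∀ b : ZMod 2, ¬ (0 + b + 1 = b)) b
          simp [G.proj_of_mem' _ hm, H.proj_of_mem' _ hn]
        · have e2 : ¬ (1 + b + 1 + 1 = b) :=
            (by decide : ∀ b : ZMod 2, ¬ (1 + b + 1 + 1 = b)) b
          simp [G.proj_of_mem' _ hm, H.proj_of_mem' _ hn, e2])

theorem tmul_mem_tensor {G : SuperGrading k M} {H : SuperGrading k N} {a b : ZMod 2} {m : M}
    {n : N} (hm : m ∈ G.part a) (hn : n ∈ H.part b) : m ⊗ₜ[k] n ∈ (G.tensor H).part (a + b) :=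
  Submodule.subset_span ⟨a, b, rfl, m, hm, n, hn, rfl⟩

theorem tensor_ext (G : SuperGrading k M) (H : SuperGrading k N) {f g : M ⊗[k] N →ₗ[k] P}
    (h : ∀ a, ∀ m ∈ G.part a, ∀ b, ∀ n ∈ H.part b, f (m ⊗ₜ n) = g (m ⊗ₜ n)) : f = g := by
  apply TensorProduct.ext
  refine G.linearMap_ext fun a m hm => H.linearMap_ext fun b n hn => ?_
  exact h a m hm b n hn

theorem mem_hom_tensor {G : SuperGrading k M} {H : SuperGrading k N} {K : SuperGrading k P}
    {p : ZMod 2} {f : M ⊗[k] N →ₗ[k] P}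
    (h : ∀ a, ∀ m ∈ G.part a, ∀ b, ∀ n ∈ H.part b, f (m ⊗ₜ n) ∈ K.part (a + b + p)) :
    f ∈ ((G.tensor H).hom K).part p := by
  rw [mem_hom]
  intro a x hx
  refine Submodule.span_induction (p := fun x _ => f x ∈ K.part (a + p)) ?_ ?_ ?_ ?_ hx
  · rintro x ⟨b, c, rfl, m, hm, n, hn, rfl⟩
    exact h b m hm c n hn
  · rw [map_zero]; exact zero_mem _
  · intro x y _ _ hx hy
    rw [map_add]; exact add_mem hx hy
  · intro c x _ hx
    rw [map_smul]; exact Submodule.smul_mem _ _ hx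

/-- A field as a purely even superspace. -/
def even (k : Type u) [Field k] : SuperGrading k k where
  part p := if p = 0 then ⊤ else ⊥
  isCompl := by simpa using isCompl_top_bot

theorem mem_even_zero (c : k) : c ∈ (even k).part 0 := by simp [even]

theorem mem_even {c : k} {p : ZMod 2} (h : c ∈ (even k).part p) : p = 0 ∨ c = 0 := by
  rcases zmod2_cases p with rfl | rfl
  · exact Or.inl rfl
  · right; simpa [even] using h

/-- The parity involution `m ↦ (-1)^{|m|} m`. -/
noncomputable def sgn (G : SuperGrading k M) : M →ₗ[k] M := G.proj 0 - G.proj 1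

theorem sgn_apply {G : SuperGrading k M} {a : ZMod 2} {m : M} (hm : m ∈ G.part a) :
    G.sgn m = superSign k a • m := by
  rcases zmod2_cases a with rfl | rfl <;> simp [sgn, G.proj_of_mem' _ hm]

variable {M' : Type w'} [AddCommGroup M'] [Module k M'] {N' : Type w''} [AddCommGroup N']
  [Module k N']

/-- The tensor product of linear maps of superspaces, with
`(f ⊗ g) (m ⊗ n) = (-1)^{|g| |m|} f m ⊗ g n`. -/
noncomputable def superMap (G : SuperGrading k M) (H : SuperGrading k N) (H' : SuperGrading k N')
    (f : M →ₗ[k] M') (g : N →ₗ[k] N') : M ⊗[k] N →ₗ[k] M' ⊗[k] N' :=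
  TensorProduct.map f ((H.hom H').proj 0 g) + TensorProduct.map (f ∘ₗ G.sgn) ((H.hom H').proj 1 g)

variable {G : SuperGrading k M} {H : SuperGrading k N} {H' : SuperGrading k N'}

theorem superMap_tmul {p a : ZMod 2} (f : M →ₗ[k] M') {g : N →ₗ[k] N'}
    (hg : g ∈ (H.hom H').part p) {m : M} (hm : m ∈ G.part a) (n : N) :
    superMap G H H' f g (m ⊗ₜ n) = superSign k (p * a) • (f m ⊗ₜ g n) := by
  rcases zmod2_cases p with rfl | rfl
  · simp [superMap, (H.hom H').proj_of_mem' _ hg]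
  · simp [superMap, (H.hom H').proj_of_mem' _ hg, sgn_apply hm, TensorProduct.smul_tmul']

theorem superMap_tmul_even (f : M →ₗ[k] M') {g : N →ₗ[k] N'}
    (hg : g ∈ (H.hom H').part 0) (m : M) (n : N) :
    superMap G H H' f g (m ⊗ₜ n) = f m ⊗ₜ g n := by
  simp [superMap, (H.hom H').proj_of_mem' _ hg]

theorem superMap_add_left (f f' : M →ₗ[k] M') (g : N →ₗ[k] N') :
    superMap G H H' (f + f') g = superMap G H H' f g + superMap G H H' f' g := by
  simp only [superMap, LinearMap.add_comp, TensorProduct.map_add_left]; abel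

theorem superMap_add_right (f : M →ₗ[k] M') (g g' : N →ₗ[k] N') :
    superMap G H H' f (g + g') = superMap G H H' f g + superMap G H H' f g' := by
  simp only [superMap, map_add, TensorProduct.map_add_right]; abel

theorem superMap_smul_left (c : k) (f : M →ₗ[k] M') (g : N →ₗ[k] N') :
    superMap G H H' (c • f) g = c • superMap G H H' f g := by
  simp only [superMap, LinearMap.smul_comp, TensorProduct.map_smul_left, smul_add]

theorem superMap_smul_right (c : k) (f : M →ₗ[k] M') (g : N →ₗ[k] N') :
    superMap G H H' f (c • g) = c • superMap G H H' f g := by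
  simp only [superMap, map_smul, TensorProduct.map_smul_right, smul_add]

theorem superMap_id : superMap G H H LinearMap.id LinearMap.id = LinearMap.id := by
  ext m n
  simp [superMap_tmul_even _ H.id_mem_hom]

theorem superMap_mem {G' : SuperGrading k M'} {p r : ZMod 2} {f : M →ₗ[k] M'} {g : N →ₗ[k] N'}
    (hf : f ∈ (G.hom G').part p) (hg : g ∈ (H.hom H').part r) :
    superMap G H H' f g ∈ ((G.tensor H).hom (G'.tensor H')).part (p + r) := by
  refine mem_hom_tensor fun a m hm b n hn => ?_
  rw [superMap_tmul f hg hm]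
  refine Submodule.smul_mem _ _ ?_
  exact part_mem_cast (tmul_mem_tensor (hf a m hm) (hg b n hn)) (by ring)

variable {M'' : Type*} [AddCommGroup M''] [Module k M''] {N'' : Type*} [AddCommGroup N'']
  [Module k N'']

theorem superMap_comp {G' : SuperGrading k M'} {H'' : SuperGrading k N''} {p r : ZMod 2}
    {h : M →ₗ[k] M'} (l : N →ₗ[k] N') (f : M' →ₗ[k] M'') {g : N' →ₗ[k] N''}
    (hg : g ∈ (H'.hom H'').part p) (hh : h ∈ (G.hom G').part r) :
    superMap G' H' H'' f g ∘ₗ superMap G H H' h l =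
      superSign k (p * r) • superMap G H H'' (f ∘ₗ h) (g ∘ₗ l) := by
  refine (H.hom H').induction (C := fun l => superMap G' H' H'' f g ∘ₗ superMap G H H' h l =
      superSign k (p * r) • superMap G H H'' (f ∘ₗ h) (g ∘ₗ l)) ?_ ?_ l
  · intro s l hl
    refine tensor_ext G H fun a m hm b n hn => ?_
    rw [LinearMap.comp_apply, superMap_tmul h hl hm, map_smul, superMap_tmul f hg (hh a m hm),
      LinearMap.smul_apply, superMap_tmul _ (comp_mem_hom hl hg) hm, smul_smul, smul_smul,
      ← superSign_add, ← superSign_add]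
    congr 2
    ring
  · intro l l' e e'
    rw [superMap_add_right, LinearMap.comp_add, e, e', LinearMap.comp_add, superMap_add_right,
      smul_add]

end Hom

end SuperGrading

/-! ## The monoidal supercategory of superspaces -/

/-- A superspace. -/
structure SVec (k : Type u) [Field k] where
  carrier : Type u
  [addCommGroup : AddCommGroup carrier]
  [module : Module k carrier]
  grading : SuperGrading k carrier

attribute [instance] SVec.addCommGroup SVec.module

namespace SVec

variable (k : Type u) [Field k]

/-- Morphisms of superspaces are arbitrary linear maps. -/
instance : Category (SVec k) where
  Hom V W := V.carrier →ₗ[k] W.carrier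
  id _ := LinearMap.id
  comp f g := g ∘ₗ f

variable {k}

/-- The linear map underlying a morphism. -/
def lin {V W : SVec k} (f : V ⟶ W) : V.carrier →ₗ[k] W.carrier := f

/-- A linear map as a morphism. -/
def ofLin {V W : SVec k} (f : V.carrier →ₗ[k] W.carrier) : V ⟶ W := f

theorem hom_ext {V W : SVec k} {f g : V ⟶ W} (h : ∀ v, lin f v = lin g v) : f = g :=
  LinearMap.ext h

variable (k)

instance : Preadditive (SVec k) where
  homGroup V W := inferInstanceAs (AddCommGroup (V.carrier →ₗ[k] W.carrier))
  add_comp _ _ _ _ _ _ := LinearMap.comp_add _ _ _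
  comp_add _ _ _ _ _ _ := LinearMap.add_comp _ _ _

instance : Linear k (SVec k) where
  homModule V W := inferInstanceAs (Module k (V.carrier →ₗ[k] W.carrier))
  smul_comp _ _ _ _ _ _ := LinearMap.comp_smul _ _ _
  comp_smul _ _ _ _ _ _ := LinearMap.smul_comp _ _ _

noncomputable instance : Supercategory k (SVec k) where
  gr V W := V.grading.hom W.grading
  id_mem V := V.grading.id_mem_hom
  comp_mem hf hg := SuperGrading.comp_mem_hom hf hg

variable {k}

/-- A linear isomorphism as an isomorphism of superspaces. -/
def isoOfLin {V W : SVec k} (e : V.carrier ≃ₗ[k] W.carrier) : V ≅ W where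
  hom := ofLin e.toLinearMap
  inv := ofLin e.symm.toLinearMap
  hom_inv_id := hom_ext fun v => e.symm_apply_apply v
  inv_hom_id := hom_ext fun v => e.apply_symm_apply v

variable (k)

open SuperGrading

noncomputable instance : MonoidalCategoryStruct (SVec k) where
  tensorObj V W := ⟨V.carrier ⊗[k] W.carrier, V.grading.tensor W.grading⟩
  tensorHom {V _ W W'} f g := ofLin (superMap V.grading W.grading W'.grading f g)
  whiskerLeft V W W' g := ofLin (superMap V.grading W.grading W'.grading LinearMap.id g)
  whiskerRight {V _} f W := ofLin (superMap V.grading W.grading W.grading f LinearMap.id)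
  tensorUnit := ⟨k, SuperGrading.even k⟩
  associator V W X := isoOfLin (TensorProduct.assoc k V.carrier W.carrier X.carrier)
  leftUnitor V := isoOfLin (TensorProduct.lid k V.carrier)
  rightUnitor V := isoOfLin (TensorProduct.rid k V.carrier)

variable {k}

theorem assoc_mem {M N P : Type*} [AddCommGroup M] [Module k M] [AddCommGroup N] [Module k N]
    [AddCommGroup P] [Module k P] (G : SuperGrading k M) (H : SuperGrading k N)
    (K : SuperGrading k P) : (TensorProduct.assoc k M N P).toLinearMap ∈
      (((G.tensor H).tensor K).hom (G.tensor (H.tensor K))).part 0 := by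
  refine mem_hom_tensor fun a x hx b p hp => ?_
  refine Submodule.span_induction (p := fun x _ => (TensorProduct.assoc k M N P).toLinearMap
    (x ⊗ₜ[k] p) ∈ (G.tensor (H.tensor K)).part (a + b + 0)) ?_ ?_ ?_ ?_ hx
  · rintro x ⟨a, b', rfl, m, hm, n, hn, rfl⟩
    exact part_mem_cast (tmul_mem_tensor hm (tmul_mem_tensor hn hp)) (by ring)
  · rw [TensorProduct.zero_tmul, map_zero]; exact zero_mem _
  · intro x y _ _ hx hy
    rw [TensorProduct.add_tmul, map_add]; exact add_mem hx hy
  · intro c x _ hx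
    rw [← TensorProduct.smul_tmul', map_smul]; exact Submodule.smul_mem _ _ hx

theorem assoc_symm_mem {M N P : Type*} [AddCommGroup M] [Module k M] [AddCommGroup N] [Module k N]
    [AddCommGroup P] [Module k P] (G : SuperGrading k M) (H : SuperGrading k N)
    (K : SuperGrading k P) : (TensorProduct.assoc k M N P).symm.toLinearMap ∈
      ((G.tensor (H.tensor K)).hom ((G.tensor H).tensor K)).part 0 := by
  refine mem_hom_tensor fun a m hm b x hx => ?_
  refine Submodule.span_induction (p := fun x _ => (TensorProduct.assoc k M N P).symm.toLinearMap
    (m ⊗ₜ[k] x) ∈ ((G.tensor H).tensor K).part (a + b + 0)) ?_ ?_ ?_ ?_ hx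
  · rintro x ⟨a, b', rfl, n, hn, p, hp, rfl⟩
    exact part_mem_cast (tmul_mem_tensor (tmul_mem_tensor hm hn) hp) (by ring)
  · rw [TensorProduct.tmul_zero, map_zero]; exact zero_mem _
  · intro x y _ _ hx hy
    rw [TensorProduct.tmul_add, map_add]; exact add_mem hx hy
  · intro c x _ hx
    rw [TensorProduct.tmul_smul, map_smul]; exact Submodule.smul_mem _ _ hx

theorem lid_mem {M : Type*} [AddCommGroup M] [Module k M] (G : SuperGrading k M) :
    (TensorProduct.lid k M).toLinearMap ∈ (((even k).tensor G).hom G).part 0 := by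
  refine mem_hom_tensor fun a c hc b m hm => ?_
  rcases mem_even hc with rfl | rfl
  · simpa using Submodule.smul_mem _ c hm
  · simp

theorem lid_symm_mem {M : Type*} [AddCommGroup M] [Module k M] (G : SuperGrading k M) :
    (TensorProduct.lid k M).symm.toLinearMap ∈ (G.hom ((even k).tensor G)).part 0 :=
  mem_hom.2 fun _ _ hm => part_mem_cast (tmul_mem_tensor (mem_even_zero 1) hm) (by ring)

theorem rid_mem {M : Type*} [AddCommGroup M] [Module k M] (G : SuperGrading k M) :
    (TensorProduct.rid k M).toLinearMap ∈ ((G.tensor (even k)).hom G).part 0 := by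
  refine mem_hom_tensor fun a m hm b c hc => ?_
  rcases mem_even hc with rfl | rfl
  · simpa using Submodule.smul_mem _ c hm
  · simp

theorem rid_symm_mem {M : Type*} [AddCommGroup M] [Module k M] (G : SuperGrading k M) :
    (TensorProduct.rid k M).symm.toLinearMap ∈ (G.hom (G.tensor (even k))).part 0 :=
  mem_hom.2 fun _ _ hm => part_mem_cast (tmul_mem_tensor hm (mem_even_zero 1)) (by ring)

theorem superMap_assoc {M₁ M₂ M₃ N₁ N₂ N₃ : Type*} [AddCommGroup M₁] [Module k M₁]
    [AddCommGroup M₂] [Module k M₂] [AddCommGroup M₃] [Module k M₃] [AddCommGroup N₁] [Module k N₁]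
    [AddCommGroup N₂] [Module k N₂] [AddCommGroup N₃] [Module k N₃]
    (G₁ : SuperGrading k M₁) (G₂ : SuperGrading k M₂) (G₃ : SuperGrading k M₃)
    (H₂ : SuperGrading k N₂) (H₃ : SuperGrading k N₃)
    (f₁ : M₁ →ₗ[k] N₁) (f₂ : M₂ →ₗ[k] N₂) (f₃ : M₃ →ₗ[k] N₃) :
    (TensorProduct.assoc k N₁ N₂ N₃).toLinearMap ∘ₗ
        superMap (G₁.tensor G₂) G₃ H₃ (superMap G₁ G₂ H₂ f₁ f₂) f₃ =
      superMap G₁ (G₂.tensor G₃) (H₂.tensor H₃) f₁ (superMap G₂ G₃ H₃ f₂ f₃) ∘ₗ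
        (TensorProduct.assoc k M₁ M₂ M₃).toLinearMap := by
  revert f₂
  refine (G₂.hom H₂).induction ?_ ?_
  swap
  · intro f f' e e'
    rw [superMap_add_right, superMap_add_left, superMap_add_left, superMap_add_right,
      LinearMap.comp_add, LinearMap.add_comp, e, e']
  intro p f₂ h₂
  revert f₃
  refine (G₃.hom H₃).induction ?_ ?_
  swap
  · intro f f' e e'
    rw [superMap_add_right, superMap_add_right, superMap_add_right,
      LinearMap.comp_add, LinearMap.add_comp, e, e']
  intro r f₃ h₃
  apply TensorProduct.ext
  refine G₁.tensor_ext G₂ fun a m hm b n hn => G₃.linearMap_ext fun c l hl => ?_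
  simp only [TensorProduct.mk_apply, LinearMap.compr₂ₛₗ_apply,
    LinearMap.comp_apply, LinearEquiv.coe_coe, TensorProduct.assoc_tmul]
  rw [superMap_tmul _ h₃ (tmul_mem_tensor hm hn), superMap_tmul _ h₂ hm,
    superMap_tmul _ (superMap_mem h₂ h₃) hm, superMap_tmul _ h₃ hn]
  simp only [← TensorProduct.smul_tmul', TensorProduct.tmul_smul, map_smul,
    TensorProduct.assoc_tmul, smul_smul, ← superSign_add]
  congr 2
  ring

variable (k)

instance : MonoidalSupercategory k (SVec k) where
  add_tensor _ _ _ := superMap_add_left _ _ _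
  tensor_add _ _ _ := superMap_add_right _ _ _
  smul_tensor _ _ _ := superMap_smul_left _ _ _
  tensor_smul _ _ _ := superMap_smul_right _ _ _
  tensor_parity hf hg := superMap_mem hf hg
  id_tensor_id _ _ := superMap_id
  interchange _ l f _ hg hh := superMap_comp l f hg hh
  whiskerLeft_eq _ _ _ _ := rfl
  whiskerRight_eq _ _ := rfl
  associator_even _ _ _ := assoc_mem _ _ _
  associator_inv_even _ _ _ := assoc_symm_mem _ _ _
  leftUnitor_even _ := lid_mem _
  leftUnitor_inv_even _ := lid_symm_mem _
  rightUnitor_even _ := rid_mem _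
  rightUnitor_inv_even _ := rid_symm_mem _
  associator_natural _ _ _ := superMap_assoc _ _ _ _ _ _ _ _
  leftUnitor_natural {X Y} f := by
    refine TensorProduct.ext' fun (c : k) m => ?_
    refine (X.grading.hom Y.grading).induction (C := fun f => (TensorProduct.lid k Y.carrier)
      (superMap (even k) X.grading Y.grading LinearMap.id f (c ⊗ₜ m)) =
        f (TensorProduct.lid k X.carrier (c ⊗ₜ m))) ?_ ?_ f
    · intro p f hf
      rw [superMap_tmul _ hf (mem_even_zero c)]
      simp
    · intro f f' e e'
      rw [superMap_add_right, LinearMap.add_apply, map_add, e, e', LinearMap.add_apply]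
  rightUnitor_natural {X Y} f := by
    refine TensorProduct.ext' fun m c => ?_
    change (TensorProduct.rid k Y.carrier)
      (superMap X.grading (even k) (even k) f LinearMap.id (m ⊗ₜ c)) =
        lin f (TensorProduct.rid k X.carrier (m ⊗ₜ c))
    rw [superMap_tmul_even _ (even k).id_mem_hom]
    simp [lin]
  pentagon V W X Y := by
    apply TensorProduct.ext_fourfold
    intro v w x y
    change superMap V.grading ((W.grading.tensor X.grading).tensor Y.grading)
      (W.grading.tensor (X.grading.tensor Y.grading)) LinearMap.id
      (TensorProduct.assoc k W.carrier X.carrier Y.carrier).toLinearMap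
      (TensorProduct.assoc k V.carrier (W.carrier ⊗[k] X.carrier) Y.carrier
        (superMap ((V.grading.tensor W.grading).tensor X.grading) Y.grading Y.grading
          (TensorProduct.assoc k V.carrier W.carrier X.carrier).toLinearMap LinearMap.id
          (((v ⊗ₜ w) ⊗ₜ x) ⊗ₜ y))) = v ⊗ₜ (w ⊗ₜ (x ⊗ₜ y))
    rw [superMap_tmul_even _ Y.grading.id_mem_hom]
    simp only [LinearEquiv.coe_coe, LinearMap.id_coe, id_eq, TensorProduct.assoc_tmul]
    rw [superMap_tmul_even _ (assoc_mem _ _ _)]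
    simp
  triangle V W := by
    apply TensorProduct.ext_threefold
    intro v c w
    change superMap V.grading ((even k).tensor W.grading) W.grading LinearMap.id
      (TensorProduct.lid k W.carrier).toLinearMap (v ⊗ₜ (c ⊗ₜ w)) =
      superMap (V.grading.tensor (even k)) W.grading W.grading
        (TensorProduct.rid k V.carrier).toLinearMap LinearMap.id ((v ⊗ₜ c) ⊗ₜ w)
    rw [superMap_tmul_even _ W.grading.id_mem_hom, superMap_tmul_even _ (lid_mem _)]
    simp [TensorProduct.smul_tmul']

end SVec

/-! ## The monoidal supercategory `STL(δ)` -/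

/-- Expressions for morphisms of `STL(δ)` from `m` to `n`, built from the generating morphisms
`cup : 0 ⟶ 2` and `cap : 2 ⟶ 0`; `comp f g` is "`f` followed by `g`". -/
inductive STLPre (k : Type u) : ℕ → ℕ → Type u
  | cup : STLPre k 0 2
  | cap : STLPre k 2 0
  | id (n : ℕ) : STLPre k n n
  | comp {l m n : ℕ} (f : STLPre k l m) (g : STLPre k m n) : STLPre k l n
  | tensor {m n m' n' : ℕ} (f : STLPre k m n) (g : STLPre k m' n') : STLPre k (m + m') (n + n')
  | zero (m n : ℕ) : STLPre k m n
  | add {m n : ℕ} (f g : STLPre k m n) : STLPre k m n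
  | smul {m n : ℕ} (c : k) (f : STLPre k m n) : STLPre k m n

namespace STLPre

/-- The identity, between two names of the same object. -/
def ofEq (k : Type u) {m n : ℕ} (h : m = n) : STLPre k m n := h ▸ id m

/-- An expression is homogeneous of parity `p`, the generating morphisms being odd. -/
inductive HasParity {k : Type u} : ∀ {m n : ℕ}, ZMod 2 → STLPre k m n → Prop
  | cup : HasParity 1 cup
  | cap : HasParity 1 cap
  | id (n : ℕ) : HasParity 0 (id n)
  | comp {l m n : ℕ} {p r : ZMod 2} {f : STLPre k l m} {g : STLPre k m n} :
      HasParity p f → HasParity r g → HasParity (p + r) (comp f g)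
  | tensor {m n m' n' : ℕ} {p r : ZMod 2} {f : STLPre k m n} {g : STLPre k m' n'} :
      HasParity p f → HasParity r g → HasParity (p + r) (tensor f g)
  | zero (m n : ℕ) (p : ZMod 2) : HasParity p (zero m n)
  | add {m n : ℕ} {p : ZMod 2} {f g : STLPre k m n} :
      HasParity p f → HasParity p g → HasParity p (add f g)
  | smul {m n : ℕ} {p : ZMod 2} (c : k) {f : STLPre k m n} :
      HasParity p f → HasParity p (smul c f)

/-- The congruence generated by the axioms of strict monoidal supercategories together with
the defining relations `zigzag`, `zigzag'` and `bubble` of `STL(δ)`. -/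
inductive Rel {k : Type u} [Field k] (δ : k) : ∀ {m n : ℕ}, STLPre k m n → STLPre k m n → Prop
  -- equivalence relation and congruence
  | refl {m n : ℕ} (f : STLPre k m n) : Rel δ f f
  | symm {m n : ℕ} {f g : STLPre k m n} : Rel δ f g → Rel δ g f
  | trans {m n : ℕ} {f g h : STLPre k m n} : Rel δ f g → Rel δ g h → Rel δ f h
  | comp {l m n : ℕ} {f f' : STLPre k l m} {g g' : STLPre k m n} :
      Rel δ f f' → Rel δ g g' → Rel δ (comp f g) (comp f' g')
  | tensor {m n m' n' : ℕ} {f f' : STLPre k m n} {g g' : STLPre k m' n'} :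
      Rel δ f f' → Rel δ g g' → Rel δ (tensor f g) (tensor f' g')
  | add {m n : ℕ} {f f' g g' : STLPre k m n} :
      Rel δ f f' → Rel δ g g' → Rel δ (add f g) (add f' g')
  | smul {m n : ℕ} (c : k) {f f' : STLPre k m n} : Rel δ f f' → Rel δ (smul c f) (smul c f')
  -- vector space axioms
  | add_assoc {m n : ℕ} (f g h : STLPre k m n) : Rel δ (add (add f g) h) (add f (add g h))
  | add_comm {m n : ℕ} (f g : STLPre k m n) : Rel δ (add f g) (add g f)
  | zero_add {m n : ℕ} (f : STLPre k m n) : Rel δ (add (zero m n) f) f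
  | zero_smul {m n : ℕ} (f : STLPre k m n) : Rel δ (smul 0 f) (zero m n)
  | one_smul {m n : ℕ} (f : STLPre k m n) : Rel δ (smul 1 f) f
  | mul_smul {m n : ℕ} (c d : k) (f : STLPre k m n) : Rel δ (smul (c * d) f) (smul c (smul d f))
  | add_smul {m n : ℕ} (c d : k) (f : STLPre k m n) :
      Rel δ (smul (c + d) f) (add (smul c f) (smul d f))
  | smul_add {m n : ℕ} (c : k) (f g : STLPre k m n) :
      Rel δ (smul c (add f g)) (add (smul c f) (smul c g))
  -- composition: category axioms and bilinearity
  | id_comp {m n : ℕ} (f : STLPre k m n) : Rel δ (comp (id m) f) f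
  | comp_id {m n : ℕ} (f : STLPre k m n) : Rel δ (comp f (id n)) f
  | assoc {l m n o : ℕ} (f : STLPre k l m) (g : STLPre k m n) (h : STLPre k n o) :
      Rel δ (comp (comp f g) h) (comp f (comp g h))
  | add_comp {l m n : ℕ} (f f' : STLPre k l m) (g : STLPre k m n) :
      Rel δ (comp (add f f') g) (add (comp f g) (comp f' g))
  | comp_add {l m n : ℕ} (f : STLPre k l m) (g g' : STLPre k m n) :
      Rel δ (comp f (add g g')) (add (comp f g) (comp f g'))
  | smul_comp {l m n : ℕ} (c : k) (f : STLPre k l m) (g : STLPre k m n) :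
      Rel δ (comp (smul c f) g) (smul c (comp f g))
  | comp_smul {l m n : ℕ} (c : k) (f : STLPre k l m) (g : STLPre k m n) :
      Rel δ (comp f (smul c g)) (smul c (comp f g))
  -- tensor product: bilinearity, units, super interchange law, strictness
  | add_tensor {m n m' n' : ℕ} (f f' : STLPre k m n) (g : STLPre k m' n') :
      Rel δ (tensor (add f f') g) (add (tensor f g) (tensor f' g))
  | tensor_add {m n m' n' : ℕ} (f : STLPre k m n) (g g' : STLPre k m' n') :
      Rel δ (tensor f (add g g')) (add (tensor f g) (tensor f g'))
  | smul_tensor {m n m' n' : ℕ} (c : k) (f : STLPre k m n) (g : STLPre k m' n') :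
      Rel δ (tensor (smul c f) g) (smul c (tensor f g))
  | tensor_smul {m n m' n' : ℕ} (c : k) (f : STLPre k m n) (g : STLPre k m' n') :
      Rel δ (tensor f (smul c g)) (smul c (tensor f g))
  | id_tensor_id (m n : ℕ) : Rel δ (tensor (id m) (id n)) (id (m + n))
  | interchange {m₁ n₁ o₁ m₂ n₂ o₂ : ℕ} {p r : ZMod 2} (h : STLPre k m₁ n₁) (l : STLPre k m₂ n₂)
      (f : STLPre k n₁ o₁) (g : STLPre k n₂ o₂) : HasParity p g → HasParity r h →
      Rel δ (comp (tensor h l) (tensor f g))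
        (smul (superSign k (p * r)) (tensor (comp h f) (comp l g)))
  | tensor_assoc {m₁ n₁ m₂ n₂ m₃ n₃ : ℕ} (f₁ : STLPre k m₁ n₁) (f₂ : STLPre k m₂ n₂)
      (f₃ : STLPre k m₃ n₃) :
      Rel δ (comp (tensor (tensor f₁ f₂) f₃) (ofEq k (Nat.add_assoc n₁ n₂ n₃)))
        (comp (ofEq k (Nat.add_assoc m₁ m₂ m₃)) (tensor f₁ (tensor f₂ f₃)))
  | id_tensor {m n : ℕ} (f : STLPre k m n) :
      Rel δ (comp (tensor (id 0) f) (ofEq k (Nat.zero_add n))) (comp (ofEq k (Nat.zero_add m)) f)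
  | tensor_id {m n : ℕ} (f : STLPre k m n) :
      Rel δ (comp (tensor f (id 0)) (ofEq k (Nat.add_zero n))) (comp (ofEq k (Nat.add_zero m)) f)
  -- the defining relations
  | zigzag : Rel δ (comp (tensor (id 1) cup) (tensor cap (id 1)) : STLPre k 1 1) (id 1)
  | zigzag' : Rel δ (comp (tensor cup (id 1)) (tensor (id 1) cap) : STLPre k 1 1) (smul (-1) (id 1))
  | bubble : Rel δ (comp cup cap) (smul δ (id 0))

/-- The setoid of `STLPre.Rel`. -/
def setoid {k : Type u} [Field k] (δ : k) (m n : ℕ) : Setoid (STLPre k m n) where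
  r := Rel δ
  iseqv := ⟨Rel.refl, Rel.symm, Rel.trans⟩

end STLPre

/-- The objects of the strict monoidal supercategory `STL(δ)`: the object `n` is the `n`-fold
tensor power of the generating object `1`. -/
structure STL (k : Type u) (δ : k) where
  n : ℕ

namespace STL

variable {k : Type u} [Field k] {δ : k}

open STLPre

/-- The class of an expression, as a morphism. -/
def Mor (δ : k) (m n : ℕ) : Type u := Quotient (STLPre.setoid δ m n)

/-- The class of an expression. -/
def cls (δ : k) {m n : ℕ} (f : STLPre k m n) : Mor δ m n := Quotient.mk (STLPre.setoid δ m n) f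

theorem cls_eq {m n : ℕ} {f g : STLPre k m n} (h : Rel δ f g) : cls δ f = cls δ g :=
  Quotient.sound (s := STLPre.setoid δ m n) h

theorem rel_of_cls {m n : ℕ} {f g : STLPre k m n} (h : cls δ f = cls δ g) : Rel δ f g :=
  Quotient.exact (s := STLPre.setoid δ m n) h

theorem cls_surj {m n : ℕ} (f : Mor δ m n) : ∃ f', cls δ f' = f := Quotient.exists_rep f

instance (m n : ℕ) : Add (Mor δ m n) where
  add := Quotient.map₂ STLPre.add fun _ _ h _ _ h' => Rel.add h h'

instance (m n : ℕ) : Zero (Mor δ m n) where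
  zero := cls δ (STLPre.zero m n)

instance (m n : ℕ) : Neg (Mor δ m n) where
  neg := Quotient.map (STLPre.smul (-1)) fun _ _ h => Rel.smul _ h

instance (m n : ℕ) : AddCommGroup (Mor δ m n) where
  nsmul := nsmulRec
  zsmul := zsmulRec
  add_assoc f g h := by
    obtain ⟨f, rfl⟩ := cls_surj f; obtain ⟨g, rfl⟩ := cls_surj g; obtain ⟨h, rfl⟩ := cls_surj h
    exact cls_eq (Rel.add_assoc f g h)
  add_comm f g := by
    obtain ⟨f, rfl⟩ := cls_surj f; obtain ⟨g, rfl⟩ := cls_surj g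
    exact cls_eq (Rel.add_comm f g)
  zero_add f := by
    obtain ⟨f, rfl⟩ := cls_surj f
    exact cls_eq (Rel.zero_add f)
  add_zero f := by
    obtain ⟨f, rfl⟩ := cls_surj f
    exact cls_eq ((Rel.add_comm _ _).trans (Rel.zero_add f))
  neg_add_cancel f := by
    obtain ⟨f, rfl⟩ := cls_surj f
    refine cls_eq (f := (f.smul (-1)).add f) (g := STLPre.zero m n) ?_
    refine (Rel.add (Rel.refl _) (Rel.one_smul f).symm).trans ?_
    refine (Rel.add_smul _ _ f).symm.trans ?_
    rw [neg_add_cancel]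
    exact Rel.zero_smul f

theorem cls_add {m n : ℕ} (f g : STLPre k m n) : cls δ (f.add g) = cls δ f + cls δ g := rfl
theorem cls_zero {m n : ℕ} : cls δ (STLPre.zero m n) = 0 := rfl

instance (m n : ℕ) : Module k (Mor δ m n) where
  smul c := Quotient.map (STLPre.smul c) fun _ _ h => Rel.smul _ h
  one_smul f := by
    obtain ⟨f, rfl⟩ := cls_surj f
    exact cls_eq (Rel.one_smul f)
  mul_smul c d f := by
    obtain ⟨f, rfl⟩ := cls_surj f
    exact cls_eq (Rel.mul_smul c d f)
  smul_zero c := by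
    refine cls_eq (f := (STLPre.zero m n).smul c) (g := STLPre.zero m n) ?_
    refine (Rel.smul c (Rel.zero_smul (STLPre.zero m n)).symm).trans ?_
    refine (Rel.mul_smul c 0 _).symm.trans ?_
    rw [mul_zero]
    exact Rel.zero_smul _
  smul_add c f g := by
    obtain ⟨f, rfl⟩ := cls_surj f; obtain ⟨g, rfl⟩ := cls_surj g
    exact cls_eq (Rel.smul_add c f g)
  add_smul c d f := by
    obtain ⟨f, rfl⟩ := cls_surj f
    exact cls_eq (Rel.add_smul c d f)
  zero_smul f := by
    obtain ⟨f, rfl⟩ := cls_surj f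
    exact cls_eq (Rel.zero_smul f)

theorem cls_smul {m n : ℕ} (c : k) (f : STLPre k m n) : cls δ (f.smul c) = c • cls δ f := rfl

instance : Category (STL k δ) where
  Hom m n := Mor δ m.n n.n
  id m := cls δ (STLPre.id m.n)
  comp := Quotient.map₂ STLPre.comp fun _ _ h _ _ h' => Rel.comp h h'
  id_comp f := by
    obtain ⟨f, rfl⟩ := cls_surj f
    exact cls_eq (Rel.id_comp f)
  comp_id f := by
    obtain ⟨f, rfl⟩ := cls_surj f
    exact cls_eq (Rel.comp_id f)
  assoc f g h := by
    obtain ⟨f, rfl⟩ := cls_surj f; obtain ⟨g, rfl⟩ := cls_surj g; obtain ⟨h, rfl⟩ := cls_surj h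
    exact cls_eq (Rel.assoc f g h)

/-- The morphism represented by an expression. -/
def hmk {m n : STL k δ} (f : STLPre k m.n n.n) : m ⟶ n := cls δ f

theorem hmk_surj {m n : STL k δ} (f : m ⟶ n) : ∃ f', hmk f' = f := cls_surj f

theorem hmk_eq {m n : STL k δ} {f g : STLPre k m.n n.n} (h : Rel δ f g) :
    (hmk f : m ⟶ n) = hmk g := cls_eq h

theorem hmk_id (m : STL k δ) : (hmk (STLPre.id m.n) : m ⟶ m) = 𝟙 m := rfl

theorem hmk_comp {l m n : STL k δ} (f : STLPre k l.n m.n) (g : STLPre k m.n n.n) :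
    (hmk (f.comp g) : l ⟶ n) = (hmk f : l ⟶ m) ≫ (hmk g : m ⟶ n) := rfl

instance : Preadditive (STL k δ) where
  homGroup m n := inferInstanceAs (AddCommGroup (Mor δ m.n n.n))
  add_comp _ _ _ f f' g := by
    obtain ⟨f, rfl⟩ := cls_surj f; obtain ⟨f', rfl⟩ := cls_surj f'; obtain ⟨g, rfl⟩ := cls_surj g
    exact cls_eq (Rel.add_comp f f' g)
  comp_add _ _ _ f g g' := by
    obtain ⟨f, rfl⟩ := cls_surj f; obtain ⟨g', rfl⟩ := cls_surj g'; obtain ⟨g, rfl⟩ := cls_surj g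
    exact cls_eq (Rel.comp_add f g g')

instance : Linear k (STL k δ) where
  homModule m n := inferInstanceAs (Module k (Mor δ m.n n.n))
  smul_comp _ _ _ c f g := by
    obtain ⟨f, rfl⟩ := cls_surj f; obtain ⟨g, rfl⟩ := cls_surj g
    exact cls_eq (Rel.smul_comp c f g)
  comp_smul _ _ _ f c g := by
    obtain ⟨f, rfl⟩ := cls_surj f; obtain ⟨g, rfl⟩ := cls_surj g
    exact cls_eq (Rel.comp_smul c f g)

theorem hmk_add {m n : STL k δ} (f g : STLPre k m.n n.n) :
    (hmk (f.add g) : m ⟶ n) = hmk f + hmk g := rfl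
theorem hmk_zero {m n : STL k δ} : (hmk (STLPre.zero m.n n.n) : m ⟶ n) = 0 := rfl
theorem hmk_smul {m n : STL k δ} (c : k) (f : STLPre k m.n n.n) :
    (hmk (f.smul c) : m ⟶ n) = c • hmk f := rfl

/-- The space of morphisms represented by homogeneous expressions of a given parity. -/
def part (δ : k) (m n : ℕ) (p : ZMod 2) : Submodule k (Mor δ m n) where
  carrier := {f | ∃ f', HasParity p f' ∧ cls δ f' = f}
  add_mem' := by
    rintro _ _ ⟨f, hf, rfl⟩ ⟨g, hg, rfl⟩
    exact ⟨_, hf.add hg, rfl⟩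
  zero_mem' := ⟨_, HasParity.zero m n p, rfl⟩
  smul_mem' := by
    rintro c _ ⟨f, hf, rfl⟩
    exact ⟨_, hf.smul c, rfl⟩

theorem comp_mem_part {l m n : ℕ} {p r : ZMod 2} {f : Mor δ l m} {g : Mor δ m n}
    (hf : f ∈ part δ l m p) (hg : g ∈ part δ m n r) :
    (Quotient.map₂ STLPre.comp (fun _ _ h _ _ h' => Rel.comp h h') f g : Mor δ l n) ∈
      part δ l n (p + r) := by
  obtain ⟨f, hf, rfl⟩ := hf
  obtain ⟨g, hg, rfl⟩ := hg
  exact ⟨_, hf.comp hg, rfl⟩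

theorem cls_mem_sup {m n : ℕ} (f : STLPre k m n) : cls δ f ∈ part δ m n 0 ⊔ part δ m n 1 := by
  suffices h : ∃ f₀ f₁, HasParity 0 f₀ ∧ HasParity 1 f₁ ∧ Rel δ f (f₀.add f₁) by
    obtain ⟨f₀, f₁, h₀, h₁, h⟩ := h
    rw [cls_eq h, cls_add]
    exact Submodule.add_mem_sup ⟨f₀, h₀, rfl⟩ ⟨f₁, h₁, rfl⟩
  have e : (1 + 1 : ZMod 2) = 0 := by decide
  have cast : ∀ {m n : ℕ} {p r : ZMod 2} {f : STLPre k m n}, HasParity p f → p = r →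
    HasParity r f := fun h e => e ▸ h
  induction f with
  | cup => exact ⟨_, _, .zero _ _ _, .cup, (Rel.zero_add _).symm⟩
  | cap => exact ⟨_, _, .zero _ _ _, .cap, (Rel.zero_add _).symm⟩
  | id n => exact ⟨_, _, .id n, .zero _ _ _, ((Rel.add_comm _ _).trans (Rel.zero_add _)).symm⟩
  | zero m n => exact ⟨_, _, .zero _ _ _, .zero _ _ _, (Rel.zero_add _).symm⟩
  | add f g hf hg =>
    obtain ⟨f₀, f₁, hf₀, hf₁, hf⟩ := hf
    obtain ⟨g₀, g₁, hg₀, hg₁, hg⟩ := hg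
    refine ⟨f₀.add g₀, f₁.add g₁, hf₀.add hg₀, hf₁.add hg₁, (hf.add hg).trans ?_⟩
    apply rel_of_cls
    simp only [cls_add]
    abel
  | smul c f hf =>
    obtain ⟨f₀, f₁, hf₀, hf₁, hf⟩ := hf
    exact ⟨f₀.smul c, f₁.smul c, hf₀.smul c, hf₁.smul c,
      (Rel.smul c hf).trans (Rel.smul_add c f₀ f₁)⟩
  | comp f g hf hg =>
    obtain ⟨f₀, f₁, hf₀, hf₁, hf⟩ := hf
    obtain ⟨g₀, g₁, hg₀, hg₁, hg⟩ := hg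
    refine ⟨(f₀.comp g₀).add (f₁.comp g₁), (f₀.comp g₁).add (f₁.comp g₀),
      (cast (hf₀.comp hg₀) (add_zero 0)).add (cast (hf₁.comp hg₁) e),
      (cast (hf₀.comp hg₁) (zero_add 1)).add (cast (hf₁.comp hg₀) (add_zero 1)), ?_⟩
    refine (hf.comp hg).trans ((Rel.add_comp _ _ _).trans ?_)
    refine ((Rel.comp_add _ _ _).add (Rel.comp_add _ _ _)).trans ?_
    apply rel_of_cls
    simp only [cls_add]
    abel
  | tensor f g hf hg =>
    obtain ⟨f₀, f₁, hf₀, hf₁, hf⟩ := hf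
    obtain ⟨g₀, g₁, hg₀, hg₁, hg⟩ := hg
    refine ⟨(f₀.tensor g₀).add (f₁.tensor g₁), (f₀.tensor g₁).add (f₁.tensor g₀),
      (cast (hf₀.tensor hg₀) (add_zero 0)).add (cast (hf₁.tensor hg₁) e),
      (cast (hf₀.tensor hg₁) (zero_add 1)).add (cast (hf₁.tensor hg₀) (add_zero 1)), ?_⟩
    refine (hf.tensor hg).trans ((Rel.add_tensor _ _ _).trans ?_)
    refine ((Rel.tensor_add _ _ _).add (Rel.tensor_add _ _ _)).trans ?_
    apply rel_of_cls
    simp only [cls_add]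
    abel

theorem comp_zero' {l m n : ℕ} {f : STLPre k l m} {g : STLPre k m n}
    (h : Rel δ f (STLPre.zero l m)) : Rel δ (f.comp g) (STLPre.zero l n) :=
  (((h.trans (Rel.zero_smul (STLPre.zero l m)).symm).comp (Rel.refl g)).trans
    (Rel.smul_comp _ _ _)).trans (Rel.zero_smul _)

theorem zero_comp' {l m n : ℕ} {f : STLPre k l m} {g : STLPre k m n}
    (h : Rel δ g (STLPre.zero m n)) : Rel δ (f.comp g) (STLPre.zero l n) :=
  (((Rel.refl f).comp (h.trans (Rel.zero_smul (STLPre.zero m n)).symm)).trans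
    (Rel.comp_smul _ _ _)).trans (Rel.zero_smul _)

theorem tensor_zero' {l m l' m' : ℕ} {f : STLPre k l m} {g : STLPre k l' m'}
    (h : Rel δ f (STLPre.zero l m)) : Rel δ (f.tensor g) (STLPre.zero _ _) :=
  (((h.trans (Rel.zero_smul (STLPre.zero l m)).symm).tensor (Rel.refl g)).trans
    (Rel.smul_tensor _ _ _)).trans (Rel.zero_smul _)

theorem zero_tensor' {l m l' m' : ℕ} {f : STLPre k l m} {g : STLPre k l' m'}
    (h : Rel δ g (STLPre.zero l' m')) : Rel δ (f.tensor g) (STLPre.zero _ _) :=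
  (((Rel.refl f).tensor (h.trans (Rel.zero_smul (STLPre.zero _ _)).symm)).trans
    (Rel.tensor_smul _ _ _)).trans (Rel.zero_smul _)

/-- A nonzero homogeneous morphism `m ⟶ n` has parity `(n - m) / 2`. -/
theorem parity_eq {m n : ℕ} {p : ZMod 2} {f : STLPre k m n} (h : HasParity p f) :
    Rel δ f (STLPre.zero m n) ∨ ∃ d : ℤ, (n : ℤ) = m + 2 * d ∧ p = d := by
  induction h with
  | cup => exact Or.inr ⟨1, by norm_num, by norm_num⟩
  | cap => exact Or.inr ⟨-1, by norm_num, by decide⟩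
  | id n => exact Or.inr ⟨0, by norm_num, by norm_num⟩
  | zero m n p => exact Or.inl (Rel.refl _)
  | add _ _ hf hg =>
    rcases hf with hf | hf
    · rcases hg with hg | hg
      · exact Or.inl ((hf.add hg).trans (Rel.zero_add _))
      · exact Or.inr hg
    · exact Or.inr hf
  | @smul m n p c f _ hf =>
    rcases hf with hf | hf
    · refine Or.inl ((Rel.smul c hf).trans ?_)
      apply rel_of_cls
      rw [cls_smul, cls_zero, smul_zero]
    · exact Or.inr hf
  | comp _ _ hf hg =>
    rcases hf with hf | ⟨d, hd, rfl⟩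
    · exact Or.inl (comp_zero' hf)
    · rcases hg with hg | ⟨e, he, rfl⟩
      · exact Or.inl (zero_comp' hg)
      · exact Or.inr ⟨d + e, by omega, by push_cast; rfl⟩
  | tensor _ _ hf hg =>
    rcases hf with hf | ⟨d, hd, rfl⟩
    · exact Or.inl (tensor_zero' hf)
    · rcases hg with hg | ⟨e, he, rfl⟩
      · exact Or.inl (zero_tensor' hg)
      · exact Or.inr ⟨d + e, by push_cast; omega, by push_cast; rfl⟩

/-- The grading on morphism spaces: `cup` and `cap` are odd. -/
def grading (δ : k) (m n : ℕ) : SuperGrading k (Mor δ m n) where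
  part := part δ m n
  isCompl := by
    constructor
    · rw [Submodule.disjoint_def]
      rintro _ ⟨f, hf, rfl⟩ ⟨g, hg, e⟩
      rcases parity_eq (δ := δ) hf with h | ⟨d, hd, hd'⟩
      · exact cls_eq h
      · rcases parity_eq (δ := δ) hg with h | ⟨d', hd'', hd'''⟩
        · rw [← e]; exact cls_eq h
        · obtain rfl : d = d' := by omega
          rw [← hd'] at hd'''
          exact absurd hd''' (by decide)
    · rw [codisjoint_iff, eq_top_iff]
      intro f _
      obtain ⟨f, rfl⟩ := cls_surj f
      exact cls_mem_sup f

instance : Supercategory k (STL k δ) where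
  gr m n := grading δ m.n n.n
  id_mem m := ⟨_, HasParity.id m.n, rfl⟩
  comp_mem hf hg := comp_mem_part hf hg

theorem parity_iff {m n : STL k δ} {p : ZMod 2} {f : m ⟶ n} :
    HomParity k p f ↔ ∃ f', HasParity p f' ∧ hmk f' = f := Iff.rfl

/-- The identity, between two names of the same object. -/
def ofEq {m n : STL k δ} (h : m.n = n.n) : m ≅ n where
  hom := hmk (STLPre.ofEq k h)
  inv := hmk (STLPre.ofEq k h.symm)
  hom_inv_id := by
    obtain ⟨m⟩ := m; obtain ⟨n⟩ := n; obtain rfl : m = n := h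
    exact Category.id_comp _
  inv_hom_id := by
    obtain ⟨m⟩ := m; obtain ⟨n⟩ := n; obtain rfl : m = n := h
    exact Category.id_comp _

theorem ofEq_even {m n : STL k δ} (h : m.n = n.n) : HomParity k 0 (ofEq h).hom := by
  obtain ⟨m⟩ := m; obtain ⟨n⟩ := n; obtain rfl : m = n := h
  exact HomParity.id _

theorem ofEq_trans {l m n : STL k δ} (h : l.n = m.n) (h' : m.n = n.n) :
    (ofEq h).hom ≫ (ofEq h').hom = (ofEq (h.trans h')).hom := by
  obtain ⟨l⟩ := l; obtain ⟨m⟩ := m; obtain ⟨n⟩ := n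
  obtain rfl : l = m := h
  exact Category.id_comp _

instance : MonoidalCategoryStruct (STL k δ) where
  tensorObj m n := ⟨m.n + n.n⟩
  tensorHom := Quotient.map₂ STLPre.tensor fun _ _ h _ _ h' => Rel.tensor h h'
  whiskerLeft m := Quotient.map (STLPre.tensor (STLPre.id m.n)) fun _ _ h => Rel.tensor (.refl _) h
  whiskerRight f n :=
    Quotient.map (STLPre.tensor · (STLPre.id n.n)) (fun _ _ h => Rel.tensor h (.refl _)) f
  tensorUnit := ⟨0⟩
  associator l m n := ofEq (Nat.add_assoc l.n m.n n.n)
  leftUnitor n := ofEq (Nat.zero_add n.n)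
  rightUnitor n := ofEq (Nat.add_zero n.n)

theorem hmk_tensor {m n m' n' : STL k δ} (f : STLPre k m.n n.n) (g : STLPre k m'.n n'.n) :
    (hmk (f.tensor g) : m ⊗ m' ⟶ n ⊗ n') = (hmk f : m ⟶ n) ⊗ₘ (hmk g : m' ⟶ n') := rfl

theorem ofEq_tensor {m n : STL k δ} (h : m.n = n.n) (l : STL k δ) :
    (ofEq h).hom ⊗ₘ 𝟙 l = (ofEq (m := m ⊗ l) (n := n ⊗ l) (congrArg (· + l.n) h)).hom := by
  obtain ⟨m⟩ := m; obtain ⟨n⟩ := n; obtain rfl : m = n := h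
  exact hmk_eq (Rel.id_tensor_id m l.n)

theorem tensor_ofEq {m n : STL k δ} (h : m.n = n.n) (l : STL k δ) :
    𝟙 l ⊗ₘ (ofEq h).hom = (ofEq (m := l ⊗ m) (n := l ⊗ n) (congrArg (l.n + ·) h)).hom := by
  obtain ⟨m⟩ := m; obtain ⟨n⟩ := n; obtain rfl : m = n := h
  exact hmk_eq (Rel.id_tensor_id l.n m)

instance : MonoidalSupercategory k (STL k δ) where
  add_tensor f f' g := by
    obtain ⟨f, rfl⟩ := hmk_surj f; obtain ⟨f', rfl⟩ := hmk_surj f'; obtain ⟨g, rfl⟩ := hmk_surj g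
    exact hmk_eq (Rel.add_tensor f f' g)
  tensor_add f g g' := by
    obtain ⟨f, rfl⟩ := hmk_surj f; obtain ⟨g', rfl⟩ := hmk_surj g'; obtain ⟨g, rfl⟩ := hmk_surj g
    exact hmk_eq (Rel.tensor_add f g g')
  smul_tensor c f g := by
    obtain ⟨f, rfl⟩ := hmk_surj f; obtain ⟨g, rfl⟩ := hmk_surj g
    exact hmk_eq (Rel.smul_tensor c f g)
  tensor_smul c f g := by
    obtain ⟨f, rfl⟩ := hmk_surj f; obtain ⟨g, rfl⟩ := hmk_surj g
    exact hmk_eq (Rel.tensor_smul c f g)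
  tensor_parity hf hg := by
    obtain ⟨f, hf, rfl⟩ := hf; obtain ⟨g, hg, rfl⟩ := hg
    exact ⟨_, hf.tensor hg, rfl⟩
  id_tensor_id m n := hmk_eq (Rel.id_tensor_id m.n n.n)
  interchange h l f g hg hh := by
    obtain ⟨h, hh, rfl⟩ := hh; obtain ⟨g, hg, rfl⟩ := hg
    obtain ⟨l, rfl⟩ := hmk_surj l; obtain ⟨f, rfl⟩ := hmk_surj f
    exact hmk_eq (Rel.interchange h l f g hg hh)
  whiskerLeft_eq l m n f := by
    obtain ⟨f, rfl⟩ := hmk_surj f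
    rfl
  whiskerRight_eq f l := by
    obtain ⟨f, rfl⟩ := hmk_surj f
    rfl
  associator_even _ _ _ := ofEq_even _
  associator_inv_even _ _ _ := ofEq_even _
  leftUnitor_even _ := ofEq_even _
  leftUnitor_inv_even _ := ofEq_even _
  rightUnitor_even _ := ofEq_even _
  rightUnitor_inv_even _ := ofEq_even _
  associator_natural f₁ f₂ f₃ := by
    obtain ⟨f₁, rfl⟩ := hmk_surj f₁; obtain ⟨f₂, rfl⟩ := hmk_surj f₂; obtain ⟨f₃, rfl⟩ := hmk_surj f₃
    exact hmk_eq (Rel.tensor_assoc f₁ f₂ f₃)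
  leftUnitor_natural f := by
    obtain ⟨f, rfl⟩ := hmk_surj f
    exact hmk_eq (Rel.id_tensor f)
  rightUnitor_natural f := by
    obtain ⟨f, rfl⟩ := hmk_surj f
    exact hmk_eq (Rel.tensor_id f)
  pentagon W X Y Z := by
    change ((ofEq _).hom ⊗ₘ 𝟙 _) ≫ (ofEq _).hom ≫ (𝟙 _ ⊗ₘ (ofEq _).hom) =
      (ofEq _).hom ≫ (ofEq _).hom
    rw [ofEq_tensor, tensor_ofEq, ofEq_trans, ofEq_trans, ofEq_trans]
  triangle X Y := by
    change (ofEq _).hom ≫ (𝟙 _ ⊗ₘ (ofEq _).hom) = (ofEq _).hom ⊗ₘ 𝟙 _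
    rw [ofEq_tensor, tensor_ofEq, ofEq_trans]

end STL

/-! ## Monoidal superfunctors out of `STL(δ)` -/

namespace TensorPower

variable {C : Type w} [Category.{v} C] [MonoidalCategory C] (X : C)

/-- The tensor powers `1, X, X ⊗ X, (X ⊗ X) ⊗ X, …` of an object. -/
def pow : ℕ → C
  | 0 => 𝟙_ C
  | 1 => X
  | n + 2 => pow (n + 1) ⊗ X

/-- The canonical isomorphism from `X^n ⊗ X` to `X^(n+1)`. -/
def succ : ∀ n : ℕ, pow X n ⊗ X ≅ pow X (n + 1)
  | 0 => λ_ X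
  | _ + 1 => Iso.refl _

/-- The canonical isomorphism from `X^m ⊗ X^n` to `X^(m+n)`. -/
def add (m : ℕ) : ∀ n : ℕ, pow X m ⊗ pow X n ≅ pow X (m + n)
  | 0 => ρ_ (pow X m)
  | n + 1 => whiskerLeftIso (pow X m) (succ X n).symm ≪≫ (α_ (pow X m) (pow X n) X).symm ≪≫
      whiskerRightIso (add m n) X ≪≫ succ X (m + n)

variable {X}

theorem eqToHom_succ {m n : ℕ} (h : m = n) :
    (succ X m).hom ≫ eqToHom (congrArg (fun i => pow X (i + 1)) h) =
      eqToHom (congrArg (pow X) h) ▷ X ≫ (succ X n).hom := by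
  subst h; simp

theorem assoc_aux {L M N N' LM MN MN' P P' P'' : C} (s : N ⊗ X ≅ N') (a : L ⊗ M ⟶ LM)
    (b : M ⊗ N ⟶ MN) (t : MN ⊗ X ≅ MN') (c : LM ⊗ N ⟶ P) (d : L ⊗ MN ⟶ P') (e : P ⟶ P')
    (u : P' ⊗ X ⟶ P'') (ih : a ▷ N ≫ c ≫ e = (α_ L M N).hom ≫ L ◁ b ≫ d) :
    a ▷ N' ≫ LM ◁ s.inv ≫ (α_ LM N X).inv ≫ c ▷ X ≫ e ▷ X ≫ u =
      (α_ L M N').hom ≫ L ◁ (M ◁ s.inv ≫ (α_ M N X).inv ≫ b ▷ X ≫ t.hom) ≫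
        L ◁ t.inv ≫ (α_ L MN X).inv ≫ d ▷ X ≫ u := by
  have ih' := congrArg (· ▷ X) ih
  simp only [comp_whiskerRight] at ih'
  rw [← whisker_exchange_assoc]
  have h1 : a ▷ (N ⊗ X) ≫ (α_ LM N X).inv = (α_ (L ⊗ M) N X).inv ≫ a ▷ N ▷ X := by simp
  rw [reassoc_of% h1, reassoc_of% ih']
  simp

theorem add_assoc (l m : ℕ) : ∀ n : ℕ,
    (add X l m).hom ▷ pow X n ≫ (add X (l + m) n).hom ≫
        eqToHom (congrArg (pow X) (Nat.add_assoc l m n)) =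
      (α_ (pow X l) (pow X m) (pow X n)).hom ≫ pow X l ◁ (add X m n).hom ≫ (add X l (m + n)).hom
  | 0 => by
    simp [add, pow]
  | n + 1 => by
    have ih := add_assoc l m n
    have e : (succ X (l + m + n)).hom ≫ eqToHom (congrArg (pow X) (Nat.add_assoc l m (n + 1))) = _ :=
      eqToHom_succ (Nat.add_assoc l m n)
    change (add X l m).hom ▷ pow X (n + 1) ≫
      (pow X (l + m) ◁ (succ X n).inv ≫ (α_ (pow X (l + m)) (pow X n) X).inv ≫
        (add X (l + m) n).hom ▷ X ≫ (succ X (l + m + n)).hom) ≫ _ =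
      (α_ (pow X l) (pow X m) (pow X (n + 1))).hom ≫ pow X l ◁
        (pow X m ◁ (succ X n).inv ≫ (α_ (pow X m) (pow X n) X).inv ≫
        (add X m n).hom ▷ X ≫ (succ X (m + n)).hom) ≫
        (pow X l ◁ (succ X (m + n)).inv ≫ (α_ (pow X l) (pow X (m + n)) X).inv ≫
        (add X l (m + n)).hom ▷ X ≫ (succ X (l + (m + n))).hom)
    simp only [Category.assoc]
    rw [e]
    exact assoc_aux (succ X n) _ _ (succ X (m + n)) _ _ _ _ ih

theorem unit_aux {N N' : C} (s : N ⊗ X ≅ N') :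
    𝟙_ C ◁ s.inv ≫ (α_ (𝟙_ C) N X).inv ≫ (λ_ N).hom ▷ X ≫ s.hom = (λ_ N').hom := by
  simp

theorem add_zero_left : ∀ n : ℕ,
    (add X 0 n).hom ≫ eqToHom (congrArg (pow X) (Nat.zero_add n)) = (λ_ (pow X n)).hom
  | 0 => by simp [add, pow, unitors_equal]
  | n + 1 => by
    have ih := add_zero_left n
    have e : (succ X (0 + n)).hom ≫ eqToHom (congrArg (pow X) (Nat.zero_add (n + 1))) = _ :=
      eqToHom_succ (Nat.zero_add n)
    change (pow X 0 ◁ (succ X n).inv ≫ (α_ (pow X 0) (pow X n) X).inv ≫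
        (add X 0 n).hom ▷ X ≫ (succ X (0 + n)).hom) ≫ _ = _
    simp only [Category.assoc]
    rw [e, ← comp_whiskerRight_assoc, ih]
    exact unit_aux (succ X n)

theorem add_one_one : (add X 1 1).hom = 𝟙 (X ⊗ X) := by
  change X ◁ (λ_ X).inv ≫ (α_ X (𝟙_ C) X).inv ≫ (ρ_ X).hom ▷ X ≫ 𝟙 _ = _
  simp
theorem add_two_one : (add X 2 1).hom = 𝟙 ((X ⊗ X) ⊗ X) := by
  change (X ⊗ X) ◁ (λ_ X).inv ≫ (α_ (X ⊗ X) (𝟙_ C) X).inv ≫ (ρ_ (X ⊗ X)).hom ▷ X ≫ 𝟙 _ = _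
  simp
theorem add_one_two : (add X 1 2).hom = (α_ X X X).inv := by
  change X ◁ 𝟙 (X ⊗ X) ≫ (α_ X X X).inv ≫ (add X 1 1).hom ▷ X ≫ 𝟙 ((X ⊗ X) ⊗ X) = _
  rw [add_one_one]
  erw [id_whiskerRight, Category.comp_id, Category.comp_id, whiskerLeft_id, Category.id_comp]
theorem add_zero_one : (add X 0 1).hom = (λ_ X).hom := by
  change 𝟙_ C ◁ (λ_ X).inv ≫ (α_ (𝟙_ C) (𝟙_ C) X).inv ≫ (ρ_ (𝟙_ C)).hom ▷ X ≫ (λ_ X).hom = _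
  simp

end TensorPower

/-- An isomorphism of the underlying category, as an isomorphism of the supercategory. -/
@[simps]
def Underlying.toIso {k : Type u} [Field k] {A : Type w} [Category.{v} A] [Preadditive A]
    [Linear k A] [Supercategory k A] {X Y : Underlying k A} (e : X ≅ Y) : X.of ≅ Y.of where
  hom := val e.hom
  inv := val e.inv
  hom_inv_id := congrArg val e.hom_inv_id
  inv_hom_id := congrArg val e.inv_hom_id

/-- An object with odd morphisms `cup` and `cap` which satisfy the defining relations of
`STL(δ)` in a monoidal supercategory. -/
structure STLRep {k : Type u} [Field k] (δ : k) (B : Type w) [Category.{v} B] [Preadditive B]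
    [Linear k B] [Supercategory k B] [MonoidalCategoryStruct B] where
  X : B
  cup : 𝟙_ B ⟶ X ⊗ X
  cap : X ⊗ X ⟶ 𝟙_ B
  cup_odd : HomParity k 1 cup
  cap_odd : HomParity k 1 cap
  zigzag : (ρ_ X).inv ≫ (𝟙 X ⊗ₘ cup) ≫ (α_ X X X).inv ≫ (cap ⊗ₘ 𝟙 X) ≫ (λ_ X).hom = 𝟙 X
  zigzag' : (λ_ X).inv ≫ (cup ⊗ₘ 𝟙 X) ≫ (α_ X X X).hom ≫ (𝟙 X ⊗ₘ cap) ≫ (ρ_ X).hom =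
    (-1 : k) • 𝟙 X
  bubble : cup ≫ cap = δ • 𝟙 (𝟙_ B)

namespace STLRep

variable {k : Type u} [Field k] {δ : k} {B : Type w} [Category.{v} B] [Preadditive B]
    [Linear k B] [Supercategory k B] [MonoidalCategoryStruct B] [MonoidalSupercategory k B]
    (R : STLRep δ B)

open MonoidalSupercategory STLPre

/-- The `n`-th tensor power. -/
def pow (n : ℕ) : B := (TensorPower.pow (⟨R.X⟩ : Underlying k B) n).of

/-- The canonical isomorphism from `X^m ⊗ X^n` to `X^(m+n)`. -/
def add (m n : ℕ) : R.pow m ⊗ R.pow n ≅ R.pow (m + n) :=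
  Underlying.toIso (TensorPower.add (⟨R.X⟩ : Underlying k B) m n)

theorem add_even (m n : ℕ) : HomParity k 0 (R.add m n).hom := Underlying.val_even _
theorem add_inv_even (m n : ℕ) : HomParity k 0 (R.add m n).inv := Underlying.val_even _

/-- The value of the monoidal superfunctor on an expression. -/
def eval : ∀ {m n : ℕ}, STLPre k m n → (R.pow m ⟶ R.pow n)
  | _, _, .cup => R.cup
  | _, _, .cap => R.cap
  | _, _, .id n => 𝟙 (R.pow n)
  | _, _, .comp f g => eval f ≫ eval g
  | _, _, .tensor f g => (R.add _ _).inv ≫ (eval f ⊗ₘ eval g) ≫ (R.add _ _).hom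
  | _, _, .zero _ _ => 0
  | _, _, .add f g => eval f + eval g
  | _, _, .smul c f => c • eval f

theorem eval_ofEq {m n : ℕ} (h : m = n) : R.eval (STLPre.ofEq k h) =
    Underlying.val (eqToHom (congrArg (TensorPower.pow (⟨R.X⟩ : Underlying k B)) h)) := by
  subst h; rfl

theorem eval_parity {m n : ℕ} {p : ZMod 2} {f : STLPre k m n} (h : HasParity p f) :
    HomParity k p (R.eval f) := by
  induction h with
  | cup => exact R.cup_odd
  | cap => exact R.cap_odd
  | id n => exact HomParity.id _
  | comp _ _ hf hg => exact hf.comp hg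
  | tensor _ _ hf hg =>
    exact ((R.add_inv_even _ _).comp ((tensor_parity hf hg).comp (R.add_even _ _))).cast (by ring)
  | zero m n p => exact Submodule.zero_mem _
  | add _ _ hf hg => exact Submodule.add_mem _ hf hg
  | smul c _ hf => exact Submodule.smul_mem _ c hf

theorem add_assoc (l m n : ℕ) :
    ((R.add l m).hom ⊗ₘ 𝟙 (R.pow n)) ≫ (R.add (l + m) n).hom ≫
        R.eval (STLPre.ofEq k (Nat.add_assoc l m n)) =
      (α_ (R.pow l) (R.pow m) (R.pow n)).hom ≫ (𝟙 (R.pow l) ⊗ₘ (R.add m n).hom) ≫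
        (R.add l (m + n)).hom := by
  rw [eval_ofEq]
  exact congrArg Underlying.val (TensorPower.add_assoc (X := (⟨R.X⟩ : Underlying k B)) l m n)

theorem add_zero_left (n : ℕ) :
    (R.add 0 n).hom ≫ R.eval (STLPre.ofEq k (Nat.zero_add n)) = (λ_ (R.pow n)).hom := by
  rw [eval_ofEq]
  exact congrArg Underlying.val (TensorPower.add_zero_left (X := (⟨R.X⟩ : Underlying k B)) n)

theorem add_zero_right (n : ℕ) : (R.add n 0).hom = (ρ_ (R.pow n)).hom := rfl

theorem hom_inv_tensor {X Y Z : B} {f : X ⟶ Y} {g : Y ⟶ X} (h : f ≫ g = 𝟙 X)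
    (hf : HomParity k 0 f) : (f ⊗ₘ 𝟙 Z) ≫ (g ⊗ₘ 𝟙 Z) = 𝟙 (X ⊗ Z) := by
  rw [tensor_comp_of_left (k := k) _ _ _ hf, h, Category.comp_id, id_tensor_id k]

theorem tensor_hom_inv (k : Type u) [Field k] [Linear k B] [Supercategory k B]
    [MonoidalSupercategory k B] {X Y Z : B} {f : X ⟶ Y} {g : Y ⟶ X} (h : f ≫ g = 𝟙 X) :
    (𝟙 Z ⊗ₘ f) ≫ (𝟙 Z ⊗ₘ g) = 𝟙 (Z ⊗ X) := by
  rw [tensor_comp_of_left (k := k) _ _ _ (HomParity.id Z), h, Category.comp_id, id_tensor_id k]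

theorem eval_tensor_tensor_left {m₁ n₁ m₂ n₂ m₃ n₃ : ℕ} (f₁ : STLPre k m₁ n₁)
    (f₂ : STLPre k m₂ n₂) (f₃ : STLPre k m₃ n₃) :
    R.eval (tensor (tensor f₁ f₂) f₃) =
      (R.add _ _).inv ≫ ((R.add _ _).inv ⊗ₘ 𝟙 _) ≫ ((R.eval f₁ ⊗ₘ R.eval f₂) ⊗ₘ R.eval f₃) ≫
        ((R.add _ _).hom ⊗ₘ 𝟙 _) ≫ (R.add _ _).hom := by
  simp only [eval]
  rw [← Category.assoc (_ ⊗ₘ R.eval f₃), tensor_comp_of_right (k := k) _ _ _ (HomParity.id _),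
    ← Category.assoc (_ ⊗ₘ 𝟙 _), tensor_comp_of_left (k := k) _ _ _ (R.add_inv_even _ _),
    Category.comp_id, Category.id_comp]

theorem eval_tensor_tensor_right {m₁ n₁ m₂ n₂ m₃ n₃ : ℕ} (f₁ : STLPre k m₁ n₁)
    (f₂ : STLPre k m₂ n₂) (f₃ : STLPre k m₃ n₃) :
    R.eval (tensor f₁ (tensor f₂ f₃)) =
      (R.add _ _).inv ≫ (𝟙 _ ⊗ₘ (R.add _ _).inv) ≫ (R.eval f₁ ⊗ₘ (R.eval f₂ ⊗ₘ R.eval f₃)) ≫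
        (𝟙 _ ⊗ₘ (R.add _ _).hom) ≫ (R.add _ _).hom := by
  simp only [eval]
  rw [← Category.assoc (R.eval f₁ ⊗ₘ _), tensor_comp_of_right (k := k) _ _ _ (R.add_even _ _),
    ← Category.assoc (𝟙 _ ⊗ₘ _), tensor_comp_of_left (k := k) _ _ _ (HomParity.id _),
    Category.comp_id, Category.id_comp]

theorem ofEq_assoc_comp (l m n : ℕ) :
    R.eval (STLPre.ofEq k (Nat.add_assoc l m n)) ≫ (R.add l (m + n)).inv ≫
      (𝟙 (R.pow l) ⊗ₘ (R.add m n).inv) =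
    (R.add (l + m) n).inv ≫ ((R.add l m).inv ⊗ₘ 𝟙 (R.pow n)) ≫
      (α_ (R.pow l) (R.pow m) (R.pow n)).hom := by
  have h := R.add_assoc l m n
  have h1 := hom_inv_tensor (Z := R.pow n) (R.add l m).inv_hom_id (R.add_inv_even l m)
  have h2 := tensor_hom_inv k (Z := R.pow l) (R.add m n).hom_inv_id
  have h' : R.eval (STLPre.ofEq k (Nat.add_assoc l m n)) =
      (R.add (l + m) n).inv ≫ ((R.add l m).inv ⊗ₘ 𝟙 (R.pow n)) ≫
        (α_ (R.pow l) (R.pow m) (R.pow n)).hom ≫ (𝟙 (R.pow l) ⊗ₘ (R.add m n).hom) ≫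
        (R.add l (m + n)).hom := by
    rw [← h, reassoc_of% h1, Iso.inv_hom_id_assoc]
  rw [h']
  simp only [Category.assoc, Iso.hom_inv_id_assoc]
  rw [h2, Category.comp_id]

theorem add_two_one : R.add 2 1 = Iso.refl ((R.X ⊗ R.X) ⊗ R.X) :=
  Iso.ext (congrArg Underlying.val (TensorPower.add_two_one (X := (⟨R.X⟩ : Underlying k B))))
theorem add_one_two : R.add 1 2 = (α_ R.X R.X R.X).symm :=
  Iso.ext (congrArg Underlying.val (TensorPower.add_one_two (X := (⟨R.X⟩ : Underlying k B))))
theorem add_zero_one : R.add 0 1 = λ_ R.X :=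
  Iso.ext (congrArg Underlying.val (TensorPower.add_zero_one (X := (⟨R.X⟩ : Underlying k B))))

theorem zigzag_aux {X : B} (cup : 𝟙_ B ⟶ X ⊗ X) (cap : X ⊗ X ⟶ 𝟙_ B) (e₁₀ : X ⊗ 𝟙_ B ≅ X)
    (e₁₂ : X ⊗ (X ⊗ X) ≅ (X ⊗ X) ⊗ X) (e₂₁ : (X ⊗ X) ⊗ X ≅ (X ⊗ X) ⊗ X) (e₀₁ : 𝟙_ B ⊗ X ≅ X)
    (h₁₀ : e₁₀ = ρ_ X) (h₁₂ : e₁₂ = (α_ X X X).symm) (h₂₁ : e₂₁ = Iso.refl _) (h₀₁ : e₀₁ = λ_ X) :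
    (e₁₀.inv ≫ (𝟙 X ⊗ₘ cup) ≫ e₁₂.hom) ≫ (e₂₁.inv ≫ (cap ⊗ₘ 𝟙 X) ≫ e₀₁.hom) =
      (ρ_ X).inv ≫ (𝟙 X ⊗ₘ cup) ≫ (α_ X X X).inv ≫ (cap ⊗ₘ 𝟙 X) ≫ (λ_ X).hom := by
  subst h₁₀ h₁₂ h₂₁ h₀₁; simp

theorem zigzag_aux' {X : B} (cup : 𝟙_ B ⟶ X ⊗ X) (cap : X ⊗ X ⟶ 𝟙_ B) (e₁₀ : X ⊗ 𝟙_ B ≅ X)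
    (e₁₂ : X ⊗ (X ⊗ X) ≅ (X ⊗ X) ⊗ X) (e₂₁ : (X ⊗ X) ⊗ X ≅ (X ⊗ X) ⊗ X) (e₀₁ : 𝟙_ B ⊗ X ≅ X)
    (h₁₀ : e₁₀ = ρ_ X) (h₁₂ : e₁₂ = (α_ X X X).symm) (h₂₁ : e₂₁ = Iso.refl _) (h₀₁ : e₀₁ = λ_ X) :
    (e₀₁.inv ≫ (cup ⊗ₘ 𝟙 X) ≫ e₂₁.hom) ≫ (e₁₂.inv ≫ (𝟙 X ⊗ₘ cap) ≫ e₁₀.hom) =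
      (λ_ X).inv ≫ (cup ⊗ₘ 𝟙 X) ≫ (α_ X X X).hom ≫ (𝟙 X ⊗ₘ cap) ≫ (ρ_ X).hom := by
  subst h₁₀ h₁₂ h₂₁ h₀₁; simp

theorem eval_rel {m n : ℕ} {f g : STLPre k m n} (h : Rel δ f g) : R.eval f = R.eval g := by
  induction h with
  | refl => rfl
  | symm _ h => exact h.symm
  | trans _ _ h h' => exact h.trans h'
  | comp _ _ h h' => simp only [eval, h, h']
  | tensor _ _ h h' => simp only [eval, h, h']
  | add _ _ h h' => simp only [eval, h, h']
  | smul _ _ h => simp only [eval, h]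
  | add_assoc => exact _root_.add_assoc _ _ _
  | add_comm => exact _root_.add_comm _ _
  | zero_add => exact _root_.zero_add _
  | zero_smul => exact _root_.zero_smul k _
  | one_smul => exact _root_.one_smul k _
  | mul_smul => exact SemigroupAction.mul_smul _ _ _
  | add_smul => exact _root_.add_smul _ _ _
  | smul_add => exact _root_.smul_add _ _ _
  | id_comp => exact Category.id_comp _
  | comp_id => exact Category.comp_id _
  | assoc => exact Category.assoc _ _ _
  | add_comp => exact Preadditive.add_comp _ _ _ _ _ _
  | comp_add => exact Preadditive.comp_add _ _ _ _ _ _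
  | smul_comp => exact Linear.smul_comp _ _ _ _ _ _
  | comp_smul => exact Linear.comp_smul _ _ _ _ _ _
  | add_tensor =>
    simp only [eval, MonoidalSupercategory.add_tensor k, Preadditive.add_comp, Preadditive.comp_add]
  | tensor_add =>
    simp only [eval, MonoidalSupercategory.tensor_add k, Preadditive.add_comp, Preadditive.comp_add]
  | smul_tensor =>
    simp only [eval, MonoidalSupercategory.smul_tensor, Linear.smul_comp, Linear.comp_smul]
  | tensor_smul =>
    simp only [eval, MonoidalSupercategory.tensor_smul, Linear.smul_comp, Linear.comp_smul]
  | id_tensor_id => simp [eval, MonoidalSupercategory.id_tensor_id k]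
  | interchange h l f g hg hh =>
    simp only [eval, Category.assoc, Iso.hom_inv_id_assoc]
    rw [← Category.assoc (_ ⊗ₘ _), MonoidalSupercategory.interchange _ _ _ _
      (R.eval_parity hg) (R.eval_parity hh), Linear.smul_comp, Linear.comp_smul]
  | tensor_assoc f₁ f₂ f₃ =>
    change R.eval (tensor (tensor f₁ f₂) f₃) ≫ R.eval _ = R.eval _ ≫ R.eval (tensor f₁ (tensor f₂ f₃))
    rw [eval_tensor_tensor_left, eval_tensor_tensor_right]
    simp only [Category.assoc]
    rw [add_assoc, reassoc_of% (associator_natural k), ← reassoc_of% (R.ofEq_assoc_comp _ _ _)]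
  | id_tensor f =>
    rename_i m n
    simp only [eval, Category.assoc, add_zero_left]
    rw [Iso.inv_comp_eq, ← Category.assoc, add_zero_left]
    exact leftUnitor_natural k _
  | tensor_id f =>
    rename_i m n
    have h : (R.eval f ⊗ₘ 𝟙 (R.pow 0)) ≫ (R.add n 0).hom = (R.add m 0).hom ≫ R.eval f :=
      rightUnitor_natural k (R.eval f)
    change ((R.add m 0).inv ≫ (R.eval f ⊗ₘ 𝟙 (R.pow 0)) ≫ (R.add n 0).hom) ≫ 𝟙 (R.pow n) =
      𝟙 (R.pow m) ≫ R.eval f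
    rw [h, Iso.inv_hom_id_assoc, Category.id_comp]
    exact Category.comp_id _
  | zigzag =>
    exact (zigzag_aux R.cup R.cap (R.add 1 0) (R.add 1 2) (R.add 2 1) (R.add 0 1) rfl
      R.add_one_two R.add_two_one R.add_zero_one).trans R.zigzag
  | zigzag' =>
    exact (zigzag_aux' R.cup R.cap (R.add 1 0) (R.add 1 2) (R.add 2 1) (R.add 0 1) rfl
      R.add_one_two R.add_two_one R.add_zero_one).trans R.zigzag'
  | bubble => exact R.bubble

/-- The monoidal superfunctor from `STL(δ)` determined by an object `X` with odd morphisms `cup`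
and `cap` satisfying the defining relations. It maps `1` to `X`. -/
def functor : MonoidalSuperfunctor k (STL k δ) B where
  obj n := R.pow n.n
  map {m n} f := Quotient.lift (s := STLPre.setoid δ m.n n.n) R.eval (fun _ _ h => R.eval_rel h) f
  map_id _ := rfl
  map_comp f g := by
    obtain ⟨f, rfl⟩ := STL.hmk_surj f; obtain ⟨g, rfl⟩ := STL.hmk_surj g
    rfl
  map_add f g := by
    obtain ⟨f, rfl⟩ := STL.hmk_surj f; obtain ⟨g, rfl⟩ := STL.hmk_surj g
    rfl
  map_smul c f := by
    obtain ⟨f, rfl⟩ := STL.hmk_surj f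
    rfl
  map_parity := by
    rintro _ _ _ _ ⟨f, hf, rfl⟩
    exact R.eval_parity hf
  μ m n := R.add m.n n.n
  ε := Iso.refl _
  μ_even _ _ := R.add_even _ _
  μ_inv_even _ _ := R.add_inv_even _ _
  ε_even := HomParity.id _
  ε_inv_even := HomParity.id _
  μ_natural f g := by
    obtain ⟨f, rfl⟩ := STL.hmk_surj f; obtain ⟨g, rfl⟩ := STL.hmk_surj g
    exact ((Iso.hom_inv_id_assoc _ _).symm : _ = (R.add _ _).hom ≫ R.eval (tensor f g))
  associativity l m n := R.add_assoc l.n m.n n.n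
  left_unitality n := by
    change _ = (𝟙 _ ⊗ₘ 𝟙 _) ≫ (R.add 0 n.n).hom ≫ R.eval (STLPre.ofEq k (Nat.zero_add n.n))
    rw [add_zero_left, MonoidalSupercategory.id_tensor_id k]
    exact (Category.id_comp _).symm
  right_unitality n := by
    change _ = (𝟙 _ ⊗ₘ 𝟙 _) ≫ (R.add n.n 0).hom ≫ 𝟙 _
    rw [MonoidalSupercategory.id_tensor_id k, Category.comp_id]
    exact (Category.id_comp _).symm

theorem functor_obj_one : R.functor.obj ⟨1⟩ = R.X := rfl

end STLRep

/-! ## The quantum supergroup and its supermodules -/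

/-- The quantum integer `[n] = (q^n - (εq)^(-n)) / (q - ε q⁻¹)`, where `ε = -1`. -/
def qInt {k : Type u} [Field k] (q : kˣ) (n : ℤ) : k :=
  (((q ^ n : kˣ) : k) - (((-q) ^ (-n) : kˣ) : k)) / ((q : k) + ((q⁻¹ : kˣ) : k))

theorem qInt_add {k : Type u} [Field k] (q : kˣ) (a b : ℤ) :
    qInt q (a + b) = ((q ^ b : kˣ) : k) * qInt q a + (((-q) ^ (-a) : kˣ) : k) * qInt q b := by
  simp only [qInt, zpow_add, neg_add, Units.val_mul]
  ring

theorem qInt_zero {k : Type u} [Field k] (q : kˣ) : qInt q 0 = 0 := by simp [qInt]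

theorem qInt_neg_one {k : Type u} [Field k] (q : kˣ) : qInt q (-1) = qInt q 1 := by
  simp only [qInt, zpow_neg, zpow_one, neg_neg, Units.val_neg, inv_neg]
  ring

theorem qInt_one_mul {k : Type u} [Field k] (q : kˣ) : qInt q 1 * qInt q 1 = qInt q 1 := by
  simp only [qInt, zpow_neg, zpow_one, Units.val_neg, inv_neg, sub_neg_eq_add]
  by_cases h : (q : k) + ((q⁻¹ : kˣ) : k) = 0
  · rw [h]; simp
  · rw [div_self h, one_mul]

/-- The generators `1_n`, `E_n`, `F_n` of `U`. -/
inductive OspGen : Type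
  | e (n : ℤ)
  | E (n : ℤ)
  | F (n : ℤ)

/-- The idempotents `1_n` are even, and the generators `E_n` and `F_n` are odd. -/
def OspGen.parity : OspGen → ZMod 2
  | .e _ => 0
  | .E _ => 1
  | .F _ => 1

namespace UqOsp

open OspGen FreeAlgebra

variable {k : Type u} [Field k]

/-- The defining relations of `U`: the `1_n` are orthogonal idempotents, `E_n ∈ 1_{n+2} U 1_n`,
`F_n ∈ 1_{n-2} U 1_n` and `E_{n-2} F_n - ε F_{n+2} E_n = [n] 1_n` (with `ε = -1`). -/
inductive Rel (q : kˣ) : FreeAlgebra k OspGen → FreeAlgebra k OspGen → Prop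
  | e_mul_self (n : ℤ) : Rel q (ι k (e n) * ι k (e n)) (ι k (e n))
  | e_mul (m n : ℤ) : m ≠ n → Rel q (ι k (e m) * ι k (e n)) 0
  | e_mul_E (n : ℤ) : Rel q (ι k (e (n + 2)) * ι k (E n)) (ι k (E n))
  | E_mul_e (n : ℤ) : Rel q (ι k (E n) * ι k (e n)) (ι k (E n))
  | e_mul_F (n : ℤ) : Rel q (ι k (e (n - 2)) * ι k (F n)) (ι k (F n))
  | F_mul_e (n : ℤ) : Rel q (ι k (F n) * ι k (e n)) (ι k (F n))
  | E_F (n : ℤ) : Rel q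
      (ι k (E (n - 2)) * ι k (F n) - (-1 : k) • (ι k (F (n + 2)) * ι k (E n)))
      (qInt q n • ι k (e n))

end UqOsp

/-- The idempotented quantum supergroup `U` of `osp(1|2)` with a unit adjoined. (A `U`-module is
the same thing as a unital module over this algebra; `U` is its ideal generated by the `1_n`.) -/
abbrev UqOsp {k : Type u} [Field k] (q : kˣ) : Type u := RingQuot (UqOsp.Rel q)

namespace UqOsp

variable {k : Type u} [Field k] {q : kˣ}

/-- The image of a generator. -/
noncomputable def gen (q : kˣ) (x : OspGen) : UqOsp q :=
  RingQuot.mkAlgHom k (Rel q) (FreeAlgebra.ι k x)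

/-- The homogeneous elements of parity `p` of the superalgebra. -/
inductive IsHomogeneous : ZMod 2 → UqOsp q → Prop
  | one : IsHomogeneous 0 1
  | gen (x : OspGen) : IsHomogeneous x.parity (gen q x)
  | mul {p r : ZMod 2} {u v : UqOsp q} :
      IsHomogeneous p u → IsHomogeneous r v → IsHomogeneous (p + r) (u * v)
  | zero (p : ZMod 2) : IsHomogeneous p 0
  | add {p : ZMod 2} {u v : UqOsp q} :
      IsHomogeneous p u → IsHomogeneous p v → IsHomogeneous p (u + v)
  | smul {p : ZMod 2} (c : k) {u : UqOsp q} : IsHomogeneous p u → IsHomogeneous p (c • u)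

theorem gen_rel {x y : FreeAlgebra k OspGen} (h : Rel q x y) :
    RingQuot.mkAlgHom k (Rel q) x = RingQuot.mkAlgHom k (Rel q) y :=
  RingQuot.mkAlgHom_rel k h

end UqOsp

/-- A finite-dimensional left `U`-supermodule which is locally unital: it is the sum of the
spaces `1_n V`. -/
structure OspMod (k : Type u) [Field k] (q : kˣ) where
  toSVec : SVec k
  finite : Module.Finite k toSVec.carrier
  act : UqOsp q →ₐ[k] Module.End k toSVec.carrier
  act_mem : ∀ {p r : ZMod 2} {u : UqOsp q} {v : toSVec.carrier}, u.IsHomogeneous p →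
    v ∈ toSVec.grading.part r → act u v ∈ toSVec.grading.part (r + p)
  locally_unital : ⨆ n : ℤ, LinearMap.range (act (UqOsp.gen q (.e n))) = ⊤

/-- The operators `1_n`, `E_n` and `F_n` of a `U`-supermodule structure on a superspace. -/
structure OspOps (k : Type u) [Field k] (q : kˣ) (V : SVec k) where
  e : ℤ → Module.End k V.carrier
  E : ℤ → Module.End k V.carrier
  F : ℤ → Module.End k V.carrier
  e_mem : ∀ n, e n ∈ (V.grading.hom V.grading).part 0
  E_mem : ∀ n, E n ∈ (V.grading.hom V.grading).part 1
  F_mem : ∀ n, F n ∈ (V.grading.hom V.grading).part 1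
  e_e_self : ∀ n v, e n (e n v) = e n v
  e_e : ∀ m n v, m ≠ n → e m (e n v) = 0
  e_E : ∀ n v, e (n + 2) (E n v) = E n v
  E_e : ∀ n v, E n (e n v) = E n v
  e_F : ∀ n v, e (n - 2) (F n v) = F n v
  F_e : ∀ n v, F n (e n v) = F n v
  E_F : ∀ n v, E (n - 2) (F n v) + F (n + 2) (E n v) = qInt q n • e n v
  locally_unital : ⨆ n : ℤ, LinearMap.range (e n) = ⊤

namespace OspOps

variable {k : Type u} [Field k] {q : kˣ} {V : SVec k} (A : OspOps k q V)

/-- The operator of a generator. -/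
def op : OspGen → Module.End k V.carrier
  | .e n => A.e n
  | .E n => A.E n
  | .F n => A.F n

/-- The action of `U`. -/
noncomputable def act : UqOsp q →ₐ[k] Module.End k V.carrier :=
  RingQuot.liftAlgHom k ⟨FreeAlgebra.lift k A.op, by
    intro x y h
    cases h <;> ext v <;> simp [op, A.e_e_self, A.e_e, A.e_E, A.E_e, A.e_F, A.F_e, A.E_F, *]⟩

theorem act_gen (x : OspGen) : A.act (UqOsp.gen q x) = A.op x := by
  rw [act, UqOsp.gen, RingQuot.liftAlgHom_mkAlgHom_apply, FreeAlgebra.lift_ι_apply]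

/-- The `U`-supermodule defined by the operators. -/
noncomputable def toOspMod (h : Module.Finite k V.carrier) : OspMod k q where
  toSVec := V
  finite := h
  act := A.act
  act_mem {p r u v} hu hv := by
    revert r v
    induction hu with
    | one => intro r v hv; simpa using hv
    | gen x =>
      intro r v hv
      rw [act_gen]
      cases x
      · exact A.e_mem _ r v hv
      · exact A.E_mem _ r v hv
      · exact A.F_mem _ r v hv
    | @mul p s u w _ _ hu hw =>
      intro r v hv
      rw [map_mul, Module.End.mul_apply]
      exact SuperGrading.part_mem_cast (hu (hw hv)) (by ring)
    | zero p => intro r v hv; simp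
    | add _ _ hu hw =>
      intro r v hv
      rw [map_add, LinearMap.add_apply]
      exact add_mem (hu hv) (hw hv)
    | smul c _ hu =>
      intro r v hv
      rw [map_smul, LinearMap.smul_apply]
      exact Submodule.smul_mem _ _ (hu hv)
  locally_unital := by
    simp only [act_gen]
    exact A.locally_unital

end OspOps

namespace OspMod

open SuperGrading

variable {k : Type u} [Field k] {q : kˣ}

/-- The grading of the underlying superspace. -/
abbrev gr (X : OspMod k q) : SuperGrading k X.toSVec.carrier := X.toSVec.grading

/-- A linear map is a `U`-supermodule homomorphism if its homogeneous component `f_p` of parity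
`p` satisfies `f_p (u v) = (-1)^{p |u|} u f_p(v)`. -/
def IsHom (X Y : OspMod k q) (f : X.toSVec.carrier →ₗ[k] Y.toSVec.carrier) : Prop :=
  ∀ (p r : ZMod 2) (u : UqOsp q), u.IsHomogeneous r → ∀ v,
    (X.gr.hom Y.gr).proj p f (X.act u v) =
      superSign k (p * r) • Y.act u ((X.gr.hom Y.gr).proj p f v)

/-- The space of `U`-supermodule homomorphisms. -/
def homs (X Y : OspMod k q) : Submodule k (X.toSVec.carrier →ₗ[k] Y.toSVec.carrier) where
  carrier := {f | IsHom X Y f}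
  add_mem' hf hg p r u hu v := by
    rw [map_add, LinearMap.add_apply, hf p r u hu, hg p r u hu, LinearMap.add_apply, map_add,
      smul_add]
  zero_mem' p r u hu v := by simp
  smul_mem' c f hf p r u hu v := by
    rw [map_smul, LinearMap.smul_apply, hf p r u hu, LinearMap.smul_apply, map_smul, smul_comm]

variable {X Y Z X' Y' : OspMod k q}

theorem mem_homs_of_homogeneous {p : ZMod 2} {f : X.toSVec.carrier →ₗ[k] Y.toSVec.carrier}
    (hf : f ∈ (X.gr.hom Y.gr).part p)
    (h : ∀ (r : ZMod 2) (u : UqOsp q), u.IsHomogeneous r → ∀ v,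
      f (X.act u v) = superSign k (p * r) • Y.act u (f v)) : f ∈ homs X Y := by
  intro s r u hu v
  rw [proj_of_mem' _ s hf]
  split_ifs with hs
  · subst hs; exact h r u hu v
  · simp

theorem homs_apply {p r : ZMod 2} {f : X.toSVec.carrier →ₗ[k] Y.toSVec.carrier} (h : f ∈ homs X Y)
    (hf : f ∈ (X.gr.hom Y.gr).part p) {u : UqOsp q} (hu : u.IsHomogeneous r)
    (v : X.toSVec.carrier) : f (X.act u v) = superSign k (p * r) • Y.act u (f v) := by
  have := h p r u hu v
  rwa [proj_of_mem _ hf] at this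

theorem proj_mem_homs {f : X.toSVec.carrier →ₗ[k] Y.toSVec.carrier} (h : f ∈ homs X Y)
    (p : ZMod 2) : (X.gr.hom Y.gr).proj p f ∈ homs X Y :=
  mem_homs_of_homogeneous (proj_mem _ p f) (h p)

theorem mem_homs_of_gen {p : ZMod 2} {f : X.toSVec.carrier →ₗ[k] Y.toSVec.carrier}
    (hf : f ∈ (X.gr.hom Y.gr).part p)
    (h : ∀ (x : OspGen) v, f (X.act (UqOsp.gen q x) v) =
      superSign k (p * x.parity) • Y.act (UqOsp.gen q x) (f v)) : f ∈ homs X Y := by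
  refine mem_homs_of_homogeneous hf fun r u hu => ?_
  induction hu with
  | one => intro v; simp
  | gen x => exact h x
  | mul _ _ hu hw =>
    intro v
    rw [map_mul, Module.End.mul_apply, hu, hw, map_smul, smul_smul, map_mul, Module.End.mul_apply,
      mul_add, superSign_add]
  | zero p => intro v; simp
  | add _ _ hu hw =>
    intro v
    rw [map_add, LinearMap.add_apply, map_add, hu, hw, ← smul_add, map_add, LinearMap.add_apply]
  | smul c _ hu =>
    intro v
    rw [map_smul, LinearMap.smul_apply, map_smul, hu, map_smul, LinearMap.smul_apply, smul_comm]

/-- To prove something about homomorphisms, it is enough to treat homogeneous ones. -/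
theorem homs_induction {C : (X.toSVec.carrier →ₗ[k] Y.toSVec.carrier) → Prop}
    (hom : ∀ p, ∀ f ∈ (X.gr.hom Y.gr).part p, f ∈ homs X Y → C f)
    (add : ∀ f g, C f → C g → C (f + g)) {f : X.toSVec.carrier →ₗ[k] Y.toSVec.carrier}
    (hf : f ∈ homs X Y) : C f := by
  rw [← (X.gr.hom Y.gr).proj_add_proj f]
  exact add _ _ (hom _ _ (proj_mem _ _ _) (proj_mem_homs hf _))
    (hom _ _ (proj_mem _ _ _) (proj_mem_homs hf _))

theorem id_mem_homs (X : OspMod k q) : LinearMap.id ∈ homs X X :=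
  mem_homs_of_homogeneous X.gr.id_mem_hom fun r u _ v => by simp

theorem comp_mem_homs {f : X.toSVec.carrier →ₗ[k] Y.toSVec.carrier}
    {g : Y.toSVec.carrier →ₗ[k] Z.toSVec.carrier} (hf : f ∈ homs X Y) (hg : g ∈ homs Y Z) :
    g ∘ₗ f ∈ homs X Z := by
  refine homs_induction (C := fun f => g ∘ₗ f ∈ homs X Z) ?_ ?_ hf
  swap
  · intro f f' h h'
    rw [LinearMap.comp_add]
    exact add_mem h h'
  intro p f hf hf'
  refine homs_induction (C := fun g => g ∘ₗ f ∈ homs X Z) ?_ ?_ hg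
  swap
  · intro f f' h h'
    rw [LinearMap.add_comp]
    exact add_mem h h'
  intro s g hg hg'
  refine mem_homs_of_homogeneous (comp_mem_hom hf hg) fun r u hu v => ?_
  rw [LinearMap.comp_apply, homs_apply hf' hf hu, map_smul, homs_apply hg' hg hu, smul_smul,
    add_mul, superSign_add, LinearMap.comp_apply]

theorem symm_mem_homs {e : X.toSVec.carrier ≃ₗ[k] Y.toSVec.carrier}
    (h : e.toLinearMap ∈ homs X Y) (he : e.toLinearMap ∈ (X.gr.hom Y.gr).part 0)
    (he' : e.symm.toLinearMap ∈ (Y.gr.hom X.gr).part 0) : e.symm.toLinearMap ∈ homs Y X := by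
  refine mem_homs_of_homogeneous he' fun r u hu v => ?_
  have := homs_apply h he hu (e.symm v)
  simp only [LinearEquiv.coe_coe, LinearEquiv.apply_symm_apply, zero_mul, superSign_zero,
    one_smul] at this ⊢
  rw [← this, LinearEquiv.symm_apply_apply]

/-- The grading on the space of homomorphisms. -/
noncomputable def homsGrading (X Y : OspMod k q) : SuperGrading k (homs X Y) :=
  SuperGrading.ofProj
    (fun p => ((X.gr.hom Y.gr).part p).comap (homs X Y).subtype)
    (fun p => ((X.gr.hom Y.gr).proj p).restrict fun _ hf => proj_mem_homs hf p)
    (fun p f => Submodule.mem_comap.2 (proj_mem (X.gr.hom Y.gr) p f.1))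
    (fun f => Subtype.ext (proj_add_proj _ f.1))
    (fun p f hf => Subtype.ext (proj_of_mem_ne (X.gr.hom Y.gr) (Submodule.mem_comap.1 hf)
      ((by decide : ∀ p : ZMod 2, p + 1 ≠ p) p)))

theorem mem_homsGrading {p : ZMod 2} {f : homs X Y} :
    f ∈ (homsGrading X Y).part p ↔ f.1 ∈ (X.gr.hom Y.gr).part p := Submodule.mem_comap

variable (k q)

instance : Category (OspMod k q) where
  Hom X Y := homs X Y
  id X := ⟨LinearMap.id, id_mem_homs X⟩
  comp f g := ⟨g.1 ∘ₗ f.1, comp_mem_homs f.2 g.2⟩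

variable {k q}

/-- The linear map underlying a homomorphism. -/
def lin (f : X ⟶ Y) : X.toSVec.carrier →ₗ[k] Y.toSVec.carrier := f.1

/-- A homomorphism as a morphism. -/
def ofLin (f : X.toSVec.carrier →ₗ[k] Y.toSVec.carrier) (h : f ∈ homs X Y) : X ⟶ Y := ⟨f, h⟩

theorem lin_mem (f : X ⟶ Y) : lin f ∈ homs X Y := f.2

theorem hom_ext {f g : X ⟶ Y} (h : lin f = lin g) : f = g := Subtype.ext h

theorem lin_ofLin (f : X.toSVec.carrier →ₗ[k] Y.toSVec.carrier) (h : f ∈ homs X Y) :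
    lin (ofLin f h) = f := rfl

variable (k q)

instance : Preadditive (OspMod k q) where
  homGroup X Y := inferInstanceAs (AddCommGroup (homs X Y))
  add_comp _ _ _ _ _ _ := Subtype.ext (LinearMap.comp_add _ _ _)
  comp_add _ _ _ _ _ _ := Subtype.ext (LinearMap.add_comp _ _ _)

instance : Linear k (OspMod k q) where
  homModule X Y := inferInstanceAs (Module k (homs X Y))
  smul_comp _ _ _ _ _ _ := Subtype.ext (LinearMap.comp_smul _ _ _)
  comp_smul _ _ _ _ _ _ := Subtype.ext (LinearMap.smul_comp _ _ _)

noncomputable instance : Supercategory k (OspMod k q) where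
  gr X Y := homsGrading X Y
  id_mem X := mem_homsGrading.2 X.gr.id_mem_hom
  comp_mem hf hg := mem_homsGrading.2
    (SuperGrading.comp_mem_hom (mem_homsGrading.1 hf) (mem_homsGrading.1 hg))

variable {k q}

theorem parity_iff {p : ZMod 2} {f : X ⟶ Y} :
    HomParity k p f ↔ lin f ∈ (X.gr.hom Y.gr).part p := mem_homsGrading

/-- An even linear isomorphism which is a homomorphism, as an isomorphism. -/
def isoOfLin (e : X.toSVec.carrier ≃ₗ[k] Y.toSVec.carrier) (h : e.toLinearMap ∈ homs X Y)
    (he : e.toLinearMap ∈ (X.gr.hom Y.gr).part 0)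
    (he' : e.symm.toLinearMap ∈ (Y.gr.hom X.gr).part 0) : X ≅ Y where
  hom := ofLin e.toLinearMap h
  inv := ofLin e.symm.toLinearMap (symm_mem_homs h he he')
  hom_inv_id := hom_ext (LinearMap.ext fun v => e.symm_apply_apply v)
  inv_hom_id := hom_ext (LinearMap.ext fun v => e.apply_symm_apply v)

end OspMod

/-! ## The tensor product of `U`-supermodules -/

namespace OspMod

open SuperGrading

section Ops

variable {k : Type u} [Field k] {q : kˣ} (X : OspMod k q)

/-- The operator `1_n`. -/
noncomputable def e (n : ℤ) : Module.End k X.toSVec.carrier := X.act (UqOsp.gen q (.e n))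
/-- The operator `E_n`. -/
noncomputable def E (n : ℤ) : Module.End k X.toSVec.carrier := X.act (UqOsp.gen q (.E n))
/-- The operator `F_n`. -/
noncomputable def F (n : ℤ) : Module.End k X.toSVec.carrier := X.act (UqOsp.gen q (.F n))

theorem e_mem (n : ℤ) : X.e n ∈ (X.gr.hom X.gr).part 0 :=
  mem_hom.2 fun _ _ hv => X.act_mem (.gen (.e n)) hv
theorem E_mem (n : ℤ) : X.E n ∈ (X.gr.hom X.gr).part 1 :=
  mem_hom.2 fun _ _ hv => X.act_mem (.gen (.E n)) hv
theorem F_mem (n : ℤ) : X.F n ∈ (X.gr.hom X.gr).part 1 :=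
  mem_hom.2 fun _ _ hv => X.act_mem (.gen (.F n)) hv

theorem act_rel {x y : FreeAlgebra k OspGen} (h : UqOsp.Rel q x y) :
    X.act (RingQuot.mkAlgHom k (UqOsp.Rel q) x) = X.act (RingQuot.mkAlgHom k (UqOsp.Rel q) y) := by
  rw [UqOsp.gen_rel h]

theorem e_e_self (n : ℤ) (v : X.toSVec.carrier) : X.e n (X.e n v) = X.e n v := by
  have := LinearMap.congr_fun (X.act_rel (.e_mul_self n)) v
  simp only [map_mul, Module.End.mul_apply] at this
  exact this
theorem e_e {m n : ℤ} (h : m ≠ n) (v : X.toSVec.carrier) : X.e m (X.e n v) = 0 := by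
  have := LinearMap.congr_fun (X.act_rel (.e_mul m n h)) v
  simp only [map_mul, Module.End.mul_apply, map_zero, LinearMap.zero_apply] at this
  exact this
theorem e_E (n : ℤ) (v : X.toSVec.carrier) : X.e (n + 2) (X.E n v) = X.E n v := by
  have := LinearMap.congr_fun (X.act_rel (.e_mul_E n)) v
  simp only [map_mul, Module.End.mul_apply] at this
  exact this
theorem E_e (n : ℤ) (v : X.toSVec.carrier) : X.E n (X.e n v) = X.E n v := by
  have := LinearMap.congr_fun (X.act_rel (.E_mul_e n)) v
  simp only [map_mul, Module.End.mul_apply] at this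
  exact this
theorem e_F (n : ℤ) (v : X.toSVec.carrier) : X.e (n - 2) (X.F n v) = X.F n v := by
  have := LinearMap.congr_fun (X.act_rel (.e_mul_F n)) v
  simp only [map_mul, Module.End.mul_apply] at this
  exact this
theorem F_e (n : ℤ) (v : X.toSVec.carrier) : X.F n (X.e n v) = X.F n v := by
  have := LinearMap.congr_fun (X.act_rel (.F_mul_e n)) v
  simp only [map_mul, Module.End.mul_apply] at this
  exact this
theorem E_F (n : ℤ) (v : X.toSVec.carrier) :
    X.E (n - 2) (X.F n v) + X.F (n + 2) (X.E n v) = qInt q n • X.e n v := by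
  have := LinearMap.congr_fun (X.act_rel (.E_F n)) v
  simp only [map_mul, map_sub, map_add, map_smul, Module.End.mul_apply, LinearMap.add_apply,
    LinearMap.smul_apply, neg_smul, one_smul, sub_neg_eq_add] at this
  exact this

/-- A homogeneous weight vector: `v ∈ 1_a V` is of parity `s`. -/
def IsWt (a : ℤ) (s : ZMod 2) (v : X.toSVec.carrier) : Prop := X.e a v = v ∧ v ∈ X.gr.part s

variable {X} {a b c : ℤ} {s t : ZMod 2} {v : X.toSVec.carrier}

theorem IsWt.e (h : X.IsWt a s v) (n : ℤ) : X.e n v = if n = a then v else 0 := by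
  split_ifs with hn
  · subst hn; exact h.1
  · rw [← h.1, X.e_e hn]
theorem IsWt.E (h : X.IsWt a s v) (n : ℤ) : X.E n v = if n = a then X.E a v else 0 := by
  rw [← X.E_e n v, h.e]
  split_ifs with hn
  · rw [hn]
  · simp
theorem IsWt.F (h : X.IsWt a s v) (n : ℤ) : X.F n v = if n = a then X.F a v else 0 := by
  rw [← X.F_e n v, h.e]
  split_ifs with hn
  · rw [hn]
  · simp
theorem IsWt.E_wt (h : X.IsWt a s v) : X.IsWt (a + 2) (s + 1) (X.E a v) :=
  ⟨X.e_E a v, X.E_mem a s v h.2⟩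
theorem IsWt.F_wt (h : X.IsWt a s v) : X.IsWt (a - 2) (s + 1) (X.F a v) :=
  ⟨X.e_F a v, X.F_mem a s v h.2⟩

/-- To prove an equality of linear maps, it is enough to evaluate on homogeneous weight
vectors. -/
theorem ext_wt {N : Type*} [AddCommGroup N] [Module k N] {f g : X.toSVec.carrier →ₗ[k] N}
    (h : ∀ a s v, X.IsWt a s v → f v = g v) : f = g := by
  ext v
  have hv : v ∈ ⨆ n : ℤ, LinearMap.range (X.e n) := X.locally_unital ▸ Submodule.mem_top
  refine Submodule.iSup_induction _ (motive := fun v => f v = g v) hv ?_ (by simp) ?_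
  · rintro n _ ⟨v, rfl⟩
    rw [← X.gr.proj_add_proj v, map_add, map_add, map_add]
    congr 1
    · exact h n _ _ ⟨X.e_e_self _ _, X.act_mem (.gen (.e n)) (X.gr.proj_mem 0 v)⟩
    · exact h n _ _ ⟨X.e_e_self _ _, X.act_mem (.gen (.e n)) (X.gr.proj_mem 1 v)⟩
  · intro v w hv hw
    rw [map_add, map_add, hv, hw]

/-- Only finitely many weights occur. -/
theorem finite_wt (X : OspMod k q) : {n : ℤ | X.e n ≠ 0}.Finite := by
  have := X.finite
  have h : ∀ n : {n : ℤ | X.e n ≠ 0}, ∃ v, X.e n v ≠ 0 := by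
    rintro ⟨n, hn⟩
    by_contra! h
    exact hn (LinearMap.ext h)
  choose v hv using h
  have hl : LinearIndependent k (fun n : {n : ℤ | X.e n ≠ 0} => X.e n (v n)) := by
    rw [linearIndependent_iff']
    intro S g hS i hi
    have h1 := congrArg (X.e i) hS
    rw [map_sum, map_zero, Finset.sum_eq_single_of_mem i hi] at h1
    · rw [map_smul, X.e_e_self] at h1
      exact (smul_eq_zero.1 h1).resolve_right (hv i)
    · intro j _ hj
      rw [map_smul, X.e_e (fun h => hj (Subtype.ext h.symm)), smul_zero]
  exact Set.finite_coe_iff.1 hl.finite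

end Ops

section Tensor

variable {k : Type u} [Field k] {q : kˣ} (X Y Z : OspMod k q)

/-- The operator by which `Δ(1_n) = ∑_{a+b=n} 1_a ⊗ 1_b` acts on `X ⊗ Y`. -/
noncomputable def tensorE₀ (n : ℤ) :
    Module.End k (X.toSVec.carrier ⊗[k] Y.toSVec.carrier) :=
  ∑ᶠ a : ℤ, superMap X.gr Y.gr Y.gr (X.e a) (Y.e (n - a))

/-- The operator by which `Δ(E_n) = ∑_{a+b=n} (E_a ⊗ 1_b + q^{-a} 1_a ⊗ E_b)` acts on
`X ⊗ Y`. -/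
noncomputable def tensorE (n : ℤ) :
    Module.End k (X.toSVec.carrier ⊗[k] Y.toSVec.carrier) :=
  ∑ᶠ a : ℤ, (superMap X.gr Y.gr Y.gr (X.E a) (Y.e (n - a)) +
    ((q ^ (-a) : kˣ) : k) • superMap X.gr Y.gr Y.gr (X.e a) (Y.E (n - a)))

/-- The operator by which `Δ(F_n) = ∑_{a+b=n} (ε^a 1_a ⊗ F_b + q^b F_a ⊗ 1_b)` acts on
`X ⊗ Y`, where `ε = -1`. -/
noncomputable def tensorF (n : ℤ) :
    Module.End k (X.toSVec.carrier ⊗[k] Y.toSVec.carrier) :=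
  ∑ᶠ a : ℤ, ((((-1) ^ a : kˣ) : k) • superMap X.gr Y.gr Y.gr (X.e a) (Y.F (n - a)) +
    ((q ^ (n - a) : kˣ) : k) • superMap X.gr Y.gr Y.gr (X.F a) (Y.e (n - a)))

theorem E_eq_zero {X : OspMod k q} {a : ℤ} (h : X.e a = 0) : X.E a = 0 := by
  ext v; rw [← X.E_e, h]; simp
theorem F_eq_zero {X : OspMod k q} {a : ℤ} (h : X.e a = 0) : X.F a = 0 := by
  ext v; rw [← X.F_e, h]; simp

theorem superMap_zero_left {M N M' N' : Type*} [AddCommGroup M] [Module k M] [AddCommGroup N]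
    [Module k N] [AddCommGroup M'] [Module k M'] [AddCommGroup N'] [Module k N']
    (G : SuperGrading k M) (H : SuperGrading k N) (H' : SuperGrading k N') (g : N →ₗ[k] N') :
    superMap G H H' (0 : M →ₗ[k] M') g = 0 := by
  have := superMap_smul_left (G := G) (H := H) (H' := H') (0 : k) (0 : M →ₗ[k] M') g
  rwa [zero_smul, zero_smul] at this

variable {X Y Z} {a b c : ℤ} {s t r : ZMod 2} {v : X.toSVec.carrier} {w : Y.toSVec.carrier}
  {z : Z.toSVec.carrier}

theorem finsum_eval {M : Type*} [AddCommGroup M] [Module k M] (f : ℤ → Module.End k M)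
    (hf : {n | f n ≠ 0}.Finite) (a : ℤ) (x : M) (h : ∀ n, n ≠ a → f n x = 0) :
    (∑ᶠ n, f n) x = f a x := by
  have := (LinearMap.toAddMonoidHom (LinearMap.applyₗ (R := k) (M₂ := M) x)).map_finsum (f := f) hf
  refine Eq.trans this ?_
  exact finsum_eq_single _ a h

theorem tensorE₀_tmul (hv : X.IsWt a s v) (hw : Y.IsWt b t w) (n : ℤ) :
    tensorE₀ X Y n (v ⊗ₜ w) = if n = a + b then v ⊗ₜ w else 0 := by
  have h : ∀ i, superMap X.gr Y.gr Y.gr (X.e i) (Y.e (n - i)) (v ⊗ₜ w) =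
      X.e i v ⊗ₜ Y.e (n - i) w := fun i => superMap_tmul_even _ (Y.e_mem _) _ _
  rw [tensorE₀, finsum_eval _ _ a, h, hv.e, hw.e, if_pos rfl]
  · by_cases hn : n = a + b
    · rw [if_pos hn, if_pos (by omega)]
    · rw [if_neg hn, if_neg (by omega), TensorProduct.tmul_zero]
  · intro i hi
    rw [h, hv.e, if_neg hi, TensorProduct.zero_tmul]
  · refine X.finite_wt.subset fun i hi hi' => hi ?_
    rw [hi', superMap_zero_left]

theorem tensorE_tmul (hv : X.IsWt a s v) (hw : Y.IsWt b t w) (n : ℤ) :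
    tensorE X Y n (v ⊗ₜ w) = if n = a + b then
      X.E a v ⊗ₜ w + (((q ^ (-a) : kˣ) : k) * superSign k s) • (v ⊗ₜ Y.E b w) else 0 := by
  have h : ∀ i, (superMap X.gr Y.gr Y.gr (X.E i) (Y.e (n - i)) +
      ((q ^ (-i) : kˣ) : k) • superMap X.gr Y.gr Y.gr (X.e i) (Y.E (n - i))) (v ⊗ₜ w) =
      X.E i v ⊗ₜ Y.e (n - i) w +
        (((q ^ (-i) : kˣ) : k) * superSign k s) • (X.e i v ⊗ₜ Y.E (n - i) w) := fun i => by
    rw [LinearMap.add_apply, LinearMap.smul_apply, superMap_tmul_even _ (Y.e_mem _),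
      superMap_tmul _ (Y.E_mem _) hv.2, smul_smul, one_mul]
  rw [tensorE, finsum_eval _ _ a, h, hv.e, hw.e, if_pos rfl, hw.E (n - a)]
  · by_cases hn : n = a + b
    · rw [if_pos hn, if_pos (by omega), if_pos (by omega)]
    · rw [if_neg hn, if_neg (by omega), if_neg (by omega)]; simp
  · intro i hi
    rw [h, hv.e, hv.E i, if_neg hi, if_neg hi]; simp
  · refine X.finite_wt.subset fun i hi hi' => hi ?_
    rw [hi', E_eq_zero hi', superMap_zero_left, superMap_zero_left, smul_zero, add_zero]

theorem tensorF_tmul (hv : X.IsWt a s v) (hw : Y.IsWt b t w) (n : ℤ) :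
    tensorF X Y n (v ⊗ₜ w) = if n = a + b then
      ((((-1) ^ a : kˣ) : k) * superSign k s) • (v ⊗ₜ Y.F b w) +
        ((q ^ b : kˣ) : k) • (X.F a v ⊗ₜ w) else 0 := by
  have h : ∀ i, ((((-1) ^ i : kˣ) : k) • superMap X.gr Y.gr Y.gr (X.e i) (Y.F (n - i)) +
      ((q ^ (n - i) : kˣ) : k) • superMap X.gr Y.gr Y.gr (X.F i) (Y.e (n - i))) (v ⊗ₜ w) =
      ((((-1) ^ i : kˣ) : k) * superSign k s) • (X.e i v ⊗ₜ Y.F (n - i) w) +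
        ((q ^ (n - i) : kˣ) : k) • (X.F i v ⊗ₜ Y.e (n - i) w) := fun i => by
    rw [LinearMap.add_apply, LinearMap.smul_apply, LinearMap.smul_apply,
      superMap_tmul_even _ (Y.e_mem _), superMap_tmul _ (Y.F_mem _) hv.2, smul_smul, one_mul]
  rw [tensorF, finsum_eval _ _ a, h, hv.e, hw.e, if_pos rfl, hw.F (n - a)]
  · by_cases hn : n = a + b
    · have hb : n - a = b := by omega
      rw [if_pos hn, if_pos hb, if_pos hb, hb]
    · rw [if_neg hn, if_neg (by omega), if_neg (by omega)]; simp
  · intro i hi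
    rw [h, hv.e, hv.F i, if_neg hi, if_neg hi]; simp
  · refine X.finite_wt.subset fun i hi hi' => hi ?_
    rw [hi', F_eq_zero hi', superMap_zero_left, superMap_zero_left, smul_zero, smul_zero, add_zero]

/-- To prove an equality of linear maps on a tensor product, it is enough to evaluate on
tensor products of homogeneous weight vectors. -/
theorem ext_wt₂ {N : Type*} [AddCommGroup N] [Module k N]
    {f g : X.toSVec.carrier ⊗[k] Y.toSVec.carrier →ₗ[k] N}
    (h : ∀ a s v, X.IsWt a s v → ∀ b t w, Y.IsWt b t w → f (v ⊗ₜ w) = g (v ⊗ₜ w)) : f = g := by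
  apply TensorProduct.ext
  refine ext_wt fun a s v hv => ext_wt fun b t w hw => ?_
  exact h a s v hv b t w hw

end Tensor

end OspMod

namespace OspMod

open SuperGrading

section Tensor

variable {k : Type u} [Field k] {q : kˣ} {X Y Z : OspMod k q} {a b c : ℤ} {s t r : ZMod 2}
  {v : X.toSVec.carrier} {w : Y.toSVec.carrier} {z : Z.toSVec.carrier}

theorem superSign_succ (s : ZMod 2) : superSign k (s + 1) = -superSign k s := by
  rw [superSign_add, superSign_one, mul_neg_one]

theorem superSign_mul_self (s : ZMod 2) : superSign k s * superSign k s = 1 := by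
  rw [← superSign_add, zmod2_add_self, superSign_zero]

theorem tensorE₀_mem (n : ℤ) :
    tensorE₀ X Y n ∈ ((X.gr.tensor Y.gr).hom (X.gr.tensor Y.gr)).part 0 :=
  finsum_induction _ (zero_mem _) (fun _ _ => add_mem) fun i =>
    part_mem_cast (superMap_mem (X.e_mem i) (Y.e_mem (n - i))) (add_zero 0)

theorem tensorE_mem (n : ℤ) :
    tensorE X Y n ∈ ((X.gr.tensor Y.gr).hom (X.gr.tensor Y.gr)).part 1 :=
  finsum_induction _ (zero_mem _) (fun _ _ => add_mem) fun i =>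
    add_mem (part_mem_cast (superMap_mem (X.E_mem i) (Y.e_mem (n - i))) (add_zero 1))
      (Submodule.smul_mem _ _
        (part_mem_cast (superMap_mem (X.e_mem i) (Y.E_mem (n - i))) (zero_add 1)))

theorem tensorF_mem (n : ℤ) :
    tensorF X Y n ∈ ((X.gr.tensor Y.gr).hom (X.gr.tensor Y.gr)).part 1 :=
  finsum_induction _ (zero_mem _) (fun _ _ => add_mem) fun i =>
    add_mem (Submodule.smul_mem _ _
        (part_mem_cast (superMap_mem (X.e_mem i) (Y.F_mem (n - i))) (zero_add 1)))
      (Submodule.smul_mem _ _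
        (part_mem_cast (superMap_mem (X.F_mem i) (Y.e_mem (n - i))) (add_zero 1)))

theorem tensor_e_e (m n : ℤ) : tensorE₀ X Y m ∘ₗ tensorE₀ X Y n =
    if m = n then tensorE₀ X Y n else 0 := by
  refine ext_wt₂ fun a s v hv b t w hw => ?_
  rw [LinearMap.comp_apply, tensorE₀_tmul hv hw]
  split_ifs with h h' h'
  · rw [tensorE₀_tmul hv hw, tensorE₀_tmul hv hw, if_pos (h'.trans h), if_pos h]
  · rw [tensorE₀_tmul hv hw, if_neg fun e => h' (e.trans h.symm)]; rfl
  · rw [tensorE₀_tmul hv hw, if_neg h, map_zero]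
  · rw [map_zero]; rfl

theorem tensor_e_E (n : ℤ) : tensorE₀ X Y (n + 2) ∘ₗ tensorE X Y n = tensorE X Y n := by
  refine ext_wt₂ fun a s v hv b t w hw => ?_
  rw [LinearMap.comp_apply, tensorE_tmul hv hw]
  split_ifs with h
  · rw [map_add, map_smul, tensorE₀_tmul hv.E_wt hw, tensorE₀_tmul hv hw.E_wt,
      if_pos (by omega), if_pos (by omega)]
  · rw [map_zero]

theorem tensor_e_F (n : ℤ) : tensorE₀ X Y (n - 2) ∘ₗ tensorF X Y n = tensorF X Y n := by
  refine ext_wt₂ fun a s v hv b t w hw => ?_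
  rw [LinearMap.comp_apply, tensorF_tmul hv hw]
  split_ifs with h
  · rw [map_add, map_smul, map_smul, tensorE₀_tmul hv.F_wt hw, tensorE₀_tmul hv hw.F_wt,
      if_pos (by omega), if_pos (by omega)]
  · rw [map_zero]

theorem tensor_E_e (n : ℤ) : tensorE X Y n ∘ₗ tensorE₀ X Y n = tensorE X Y n := by
  refine ext_wt₂ fun a s v hv b t w hw => ?_
  rw [LinearMap.comp_apply, tensorE₀_tmul hv hw]
  split_ifs with h
  · rfl
  · rw [map_zero, tensorE_tmul hv hw, if_neg h]

theorem tensor_F_e (n : ℤ) : tensorF X Y n ∘ₗ tensorE₀ X Y n = tensorF X Y n := by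
  refine ext_wt₂ fun a s v hv b t w hw => ?_
  rw [LinearMap.comp_apply, tensorE₀_tmul hv hw]
  split_ifs with h
  · rfl
  · rw [map_zero, tensorF_tmul hv hw, if_neg h]

theorem tensor_E_F (n : ℤ) :
    tensorE X Y (n - 2) ∘ₗ tensorF X Y n + tensorF X Y (n + 2) ∘ₗ tensorE X Y n =
      qInt q n • tensorE₀ X Y n := by
  refine ext_wt₂ fun a s v hv b t w hw => ?_
  rw [LinearMap.add_apply, LinearMap.comp_apply, LinearMap.comp_apply, LinearMap.smul_apply,
    tensorE_tmul hv hw, tensorF_tmul hv hw, tensorE₀_tmul hv hw]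
  split_ifs with h
  swap
  · simp
  subst h
  rw [map_add, map_smul, map_smul, map_add, map_smul, tensorE_tmul hv hw.F_wt,
    tensorE_tmul hv.F_wt hw, tensorF_tmul hv hw.E_wt, tensorF_tmul hv.E_wt hw,
    if_pos (by omega), if_pos (by omega), if_pos (by omega), if_pos (by omega),
    superSign_succ, qInt_add]
  have h1 : (((-1) ^ (a + 2) : kˣ) : k) = (((-1) ^ a : kˣ) : k) := by
    rw [zpow_add]; simp
  have h2 : ((q ^ (-(a - 2)) : kˣ) : k) * ((q ^ b : kˣ) : k) =
      ((q ^ (-a) : kˣ) : k) * ((q ^ (b + 2) : kˣ) : k) := by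
    rw [← Units.val_mul, ← Units.val_mul, ← zpow_add, ← zpow_add]; congr 2; ring
  have h3 : (((-q) ^ (-a) : kˣ) : k) = (((-1) ^ a : kˣ) : k) * ((q ^ (-a) : kˣ) : k) := by
    rw [neg_eq_neg_one_mul, mul_zpow, zpow_neg (-1 : kˣ), ← inv_zpow]; simp
  have h4 := superSign_mul_self (k := k) s
  have hX : qInt q a • (v ⊗ₜ[k] w) = X.E (a - 2) (X.F a v) ⊗ₜ w + X.F (a + 2) (X.E a v) ⊗ₜ w := by
    rw [← TensorProduct.add_tmul, X.E_F, hv.1, TensorProduct.smul_tmul']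
  have hY : qInt q b • (v ⊗ₜ[k] w) = v ⊗ₜ Y.E (b - 2) (Y.F b w) + v ⊗ₜ Y.F (b + 2) (Y.E b w) := by
    rw [← TensorProduct.tmul_add, Y.E_F, hw.1, TensorProduct.tmul_smul]
  have hX' : (((q ^ b : kˣ) : k) * qInt q a) • (v ⊗ₜ[k] w) = ((q ^ b : kˣ) : k) •
      (X.E (a - 2) (X.F a v) ⊗ₜ w + X.F (a + 2) (X.E a v) ⊗ₜ w) := by
    rw [← hX, smul_smul]
  have hY' : ((((-1) ^ a : kˣ) : k) * ((q ^ (-a) : kˣ) : k) * qInt q b) • (v ⊗ₜ[k] w) =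
      ((((-1) ^ a : kˣ) : k) * ((q ^ (-a) : kˣ) : k)) •
      (v ⊗ₜ Y.E (b - 2) (Y.F b w) + v ⊗ₜ Y.F (b + 2) (Y.E b w)) := by
    rw [← hY, smul_smul]
  rw [add_smul, h1, h3, hX', hY']
  clear hX hY hX' hY' h1 h3
  generalize ((q ^ (-(a - 2)) : kˣ) : k) = x₁ at h2 ⊢
  generalize ((q ^ b : kˣ) : k) = x₂ at h2 ⊢
  generalize ((q ^ (-a) : kˣ) : k) = x₃ at h2 ⊢
  generalize ((q ^ (b + 2) : kˣ) : k) = x₄ at h2 ⊢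
  generalize (((-1) ^ a : kˣ) : k) = x₅ at h2 ⊢
  generalize superSign k s = x₆ at h4 ⊢
  match_scalars <;> grind

end Tensor

end OspMod

namespace OspMod

open SuperGrading

section Tensor

variable {k : Type u} [Field k] {q : kˣ} (X Y Z : OspMod k q)

/-- The operators by which the generators act on `X ⊗ Y`, through the comultiplication. -/
noncomputable def tensorOps : OspOps k q (X.toSVec ⊗ Y.toSVec) where
  e := tensorE₀ X Y
  E := tensorE X Y
  F := tensorF X Y
  e_mem := tensorE₀_mem
  E_mem := tensorE_mem
  F_mem := tensorF_mem
  e_e_self n v := (LinearMap.congr_fun (tensor_e_e n n) v).trans (by rw [if_pos rfl])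
  e_e m n v h := (LinearMap.congr_fun (tensor_e_e m n) v).trans (by rw [if_neg h]; rfl)
  e_E n v := LinearMap.congr_fun (tensor_e_E n) v
  E_e n v := LinearMap.congr_fun (tensor_E_e n) v
  e_F n v := LinearMap.congr_fun (tensor_e_F n) v
  F_e n v := LinearMap.congr_fun (tensor_F_e n) v
  E_F n v := LinearMap.congr_fun (tensor_E_F n) v
  locally_unital := by
    rw [eq_top_iff]
    have h : (⨆ n : ℤ, LinearMap.range (tensorE₀ X Y n)).mkQ = 0 := by
      refine ext_wt₂ fun a s v hv b t w hw => ?_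
      rw [LinearMap.zero_apply, Submodule.mkQ_apply, Submodule.Quotient.mk_eq_zero]
      refine Submodule.mem_iSup_of_mem (a + b) ⟨v ⊗ₜ w, ?_⟩
      rw [tensorE₀_tmul hv hw, if_pos rfl]
    intro x _
    have := LinearMap.congr_fun h x
    rwa [LinearMap.zero_apply, Submodule.mkQ_apply, Submodule.Quotient.mk_eq_zero] at this

/-- The tensor product of `U`-supermodules. -/
noncomputable def tensor : OspMod k q :=
  (tensorOps X Y).toOspMod (by
    have := X.finite
    have := Y.finite
    exact inferInstanceAs (Module.Finite k (TensorProduct k X.toSVec.carrier Y.toSVec.carrier)))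

/-- The operators by which the generators act on the trivial module, through the counit. -/
noncomputable def unitOps : OspOps k q (𝟙_ (SVec k)) where
  e n := if n = 0 then LinearMap.id else 0
  E _ := 0
  F _ := 0
  e_mem n := by
    split_ifs
    · exact (even k).id_mem_hom
    · exact zero_mem _
  E_mem _ := zero_mem _
  F_mem _ := zero_mem _
  e_e_self n v := by split_ifs <;> rfl
  e_e m n v h := by
    by_cases hn : n = 0
    · rw [if_neg (fun hm => h (hm.trans hn.symm))]; rfl
    · rw [if_neg hn, LinearMap.zero_apply, map_zero]
  e_E n v := by rw [LinearMap.zero_apply, map_zero]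
  E_e n v := rfl
  e_F n v := by rw [LinearMap.zero_apply, map_zero]
  F_e n v := rfl
  E_F n v := by
    rw [LinearMap.zero_apply, add_zero]
    split_ifs with h
    · rw [h, qInt_zero, zero_smul]
    · rw [LinearMap.zero_apply, smul_zero]
  locally_unital := by
    rw [eq_top_iff]
    intro v _
    exact Submodule.mem_iSup_of_mem 0 ⟨v, by rw [if_pos rfl]; rfl⟩

/-- The trivial `U`-supermodule. -/
noncomputable def unit (k : Type u) [Field k] (q : kˣ) : OspMod k q :=
  unitOps.toOspMod (inferInstanceAs (Module.Finite k k))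

variable {X Y Z} {a b c : ℤ} {s t r : ZMod 2}
  {v : X.toSVec.carrier} {w : Y.toSVec.carrier} {z : Z.toSVec.carrier}

theorem tensor_e (n : ℤ) : (tensor X Y).e n = tensorE₀ X Y n := (tensorOps X Y).act_gen (.e n)
theorem tensor_E (n : ℤ) : (tensor X Y).E n = tensorE X Y n := (tensorOps X Y).act_gen (.E n)
theorem tensor_F (n : ℤ) : (tensor X Y).F n = tensorF X Y n := (tensorOps X Y).act_gen (.F n)

/-- A pure tensor. -/
noncomputable def tm (v : X.toSVec.carrier) (w : Y.toSVec.carrier) :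
    (tensor X Y).toSVec.carrier := v ⊗ₜ[k] w

theorem tm_wt (hv : X.IsWt a s v) (hw : Y.IsWt b t w) :
    (tensor X Y).IsWt (a + b) (s + t) (tm v w) := by
  refine ⟨?_, tmul_mem_tensor hv.2 hw.2⟩
  rw [tensor_e]
  exact (tensorE₀_tmul hv hw (a + b)).trans (if_pos rfl)

theorem tm_E (hv : X.IsWt a s v) (hw : Y.IsWt b t w) : (tensor X Y).E (a + b) (tm v w) =
    tm (X.E a v) w + (((q ^ (-a) : kˣ) : k) * superSign k s) • tm v (Y.E b w) := by
  rw [tensor_E]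
  exact (tensorE_tmul hv hw (a + b)).trans (if_pos rfl)

theorem tm_F (hv : X.IsWt a s v) (hw : Y.IsWt b t w) : (tensor X Y).F (a + b) (tm v w) =
    ((((-1) ^ a : kˣ) : k) * superSign k s) • tm v (Y.F b w) +
      ((q ^ b : kˣ) : k) • tm (X.F a v) w := by
  rw [tensor_F]
  exact (tensorF_tmul hv hw (a + b)).trans (if_pos rfl)

theorem add_tm (v v' : X.toSVec.carrier) (w : Y.toSVec.carrier) :
    tm (v + v') w = tm v w + tm v' w := TensorProduct.add_tmul _ _ _
theorem tm_add (v : X.toSVec.carrier) (w w' : Y.toSVec.carrier) :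
    tm v (w + w') = tm v w + tm v w' := TensorProduct.tmul_add _ _ _
theorem smul_tm (c : k) (v : X.toSVec.carrier) (w : Y.toSVec.carrier) :
    tm (c • v) w = c • tm v w := TensorProduct.smul_tmul' _ _ _
theorem tm_smul (c : k) (v : X.toSVec.carrier) (w : Y.toSVec.carrier) :
    tm v (c • w) = c • tm v w := TensorProduct.tmul_smul _ _ _

theorem unit_e (n : ℤ) : (unit k q).e n = if n = 0 then LinearMap.id else 0 :=
  unitOps.act_gen (.e n)
theorem unit_E (n : ℤ) : (unit k q).E n = 0 := unitOps.act_gen (.E n)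
theorem unit_F (n : ℤ) : (unit k q).F n = 0 := unitOps.act_gen (.F n)

/-- A vector of the trivial module, as a scalar. -/
def unitScalar (c : (unit k q).toSVec.carrier) : k := c

theorem unit_E_apply (n : ℤ) (c : (unit k q).toSVec.carrier) : (unit k q).E n c = 0 := by
  rw [unit_E]; rfl
theorem unit_F_apply (n : ℤ) (c : (unit k q).toSVec.carrier) : (unit k q).F n c = 0 := by
  rw [unit_F]; rfl

theorem zero_tm (w : Y.toSVec.carrier) : tm (0 : X.toSVec.carrier) w = 0 :=
  TensorProduct.zero_tmul _ _
theorem tm_zero (v : X.toSVec.carrier) : tm v (0 : Y.toSVec.carrier) = 0 :=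
  TensorProduct.tmul_zero _ _

theorem unit_wt (c : (unit k q).toSVec.carrier) : (unit k q).IsWt 0 0 c := by
  refine ⟨?_, mem_even_zero (k := k) c⟩
  rw [unit_e, if_pos rfl]
  rfl

/-- To check that a map is a homomorphism, it is enough to evaluate on enough weight vectors. -/
theorem mem_homs_of_wt {p : ZMod 2} {f : X.toSVec.carrier →ₗ[k] Y.toSVec.carrier}
    (hf : f ∈ (X.gr.hom Y.gr).part p) (P : ℤ → ZMod 2 → X.toSVec.carrier → Prop)
    (hP : ∀ a s v, P a s v → X.IsWt a s v)
    (ext : ∀ g h : X.toSVec.carrier →ₗ[k] Y.toSVec.carrier,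
      (∀ a s v, P a s v → g v = h v) → g = h)
    (he : ∀ a s v, P a s v → Y.e a (f v) = f v)
    (hE : ∀ a s v, P a s v → f (X.E a v) = superSign k p • Y.E a (f v))
    (hF : ∀ a s v, P a s v → f (X.F a v) = superSign k p • Y.F a (f v)) : f ∈ homs X Y := by
  have hw : ∀ a s v, P a s v → Y.IsWt a (s + p) (f v) := fun a s v h =>
    ⟨he a s v h, hf s v (hP a s v h).2⟩
  refine mem_homs_of_gen hf fun x v => ?_
  cases x with
  | e n =>
    refine LinearMap.congr_fun (ext (f ∘ₗ X.e n) (superSign k (p * 0) • (Y.e n ∘ₗ f)) ?_) v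
    intro a s v h
    rw [LinearMap.comp_apply, (hP a s v h).e, LinearMap.smul_apply, LinearMap.comp_apply,
      (hw a s v h).e]
    split_ifs <;> simp
  | E n =>
    refine LinearMap.congr_fun (ext (f ∘ₗ X.E n) (superSign k (p * 1) • (Y.E n ∘ₗ f)) ?_) v
    intro a s v h
    rw [LinearMap.comp_apply, (hP a s v h).E, LinearMap.smul_apply, LinearMap.comp_apply,
      (hw a s v h).E, mul_one]
    split_ifs
    · exact hE a s v h
    · simp
  | F n =>
    refine LinearMap.congr_fun (ext (f ∘ₗ X.F n) (superSign k (p * 1) • (Y.F n ∘ₗ f)) ?_) v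
    intro a s v h
    rw [LinearMap.comp_apply, (hP a s v h).F, LinearMap.smul_apply, LinearMap.comp_apply,
      (hw a s v h).F, mul_one]
    split_ifs
    · exact hF a s v h
    · simp

variable {X' Y' : OspMod k q}

theorem superMap_aux {p r : ZMod 2} {f : X.toSVec.carrier →ₗ[k] X'.toSVec.carrier}
    {g : Y.toSVec.carrier →ₗ[k] Y'.toSVec.carrier} (hf : f ∈ (X.gr.hom X'.gr).part p)
    (hf' : f ∈ homs X X') (hg : g ∈ (Y.gr.hom Y'.gr).part r) (hg' : g ∈ homs Y Y')
    (T : (tensor X Y).toSVec.carrier →ₗ[k] (tensor X' Y').toSVec.carrier)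
    (hT : T ∈ ((tensor X Y).gr.hom (tensor X' Y').gr).part (p + r))
    (hm : ∀ {a : ℤ} {s : ZMod 2} {v : X.toSVec.carrier}, X.IsWt a s v → ∀ w : Y.toSVec.carrier,
      T (tm v w) = superSign k (r * s) • tm (f v) (g w)) :
    T ∈ homs (tensor X Y) (tensor X' Y') := by
  have hfw : ∀ {a s v}, X.IsWt a s v → X'.IsWt a (s + p) (f v) := fun {a s v} hv =>
    ⟨by
      have h := homs_apply hf' hf (.gen (.e a)) v
      rw [OspGen.parity, mul_zero, superSign_zero, one_smul] at h
      exact h.symm.trans (congrArg f hv.1), hf s v hv.2⟩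
  have hgw : ∀ {a s v}, Y.IsWt a s v → Y'.IsWt a (s + r) (g v) := fun {a s v} hv =>
    ⟨by
      have h := homs_apply hg' hg (.gen (.e a)) v
      rw [OspGen.parity, mul_zero, superSign_zero, one_smul] at h
      exact h.symm.trans (congrArg g hv.1), hg s v hv.2⟩
  have hfE : ∀ a v, f (X.E a v) = superSign k p • X'.E a (f v) := fun a v => by
    have h := homs_apply hf' hf (.gen (.E a)) v
    rwa [OspGen.parity, mul_one] at h
  have hfF : ∀ a v, f (X.F a v) = superSign k p • X'.F a (f v) := fun a v => by
    have h := homs_apply hf' hf (.gen (.F a)) v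
    rwa [OspGen.parity, mul_one] at h
  have hgE : ∀ a v, g (Y.E a v) = superSign k r • Y'.E a (g v) := fun a v => by
    have h := homs_apply hg' hg (.gen (.E a)) v
    rwa [OspGen.parity, mul_one] at h
  have hgF : ∀ a v, g (Y.F a v) = superSign k r • Y'.F a (g v) := fun a v => by
    have h := homs_apply hg' hg (.gen (.F a)) v
    rwa [OspGen.parity, mul_one] at h
  have hr := superSign_mul_self (k := k) r
  have hp := superSign_mul_self (k := k) p
  refine mem_homs_of_wt (p := p + r) hT
    (fun n u x => ∃ (a : ℤ) (s : ZMod 2) (v : X.toSVec.carrier) (b : ℤ) (t : ZMod 2)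
      (w : Y.toSVec.carrier), X.IsWt a s v ∧ Y.IsWt b t w ∧ n = a + b ∧ u = s + t ∧ x = tm v w)
    ?_ ?_ ?_ ?_ ?_
  · rintro _ _ _ ⟨a, s, v, b, t, w, hv, hw, rfl, rfl, rfl⟩
    exact tm_wt hv hw
  · intro g h H
    exact ext_wt₂ fun a s v hv b t w hw => H _ _ _ ⟨a, s, v, b, t, w, hv, hw, rfl, rfl, rfl⟩
  · rintro _ _ _ ⟨a, s, v, b, t, w, hv, hw, rfl, rfl, rfl⟩
    rw [hm hv, map_smul, (tm_wt (hfw hv) (hgw hw)).1]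
  · rintro _ _ _ ⟨a, s, v, b, t, w, hv, hw, rfl, rfl, rfl⟩
    rw [hm hv, map_smul, tm_E hv hw, tm_E (hfw hv) (hgw hw), map_add, map_smul, hm hv, hm hv.E_wt,
      hfE, hgE, smul_tm, tm_smul]
    simp only [superSign_add, mul_add, mul_one]
    match_scalars <;> grind
  · rintro _ _ _ ⟨a, s, v, b, t, w, hv, hw, rfl, rfl, rfl⟩
    rw [hm hv, map_smul, tm_F hv hw, tm_F (hfw hv) (hgw hw), map_add, map_smul, map_smul, hm hv,
      hm hv.F_wt, hfF, hgF, smul_tm, tm_smul]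
    simp only [superSign_add, mul_add, mul_one]
    match_scalars <;> grind

theorem superMap_mem_homs {f : X.toSVec.carrier →ₗ[k] X'.toSVec.carrier}
    {g : Y.toSVec.carrier →ₗ[k] Y'.toSVec.carrier} (hf : f ∈ homs X X') (hg : g ∈ homs Y Y') :
    (superMap X.gr Y.gr Y'.gr f g :
      (tensor X Y).toSVec.carrier →ₗ[k] (tensor X' Y').toSVec.carrier) ∈
      homs (tensor X Y) (tensor X' Y') := by
  refine homs_induction (C := fun f => (superMap X.gr Y.gr Y'.gr f g :
      (tensor X Y).toSVec.carrier →ₗ[k] (tensor X' Y').toSVec.carrier) ∈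
      homs (tensor X Y) (tensor X' Y')) ?_ ?_ hf
  swap
  · intro f f' h h'
    rw [superMap_add_left]
    exact add_mem h h'
  intro p f hf hf'
  refine homs_induction (C := fun g => (superMap X.gr Y.gr Y'.gr f g :
      (tensor X Y).toSVec.carrier →ₗ[k] (tensor X' Y').toSVec.carrier) ∈
      homs (tensor X Y) (tensor X' Y')) ?_ ?_ hg
  swap
  · intro f f' h h'
    rw [superMap_add_right]
    exact add_mem h h'
  intro r g hg hg'
  exact superMap_aux hf hf' hg hg' _ (superMap_mem hf hg) fun hv w => superMap_tmul f hg hv.2 w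

theorem assoc_aux
    (α : (tensor (tensor X Y) Z).toSVec.carrier →ₗ[k] (tensor X (tensor Y Z)).toSVec.carrier)
    (hα' : α ∈ ((tensor (tensor X Y) Z).gr.hom (tensor X (tensor Y Z)).gr).part 0)
    (hm : ∀ v w z, α (tm (tm v w) z) = tm v (tm w z)) :
    α ∈ homs (tensor (tensor X Y) Z) (tensor X (tensor Y Z)) := by
  refine mem_homs_of_wt hα' (fun n u x => ∃ a s v b t w c r z, X.IsWt a s v ∧ Y.IsWt b t w ∧
      Z.IsWt c r z ∧ n = a + b + c ∧ u = s + t + r ∧ x = tm (tm v w) z) ?_ ?_ ?_ ?_ ?_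
  · rintro _ _ _ ⟨a, s, v, b, t, w, c, r, z, hv, hw, hz, rfl, rfl, rfl⟩
    exact tm_wt (tm_wt hv hw) hz
  · intro g h H
    apply TensorProduct.ext
    refine ext_wt₂ fun a s v hv b t w hw => ext_wt fun c r z hz => ?_
    exact H _ _ _ ⟨a, s, v, b, t, w, c, r, z, hv, hw, hz, rfl, rfl, rfl⟩
  · rintro _ _ _ ⟨a, s, v, b, t, w, c, r, z, hv, hw, hz, rfl, rfl, rfl⟩
    rw [hm, add_assoc, (tm_wt hv (tm_wt hw hz)).1]
  · rintro _ _ _ ⟨a, s, v, b, t, w, c, r, z, hv, hw, hz, rfl, rfl, rfl⟩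
    have h := tm_E (tm_wt hv hw) hz
    have h' := tm_E hv (tm_wt hw hz)
    rw [← add_assoc] at h'
    rw [hm, h, h', tm_E hv hw, tm_E hw hz]
    simp only [map_add, map_smul, add_tm, tm_add, smul_tm, tm_smul, hm, superSign_add, neg_add,
      zpow_add, Units.val_mul, superSign_zero]
    generalize ((q ^ (-a) : kˣ) : k) = x₁
    generalize ((q ^ (-b) : kˣ) : k) = x₂
    module
  · rintro _ _ _ ⟨a, s, v, b, t, w, c, r, z, hv, hw, hz, rfl, rfl, rfl⟩
    have h := tm_F (tm_wt hv hw) hz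
    have h' := tm_F hv (tm_wt hw hz)
    rw [← add_assoc] at h'
    rw [hm, h, h', tm_F hv hw, tm_F hw hz]
    simp only [map_add, map_smul, add_tm, tm_add, smul_tm, tm_smul, hm, superSign_add, zpow_add,
      Units.val_mul, superSign_zero]
    generalize ((q ^ b : kˣ) : k) = x₁
    generalize ((q ^ c : kˣ) : k) = x₂
    generalize (((-1) ^ a : kˣ) : k) = x₃
    generalize (((-1) ^ b : kˣ) : k) = x₄
    module

theorem assoc_mem_homs (X Y Z : OspMod k q) :
    ((TensorProduct.assoc k X.toSVec.carrier Y.toSVec.carrier Z.toSVec.carrier).toLinearMap :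
      (tensor (tensor X Y) Z).toSVec.carrier →ₗ[k] (tensor X (tensor Y Z)).toSVec.carrier) ∈
      homs (tensor (tensor X Y) Z) (tensor X (tensor Y Z)) :=
  assoc_aux _ (SVec.assoc_mem _ _ _) fun _ _ _ => rfl

theorem lid_aux (l : (tensor (unit k q) X).toSVec.carrier →ₗ[k] X.toSVec.carrier)
    (hl' : l ∈ ((tensor (unit k q) X).gr.hom X.gr).part 0)
    (hm : ∀ (c : (unit k q).toSVec.carrier) v, l (tm c v) = unitScalar c • v) : l ∈ homs (tensor (unit k q) X) X := by
  refine mem_homs_of_wt hl' (fun n u x => ∃ s v, ∃ c : (unit k q).toSVec.carrier, X.IsWt n s v ∧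
      u = 0 + s ∧ x = tm c v) ?_ ?_ ?_ ?_ ?_
  · rintro n _ _ ⟨s, v, c, hv, rfl, rfl⟩
    have := tm_wt (unit_wt c) hv
    rwa [zero_add] at this
  · intro g h H
    apply TensorProduct.ext
    apply LinearMap.ext
    intro c
    refine ext_wt fun a s v hv => ?_
    exact H _ _ _ ⟨s, v, c, hv, rfl, rfl⟩
  · rintro n _ _ ⟨s, v, c, hv, rfl, rfl⟩
    rw [hm, map_smul, hv.1]
  · rintro n _ _ ⟨s, v, c, hv, rfl, rfl⟩
    have h := tm_E (unit_wt c) hv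
    rw [zero_add, unit_E_apply, zero_tm, zero_add] at h
    rw [h]
    simp [hm]
  · rintro n _ _ ⟨s, v, c, hv, rfl, rfl⟩
    have h := tm_F (unit_wt c) hv
    rw [zero_add, unit_F_apply, zero_tm, smul_zero, add_zero] at h
    rw [h]
    simp [hm]

theorem lid_mem_homs (X : OspMod k q) :
    ((TensorProduct.lid k X.toSVec.carrier).toLinearMap :
      (tensor (unit k q) X).toSVec.carrier →ₗ[k] X.toSVec.carrier) ∈
      homs (tensor (unit k q) X) X :=
  lid_aux _ (SVec.lid_mem _) fun _ _ => rfl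

theorem rid_aux (l : (tensor X (unit k q)).toSVec.carrier →ₗ[k] X.toSVec.carrier)
    (hl' : l ∈ ((tensor X (unit k q)).gr.hom X.gr).part 0)
    (hm : ∀ (c : (unit k q).toSVec.carrier) v, l (tm v c) = unitScalar c • v) : l ∈ homs (tensor X (unit k q)) X := by
  refine mem_homs_of_wt hl' (fun n u x => ∃ s v, ∃ c : (unit k q).toSVec.carrier, X.IsWt n s v ∧
      u = s + 0 ∧ x = tm v c) ?_ ?_ ?_ ?_ ?_
  · rintro n _ _ ⟨s, v, c, hv, rfl, rfl⟩
    have := tm_wt hv (unit_wt c)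
    rwa [add_zero n] at this
  · intro g h H
    apply TensorProduct.ext
    refine ext_wt fun a s v hv => ?_
    apply LinearMap.ext
    intro c
    exact H _ _ _ ⟨s, v, c, hv, rfl, rfl⟩
  · rintro n _ _ ⟨s, v, c, hv, rfl, rfl⟩
    rw [hm, map_smul, hv.1]
  · rintro n _ _ ⟨s, v, c, hv, rfl, rfl⟩
    have h := tm_E hv (unit_wt c)
    rw [add_zero, unit_E_apply, tm_zero, smul_zero, add_zero] at h
    rw [h]
    simp [hm]
  · rintro n _ _ ⟨s, v, c, hv, rfl, rfl⟩
    have h := tm_F hv (unit_wt c)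
    rw [add_zero, unit_F_apply, tm_zero, smul_zero, zero_add] at h
    rw [h]
    simp [hm]

theorem rid_mem_homs (X : OspMod k q) :
    ((TensorProduct.rid k X.toSVec.carrier).toLinearMap :
      (tensor X (unit k q)).toSVec.carrier →ₗ[k] X.toSVec.carrier) ∈
      homs (tensor X (unit k q)) X :=
  rid_aux _ (SVec.rid_mem _) fun _ _ => rfl

end Tensor

section Instances

variable (k : Type u) [Field k] (q : kˣ)

noncomputable instance : MonoidalCategoryStruct (OspMod k q) where
  tensorObj := tensor
  tensorHom f g := ofLin _ (superMap_mem_homs (lin_mem f) (lin_mem g))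
  whiskerLeft X _ _ g := ofLin _ (superMap_mem_homs (id_mem_homs X) (lin_mem g))
  whiskerRight f Y := ofLin _ (superMap_mem_homs (lin_mem f) (id_mem_homs Y))
  tensorUnit := unit k q
  associator X Y Z := isoOfLin (X := tensor (tensor X Y) Z) (Y := tensor X (tensor Y Z)) _
    (assoc_mem_homs X Y Z) (SVec.assoc_mem _ _ _) (SVec.assoc_symm_mem _ _ _)
  leftUnitor X := isoOfLin (X := tensor (unit k q) X) (Y := X) _ (lid_mem_homs X)
    (SVec.lid_mem _) (SVec.lid_symm_mem _)
  rightUnitor X := isoOfLin (X := tensor X (unit k q)) (Y := X) _ (rid_mem_homs X)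
    (SVec.rid_mem _) (SVec.rid_symm_mem _)

end Instances

end OspMod

namespace OspMod

open SuperGrading

section Instances

variable (k : Type u) [Field k] (q : kˣ)

instance : MonoidalSupercategory k (OspMod k q) where
  add_tensor _ _ _ := hom_ext (superMap_add_left _ _ _)
  tensor_add _ _ _ := hom_ext (superMap_add_right _ _ _)
  smul_tensor _ _ _ := hom_ext (superMap_smul_left _ _ _)
  tensor_smul _ _ _ := hom_ext (superMap_smul_right _ _ _)
  tensor_parity hf hg := parity_iff.2 (superMap_mem (parity_iff.1 hf) (parity_iff.1 hg))
  id_tensor_id _ _ := hom_ext superMap_id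
  interchange _ l f _ hg hh :=
    hom_ext (superMap_comp (lin l) (lin f) (parity_iff.1 hg) (parity_iff.1 hh))
  whiskerLeft_eq _ _ _ _ := rfl
  whiskerRight_eq _ _ := rfl
  associator_even _ _ _ := parity_iff.2 (SVec.assoc_mem _ _ _)
  associator_inv_even _ _ _ := parity_iff.2 (SVec.assoc_symm_mem _ _ _)
  leftUnitor_even _ := parity_iff.2 (SVec.lid_mem _)
  leftUnitor_inv_even _ := parity_iff.2 (SVec.lid_symm_mem _)
  rightUnitor_even _ := parity_iff.2 (SVec.rid_mem _)
  rightUnitor_inv_even _ := parity_iff.2 (SVec.rid_symm_mem _)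
  associator_natural f₁ f₂ f₃ :=
    hom_ext (SVec.superMap_assoc _ _ _ _ _ (lin f₁) (lin f₂) (lin f₃))
  leftUnitor_natural {X Y} f := hom_ext
    (MonoidalSupercategory.leftUnitor_natural k (SVec.ofLin (V := X.toSVec) (W := Y.toSVec) (lin f)))
  rightUnitor_natural {X Y} f := hom_ext
    (MonoidalSupercategory.rightUnitor_natural k (SVec.ofLin (V := X.toSVec) (W := Y.toSVec) (lin f)))
  pentagon W X Y Z := hom_ext
    (MonoidalSupercategory.pentagon k W.toSVec X.toSVec Y.toSVec Z.toSVec)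
  triangle X Y := hom_ext (MonoidalSupercategory.triangle k X.toSVec Y.toSVec)

/-- The fiber functor: it forgets the action of `U`. -/
noncomputable def forget : MonoidalSuperfunctor k (OspMod k q) (SVec k) where
  obj X := X.toSVec
  map f := SVec.ofLin (lin f)
  map_id _ := rfl
  map_comp _ _ := rfl
  map_add _ _ := rfl
  map_smul _ _ := rfl
  map_parity hf := parity_iff.1 hf
  μ X Y := Iso.refl (X.toSVec ⊗ Y.toSVec)
  ε := Iso.refl (𝟙_ (SVec k))
  μ_even _ _ := HomParity.id _
  μ_inv_even _ _ := HomParity.id _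
  ε_even := HomParity.id _
  ε_inv_even := HomParity.id _
  μ_natural _ _ := rfl
  associativity X Y Z := by
    change (𝟙 _ ⊗ₘ 𝟙 _) ≫ 𝟙 _ ≫ (α_ X.toSVec Y.toSVec Z.toSVec).hom =
      (α_ X.toSVec Y.toSVec Z.toSVec).hom ≫ (𝟙 _ ⊗ₘ 𝟙 _) ≫ 𝟙 _
    simp [MonoidalSupercategory.id_tensor_id k]
  left_unitality X := by
    change (λ_ X.toSVec).hom = (𝟙 _ ⊗ₘ 𝟙 _) ≫ 𝟙 _ ≫ (λ_ X.toSVec).hom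
    simp [MonoidalSupercategory.id_tensor_id k]
  right_unitality X := by
    change (ρ_ X.toSVec).hom = (𝟙 _ ⊗ₘ 𝟙 _) ≫ 𝟙 _ ≫ (ρ_ X.toSVec).hom
    simp [MonoidalSupercategory.id_tensor_id k]

end Instances

end OspMod

/-! ## The representation `V(1)` and the superfunctor `G` -/

section Rep

open SuperGrading

variable (k : Type u) [Field k]

/-- The grading on `V = k × k` for which `v₁ = (1, 0)` is even and `v₋₁ = (0, 1)` is odd. -/
def gradingV : SuperGrading k (k × k) where
  part := fun p => if p = 0 then LinearMap.ker (LinearMap.snd k k k)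
    else LinearMap.ker (LinearMap.fst k k k)
  isCompl := by
    rw [if_pos rfl, if_neg (by decide)]
    constructor
    · rw [Submodule.disjoint_def]
      rintro ⟨x, y⟩ h h'
      exact Prod.ext (LinearMap.mem_ker.1 h') (LinearMap.mem_ker.1 h)
    · rw [codisjoint_iff, eq_top_iff]
      rintro ⟨x, y⟩ _
      rw [show ((x, y) : k × k) = (x, 0) + (0, y) by simp]
      exact Submodule.add_mem_sup (LinearMap.mem_ker.2 rfl) (LinearMap.mem_ker.2 rfl)

/-- The superspace `V` with basis `v₁, v₋₁`. -/
def SVec.V : SVec k where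
  carrier := k × k
  grading := gradingV k

variable {k}

theorem mem_gradingV_zero {v : k × k} : v ∈ (gradingV k).part 0 ↔ v.2 = 0 := Iff.rfl
theorem mem_gradingV_one {v : k × k} : v ∈ (gradingV k).part 1 ↔ v.1 = 0 := Iff.rfl

/-- The operator `1_n` on `V(1)`: it fixes `v_n`. -/
def OspMod.eV (k : Type u) [Field k] (n : ℤ) : k × k →ₗ[k] k × k where
  toFun v := (if n = 1 then v.1 else 0, if n = -1 then v.2 else 0)
  map_add' v w := by ext <;> simp <;> split_ifs <;> simp
  map_smul' c v := by ext <;> simp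

/-- The operator `E_n` on `V(1)`: `E_{-1} v_{-1} = [1] v_1`. -/
def OspMod.EV (q : kˣ) (n : ℤ) : k × k →ₗ[k] k × k where
  toFun v := (if n = -1 then qInt q 1 * v.2 else 0, 0)
  map_add' v w := by ext <;> simp; split_ifs <;> ring
  map_smul' c v := by ext <;> simp; split_ifs <;> ring

/-- The operator `F_n` on `V(1)`: `F_1 v_1 = [1] v_{-1}`. -/
def OspMod.FV (q : kˣ) (n : ℤ) : k × k →ₗ[k] k × k where
  toFun v := (0, if n = 1 then qInt q 1 * v.1 else 0)
  map_add' v w := by ext <;> simp; split_ifs <;> ring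
  map_smul' c v := by ext <;> simp; split_ifs <;> ring

theorem gradingV_cases {a : ZMod 2} {v : k × k} (h : v ∈ (gradingV k).part a) :
    (a = 0 ∧ v.2 = 0) ∨ (a = 1 ∧ v.1 = 0) := by
  rcases zmod2_cases a with rfl | rfl
  · exact Or.inl ⟨rfl, mem_gradingV_zero.1 h⟩
  · exact Or.inr ⟨rfl, mem_gradingV_one.1 h⟩

theorem OspMod.eV_mem (n : ℤ) :
    OspMod.eV k n ∈ ((gradingV k).hom (gradingV k)).part 0 := by
  refine mem_hom.2 fun a (v : k × k) hv => ?_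
  rcases gradingV_cases hv with ⟨rfl, h⟩ | ⟨rfl, h⟩
  · exact mem_gradingV_zero.2 (show (if n = -1 then v.2 else 0) = 0 by simp [h])
  · exact mem_gradingV_one.2 (show (if n = 1 then v.1 else 0) = 0 by simp [h])

theorem OspMod.EV_mem (q : kˣ) (n : ℤ) :
    OspMod.EV q n ∈ ((gradingV k).hom (gradingV k)).part 1 := by
  refine mem_hom.2 fun a (v : k × k) hv => ?_
  rcases gradingV_cases hv with ⟨rfl, h⟩ | ⟨rfl, h⟩
  · exact mem_gradingV_one.2 (show (if n = -1 then qInt q 1 * v.2 else 0) = 0 by simp [h])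
  · exact mem_gradingV_zero.2 rfl

theorem OspMod.FV_mem (q : kˣ) (n : ℤ) :
    OspMod.FV q n ∈ ((gradingV k).hom (gradingV k)).part 1 := by
  refine mem_hom.2 fun a (v : k × k) hv => ?_
  rcases gradingV_cases hv with ⟨rfl, h⟩ | ⟨rfl, h⟩
  · exact mem_gradingV_one.2 rfl
  · exact mem_gradingV_zero.2 (show (if n = 1 then qInt q 1 * v.1 else 0) = 0 by simp [h])

section

variable (q : kˣ) (m n : ℤ) (v : k × k)

namespace OspMod

theorem eV_apply : eV k n v = (if n = 1 then v.1 else 0, if n = -1 then v.2 else 0) := rfl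
theorem EV_apply : EV q n v = (if n = -1 then qInt q 1 * v.2 else 0, 0) := rfl
theorem FV_apply : FV q n v = (0, if n = 1 then qInt q 1 * v.1 else 0) := rfl

theorem eV_eV_self : eV k n (eV k n v) = eV k n v := by
  simp only [eV_apply]; ext <;> dsimp only <;> split_ifs <;> rfl

theorem eV_eV (h : m ≠ n) : eV k m (eV k n v) = 0 := by
  simp only [eV_apply]; ext <;> dsimp only <;> split_ifs <;> first | rfl | omega

theorem eV_EV : eV k (n + 2) (EV q n v) = EV q n v := by
  simp only [eV_apply, EV_apply]; ext <;> dsimp only <;> split_ifs <;> first | rfl | omega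

theorem EV_eV : EV q n (eV k n v) = EV q n v := by
  simp only [eV_apply, EV_apply]; ext <;> dsimp only <;> split_ifs <;> first | rfl | omega

theorem eV_FV : eV k (n - 2) (FV q n v) = FV q n v := by
  simp only [eV_apply, FV_apply]; ext <;> dsimp only <;> split_ifs <;> first | rfl | omega

theorem FV_eV : FV q n (eV k n v) = FV q n v := by
  simp only [eV_apply, FV_apply]; ext <;> dsimp only <;> split_ifs <;> first | rfl | omega

theorem EV_FV : EV q (n - 2) (FV q n v) + FV q (n + 2) (EV q n v) = qInt q n • eV k n v := by
  have h := qInt_one_mul q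
  simp only [eV_apply, EV_apply, FV_apply, Prod.mk_add_mk, add_zero, zero_add, Prod.smul_mk,
    smul_eq_mul]
  by_cases h1 : n = 1
  · subst h1
    ext
    · have : qInt q 1 * (qInt q 1 * v.1) = qInt q 1 * v.1 := by rw [← mul_assoc, h]
      simpa using this
    · norm_num
  · by_cases h2 : n = -1
    · subst h2
      ext
      · norm_num
      · norm_num
        rw [← mul_assoc, h, qInt_neg_one]
    · have h3 : n + 2 ≠ 1 := by omega
      have h4 : n - 2 ≠ -1 := by omega
      simp [h1, h2, h3, h4]

theorem iSup_range_eV : ⨆ n : ℤ, LinearMap.range (eV k n) = ⊤ := by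
  rw [eq_top_iff]
  rintro ⟨x, y⟩ _
  rw [show ((x, y) : k × k) = (x, 0) + (0, y) by simp]
  refine add_mem (Submodule.mem_iSup_of_mem 1 ⟨(x, 0), ?_⟩)
    (Submodule.mem_iSup_of_mem (-1) ⟨(0, y), ?_⟩)
  · simp [eV_apply]
  · norm_num [eV_apply]

end OspMod

end

/-- The operators on `V(1)`. -/
def OspMod.opsV (q : kˣ) : OspOps k q (SVec.V k) where
  e := eV k
  E := EV q
  F := FV q
  e_mem := eV_mem
  E_mem := EV_mem q
  F_mem := FV_mem q
  e_e_self := eV_eV_self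
  e_e := eV_eV
  e_E := eV_EV q
  E_e := EV_eV q
  e_F := eV_FV q
  F_e := FV_eV q
  E_F := EV_FV q
  locally_unital := iSup_range_eV

/-- The irreducible `U`-supermodule `V(1)`. -/
noncomputable def OspMod.V1 (q : kˣ) : OspMod k q :=
  (opsV q).toOspMod (inferInstanceAs (Module.Finite k (k × k)))

/-- The parameter `δ = -[2] = -(q + ε q⁻¹)`, where `ε = -1`. -/
def stlParam (q : kˣ) : k := -((q : k) - ((q⁻¹ : kˣ) : k))

/-- The map `1 ↦ v₋₁ ⊗ v₁ - q v₁ ⊗ v₋₁`. -/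
noncomputable def cupV (q : kˣ) : k →ₗ[k] (k × k) ⊗[k] (k × k) :=
  LinearMap.toSpanSingleton k _
    ((((0, 1) : k × k) ⊗ₜ[k] ((1, 0) : k × k)) - (q : k) • (((1, 0) : k × k) ⊗ₜ[k] ((0, 1) : k × k)))

/-- The map with `v₁ ⊗ v₋₁ ↦ 1`, `v₋₁ ⊗ v₁ ↦ - ε q⁻¹ = q⁻¹`, and `v₁ ⊗ v₁, v₋₁ ⊗ v₋₁ ↦ 0`. -/
noncomputable def capV (q : kˣ) : (k × k) ⊗[k] (k × k) →ₗ[k] k :=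
  TensorProduct.lift (LinearMap.mk₂ k
    (fun v w : k × k => v.1 * w.2 + ((q⁻¹ : kˣ) : k) * (v.2 * w.1))
    (fun v v' w => by simp; ring) (fun c v w => by simp; ring)
    (fun v w w' => by simp; ring) (fun c v w => by simp; ring))

theorem cupV_apply (q : kˣ) (c : k) : cupV q c = c •
    ((((0, 1) : k × k) ⊗ₜ[k] ((1, 0) : k × k)) -
      (q : k) • (((1, 0) : k × k) ⊗ₜ[k] ((0, 1) : k × k))) := rfl

theorem capV_tmul (q : kˣ) (v w : k × k) :
    capV q (v ⊗ₜ w) = v.1 * w.2 + ((q⁻¹ : kˣ) : k) * (v.2 * w.1) := by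
  simp [capV]

theorem v_one_mem : ((1, 0) : k × k) ∈ (gradingV k).part 0 := mem_gradingV_zero.2 rfl
theorem v_neg_one_mem : ((0, 1) : k × k) ∈ (gradingV k).part 1 := mem_gradingV_one.2 rfl

theorem cupV_mem (q : kˣ) :
    cupV q ∈ ((even k).hom ((gradingV k).tensor (gradingV k))).part 1 := by
  refine mem_hom.2 fun a c hc => ?_
  rcases mem_even hc with rfl | rfl
  · rw [cupV_apply]
    refine Submodule.smul_mem _ c (Submodule.sub_mem _ ?_ (Submodule.smul_mem _ _ ?_))
    · exact part_mem_cast (tmul_mem_tensor v_neg_one_mem v_one_mem) (by decide)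
    · exact part_mem_cast (tmul_mem_tensor v_one_mem v_neg_one_mem) (by decide)
  · rw [map_zero]; exact Submodule.zero_mem _

theorem capV_mem (q : kˣ) :
    capV q ∈ (((gradingV k).tensor (gradingV k)).hom (even k)).part 1 := by
  refine mem_hom_tensor fun a v hv b w hw => ?_
  rw [capV_tmul]
  rcases gradingV_cases hv with ⟨rfl, hv'⟩ | ⟨rfl, hv'⟩ <;>
    rcases gradingV_cases hw with ⟨rfl, hw'⟩ | ⟨rfl, hw'⟩ <;> rw [hv', hw']
  · simp
  · exact part_mem_cast (mem_even_zero _) (by decide)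
  · exact part_mem_cast (mem_even_zero _) (by decide)
  · simp

theorem zigzag_V (q : kˣ) (v : k × k) : TensorProduct.lid k (k × k)
    (superMap ((gradingV k).tensor (gradingV k)) (gradingV k) (gradingV k) (capV q) LinearMap.id
      ((TensorProduct.assoc k (k × k) (k × k) (k × k)).symm
        (superMap (gradingV k) (even k) ((gradingV k).tensor (gradingV k)) LinearMap.id (cupV q)
          ((TensorProduct.rid k (k × k)).symm v)))) = v := by
  refine (gradingV k).induction (C := fun v => TensorProduct.lid k (k × k)
    (superMap ((gradingV k).tensor (gradingV k)) (gradingV k) (gradingV k) (capV q) LinearMap.id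
      ((TensorProduct.assoc k (k × k) (k × k) (k × k)).symm
        (superMap (gradingV k) (even k) ((gradingV k).tensor (gradingV k)) LinearMap.id (cupV q)
          ((TensorProduct.rid k (k × k)).symm v)))) = v) ?_ ?_ v
  · intro p v hv
    rw [TensorProduct.rid_symm_apply, superMap_tmul _ (cupV_mem q) hv, cupV_apply, one_smul,
      TensorProduct.tmul_sub, TensorProduct.tmul_smul, LinearMap.id_apply]
    simp only [map_smul, map_sub, TensorProduct.assoc_symm_tmul]
    rw [superMap_tmul_even _ (gradingV k).id_mem_hom,
      superMap_tmul_even _ (gradingV k).id_mem_hom, capV_tmul, capV_tmul]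
    rcases gradingV_cases hv with ⟨rfl, hv'⟩ | ⟨rfl, hv'⟩
    · ext <;> simp [hv']
    · ext <;> simp [hv']
  · intro v w hv hw
    simp only [map_add, hv, hw]

theorem zigzag_V' (q : kˣ) (v : k × k) : TensorProduct.rid k (k × k)
    (superMap (gradingV k) ((gradingV k).tensor (gradingV k)) (even k) LinearMap.id (capV q)
      ((TensorProduct.assoc k (k × k) (k × k) (k × k))
        (superMap (even k) (gradingV k) (gradingV k) (cupV q) LinearMap.id
          ((TensorProduct.lid k (k × k)).symm v)))) = (-1 : k) • v := by
  rw [TensorProduct.lid_symm_apply, superMap_tmul_even _ (gradingV k).id_mem_hom, cupV_apply,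
    one_smul, TensorProduct.sub_tmul, ← TensorProduct.smul_tmul', map_sub, map_smul,
    LinearMap.id_apply, TensorProduct.assoc_tmul, TensorProduct.assoc_tmul, map_sub, map_smul,
    superMap_tmul _ (capV_mem q) v_neg_one_mem, superMap_tmul _ (capV_mem q) v_one_mem,
    capV_tmul, capV_tmul]
  ext <;> simp

/-- The superspace `V` with the maps `cup` and `cap`. -/
noncomputable def stlRepV (q : kˣ) : STLRep (stlParam q) (SVec k) where
  X := SVec.V k
  cup := SVec.ofLin (V := 𝟙_ (SVec k)) (W := SVec.V k ⊗ SVec.V k) (cupV q)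
  cap := SVec.ofLin (V := SVec.V k ⊗ SVec.V k) (W := 𝟙_ (SVec k)) (capV q)
  cup_odd := cupV_mem q
  cap_odd := capV_mem q
  zigzag := LinearMap.ext (zigzag_V q)
  zigzag' := LinearMap.ext (zigzag_V' q)
  bubble := by
    refine LinearMap.ext fun (c : k) => ?_
    change capV q (cupV q c) = stlParam q * c
    rw [cupV_apply, map_smul, map_sub, map_smul, capV_tmul, capV_tmul]
    simp [stlParam]
    ring

/-- The monoidal superfunctor `G` with `G(n) = V^{⊗ n}`. -/
noncomputable def stlG (q : kˣ) : MonoidalSuperfunctor k (STL k (stlParam q)) (SVec k) :=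
  (stlRepV q).functor

end Rep

/-!
Write `δ = -[2]`, let `V = V(1)` have the basis `v₁`, `v₋₁`, and let `U` be the superalgebra of
which `OspMod k q` is the category of supermodules. Morphisms of `STL(δ)` are combinations of
diagrams of strands, cups and caps, read from bottom to top.

*The functor `F`.* The cup and cap maps are odd `U`-supermodule homomorphisms which satisfy the
relations of `STL(δ)`, so they define `F = OspMod.stlF q` by the universal property. It is unique
(`OspMod.eq_of_comp_forget`): the coherence isomorphism `F(n) ⊗ F(1) ≅ F(n + 1)` is prescribed as a
linear map, and it is a homomorphism, so it determines the action of `U` on `F(n + 1)` from the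
actions on `F(n)` and on `F(1)`.

*`F` is fully faithful.* Neither a basis of `Hom(m, n)` in `STL(δ)` nor a dimension formula is
needed; everything is reduced to the images of the highest weight vector `v₁^{⊗ w}`.

* Every diagram can be rewritten as a multiple of one in which all caps precede all cups
  (`STL.mem_capCupSpan`). Bending the last strand at the top down to the bottom
  expresses a morphism `w → n + 1` through a morphism `w + 1 → n`, and on `v₁^{⊗ w}` this passes to
  the coordinates with respect to the last tensor factor. By induction on `n`, a morphism which
  kills `v₁^{⊗ w}` lies in the span of the diagrams which begin with a cap
  (`OspMod.mem_capIdeal_of_actL_hvec`). For `w = 0` there are no such diagrams, so the morphism is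
  zero; bending all strands at the bottom up to the top reduces faithfulness to this case
  (`OspMod.eq_zero_of_actL`).
* Every vector of weight `w` in `V^{⊗ n}` which is killed by the operators `E_a` is the image of
  `v₁^{⊗ w}` under a morphism of `STL(δ)` (`OspMod.exists_actL_hvec_eq`). The proof is an induction
  on `n`: the `v₋₁`-coordinate with respect to the last factor is again a highest weight vector,
  of weight `w + 1`, and after subtracting the morphism obtained from it by bending a strand, only
  a vector `x ⊗ v₁` remains. Here one uses that the weight of a nonzero highest weight vector is not
  negative (`OspMod.highest_weight_nonneg`). For `w = 0` this computes `Hom(k, V^{⊗ n})`, and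
  bending reduces fullness to this case (`OspMod.exists_actL_eq`).

*Complete reducibility.* Let `M` be a nonzero supermodule and `n` its maximal weight. As `q` is not
a root of unity, the constants `c_j` in `E F^j v = c_j F^{j-1} v`, for a highest weight vector `v`
of weight `n`, are nonzero for `1 ≤ j ≤ n`. This makes it possible to write down homomorphisms
`a : M → V^{⊗ n}` and `b : V^{⊗ n} → M` whose images are generated by a highest weight vector of
weight `n` (`OspMod.hwMap`) such that `b ∘ a` is a nonzero idempotent
(`OspMod.exists_summand`). Induction on the dimension shows that the identity of `M` is a sum of
homogeneous maps which factor through tensor powers of `V` (`OspMod.exists_sum_comp_eq_id`).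

*Envelopes.* As supermodules have parity shifts, `F` extends to the `Π`-envelope
(`MonoidalSuperfunctor.piLift`), and the extension is fully faithful on even morphisms. An additive
fully faithful monoidal functor to an idempotent complete category with finite biproducts, such that
every object is a retract of a finite sum of objects in the image, extends to an equivalence from
the additive Karoubi envelope (`AdditiveKaroubi.exists_monoidal_equivalence`).
-/

/-! ### Extending functors to the additive Karoubi envelope -/

namespace MatMonoidal

variable {C : Type w} [Category.{v} C] [Preadditive C] {D : Type w'} [Category.{v} D]
  [Preadditive D] (F : C ⥤ D) [F.Additive]

theorem mapMat_map_reindexHom {M N : Mat_ C} (e : M.ι → N.ι) (φ : ∀ i, M.X i ⟶ N.X (e i)) :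
    F.mapMat_.map (reindexHom e φ) =
      reindexHom (M := F.mapMat_.obj M) (N := F.mapMat_.obj N) e (fun i => F.map (φ i)) := by
  ext i j
  by_cases h : e i = j
  · subst h
    exact (congrArg F.map (reindexHom_apply e φ i)).trans
      (reindexHom_apply (M := F.mapMat_.obj M) (N := F.mapMat_.obj N) e
        (fun i => F.map (φ i)) i).symm
  · exact ((congrArg F.map (reindexHom_apply_ne e φ i j h)).trans (F.map_zero _ _)).trans
      (reindexHom_apply_ne (M := F.mapMat_.obj M) (N := F.mapMat_.obj N) e
        (fun i => F.map (φ i)) i j h).symm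

instance mapMat_additive : F.mapMat_.Additive where
  map_add {M N f g} := by
    ext i j
    exact F.map_add

instance mapMat_full [F.Full] : F.mapMat_.Full where
  map_surjective f := ⟨fun i j => F.preimage (f i j), by ext i j; exact F.map_preimage _⟩

instance mapMat_faithful [F.Faithful] : F.mapMat_.Faithful where
  map_injective h := by
    ext i j
    exact F.map_injective (congr_fun (congr_fun h i) j)

variable [MonoidalCategory C] [MonoidalPreadditive C] [MonoidalCategory D] [MonoidalPreadditive D]
  [F.Monoidal]

/-- The comparison isomorphism between tensor products of tuples for the entrywise extension of a
monoidal functor. -/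
noncomputable def mapMatμ (M N : Mat_ C) :
    F.mapMat_.obj M ⊗ F.mapMat_.obj N ≅ F.mapMat_.obj (M ⊗ N) :=
  reindexIso (M := F.mapMat_.obj M ⊗ F.mapMat_.obj N) (N := F.mapMat_.obj (M ⊗ N)) (fun p => p)
    (fun p => p) (fun _ => rfl) (fun _ => rfl)
    (fun p => Functor.Monoidal.μIso F (M.X p.1) (N.X p.2))

theorem mapMatμ_hom (M N : Mat_ C) : (mapMatμ F M N).hom =
    reindexHom (M := F.mapMat_.obj M ⊗ F.mapMat_.obj N) (N := F.mapMat_.obj (M ⊗ N)) (fun p => p)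
      (fun p => Functor.LaxMonoidal.μ F (M.X p.1) (N.X p.2)) := rfl

theorem mapMatμ_natural {M M' N N' : Mat_ C} (f : M ⟶ M') (g : N ⟶ N') :
    (F.mapMat_.map f ⊗ₘ F.mapMat_.map g) ≫ (mapMatμ F M' N').hom =
      (mapMatμ F M N).hom ≫ F.mapMat_.map (f ⊗ₘ g) := by
  ext p q
  rw [mapMatμ_hom, mapMatμ_hom]
  have h1 := comp_reindexHom_apply (M := F.mapMat_.obj M ⊗ F.mapMat_.obj N)
    (N := F.mapMat_.obj M' ⊗ F.mapMat_.obj N') (K := F.mapMat_.obj (M' ⊗ N')) (fun p => p)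
    (fun _ _ h => h) (fun p => Functor.LaxMonoidal.μ F (M'.X p.1) (N'.X p.2))
    (F.mapMat_.map f ⊗ₘ F.mapMat_.map g) p q
  rw [h1]
  have h2 := reindexHom_comp_apply (M := F.mapMat_.obj M ⊗ F.mapMat_.obj N)
    (N := F.mapMat_.obj (M ⊗ N)) (K := F.mapMat_.obj (M' ⊗ N')) (fun p => p)
    (fun p => Functor.LaxMonoidal.μ F (M.X p.1) (N.X p.2)) (F.mapMat_.map (f ⊗ₘ g)) p q
  rw [h2]
  exact Functor.LaxMonoidal.μ_natural F (f p.1 q.1) (g p.2 q.2)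

/-- The entrywise extension of a monoidal functor to additive envelopes is monoidal. -/
noncomputable instance mapMatMonoidal : F.mapMat_.Monoidal :=
  Functor.CoreMonoidal.toMonoidal
    { εIso := reindexIso (M := 𝟙_ (Mat_ D)) (N := F.mapMat_.obj (𝟙_ (Mat_ C))) (fun p => p)
        (fun p => p) (fun _ => rfl) (fun _ => rfl) (fun _ => Functor.Monoidal.εIso F)
      μIso := mapMatμ F
      μIso_hom_natural_left := fun {X Y} f X' => by
        rw [← tensorHom_id, ← tensorHom_id, ← mapMatμ_natural, CategoryTheory.Functor.map_id]
      μIso_hom_natural_right := fun {X Y} X' f => by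
        rw [← id_tensorHom, ← id_tensorHom, ← mapMatμ_natural, CategoryTheory.Functor.map_id]
      associativity := fun X Y Z => by
        rw [← tensorHom_id, ← id_tensorHom, mapMatμ_hom, mapMatμ_hom, mapMatμ_hom,
          mapMatμ_hom, ← reindexHom_id, ← reindexHom_id, associator_hom_def, associator_hom_def,
          mapMat_map_reindexHom]
        erw [reindexHom_tensor, reindexHom_tensor, reindexHom_comp, reindexHom_comp,
          reindexHom_comp, reindexHom_comp]
        congr 1
        funext p
        have := Functor.LaxMonoidal.associativity F (X.X p.1.1) (Y.X p.1.2) (Z.X p.2)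
        rw [← tensorHom_id, ← id_tensorHom] at this
        exact this
      left_unitality := fun X => by
        rw [← tensorHom_id, mapMatμ_hom, ← reindexHom_id, leftUnitor_hom_def, leftUnitor_hom_def,
          mapMat_map_reindexHom]
        erw [reindexHom_tensor, reindexHom_comp, reindexHom_comp]
        congr 1
        funext p
        have := Functor.LaxMonoidal.left_unitality F (X.X p.2)
        rw [← tensorHom_id] at this
        exact this
      right_unitality := fun X => by
        rw [← id_tensorHom, mapMatμ_hom, ← reindexHom_id, rightUnitor_hom_def,
          rightUnitor_hom_def, mapMat_map_reindexHom]
        erw [reindexHom_tensor, reindexHom_comp, reindexHom_comp]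
        congr 1
        funext p
        have := Functor.LaxMonoidal.right_unitality F (X.X p.1)
        rw [← id_tensorHom] at this
        exact this }

theorem mapMat_μ (M N : Mat_ C) : Functor.LaxMonoidal.μ F.mapMat_ M N = (mapMatμ F M N).hom := rfl

theorem mapMat_ε : Functor.LaxMonoidal.ε F.mapMat_ =
    reindexHom (M := 𝟙_ (Mat_ D)) (N := F.mapMat_.obj (𝟙_ (Mat_ C))) (fun p => p)
      (fun _ => Functor.LaxMonoidal.ε F) := rfl

end MatMonoidal

namespace KaroubiMonoidal

open Idempotents

/-- The extension of a functor to Karoubi envelopes. -/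
def mapKaroubi {C : Type w} [Category.{v} C] {D : Type w'} [Category.{v'} D] (F : C ⥤ D) :
    Karoubi C ⥤ Karoubi D where
  obj P := ⟨F.obj P.X, F.map P.p, by rw [← F.map_comp, P.idem]⟩
  map f := ⟨F.map f.f, by
    change F.map _ ≫ F.map _ ≫ F.map _ = F.map _
    rw [← F.map_comp, ← F.map_comp, f.comm]⟩
  map_id _ := rfl
  map_comp f g := Karoubi.hom_ext _ _ (F.map_comp f.f g.f)

section

variable {C : Type w} [Category.{v} C] {D : Type w'} [Category.{v'} D] (F : C ⥤ D)

instance mapKaroubi_full [F.Full] [F.Faithful] : (mapKaroubi F).Full where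
  map_surjective {P Q} f := by
    obtain ⟨g, hg⟩ : ∃ g, F.map g = f.f := F.map_surjective f.f
    refine ⟨⟨g, F.map_injective ?_⟩, Karoubi.hom_ext _ _ hg⟩
    rw [F.map_comp, F.map_comp, hg]
    exact f.comm

instance mapKaroubi_faithful [F.Faithful] : (mapKaroubi F).Faithful where
  map_injective h := Karoubi.hom_ext _ _ (F.map_injective (congrArg Karoubi.Hom.f h))

instance mapKaroubi_additive [Preadditive C] [Preadditive D] [F.Additive] :
    (mapKaroubi F).Additive where
  map_add := Karoubi.hom_ext _ _ F.map_add

end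

variable {C : Type w} [Category.{v} C] [MonoidalCategory C] {D : Type w'} [Category.{v'} D]
  [MonoidalCategory D] (F : C ⥤ D) [F.Monoidal]

open Functor.LaxMonoidal

/-- The comparison isomorphism for the extension of a monoidal functor to Karoubi envelopes. -/
def mapKaroubiμ (P Q : Karoubi C) :
    (mapKaroubi F).obj P ⊗ (mapKaroubi F).obj Q ≅ (mapKaroubi F).obj (P ⊗ Q) :=
  mkIso (P := tensorObj ((mapKaroubi F).obj P) ((mapKaroubi F).obj Q))
    (Q := (mapKaroubi F).obj (tensorObj P Q)) (Functor.Monoidal.μIso F P.X Q.X)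
    (μ_natural F P.p Q.p)

theorem mapKaroubi_assoc_aux {X Y Z : C} {p : X ⟶ X} {q : Y ⟶ Y} {r : Z ⟶ Z} (hp : p ≫ p = p)
    (hq : q ≫ q = q) (hr : r ≫ r = r) :
    (((F.map p ⊗ₘ F.map q) ≫ μ F X Y) ⊗ₘ F.map r) ≫
        ((F.map (p ⊗ₘ q) ⊗ₘ F.map r) ≫ μ F (X ⊗ Y) Z) ≫
          F.map (((p ⊗ₘ q) ⊗ₘ r) ≫ (α_ X Y Z).hom) =
      (((F.map p ⊗ₘ F.map q) ⊗ₘ F.map r) ≫ (α_ _ _ _).hom) ≫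
        (F.map p ⊗ₘ ((F.map q ⊗ₘ F.map r) ≫ μ F Y Z)) ≫
          ((F.map p ⊗ₘ F.map (q ⊗ₘ r)) ≫ μ F X (Y ⊗ Z)) := by
  have hp' : F.map p ≫ F.map p = F.map p := by rw [← F.map_comp, hp]
  have hq' : F.map q ≫ F.map q = F.map q := by rw [← F.map_comp, hq]
  have hr' : F.map r ≫ F.map r = F.map r := by rw [← F.map_comp, hr]
  have ht : ((F.map p ⊗ₘ F.map q) ⊗ₘ F.map r) ≫ ((F.map p ⊗ₘ F.map q) ⊗ₘ F.map r) =
      ((F.map p ⊗ₘ F.map q) ⊗ₘ F.map r) := by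
    rw [tensorHom_comp_tensorHom, tensorHom_comp_tensorHom, hp', hq', hr']
  have e1 : ((F.map p ⊗ₘ F.map q) ≫ μ F X Y) ⊗ₘ F.map r =
      ((F.map p ⊗ₘ F.map q) ⊗ₘ F.map r) ≫ (μ F X Y ▷ F.obj Z) := by
    rw [← tensorHom_id, tensorHom_comp_tensorHom, Category.comp_id]
  have e2 : F.map p ⊗ₘ ((F.map q ⊗ₘ F.map r) ≫ μ F Y Z) =
      (F.map p ⊗ₘ (F.map q ⊗ₘ F.map r)) ≫ (F.obj X ◁ μ F Y Z) := by
    rw [← id_tensorHom, tensorHom_comp_tensorHom, Category.comp_id]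
  have m1 : (μ F X Y ▷ F.obj Z) ≫ (F.map (p ⊗ₘ q) ⊗ₘ F.map r) =
      ((F.map p ⊗ₘ F.map q) ⊗ₘ F.map r) ≫ (μ F X Y ▷ F.obj Z) := by
    rw [← tensorHom_id, tensorHom_comp_tensorHom, tensorHom_comp_tensorHom, ← μ_natural,
      Category.id_comp, Category.comp_id]
  have m2 : (F.obj X ◁ μ F Y Z) ≫ (F.map p ⊗ₘ F.map (q ⊗ₘ r)) =
      (F.map p ⊗ₘ (F.map q ⊗ₘ F.map r)) ≫ (F.obj X ◁ μ F Y Z) := by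
    rw [← id_tensorHom, tensorHom_comp_tensorHom, tensorHom_comp_tensorHom, ← μ_natural,
      Category.id_comp, Category.comp_id]
  rw [e1, e2, F.map_comp]
  simp only [Category.assoc]
  rw [← μ_natural_assoc, reassoc_of% m1, reassoc_of% m1, reassoc_of% ht, reassoc_of% ht,
    reassoc_of% m2, associativity, ← associator_naturality_assoc, reassoc_of% ht,
    ← associator_naturality_assoc, reassoc_of% ht]

theorem mapKaroubi_left_aux {X : C} {p : X ⟶ X} (hp : p ≫ p = p) :
    (𝟙 (𝟙_ D) ⊗ₘ F.map p) ≫ (λ_ (F.obj X)).hom =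
      ((𝟙 _ ≫ ε F) ⊗ₘ F.map p) ≫ ((F.map (𝟙 _) ⊗ₘ F.map p) ≫ μ F (𝟙_ C) X) ≫
        F.map ((𝟙 _ ⊗ₘ p) ≫ (λ_ X).hom) := by
  have hp' : F.map p ≫ F.map p = F.map p := by rw [← F.map_comp, hp]
  rw [F.map_comp, Category.assoc, ← μ_natural_assoc, F.map_id, tensorHom_comp_tensorHom_assoc,
    tensorHom_comp_tensorHom_assoc, hp', hp', left_unitality, ← tensorHom_id,
    tensorHom_comp_tensorHom_assoc]
  simp only [Category.id_comp, Category.comp_id]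

theorem mapKaroubi_right_aux {X : C} {p : X ⟶ X} (hp : p ≫ p = p) :
    (F.map p ⊗ₘ 𝟙 (𝟙_ D)) ≫ (ρ_ (F.obj X)).hom =
      (F.map p ⊗ₘ (𝟙 _ ≫ ε F)) ≫ ((F.map p ⊗ₘ F.map (𝟙 _)) ≫ μ F X (𝟙_ C)) ≫
        F.map ((p ⊗ₘ 𝟙 _) ≫ (ρ_ X).hom) := by
  have hp' : F.map p ≫ F.map p = F.map p := by rw [← F.map_comp, hp]
  rw [F.map_comp, Category.assoc, ← μ_natural_assoc, F.map_id, tensorHom_comp_tensorHom_assoc,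
    tensorHom_comp_tensorHom_assoc, hp', hp', right_unitality, ← id_tensorHom,
    tensorHom_comp_tensorHom_assoc]
  simp only [Category.id_comp, Category.comp_id]

theorem mapKaroubi_natural_aux {X X' Y Y' : C} {p : X ⟶ X} {q : Y ⟶ Y} {p' : X' ⟶ X'}
    {q' : Y' ⟶ Y'} {f : X ⟶ X'} {g : Y ⟶ Y'} (hp : p ≫ f = f) (hq : q ≫ g = g)
    (hp' : f ≫ p' = f) (hq' : g ≫ q' = g) :
    (F.map f ⊗ₘ F.map g) ≫ ((F.map p' ⊗ₘ F.map q') ≫ μ F X' Y') =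
      ((F.map p ⊗ₘ F.map q) ≫ μ F X Y) ≫ F.map (f ⊗ₘ g) := by
  rw [Category.assoc, ← μ_natural, tensorHom_comp_tensorHom_assoc, tensorHom_comp_tensorHom_assoc]
  simp only [← F.map_comp, hp, hp', hq, hq']

/-- The extension of a monoidal functor to Karoubi envelopes is monoidal. -/
instance mapKaroubiMonoidal : (mapKaroubi F).Monoidal :=
  Functor.CoreMonoidal.toMonoidal
    { εIso := mkIso (P := ⟨𝟙_ D, 𝟙 _, by simp⟩) (Q := (mapKaroubi F).obj ⟨𝟙_ C, 𝟙 _, by simp⟩)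
        (Functor.Monoidal.εIso F) (by
          change 𝟙 _ ≫ ε F = ε F ≫ F.map (𝟙 _)
          rw [F.map_id, Category.id_comp, Category.comp_id])
      μIso := mapKaroubiμ F
      μIso_hom_natural_left := fun {X Y} f X' => Karoubi.hom_ext _ _
        (mapKaroubi_natural_aux F (Karoubi.p_comp f) X'.idem (Karoubi.comp_p f) X'.idem)
      μIso_hom_natural_right := fun {X Y} X' f => Karoubi.hom_ext _ _
        (mapKaroubi_natural_aux F X'.idem (Karoubi.p_comp f) X'.idem (Karoubi.comp_p f))
      associativity := fun X Y Z => Karoubi.hom_ext _ _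
        (mapKaroubi_assoc_aux F X.idem Y.idem Z.idem)
      left_unitality := fun X => Karoubi.hom_ext _ _ (mapKaroubi_left_aux F X.idem)
      right_unitality := fun X => Karoubi.hom_ext _ _ (mapKaroubi_right_aux F X.idem) }

end KaroubiMonoidal

namespace AdditiveKaroubi

open Idempotents Limits MatMonoidal KaroubiMonoidal

section

variable (D : Type w) [Category.{v} D] [Preadditive D]

/-- The canonical functor to the additive Karoubi envelope. -/
noncomputable abbrev toKar : D ⥤ Karoubi (Mat_ D) := Mat_.embedding D ⋙ toKaroubi _

theorem embedding_isEquivalence [HasFiniteBiproducts D] : (Mat_.embedding D).IsEquivalence where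
  essSurj := ⟨fun M => ⟨⨁ M.X, ⟨(Mat_.embedding D).mapBiproduct M.X ≪≫
    M.isoBiproductEmbedding.symm⟩⟩⟩

theorem toKar_isEquivalence [HasFiniteBiproducts D] [IsIdempotentComplete D] :
    (toKar D).IsEquivalence := by
  have := embedding_isEquivalence D
  have : IsIdempotentComplete (Mat_ D) :=
    (isIdempotentComplete_iff_of_equivalence (Mat_.embedding D).asEquivalence).1 inferInstance
  infer_instance

end

variable {C : Type w} [Category.{v} C] [Preadditive C] {D : Type w'} [Category.{v} D]
  [Preadditive D] (F : C ⥤ D) [F.Additive]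

/-- The extension of an additive functor to additive Karoubi envelopes. -/
noncomputable abbrev mapKar : Karoubi (Mat_ C) ⥤ Karoubi (Mat_ D) := mapKaroubi F.mapMat_

/-- If every object of `D` is a retract of a finite sum of objects in the image of `F`, then the
extension of `F` to additive Karoubi envelopes is essentially surjective. -/
theorem mapKar_essSurj [F.Full] [F.Faithful] [HasFiniteBiproducts D] [IsIdempotentComplete D]
    (hF : ∀ X : D, ∃ (n : ℕ) (c : Fin n → C) (a : ∀ i, X ⟶ F.obj (c i))
      (b : ∀ i, F.obj (c i) ⟶ X), ∑ i, a i ≫ b i = 𝟙 X) : (mapKar F).EssSurj := by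
  have := toKar_isEquivalence D
  refine ⟨fun Z => ?_⟩
  let X := (toKar D).objPreimage Z
  obtain ⟨n, c, a, b, hab⟩ := hF X
  let M : Mat_ C := ⟨Fin n, c⟩
  let a' : (Mat_.embedding D).obj X ⟶ F.mapMat_.obj M := fun _ i => a i
  let b' : F.mapMat_.obj M ⟶ (Mat_.embedding D).obj X := fun i _ => b i
  have hab' : a' ≫ b' = 𝟙 _ := by
    have h (i j : PUnit) : (a' ≫ b') i j = 𝟙 ((Mat_.embedding D).obj X) i j :=
      (Mat_.comp_apply a' b' i j).trans
        (hab.trans (Mat_.id_apply_self ((Mat_.embedding D).obj X) PUnit.unit).symm)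
    exact funext fun i => funext fun j => h i j
  have hp : F.mapMat_.map (F.mapMat_.preimage (b' ≫ a')) = b' ≫ a' := F.mapMat_.map_preimage _
  let P : Karoubi (Mat_ C) := ⟨M, F.mapMat_.preimage (b' ≫ a'), F.mapMat_.map_injective (by
    rw [F.mapMat_.map_comp, hp, Category.assoc, reassoc_of% hab'])⟩
  refine ⟨P, ⟨?_ ≪≫ (toKar D).objObjPreimageIso Z⟩⟩
  refine ⟨⟨b', ?_⟩, ⟨a', ?_⟩, ?_, ?_⟩
  · change F.mapMat_.map (F.mapMat_.preimage (b' ≫ a')) ≫ b' ≫ 𝟙 _ = b'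
    rw [hp, Category.assoc, Category.comp_id, hab', Category.comp_id]
  · change 𝟙 _ ≫ a' ≫ F.mapMat_.map (F.mapMat_.preimage (b' ≫ a')) = a'
    rw [hp, Category.id_comp, reassoc_of% hab']
  · exact Karoubi.hom_ext _ _ hp.symm
  · exact Karoubi.hom_ext _ _ hab'

variable [MonoidalCategory C] [MonoidalPreadditive C] [MonoidalCategory D] [MonoidalPreadditive D]
  [F.Monoidal]

/-- The extension of an additive functor to additive Karoubi envelopes restricts to the functor. -/
noncomputable def toKarCompIso : toKar C ⋙ mapKar F ≅ F ⋙ toKar D :=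
  NatIso.ofComponents (fun X =>
    { hom := ⟨𝟙 ((Mat_.embedding D).obj (F.obj X)), by
        change F.mapMat_.map (𝟙 ((Mat_.embedding C).obj X)) ≫
          𝟙 ((Mat_.embedding D).obj (F.obj X)) ≫ 𝟙 _ = 𝟙 _
        rw [F.mapMat_.map_id]
        exact (Category.id_comp _).trans (Category.id_comp _)⟩
      inv := ⟨𝟙 ((Mat_.embedding D).obj (F.obj X)), by
        change 𝟙 ((Mat_.embedding D).obj (F.obj X)) ≫ 𝟙 _ ≫
          F.mapMat_.map (𝟙 ((Mat_.embedding C).obj X)) = 𝟙 _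
        rw [F.mapMat_.map_id]
        exact (Category.id_comp _).trans (Category.id_comp _)⟩
      hom_inv_id := Karoubi.hom_ext _ _ (by
        change 𝟙 ((Mat_.embedding D).obj (F.obj X)) ≫ 𝟙 _ =
          F.mapMat_.map (𝟙 ((Mat_.embedding C).obj X))
        rw [F.mapMat_.map_id]
        exact Category.id_comp _)
      inv_hom_id := Karoubi.hom_ext _ _
        (Category.id_comp (𝟙 ((Mat_.embedding D).obj (F.obj X)))) })
    (fun {X Y} f => Karoubi.hom_ext _ _
      ((Category.comp_id (F.mapMat_.map ((Mat_.embedding C).map f))).trans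
      (Category.id_comp ((Mat_.embedding D).map (F.map f))).symm))

open Functor.LaxMonoidal

theorem toKar_ε_f : (ε (toKar C)).f = 𝟙 (𝟙_ (Mat_ C)) := by
  rw [Functor.LaxMonoidal.comp_ε]
  exact Category.id_comp (𝟙 (𝟙_ (Mat_ C)))

theorem toKar_μ_f (X Y : C) : (μ (toKar C) X Y).f = (embeddingμ X Y).hom := by
  rw [Functor.LaxMonoidal.comp_μ]
  exact (by simp : ((𝟙 ((Mat_.embedding C).obj X) ⊗ₘ 𝟙 ((Mat_.embedding C).obj Y)) ≫ 𝟙 _) ≫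
    (embeddingμ X Y).hom = (embeddingμ X Y).hom)

instance : NatTrans.IsMonoidal (toKarCompIso F).hom where
  unit := by
    rw [Functor.LaxMonoidal.comp_ε, Functor.LaxMonoidal.comp_ε]
    apply Karoubi.hom_ext
    change ((𝟙 _ ≫ ε F.mapMat_) ≫ F.mapMat_.map (ε (toKar C)).f) ≫ 𝟙 _ =
      (ε (toKar D)).f ≫ (Mat_.embedding D).map (ε F)
    rw [toKar_ε_f, toKar_ε_f, Category.id_comp]
    refine (Category.comp_id _).trans (Eq.trans ?_ (Category.id_comp _).symm)
    refine (congrArg (ε F.mapMat_ ≫ ·) (F.mapMat_.map_id (𝟙_ (Mat_ C)))).trans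
      ((Category.comp_id _).trans ?_)
    rw [mapMat_ε, embedding_map_eq]
    rfl
  tensor X Y := by
    rw [Functor.LaxMonoidal.comp_μ, Functor.LaxMonoidal.comp_μ]
    apply Karoubi.hom_ext
    change (((F.mapMat_.map (𝟙 _) ⊗ₘ F.mapMat_.map (𝟙 _)) ≫ μ F.mapMat_ _ _) ≫
      F.mapMat_.map (μ (toKar C) X Y).f) ≫ 𝟙 _ =
      (𝟙 _ ⊗ₘ 𝟙 _) ≫ (μ (toKar D) _ _).f ≫ (Mat_.embedding D).map (μ F X Y)
    rw [toKar_μ_f, toKar_μ_f, F.mapMat_.map_id, F.mapMat_.map_id, id_tensorHom_id, id_tensorHom_id,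
      Category.id_comp]
    refine (Category.comp_id _).trans (Eq.trans ?_ (Category.id_comp _).symm)
    rw [mapMat_μ, mapMatμ_hom, embeddingμ_hom, embeddingμ_hom, embedding_map_eq]
    erw [mapMat_map_reindexHom]
    erw [reindexHom_comp, reindexHom_comp]
    congr 1
    funext p
    exact ((congrArg (μ F X Y ≫ ·) (F.map_id _)).trans (Category.comp_id _)).trans
      (Category.id_comp _).symm

end AdditiveKaroubi

/-- If `e` is a monoidal equivalence, a monoidal extension of `F ⋙ e.functor` along `S` gives a
monoidal extension of `F`. -/
theorem Equivalence.exists_extension {C : Type*} [Category* C] [MonoidalCategory C]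
    {C' : Type*} [Category* C'] [MonoidalCategory C'] {D : Type*} [Category* D]
    [MonoidalCategory D] {K : Type*} [Category* K] [MonoidalCategory K] (e : D ≌ K)
    [e.functor.Monoidal] (F : C ⥤ D) [F.Monoidal] (S : C ⥤ C') [S.Monoidal] (H : C' ⥤ K)
    [H.Monoidal] (i : S ⋙ H ≅ F ⋙ e.functor) [NatTrans.IsMonoidal i.hom] :
    ∃ _ : e.inverse.Monoidal, ∃ θ : S ⋙ H ⋙ e.inverse ≅ F, NatTrans.IsMonoidal θ.hom := by
  let := e.inverseMonoidal
  have : e.IsMonoidal := ⟨rfl, fun _ _ => rfl⟩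
  refine ⟨inferInstance, (Functor.associator _ _ _).symm ≪≫
    Functor.isoWhiskerRight i e.inverse ≪≫ Functor.associator _ _ _ ≪≫
    Functor.isoWhiskerLeft F e.unitIso.symm ≪≫ F.rightUnitor, ?_⟩
  have h1 : NatTrans.IsMonoidal e.unitIso.hom := inferInstanceAs (NatTrans.IsMonoidal e.unit)
  have h2 : NatTrans.IsMonoidal (Functor.whiskerRight i.hom e.inverse) := inferInstance
  have h3 : NatTrans.IsMonoidal (Functor.whiskerLeft F e.unitIso.inv) := inferInstance
  have h4 : NatTrans.IsMonoidal (Functor.associator S H e.inverse).inv := inferInstance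
  have h5 : NatTrans.IsMonoidal (Functor.associator F e.functor e.inverse).hom := inferInstance
  have h6 : NatTrans.IsMonoidal F.rightUnitor.hom := inferInstance
  simp only [Iso.trans_hom, Iso.symm_hom, Functor.isoWhiskerRight_hom, Functor.isoWhiskerLeft_hom]
  infer_instance

/-- An additive, fully faithful monoidal functor `F : C ⥤ D` to an idempotent complete category
with finite biproducts, such that every object of `D` is a retract of a finite sum of objects in
the image, extends to a monoidal equivalence from the additive Karoubi envelope of `C` to `D`. -/
theorem AdditiveKaroubi.exists_monoidal_equivalence {C : Type w} [Category.{v} C] [Preadditive C]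
    {D : Type w'} [Category.{v} D] [Preadditive D] [MonoidalCategory C] [MonoidalPreadditive C]
    [MonoidalCategory D] [MonoidalPreadditive D] (F : C ⥤ D) [F.Additive] [F.Monoidal] [F.Full]
    [F.Faithful] [Limits.HasFiniteBiproducts D] [IsIdempotentComplete D]
    (hF : ∀ X : D, ∃ (n : ℕ) (c : Fin n → C) (a : ∀ i, X ⟶ F.obj (c i))
      (b : ∀ i, F.obj (c i) ⟶ X), ∑ i, a i ≫ b i = 𝟙 X) :
    ∃ (F' : Idempotents.Karoubi (Mat_ C) ⥤ D) (_ : F'.Monoidal),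
      (∃ θ : toKar C ⋙ F' ≅ F, NatTrans.IsMonoidal θ.hom) ∧ F'.Additive ∧ F'.IsEquivalence := by
  have := toKar_isEquivalence D
  have := mapKar_essSurj F hF
  have : (mapKar F).IsEquivalence := {}
  have : (toKar D).asEquivalence.functor.Additive := inferInstanceAs (toKar D).Additive
  have : (toKar D).asEquivalence.inverse.Additive := inferInstance
  obtain ⟨h, θ⟩ := @Equivalence.exists_extension _ _ _ _ _ _ _ _ _ _ _ _ (toKar D).asEquivalence
    (inferInstance : (toKar D).Monoidal) F _ (toKar C) _ (mapKar F) _ (toKarCompIso F)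
    (inferInstance : NatTrans.IsMonoidal (toKarCompIso F).hom)
  exact ⟨mapKar F ⋙ (toKar D).asEquivalence.inverse, inferInstance, θ, inferInstance,
    inferInstance⟩

/-! ### Planar calculus in `STL(δ)` -/

namespace STL

open MonoidalSupercategory

variable {k : Type u} [Field k] {δ : k}

/-- The space of morphisms from `m` to `n`. -/
abbrev H (δ : k) (m n : ℕ) := (⟨m⟩ : STL k δ) ⟶ ⟨n⟩

/-- Adding a strand on the right. -/
def addR {m n : ℕ} (f : H δ m n) : H δ (m + 1) (n + 1) := f ⊗ₘ 𝟙 (⟨1⟩ : STL k δ)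

/-- Adding `i` strands on the left. -/
def addL (i : ℕ) {m n : ℕ} (f : H δ m n) : H δ (i + m) (i + n) := 𝟙 (⟨i⟩ : STL k δ) ⊗ₘ f

/-- The cup to the right of `i` strands. -/
def cupAt (δ : k) (i : ℕ) : H δ i (i + 2) := addL i (hmk STLPre.cup : H δ 0 2)

/-- The cap to the right of `i` strands. -/
def capAt (δ : k) (i : ℕ) : H δ (i + 2) i := addL i (hmk STLPre.cap : H δ 2 0)

theorem cup_odd : HomParity k 1 (hmk STLPre.cup : H δ 0 2) := ⟨_, .cup, rfl⟩
theorem cap_odd : HomParity k 1 (hmk STLPre.cap : H δ 2 0) := ⟨_, .cap, rfl⟩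

theorem addR_comp {l m n : ℕ} (f : H δ l m) (g : H δ m n) : addR (f ≫ g) = addR f ≫ addR g := by
  rw [addR, addR, addR, tensor_comp_of_right (k := k) _ _ _ (HomParity.id _), Category.comp_id]

theorem addR_id (n : ℕ) : addR (𝟙 (⟨n⟩ : STL k δ)) = 𝟙 (⟨n + 1⟩ : STL k δ) := id_tensor_id k _ _

theorem addR_add {m n : ℕ} (f g : H δ m n) : addR (f + g) = addR f + addR g := add_tensor k _ _ _

theorem addR_smul {m n : ℕ} (c : k) (f : H δ m n) : addR (c • f) = c • addR f := smul_tensor _ _ _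

theorem addR_zero {m n : ℕ} : addR (0 : H δ m n) = 0 := zero_tensorHom k _

theorem addR_parity {m n : ℕ} {p : ZMod 2} {f : H δ m n} (h : HomParity k p f) :
    HomParity k p (addR f) :=
  (tensor_parity h (HomParity.id _)).cast (add_zero p)

theorem addL_comp (i : ℕ) {l m n : ℕ} (f : H δ l m) (g : H δ m n) :
    addL i (f ≫ g) = addL i f ≫ addL i g := by
  rw [addL, addL, addL, tensor_comp_of_left (k := k) _ _ _ (HomParity.id _), Category.comp_id]

theorem addL_id (i n : ℕ) : addL i (𝟙 (⟨n⟩ : STL k δ)) = 𝟙 (⟨i + n⟩ : STL k δ) := id_tensor_id k _ _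

theorem addL_add (i : ℕ) {m n : ℕ} (f g : H δ m n) : addL i (f + g) = addL i f + addL i g :=
  tensor_add k _ _ _

theorem addL_smul (i : ℕ) {m n : ℕ} (c : k) (f : H δ m n) : addL i (c • f) = c • addL i f :=
  tensor_smul _ _ _

theorem addL_zero (i : ℕ) {m n : ℕ} : addL i (0 : H δ m n) = 0 := tensorHom_zero k _

theorem tensor_tensor_one {m n m' n' : ℕ} (f : H δ m n) (g : H δ m' n') :
    ((f ⊗ₘ addR g : (⟨m⟩ : STL k δ) ⊗ ⟨m' + 1⟩ ⟶ (⟨n⟩ : STL k δ) ⊗ ⟨n' + 1⟩) :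
      H δ (m + m' + 1) (n + n' + 1)) = addR (f ⊗ₘ g : H δ (m + m') (n + n')) := by
  obtain ⟨f, rfl⟩ := hmk_surj f; obtain ⟨g, rfl⟩ := hmk_surj g
  have h := hmk_eq (δ := δ) (m := ⟨m + m' + 1⟩) (n := ⟨n + n' + 1⟩)
    (STLPre.Rel.tensor_assoc f g (.id 1))
  exact ((Category.id_comp _).symm.trans h.symm).trans (Category.comp_id _)

theorem addL_addR (i : ℕ) {m n : ℕ} (f : H δ m n) :
    (addL i (addR f) : H δ (i + m + 1) (i + n + 1)) = addR (addL i f) :=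
  tensor_tensor_one _ _

theorem tensor_id_two {m n : ℕ} (f : H δ m n) :
    (f ⊗ₘ 𝟙 (⟨2⟩ : STL k δ) : H δ (m + 2) (n + 2)) = addR (addR f) := by
  have h := tensor_tensor_one f (𝟙 (⟨1⟩ : STL k δ))
  rw [addR_id] at h
  exact h

theorem tensor_id_zero {m n : ℕ} (f : H δ m n) :
    (f ⊗ₘ 𝟙 (⟨0⟩ : STL k δ) : H δ m n) = f := by
  obtain ⟨f, rfl⟩ := hmk_surj f
  have h := hmk_eq (δ := δ) (m := ⟨m⟩) (n := ⟨n⟩) (STLPre.Rel.tensor_id f)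
  exact ((Category.comp_id _).symm.trans h).trans (Category.id_comp _)

theorem comp_cupAt {m n : ℕ} {p : ZMod 2} {f : H δ m n} (h : HomParity k p f) :
    f ≫ cupAt δ n = superSign k p • (cupAt δ m ≫ addR (addR f)) := by
  have h1 := interchange (k := k) f (𝟙 (⟨0⟩ : STL k δ)) (𝟙 (⟨n⟩ : STL k δ))
    (hmk STLPre.cup : H δ 0 2) cup_odd h
  have h2 := tensor_comp_of_left (k := k) (hmk STLPre.cup : H δ 0 2) f (𝟙 (⟨2⟩ : STL k δ))
    (HomParity.id (⟨m⟩ : STL k δ))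
  rw [← tensor_id_two]
  refine (congrArg (· ≫ cupAt δ n) (tensor_id_zero f).symm).trans (h1.trans ?_)
  rw [one_mul]
  congr 1
  refine Eq.trans ?_ h2.symm
  rw [Category.comp_id, Category.id_comp, Category.comp_id, Category.id_comp]

theorem comp_capAt {m n : ℕ} {p : ZMod 2} {f : H δ m n} (h : HomParity k p f) :
    addR (addR f) ≫ capAt δ n = superSign k p • (capAt δ m ≫ f) := by
  have h1 := interchange (k := k) f (𝟙 (⟨2⟩ : STL k δ)) (𝟙 (⟨n⟩ : STL k δ))
    (hmk STLPre.cap : H δ 2 0) cap_odd h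
  have h2 := tensor_comp_of_left (k := k) (hmk STLPre.cap : H δ 2 0) f (𝟙 (⟨0⟩ : STL k δ))
    (HomParity.id (⟨m⟩ : STL k δ))
  rw [← tensor_id_two]
  refine h1.trans ?_
  rw [one_mul]
  congr 1
  refine Eq.trans ?_ (h2.symm.trans (congrArg (capAt δ m ≫ ·) (tensor_id_zero f)))
  rw [Category.comp_id, Category.id_comp, Category.comp_id, Category.id_comp]

theorem cupAt_add (i j : ℕ) : cupAt δ (i + j) = addL i (cupAt δ j) := by
  have h := hmk_eq (δ := δ) (m := ⟨i + j⟩) (n := ⟨i + j + 2⟩)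
    (STLPre.Rel.tensor_assoc (.id i) (.id j) STLPre.cup)
  have h' : (hmk ((STLPre.id i).tensor (.id j)) : H δ (i + j) (i + j)) = hmk (.id (i + j)) :=
    id_tensor_id k (⟨i⟩ : STL k δ) ⟨j⟩
  have h'' : cupAt δ (i + j) = ((hmk ((STLPre.id i).tensor (.id j)) : H δ (i + j) (i + j)) ⊗ₘ
    (hmk STLPre.cup : H δ 0 2)) := by rw [h']; rfl
  rw [h'']
  exact ((Category.comp_id _).symm.trans h).trans (Category.id_comp _)

theorem capAt_add (i j : ℕ) : capAt δ (i + j) = addL i (capAt δ j) := by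
  have h := hmk_eq (δ := δ) (m := ⟨i + j + 2⟩) (n := ⟨i + j⟩)
    (STLPre.Rel.tensor_assoc (.id i) (.id j) STLPre.cap)
  have h' : (hmk ((STLPre.id i).tensor (.id j)) : H δ (i + j) (i + j)) = hmk (.id (i + j)) :=
    id_tensor_id k (⟨i⟩ : STL k δ) ⟨j⟩
  have h'' : capAt δ (i + j) = ((hmk ((STLPre.id i).tensor (.id j)) : H δ (i + j) (i + j)) ⊗ₘ
    (hmk STLPre.cap : H δ 2 0)) := by rw [h']; rfl
  rw [h'']
  exact ((Category.comp_id _).symm.trans h).trans (Category.id_comp _)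

theorem cupAt_comp_addR_capAt (i : ℕ) :
    cupAt δ (i + 1) ≫ addR (capAt δ i) = 𝟙 (⟨i + 1⟩ : STL k δ) := by
  rw [cupAt_add, capAt, ← addL_addR]
  refine (addL_comp i (cupAt δ 1) (addR (hmk STLPre.cap : H δ 2 0))).symm.trans ?_
  have h := hmk_eq (δ := δ) (m := ⟨1⟩) (n := ⟨1⟩) (STLPre.Rel.zigzag)
  exact (congrArg (addL i) h).trans (addL_id i 1)

theorem addR_cupAt_comp_capAt (i : ℕ) :
    addR (cupAt δ i) ≫ capAt δ (i + 1) = (-1 : k) • 𝟙 (⟨i + 1⟩ : STL k δ) := by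
  rw [capAt_add, cupAt, ← addL_addR]
  refine (addL_comp i (addR (hmk STLPre.cup : H δ 0 2)) (capAt δ 1)).symm.trans ?_
  have h := hmk_eq (δ := δ) (m := ⟨1⟩) (n := ⟨1⟩) (STLPre.Rel.zigzag')
  refine (congrArg (addL i) h).trans ((addL_smul i (-1 : k) (𝟙 (⟨1⟩ : STL k δ))).trans ?_)
  exact congrArg _ (addL_id i 1)

theorem cupAt_comp_capAt (i : ℕ) : cupAt δ i ≫ capAt δ i = δ • 𝟙 (⟨i⟩ : STL k δ) := by
  refine (addL_comp i (hmk STLPre.cup : H δ 0 2) (hmk STLPre.cap : H δ 2 0)).symm.trans ?_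
  have h := hmk_eq (δ := δ) (m := ⟨0⟩) (n := ⟨0⟩) (STLPre.Rel.bubble)
  refine (congrArg (addL i) h).trans ((addL_smul i δ (𝟙 (⟨0⟩ : STL k δ))).trans ?_)
  exact congrArg _ (addL_id i 0)

theorem cupAt_odd (i : ℕ) : HomParity k 1 (cupAt δ i) :=
  (tensor_parity (HomParity.id (⟨i⟩ : STL k δ)) cup_odd).cast (zero_add 1)

theorem capAt_odd (i : ℕ) : HomParity k 1 (capAt δ i) :=
  (tensor_parity (HomParity.id (⟨i⟩ : STL k δ)) cap_odd).cast (zero_add 1)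

/-- Every morphism is a sum of two homogeneous ones. -/
theorem exists_add_parity {m n : ℕ} (f : H δ m n) :
    ∃ f₀ f₁, HomParity k 0 f₀ ∧ HomParity k 1 f₁ ∧ f = f₀ + f₁ := by
  exact ⟨_, _, SuperGrading.proj_mem _ 0 f, SuperGrading.proj_mem _ 1 f,
    (SuperGrading.proj_add_proj (Supercategory.gr (k := k) (⟨m⟩ : STL k δ) ⟨n⟩) f).symm⟩

/-- The last upper endpoint of a morphism can be bent down. -/
theorem exists_eq_cupAt_comp {w n : ℕ} (f : H δ w (n + 1)) :
    ∃ g : H δ (w + 1) n, f = cupAt δ w ≫ addR g := by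
  have key : ∀ {p : ZMod 2} {f : H δ w (n + 1)}, HomParity k p f →
      ∃ g : H δ (w + 1) n, f = cupAt δ w ≫ addR g := by
    intro p f hf
    refine ⟨superSign k p • (addR f ≫ capAt δ n), ?_⟩
    rw [addR_smul, addR_comp, Linear.comp_smul, ← Category.assoc]
    refine Eq.trans ?_ ((Linear.smul_comp _ _ _ (superSign k p) _ _))
    rw [← comp_cupAt hf, Category.assoc, cupAt_comp_addR_capAt, Category.comp_id]
  obtain ⟨f₀, f₁, h₀, h₁, rfl⟩ := exists_add_parity f
  obtain ⟨g₀, e₀⟩ := key h₀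
  obtain ⟨g₁, e₁⟩ := key h₁
  exact ⟨g₀ + g₁, by rw [addR_add, Preadditive.comp_add, ← e₀, ← e₁]⟩

/-- Bending an endpoint up and down again gives a homogeneous morphism back up to sign. -/
theorem addR_cupAt_comp_addR_comp_capAt {m n : ℕ} {p : ZMod 2} {f : H δ (m + 1) n}
    (h : HomParity k p f) :
    addR (cupAt δ m ≫ addR f) ≫ capAt δ n = (superSign k p * (-1)) • f := by
  rw [addR_comp, Category.assoc, comp_capAt h, Linear.comp_smul, ← Category.assoc,
    addR_cupAt_comp_capAt, Linear.smul_comp, Category.id_comp, smul_smul]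

/-! ### Morphisms beginning with a cap -/

/-- The morphisms which consist of one cap and of vertical strands. -/
inductive IsCap : ∀ {m n : ℕ}, H δ m n → Prop
  | base (i : ℕ) : IsCap (capAt δ i)
  | addR {m n : ℕ} {f : H δ m n} : IsCap f → IsCap (addR f)

/-- The morphisms which consist of one cup and of vertical strands. -/
inductive IsCup : ∀ {m n : ℕ}, H δ m n → Prop
  | base (i : ℕ) : IsCup (cupAt δ i)
  | addR {m n : ℕ} {f : H δ m n} : IsCup f → IsCup (addR f)

theorem IsCap.lt {m n : ℕ} {f : H δ m n} (h : IsCap f) : m = n + 2 := by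
  induction h with
  | base i => rfl
  | addR _ ih => omega

theorem IsCup.lt {m n : ℕ} {f : H δ m n} (h : IsCup f) : n = m + 2 := by
  induction h with
  | base i => rfl
  | addR _ ih => omega

theorem IsCap.odd {m n : ℕ} {f : H δ m n} (h : IsCap f) : HomParity k 1 f := by
  induction h with
  | base i => exact capAt_odd i
  | addR _ ih => exact addR_parity ih

theorem IsCup.odd {m n : ℕ} {f : H δ m n} (h : IsCup f) : HomParity k 1 f := by
  induction h with
  | base i => exact cupAt_odd i
  | addR _ ih => exact addR_parity ih

/-- The span of the morphisms which begin with a cap. -/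
def capIdeal (δ : k) (m n : ℕ) : Submodule k (H δ m n) :=
  Submodule.span k {f | ∃ (l : ℕ) (c : H δ m l) (g : H δ l n), IsCap c ∧ f = c ≫ g}

theorem comp_mem_capIdeal {m l n : ℕ} {c : H δ m l} (hc : IsCap c) (g : H δ l n) :
    c ≫ g ∈ capIdeal δ m n := Submodule.subset_span ⟨l, c, g, hc, rfl⟩

theorem capIdeal_comp {m n o : ℕ} {f : H δ m n} (hf : f ∈ capIdeal δ m n) (g : H δ n o) :
    f ≫ g ∈ capIdeal δ m o := by
  induction hf using Submodule.span_induction with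
  | mem f h =>
    obtain ⟨l, c, g', hc, rfl⟩ := h
    rw [Category.assoc]
    exact comp_mem_capIdeal hc _
  | zero => rw [Limits.zero_comp]; exact Submodule.zero_mem _
  | add f f' _ _ h h' => rw [Preadditive.add_comp]; exact Submodule.add_mem _ h h'
  | smul c f _ h => rw [Linear.smul_comp]; exact Submodule.smul_mem _ _ h

theorem addR_mem_capIdeal {m n : ℕ} {f : H δ m n} (hf : f ∈ capIdeal δ m n) :
    addR f ∈ capIdeal δ (m + 1) (n + 1) := by
  induction hf using Submodule.span_induction with
  | mem f h =>
    obtain ⟨l, c, g', hc, rfl⟩ := h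
    rw [addR_comp]
    exact comp_mem_capIdeal hc.addR _
  | zero => rw [addR_zero]; exact Submodule.zero_mem _
  | add f f' _ _ h h' => rw [addR_add]; exact Submodule.add_mem _ h h'
  | smul c f _ h => rw [addR_smul]; exact Submodule.smul_mem _ _ h

theorem eq_zero_of_mem_capIdeal {m n : ℕ} (hm : m < 2) {f : H δ m n} (hf : f ∈ capIdeal δ m n) :
    f = 0 := by
  induction hf using Submodule.span_induction with
  | mem f h =>
    obtain ⟨l, c, g', hc, rfl⟩ := h
    exact absurd hc.lt (by omega)
  | zero => rfl
  | add f f' _ _ h h' => rw [h, h', add_zero]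
  | smul c f _ h => rw [h, smul_zero]

/-- Bending the last lower endpoint of a morphism beginning with a cap gives a morphism beginning
with a cap, except if that cap gets straightened. -/
theorem exists_cupAt_comp_addR_eq {w n : ℕ} {g : H δ (w + 2) n} (hg : g ∈ capIdeal δ (w + 2) n) :
    ∃ (ν : H δ (w + 1) (n + 1)) (g' : H δ w n), ν ∈ capIdeal δ (w + 1) (n + 1) ∧
      cupAt δ (w + 1) ≫ addR g = ν + addR g' := by
  induction hg using Submodule.span_induction with
  | mem f h =>
    obtain ⟨l, c, g', hc, rfl⟩ := h
    cases hc with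
    | base =>
      refine ⟨0, g', Submodule.zero_mem _, ?_⟩
      rw [addR_comp, ← Category.assoc, cupAt_comp_addR_capAt, Category.id_comp, zero_add]
    | @addR _ l f hf =>
      refine ⟨superSign k 1 • (f ≫ cupAt δ l ≫ addR g'), 0,
        Submodule.smul_mem _ _ (comp_mem_capIdeal hf _), ?_⟩
      rw [addR_zero, add_zero, addR_comp, ← Category.assoc, ← Category.assoc f,
        comp_cupAt hf.odd, Linear.smul_comp, smul_smul, ← superSign_add, zmod2_add_self,
        superSign_zero, one_smul]
  | zero => exact ⟨0, 0, Submodule.zero_mem _, by simp [addR_zero]⟩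
  | add f f' _ _ h h' =>
    obtain ⟨ν, g, hν, e⟩ := h
    obtain ⟨ν', g', hν', e'⟩ := h'
    refine ⟨ν + ν', g + g', Submodule.add_mem _ hν hν', ?_⟩
    rw [addR_add, Preadditive.comp_add, e, e', addR_add]
    abel
  | smul c f _ h =>
    obtain ⟨ν, g, hν, e⟩ := h
    refine ⟨c • ν, c • g, Submodule.smul_mem _ _ hν, ?_⟩
    rw [addR_smul, Linear.comp_smul, e, addR_smul, smul_add]

/-- The compositions of morphisms which consist of one cup or cap and of vertical strands. -/
inductive IsWord : ∀ {m n : ℕ}, H δ m n → Prop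
  | id (n : ℕ) : IsWord (𝟙 (⟨n⟩ : STL k δ))
  | cup {l m n : ℕ} {f : H δ l m} {c : H δ m n} : IsWord f → IsCup c → IsWord (f ≫ c)
  | cap {l m n : ℕ} {f : H δ l m} {c : H δ m n} : IsWord f → IsCap c → IsWord (f ≫ c)

/-- The compositions of morphisms which consist of one cup and of vertical strands. -/
inductive IsCupWord : ∀ {m n : ℕ}, H δ m n → Prop
  | id (n : ℕ) : IsCupWord (𝟙 (⟨n⟩ : STL k δ))
  | cup {l m n : ℕ} {f : H δ l m} {c : H δ m n} : IsCupWord f → IsCup c → IsCupWord (f ≫ c)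

theorem IsWord.comp {l m n : ℕ} {f : H δ l m} {g : H δ m n} (hf : IsWord f) (hg : IsWord g) :
    IsWord (f ≫ g) := by
  induction hg with
  | id => rwa [Category.comp_id]
  | cup _ hc ih => rw [← Category.assoc]; exact ih.cup hc
  | cap _ hc ih => rw [← Category.assoc]; exact ih.cap hc

theorem IsWord.addR {m n : ℕ} {f : H δ m n} (hf : IsWord f) : IsWord (addR f) := by
  induction hf with
  | id => rw [addR_id]; exact .id _
  | cup _ hc ih => rw [addR_comp]; exact ih.cup hc.addR
  | cap _ hc ih => rw [addR_comp]; exact ih.cap hc.addR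

theorem IsCup.addL (i : ℕ) {m n : ℕ} {f : H δ m n} (hf : IsCup f) : IsCup (addL i f) := by
  induction hf with
  | base j => rw [← cupAt_add]; exact .base _
  | addR _ ih =>
    have h := ih.addR
    rw [← addL_addR] at h
    exact h

theorem IsCap.addL (i : ℕ) {m n : ℕ} {f : H δ m n} (hf : IsCap f) : IsCap (addL i f) := by
  induction hf with
  | base j => rw [← capAt_add]; exact .base _
  | addR _ ih =>
    have h := ih.addR
    rw [← addL_addR] at h
    exact h

theorem IsWord.addL (i : ℕ) {m n : ℕ} {f : H δ m n} (hf : IsWord f) : IsWord (addL i f) := by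
  induction hf with
  | id => rw [addL_id]; exact .id _
  | cup _ hc ih => rw [addL_comp]; exact ih.cup (hc.addL i)
  | cap _ hc ih => rw [addL_comp]; exact ih.cap (hc.addL i)

theorem IsWord.tensor_id {m n : ℕ} {f : H δ m n} (hf : IsWord f) :
    ∀ i : ℕ, IsWord (f ⊗ₘ 𝟙 (⟨i⟩ : STL k δ) : H δ (m + i) (n + i))
  | 0 => by rw [tensor_id_zero]; exact hf
  | i + 1 => by
    have h := (IsWord.tensor_id hf i).addR
    rw [← tensor_tensor_one, addR_id] at h
    exact h

/-- The span of the compositions of morphisms which consist of one cup or cap and of vertical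
strands. -/
def wordSpan (δ : k) (m n : ℕ) : Submodule k (H δ m n) := Submodule.span k {f | IsWord f}

theorem comp_mem_wordSpan {l m n : ℕ} {f : H δ l m} {g : H δ m n} (hf : f ∈ wordSpan δ l m)
    (hg : g ∈ wordSpan δ m n) : f ≫ g ∈ wordSpan δ l n := by
  have := Submodule.apply_mem_map₂ (Linear.comp (S := k) (⟨l⟩ : STL k δ) ⟨m⟩ ⟨n⟩) hf hg
  rw [wordSpan, wordSpan, Submodule.map₂_span_span] at this
  refine Submodule.span_mono ?_ this
  rintro _ ⟨f, hf, g, hg, rfl⟩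
  exact IsWord.comp hf hg

theorem addL_mem_wordSpan (i : ℕ) {m n : ℕ} {f : H δ m n} (hf : f ∈ wordSpan δ m n) :
    addL i f ∈ wordSpan δ (i + m) (i + n) := by
  induction hf using Submodule.span_induction with
  | mem f h => exact Submodule.subset_span (IsWord.addL i h)
  | zero => rw [addL_zero]; exact Submodule.zero_mem _
  | add f f' _ _ h h' => rw [addL_add]; exact Submodule.add_mem _ h h'
  | smul c f _ h => rw [addL_smul]; exact Submodule.smul_mem _ _ h

theorem tensor_id_mem_wordSpan (i : ℕ) {m n : ℕ} {f : H δ m n} (hf : f ∈ wordSpan δ m n) :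
    (f ⊗ₘ 𝟙 (⟨i⟩ : STL k δ) : H δ (m + i) (n + i)) ∈ wordSpan δ (m + i) (n + i) := by
  induction hf using Submodule.span_induction with
  | mem f h => exact Submodule.subset_span (IsWord.tensor_id h i)
  | zero => rw [zero_tensorHom k]; exact Submodule.zero_mem _
  | add f f' _ _ h h' => rw [add_tensor k]; exact Submodule.add_mem _ h h'
  | smul c f _ h => rw [smul_tensor]; exact Submodule.smul_mem _ _ h

theorem id_zero_tensor {m n : ℕ} (f : STLPre k m n) (hm : 0 + m = m) (hn : 0 + n = n) :
    (addL 0 (hmk f : H δ m n)) ≫ (hmk (STLPre.ofEq k hn) : H δ (0 + n) n) =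
      (hmk (STLPre.ofEq k hm) : H δ (0 + m) m) ≫ hmk f :=
  hmk_eq (δ := δ) (m := ⟨0 + m⟩) (n := ⟨n⟩) (STLPre.Rel.id_tensor f)

theorem cupAt_zero : cupAt δ 0 = (hmk STLPre.cup : H δ 0 2) :=
  ((Category.comp_id _).symm.trans (id_zero_tensor STLPre.cup rfl rfl)).trans (Category.id_comp _)

theorem capAt_zero : capAt δ 0 = (hmk STLPre.cap : H δ 2 0) :=
  ((Category.comp_id _).symm.trans (id_zero_tensor STLPre.cap rfl rfl)).trans (Category.id_comp _)

/-- A diagram `f ⊗ g` equals `(id ⊗ g) ≫ (f ⊗ id)`, so every diagram can be cut into layers with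
a single cup or cap each. -/
theorem hmk_mem_wordSpan {m n : ℕ} (f : STLPre k m n) : (hmk f : H δ m n) ∈ wordSpan δ m n := by
  induction f with
  | cup =>
    refine Submodule.subset_span ?_
    rw [← cupAt_zero]
    have h := (IsWord.id (δ := δ) 0).cup (IsCup.base 0)
    rwa [Category.id_comp] at h
  | cap =>
    refine Submodule.subset_span ?_
    rw [← capAt_zero]
    have h := (IsWord.id (δ := δ) 2).cap (IsCap.base 0)
    rwa [Category.id_comp] at h
  | id n => exact Submodule.subset_span (IsWord.id n)
  | comp f g hf hg => exact comp_mem_wordSpan hf hg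
  | @tensor m n m' n' f g hf hg =>
    have h := comp_mem_wordSpan (addL_mem_wordSpan m hg) (tensor_id_mem_wordSpan n' hf)
    have e := tensor_comp_of_left (k := k) (hmk g : H δ m' n') (hmk f : H δ m n)
      (𝟙 (⟨n'⟩ : STL k δ)) (HomParity.id (⟨m⟩ : STL k δ))
    rw [Category.id_comp, Category.comp_id] at e
    exact (congrArg (· ∈ wordSpan δ (m + m') (n + n')) e).mp h
  | zero m n => exact Submodule.zero_mem _
  | add f g hf hg => exact Submodule.add_mem _ hf hg
  | smul c f hf => exact Submodule.smul_mem _ c hf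

/-- A cup followed by a cap is a multiple of an identity, or of a cap followed by a cup. -/
theorem IsCup.comp_cap {l m n : ℕ} {c : H δ l m} (hc : IsCup c) {d : H δ m n} (hd : IsCap d) :
    (∃ (h : l = n) (a : k), c ≫ d = a • (ofEq (m := ⟨l⟩) (n := ⟨n⟩) h).hom) ∨
      ∃ (o : ℕ) (a : k) (d' : H δ l o) (c' : H δ o n), IsCap d' ∧ IsCup c' ∧
        c ≫ d = a • (d' ≫ c') := by
  induction hc generalizing n with
  | base i =>
    cases hd with
    | base => exact Or.inl ⟨rfl, δ, cupAt_comp_capAt _⟩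
    | addR hd' =>
      cases hd' with
      | base => exact Or.inl ⟨rfl, 1, (cupAt_comp_addR_capAt _).trans (one_smul k _).symm⟩
      | @addR _ n f hf =>
        refine Or.inr ⟨n, superSign k 1, f, cupAt δ n, hf, .base n, ?_⟩
        rw [comp_cupAt hf.odd, smul_smul, ← superSign_add, zmod2_add_self, superSign_zero,
          one_smul]
  | addR hc' ih =>
    rename_i l' m' c'
    cases hd with
    | base =>
      cases hc' with
      | base => exact Or.inl ⟨rfl, -1, addR_cupAt_comp_capAt _⟩
      | @addR l _ f hf =>
        exact Or.inr ⟨l, superSign k 1, capAt δ l, f, .base _, hf, comp_capAt hf.odd⟩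
    | @addR _ n d' hd' =>
      rw [← addR_comp]
      rcases ih hd' with ⟨h, a, e⟩ | ⟨o, a, d'', c'', hd'', hc'', e⟩
      · subst h
        refine Or.inl ⟨rfl, a, ?_⟩
        rw [e, addR_smul]
        exact congrArg _ (addR_id l')
      · exact Or.inr ⟨o + 1, a, _, _, hd''.addR, hc''.addR, by rw [e, addR_smul, addR_comp]⟩

/-- The span of the morphisms which begin with a cap and of those without caps. -/
def capCupSpan (δ : k) (m n : ℕ) : Submodule k (H δ m n) :=
  capIdeal δ m n ⊔ Submodule.span k {f | IsCupWord f}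

theorem capCupSpan_comp_cup {l m n : ℕ} {f : H δ l m} (hf : f ∈ capCupSpan δ l m) {c : H δ m n}
    (hc : IsCup c) : f ≫ c ∈ capCupSpan δ l n := by
  obtain ⟨g, hg, g', hg', rfl⟩ := Submodule.mem_sup.1 hf
  rw [Preadditive.add_comp]
  refine Submodule.add_mem_sup (capIdeal_comp hg c) ?_
  clear hf
  induction hg' using Submodule.span_induction with
  | mem f h => exact Submodule.subset_span (h.cup hc)
  | zero => rw [Limits.zero_comp]; exact Submodule.zero_mem _
  | add f f' _ _ h h' => rw [Preadditive.add_comp]; exact Submodule.add_mem _ h h'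
  | smul c f _ h => rw [Linear.smul_comp]; exact Submodule.smul_mem _ _ h

theorem IsCupWord.comp_cap {l m : ℕ} {f : H δ l m} (hf : IsCupWord f) :
    ∀ {n : ℕ} {d : H δ m n}, IsCap d → f ≫ d ∈ capCupSpan δ l n := by
  induction hf with
  | id =>
    intro n d hd
    exact Submodule.mem_sup_left (by simpa using comp_mem_capIdeal hd (𝟙 _))
  | @cup _ _ f _ hf hc ih =>
    intro n d hd
    rw [Category.assoc]
    rcases hc.comp_cap hd with ⟨h, a, e⟩ | ⟨o, a, d', c', hd', hc', e⟩
    · subst h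
      rw [e, Linear.comp_smul]
      refine Submodule.smul_mem _ _ (Submodule.mem_sup_right (Submodule.subset_span ?_))
      have e' := Category.comp_id f
      exact e'.symm ▸ hf
    · rw [e, Linear.comp_smul, ← Category.assoc]
      exact Submodule.smul_mem _ _ (capCupSpan_comp_cup (ih hd') hc')

theorem capCupSpan_comp_cap {l m n : ℕ} {f : H δ l m} (hf : f ∈ capCupSpan δ l m) {d : H δ m n}
    (hd : IsCap d) : f ≫ d ∈ capCupSpan δ l n := by
  obtain ⟨g, hg, g', hg', rfl⟩ := Submodule.mem_sup.1 hf
  rw [Preadditive.add_comp]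
  refine Submodule.add_mem _ (Submodule.mem_sup_left (capIdeal_comp hg d)) ?_
  clear hf
  induction hg' using Submodule.span_induction with
  | mem f h => exact IsCupWord.comp_cap h hd
  | zero => rw [Limits.zero_comp]; exact Submodule.zero_mem _
  | add f f' _ _ h h' => rw [Preadditive.add_comp]; exact Submodule.add_mem _ h h'
  | smul c f _ h => rw [Linear.smul_comp]; exact Submodule.smul_mem _ _ h

/-- The normal form: caps can be moved to the front of a diagram, past all cups. -/
theorem mem_capCupSpan {m n : ℕ} (f : H δ m n) : f ∈ capCupSpan δ m n := by
  have h : wordSpan δ m n ≤ capCupSpan δ m n := by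
    clear f
    refine Submodule.span_le.2 fun f hf => ?_
    induction hf with
    | id => exact Submodule.mem_sup_right (Submodule.subset_span (IsCupWord.id _))
    | cup _ hc ih => exact capCupSpan_comp_cup ih hc
    | cap _ hd ih => exact capCupSpan_comp_cap ih hd
  obtain ⟨f, rfl⟩ := hmk_surj f
  exact h (hmk_mem_wordSpan f)

theorem IsCupWord.le {m n : ℕ} {f : H δ m n} (hf : IsCupWord f) :
    m < n ∨ ∃ h : m = n, f = (ofEq (m := ⟨m⟩) (n := ⟨n⟩) h).hom := by
  induction hf with
  | id => exact Or.inr ⟨rfl, rfl⟩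
  | cup _ hc ih =>
    have := hc.lt
    rcases ih with h | ⟨h, _⟩ <;> exact Or.inl (by omega)

/-- A morphism from a nonzero tensor power to the unit object is a combination of diagrams which
begin with a cap, since a diagram without caps cannot decrease the number of strands. -/
theorem mem_capIdeal_of_unit {m : ℕ} (f : H δ (m + 1) 0) : f ∈ capIdeal δ (m + 1) 0 := by
  obtain ⟨g, hg, g', hg', rfl⟩ := Submodule.mem_sup.1 (mem_capCupSpan f)
  refine Submodule.add_mem _ hg ?_
  suffices h : g' = 0 by rw [h]; exact Submodule.zero_mem _
  induction hg' using Submodule.span_induction with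
  | mem f h =>
    rcases IsCupWord.le h with h | ⟨h, _⟩ <;> omega
  | zero => rfl
  | add f f' _ _ h h' => rw [h, h', add_zero]
  | smul c f _ h => rw [h, smul_zero]

theorem exists_eq_smul_id (f : H δ 0 0) : ∃ a : k, f = a • 𝟙 (⟨0⟩ : STL k δ) := by
  obtain ⟨g, hg, g', hg', rfl⟩ := Submodule.mem_sup.1 (mem_capCupSpan f)
  rw [eq_zero_of_mem_capIdeal (by norm_num) hg, zero_add]
  clear hg
  induction hg' using Submodule.span_induction with
  | mem f h =>
    rcases IsCupWord.le h with h | ⟨h, e⟩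
    · omega
    · exact ⟨1, by rw [e, one_smul]; rfl⟩
  | zero => exact ⟨0, (zero_smul k _).symm⟩
  | add f f' _ _ h h' =>
    obtain ⟨a, rfl⟩ := h
    obtain ⟨b, rfl⟩ := h'
    exact ⟨a + b, (add_smul _ _ _).symm⟩
  | smul c f _ h =>
    obtain ⟨a, rfl⟩ := h
    exact ⟨c * a, smul_smul _ _ _⟩

end STL

/-! ### Quantum integers -/

section QInt

variable {k : Type u} [Field k] {q : kˣ}

theorem add_inv_ne_zero (hq : ∀ n : ℕ, 0 < n → q ^ n ≠ 1) : (q : k) + ((q⁻¹ : kˣ) : k) ≠ 0 := by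
  intro h
  have h1 : (q : k) * q = -1 := by
    have := congrArg ((q : k) * ·) h
    simp only [mul_add, Units.mul_inv, mul_zero] at this
    linear_combination this
  refine hq 4 (by norm_num) (Units.ext ?_)
  push_cast
  linear_combination (q * q - 1 : k) * h1

theorem qInt_ne_zero (hq : ∀ n : ℕ, 0 < n → q ^ n ≠ 1) {n : ℤ} (hn : n ≠ 0) : qInt q n ≠ 0 := by
  have h0 := add_inv_ne_zero hq
  have key : ∀ m : ℕ, 0 < m → (q ^ (m : ℤ) : kˣ) ≠ (-q) ^ (-(m : ℤ)) := by
    intro m hm h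
    have h2 : q ^ m * (-q) ^ m = 1 := by
      rw [zpow_neg, zpow_natCast, zpow_natCast] at h
      rw [h, inv_mul_cancel]
    refine hq (4 * m) (by omega) ?_
    have h3 : (q ^ m * (-q) ^ m) ^ 2 = q ^ (4 * m) := by
      rw [mul_pow, ← pow_mul, ← pow_mul, mul_comm m 2, pow_mul (-q), neg_sq, ← pow_mul, ← pow_add]
      congr 1; ring
    rw [← h3, h2, one_pow]
  intro h
  have h1 : ((q ^ n : kˣ) : k) = (((-q) ^ (-n) : kˣ) : k) := by
    unfold qInt at h
    rcases div_eq_zero_iff.1 h with h | h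
    · exact sub_eq_zero.1 h
    · exact absurd h h0
  have h1' := Units.ext h1
  rcases Int.lt_or_gt_of_ne hn with hn | hn
  · refine key (-n).toNat (by omega) ?_
    have : ((-n).toNat : ℤ) = -n := Int.toNat_of_nonneg (by omega)
    rw [this, neg_neg, zpow_neg, h1', zpow_neg, inv_inv]
  · refine key n.toNat (by omega) ?_
    rwa [Int.toNat_of_nonneg (by omega)]

theorem qInt_neg (n : ℤ) : qInt q (-n) = -(((-1) ^ n : kˣ) : k) * qInt q n := by
  unfold qInt
  have e : ∀ m : ℤ, (-q) ^ m = (-1) ^ m * q ^ m := fun m => by rw [neg_eq_neg_one_mul, mul_zpow]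
  have h1 : ((-1 : kˣ) ^ (-n)) = (-1) ^ n := by rw [zpow_neg, ← inv_zpow]; simp
  have h2 : (((-1) ^ n : kˣ) : k) * (((-1) ^ n : kˣ) : k) = 1 := by
    rw [← Units.val_mul, ← mul_zpow]; simp
  rw [neg_neg, e, e, h1, Units.val_mul, Units.val_mul, ← mul_div_assoc]
  congr 1
  generalize (((-1) ^ n : kˣ) : k) = t at h2
  linear_combination -(((q ^ (-n) : kˣ)) : k) * h2

/-- The structure constants of the module generated by a highest weight vector of weight `a`,
see `OspMod.Et_Ft_pow_succ`. -/
def hwCoeff (q : kˣ) (a : ℤ) : ℕ → k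
  | 0 => 0
  | m + 1 => qInt q (a - 2 * m) - hwCoeff q a m

theorem qInt_mul_sub (hq : ∀ n : ℕ, 0 < n → q ^ n ≠ 1) (a m : ℤ) :
    qInt q (m + 1) * qInt q (a - m) - qInt q m * qInt q (a + 1 - m) =
      (((-1) ^ m : kˣ) : k) * qInt q (a - 2 * m) := by
  have h0 := add_inv_ne_zero hq
  unfold qInt
  have e : ∀ m : ℤ, (-q) ^ m = (-1) ^ m * q ^ m := fun m => by rw [neg_eq_neg_one_mul, mul_zpow]
  have s : ∀ n : ℤ, ((-1 : kˣ) ^ (-n)) = (-1) ^ n := fun n => by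
    rw [zpow_neg, ← inv_zpow]; simp
  simp only [e, s, neg_sub, neg_add, Units.val_mul]
  have hm := Units.ne_zero (q ^ m)
  have ha := Units.ne_zero (q ^ a)
  have hq0 := Units.ne_zero q
  simp only [zpow_sub, zpow_add, zpow_neg, Units.val_mul, Units.val_inv_eq_inv_val, zpow_one,
    two_mul, Units.val_neg, Units.val_one, inv_neg, inv_one, Units.val_inv_eq_inv_val] at h0 ⊢
  have t1 : (((-1 : kˣ) ^ m : kˣ) : k) * (((-1) ^ m : kˣ) : k) = 1 := by
    rw [← Units.val_mul, ← mul_zpow]; simp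
  have t1' : (((-1 : kˣ) ^ m : kˣ) : k)⁻¹ = (((-1) ^ m : kˣ) : k) := by
    rw [← Units.val_inv_eq_inv_val, ← zpow_neg, s]
  simp only [t1']
  generalize (((-1 : kˣ) ^ m : kˣ) : k) = s at *
  generalize (((-1 : kˣ) ^ a : kˣ) : k) = t at *
  generalize ((q ^ m : kˣ) : k) = x at *
  generalize ((q ^ a : kˣ) : k) = y at *
  generalize (q : k) = z at *
  have hz : z ^ 2 + 1 ≠ 0 := fun h => h0 (by field_simp; simpa using h)
  field_simp
  linear_combination (z ^ 2 + 1) * x ^ 4 * s / t * t1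

theorem neg_one_pow_mul_hwCoeff (hq : ∀ n : ℕ, 0 < n → q ^ n ≠ 1) (a : ℤ) (m : ℕ) :
    (((-1) ^ (m : ℤ) : kˣ) : k) * hwCoeff q a m = -(qInt q m * qInt q (a + 1 - m)) := by
  induction m with
  | zero => simp [hwCoeff, qInt_zero]
  | succ m ih =>
    have h := qInt_mul_sub hq a m
    have e : a + 1 - ((m + 1 : ℕ) : ℤ) = a - m := by push_cast; ring
    rw [e]
    have e2 : (((-1) ^ ((m + 1 : ℕ) : ℤ) : kˣ) : k) = -(((-1) ^ (m : ℤ) : kˣ) : k) := by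
      rw [zpow_natCast, zpow_natCast, pow_succ]; simp
    rw [e2, hwCoeff]
    push_cast at h ih ⊢
    linear_combination ih + h

theorem hwCoeff_ne_zero (hq : ∀ n : ℕ, 0 < n → q ^ n ≠ 1) {a : ℤ} {m : ℕ} (hm : m ≠ 0)
    (ha : a + 1 ≠ m) : hwCoeff q a m ≠ 0 := by
  intro h
  have h1 := neg_one_pow_mul_hwCoeff hq a m
  rw [h, mul_zero, eq_comm, neg_eq_zero] at h1
  rcases mul_eq_zero.1 h1 with h2 | h2
  · exact qInt_ne_zero hq (by exact_mod_cast hm) h2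
  · exact qInt_ne_zero hq (by omega) h2

end QInt

/-! ### Highest weight theory -/

section HighestWeight

variable {k : Type u} [Field k] {V : Type w} [AddCommGroup V] [Module k V]

/-- The numbers `c_0 = 0`, `c_{j+1} = γ_j - c_j`. -/
def altCoeff (γ : ℕ → k) : ℕ → k
  | 0 => 0
  | j + 1 => γ j - altCoeff γ j

/-- Moving `A` past the powers of `B`, for operators whose anticommutator acts on `B^j v` by the
scalar `γ_j`. -/
theorem apply_pow_succ {A B : Module.End k V} {v : V} {γ : ℕ → k} (hA : A v = 0)
    (h : ∀ j : ℕ, A (B ((B ^ j) v)) + B (A ((B ^ j) v)) = γ j • (B ^ j) v) (j : ℕ) :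
    A ((B ^ (j + 1)) v) = altCoeff γ (j + 1) • (B ^ j) v := by
  induction j with
  | zero => simpa [altCoeff, hA] using h 0
  | succ j ih =>
    have := h (j + 1)
    rw [ih, map_smul] at this
    rw [pow_succ', Module.End.mul_apply, altCoeff, sub_smul, ← this, pow_succ', Module.End.mul_apply,
      add_sub_cancel_right]

/-- If `B` acts nilpotently on `v`, then one of the constants `c_{j+1}` vanishes, namely the one
which belongs to the last nonzero vector `B^j v`. -/
theorem exists_altCoeff_eq_zero {A B : Module.End k V} {v : V} {γ : ℕ → k} (hv : v ≠ 0)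
    (hA : A v = 0)
    (h : ∀ j : ℕ, A (B ((B ^ j) v)) + B (A ((B ^ j) v)) = γ j • (B ^ j) v)
    (hB : ∃ N, (B ^ N) v = 0) : ∃ j, altCoeff γ (j + 1) = 0 ∧ (B ^ j) v ≠ 0 := by
  classical
  have h1 := Nat.find_spec hB
  have h2 : Nat.find hB ≠ 0 := fun h0 => by rw [h0] at h1; exact hv (by simpa using h1)
  obtain ⟨j, hj⟩ := Nat.exists_eq_succ_of_ne_zero h2
  have h3 : (B ^ j) v ≠ 0 := Nat.find_min hB (by omega)
  refine ⟨j, ?_, h3⟩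
  have h4 := apply_pow_succ hA h j
  rw [hj] at h1
  rw [h1, map_zero, eq_comm] at h4
  exact (smul_eq_zero.1 h4).resolve_right h3

end HighestWeight

namespace OspMod

section Total

variable {k : Type u} [Field k] {q : kˣ} (X : OspMod k q)

/-- The sum of all the operators `E_n`. -/
noncomputable def Et : Module.End k X.toSVec.carrier := ∑ᶠ n, X.E n

/-- The sum of all the operators `F_n`. -/
noncomputable def Ft : Module.End k X.toSVec.carrier := ∑ᶠ n, X.F n

variable {X} {a b : ℤ} {s : ZMod 2} {v : X.toSVec.carrier}

theorem Et_apply (h : X.e a v = v) : X.Et v = X.E a v :=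
  finsum_eval _ (X.finite_wt.subset fun i hi hi' => hi (E_eq_zero hi')) a v fun n hn => by
    rw [← X.E_e, ← h, X.e_e hn, map_zero]

theorem Ft_apply (h : X.e a v = v) : X.Ft v = X.F a v :=
  finsum_eval _ (X.finite_wt.subset fun i hi hi' => hi (F_eq_zero hi')) a v fun n hn => by
    rw [← X.F_e, ← h, X.e_e hn, map_zero]

theorem e_Et (h : X.e a v = v) : X.e (a + 2) (X.Et v) = X.Et v := by
  rw [Et_apply h, X.e_E]

theorem e_Ft (h : X.e a v = v) : X.e (a - 2) (X.Ft v) = X.Ft v := by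
  rw [Ft_apply h, X.e_F]

theorem e_Et_pow (h : X.e a v = v) (j : ℕ) : X.e (a + 2 * j) ((X.Et ^ j) v) = (X.Et ^ j) v := by
  induction j with
  | zero => simpa using h
  | succ j ih =>
    have := e_Et ih
    rwa [pow_succ', Module.End.mul_apply, Nat.cast_succ, mul_add, mul_one, ← add_assoc]

theorem e_Ft_pow (h : X.e a v = v) (j : ℕ) : X.e (a - 2 * j) ((X.Ft ^ j) v) = (X.Ft ^ j) v := by
  induction j with
  | zero => simpa using h
  | succ j ih =>
    have := e_Ft ih
    rwa [pow_succ', Module.End.mul_apply, Nat.cast_succ, mul_add, mul_one, ← sub_sub]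

theorem Et_Ft (h : X.e a v = v) : X.Et (X.Ft v) + X.Ft (X.Et v) = qInt q a • v := by
  rw [Et_apply (e_Ft h), Ft_apply (e_Et h), Et_apply h, Ft_apply h, X.E_F, h]

theorem Et_mem : X.Et ∈ (X.gr.hom X.gr).part 1 :=
  finsum_induction _ (zero_mem _) (fun _ _ => add_mem) X.E_mem

theorem Ft_mem : X.Ft ∈ (X.gr.hom X.gr).part 1 :=
  finsum_induction _ (zero_mem _) (fun _ _ => add_mem) X.F_mem

theorem pow_mem_part {A : Module.End k X.toSVec.carrier} (hA : A ∈ (X.gr.hom X.gr).part 1)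
    (hv : v ∈ X.gr.part s) (j : ℕ) : (A ^ j) v ∈ X.gr.part (s + j) := by
  induction j with
  | zero => simpa using hv
  | succ j ih =>
    rw [pow_succ', Module.End.mul_apply]
    exact SuperGrading.part_mem_cast (hA _ _ ih) (by push_cast; ring)

theorem exists_Et_pow_eq_zero (h : X.e a v = v) : ∃ N, (X.Et ^ N) v = 0 := by
  by_contra! hN
  refine Set.infinite_of_injective_forall_mem (f := fun j : ℕ => a + 2 * (j : ℤ))
    (fun i j hij => by simpa using hij) (fun j => ?_) X.finite_wt
  exact fun h0 => hN j (by rw [← e_Et_pow h, h0, LinearMap.zero_apply])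

theorem exists_Ft_pow_eq_zero (h : X.e a v = v) : ∃ N, (X.Ft ^ N) v = 0 := by
  by_contra! hN
  refine Set.infinite_of_injective_forall_mem (f := fun j : ℕ => a - 2 * (j : ℤ))
    (fun i j hij => by simpa using hij) (fun j => ?_) X.finite_wt
  exact fun h0 => hN j (by rw [← e_Ft_pow h, h0, LinearMap.zero_apply])

theorem altCoeff_qInt (a : ℤ) (j : ℕ) :
    altCoeff (fun j : ℕ => qInt q (a - 2 * j)) j = hwCoeff q a j := by
  induction j with
  | zero => rfl
  | succ j ih => rw [altCoeff, hwCoeff, ih]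

theorem altCoeff_qInt_neg (a : ℤ) (j : ℕ) :
    altCoeff (fun j : ℕ => qInt q (a + 2 * j)) j =
      -(((-1) ^ a : kˣ) : k) * hwCoeff q (-a) j := by
  induction j with
  | zero => simp [altCoeff, hwCoeff]
  | succ j ih =>
    have e : a + 2 * (j : ℤ) = -(-a - 2 * j) := by ring
    have e2 : ((-1 : kˣ)) ^ (-a - 2 * (j : ℤ)) = (-1) ^ a := by
      rw [zpow_sub, zpow_mul, zpow_neg, ← inv_zpow]; simp
    rw [altCoeff, hwCoeff, ih, e, qInt_neg, e2]
    ring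

/-- `E F^{j+1} v = c_{j+1} F^j v` for a highest weight vector `v`. -/
theorem Et_Ft_pow_succ (h : X.e a v = v) (hE : X.Et v = 0) (j : ℕ) :
    X.Et ((X.Ft ^ (j + 1)) v) = hwCoeff q a (j + 1) • (X.Ft ^ j) v := by
  rw [apply_pow_succ hE (fun j => Et_Ft (e_Ft_pow h j)), altCoeff_qInt]

/-- `E^{j+1} F x = c_{j+1} E^j x` if `x` is of weight `n - 2j` and `n` is the highest weight. -/
theorem Et_pow_succ_Ft {n : ℤ} (hn : X.Et ∘ₗ X.e n = 0) (j : ℕ) {x : X.toSVec.carrier}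
    (h : X.e (n - 2 * j) x = x) :
    (X.Et ^ (j + 1)) (X.Ft x) = hwCoeff q n (j + 1) • (X.Et ^ j) x := by
  induction j generalizing x with
  | zero =>
    have h0 : X.e n x = x := by simpa using h
    have h1 := Et_Ft h0
    have h2 : X.Et x = 0 := by rw [← h0]; exact LinearMap.congr_fun hn x
    rw [h2, map_zero, add_zero] at h1
    simpa [hwCoeff] using h1
  | succ j ih =>
    have h1 := Et_Ft h
    have h2 : X.e (n - 2 * j) (X.Et x) = X.Et x := by
      have := e_Et h
      push_cast at this
      rwa [show n - 2 * ((j : ℤ) + 1) + 2 = n - 2 * j by ring] at this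
    rw [pow_succ, Module.End.mul_apply, ← sub_eq_iff_eq_add.2 h1.symm, map_sub, ih h2, map_smul,
      ← Module.End.mul_apply (X.Et ^ j), ← pow_succ, hwCoeff.eq_2 q n (j + 1), sub_smul]

variable (hq : ∀ n : ℕ, 0 < n → q ^ n ≠ 1)
include hq

/-- The weight of a highest weight vector is not negative. -/
theorem highest_weight_nonneg (h : X.e a v = v) (hE : X.Et v = 0) (hv : v ≠ 0) : 0 ≤ a := by
  obtain ⟨j, hj, -⟩ := exists_altCoeff_eq_zero hv hE (fun j => Et_Ft (e_Ft_pow h j))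
    (exists_Ft_pow_eq_zero h)
  rw [altCoeff_qInt] at hj
  by_contra! ha
  exact hwCoeff_ne_zero hq (by omega) (by push_cast; omega) hj

/-- The vector `F^{n+1} v` is a highest weight vector of negative weight `-n-2`. -/
theorem Ft_pow_eq_zero {n : ℕ} (h : X.e n v = v) (hE : X.Et v = 0) : (X.Ft ^ (n + 1)) v = 0 := by
  by_contra hv
  have h1 := e_Ft_pow h (n + 1)
  have h2 : X.Et ((X.Ft ^ (n + 1)) v) = 0 := by
    have h3 := neg_one_pow_mul_hwCoeff hq (n : ℤ) (n + 1)
    rw [Nat.cast_succ, sub_self, qInt_zero, mul_zero, neg_zero] at h3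
    rw [Et_Ft_pow_succ h hE, (mul_eq_zero.1 h3).resolve_left (Units.ne_zero _), zero_smul]
  have := highest_weight_nonneg hq h1 h2 hv
  push_cast at this
  omega

/-- If all weights are at most `n`, then they are at least `-n`. -/
theorem e_eq_zero_of_lt_neg {n : ℤ} (hn : ∀ b, n < b → X.e b = 0) {b : ℤ} (hb : b < -n) :
    X.e b = 0 := by
  by_contra hb0
  have hfin : {m : ℤ | X.e m ≠ 0 ∧ m < -n}.Finite := X.finite_wt.subset fun m hm => hm.1
  obtain ⟨c, ⟨hc, hcn⟩, hmin⟩ := hfin.exists_minimal ⟨b, hb0, hb⟩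
  obtain ⟨v, hv⟩ : ∃ v, X.e c v ≠ 0 := by
    by_contra! h
    exact hc (LinearMap.ext h)
  have h := X.e_e_self c v
  have hF : X.Ft (X.e c v) = 0 := by
    by_contra h0
    have h1 : X.e (c - 2) ≠ 0 := fun h1 => h0 (by rw [← e_Ft h, h1, LinearMap.zero_apply])
    have := hmin ⟨h1, by omega⟩ (by omega)
    omega
  obtain ⟨j, hj, hj0⟩ := exists_altCoeff_eq_zero hv hF
    (fun j => by rw [add_comm]; exact Et_Ft (e_Et_pow h j)) (exists_Et_pow_eq_zero h)
  rw [altCoeff_qInt_neg] at hj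
  have h2 : hwCoeff q (-c) (j + 1) = 0 := by
    refine (mul_eq_zero.1 hj).resolve_left (neg_ne_zero.2 (Units.ne_zero _))
  have h3 : -c + 1 = ((j + 1 : ℕ) : ℤ) := by
    by_contra h3
    exact hwCoeff_ne_zero hq (by omega) h3 h2
  push_cast at h3
  exact hj0 (by rw [← e_Et_pow h, hn _ (by omega), LinearMap.zero_apply])

end Total

section HwMap

variable {k : Type u} [Field k] {q : kˣ} {M N : OspMod k q}

/-- For a module `M` of highest weight `n`, a functional `lam` on `M` and a highest weight
vector `u` of weight `n` in `N`, this is the map `M → N` which sends a vector `x` of weight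
`n - 2j` to a multiple of `lam (E^j x) • F^j u`, where the multiple is chosen in such a way that
the map is a homomorphism of parity `p`. -/
noncomputable def hwMap (p : ZMod 2) (n : ℕ) (lam : M.toSVec.carrier →ₗ[k] k)
    (u : N.toSVec.carrier) : M.toSVec.carrier →ₗ[k] N.toSVec.carrier :=
  ∑ j ∈ Finset.range (n + 1),
    (superSign k p ^ j * (∏ i ∈ Finset.range j, hwCoeff q n (i + 1))⁻¹) •
      (lam ∘ₗ (M.Et ^ j : Module.End k _) ∘ₗ M.e (n - 2 * j)).smulRight ((N.Ft ^ j) u)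

variable {p s t : ZMod 2} {n : ℕ} {lam : M.toSVec.carrier →ₗ[k] k} {u : N.toSVec.carrier}

theorem hwMap_apply {j : ℕ} (hj : j ≤ n) {x : M.toSVec.carrier} (hx : M.e (n - 2 * j) x = x) :
    hwMap p n lam u x = (superSign k p ^ j * (∏ i ∈ Finset.range j, hwCoeff q n (i + 1))⁻¹ *
      lam ((M.Et ^ j) x)) • (N.Ft ^ j) u := by
  rw [hwMap, LinearMap.sum_apply, Finset.sum_eq_single_of_mem j (Finset.mem_range.2 (by omega))]
  · simp [hx, smul_smul]
  · intro i _ hi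
    have : M.e ((n : ℤ) - 2 * i) x = 0 := by rw [← hx, M.e_e (by omega)]
    simp [this]

theorem hwMap_eq_zero {b : ℤ} {x : M.toSVec.carrier} (hx : M.e b x = x)
    (hb : ∀ j : ℕ, j ≤ n → b ≠ n - 2 * j) : hwMap (N := N) p n lam u x = 0 := by
  rw [hwMap, LinearMap.sum_apply]
  refine Finset.sum_eq_zero fun i hi => ?_
  have : M.e ((n : ℤ) - 2 * i) x = 0 := by
    rw [← hx, M.e_e (hb i (by simpa [Nat.lt_succ_iff] using hi)).symm]
  simp [this]

theorem hwMap_mem (hlam : ∀ x ∈ M.gr.part (s + 1), lam x = 0) (hu : u ∈ N.gr.part t) :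
    hwMap p n lam u ∈ (M.gr.hom N.gr).part (s + t) := by
  refine sum_mem fun j _ => Submodule.smul_mem _ _ fun r x hx => ?_
  rw [LinearMap.smulRight_apply]
  have h1 : (M.Et ^ j) (M.e (n - 2 * j) x) ∈ M.gr.part (r + j) :=
    pow_mem_part Et_mem (SuperGrading.part_mem_cast (M.e_mem _ _ _ hx) (add_zero r)) j
  by_cases hs : r + j = s
  · refine Submodule.smul_mem _ _ (SuperGrading.part_mem_cast (pow_mem_part Ft_mem hu j) ?_)
    rw [← hs, ← add_assoc, ← add_assoc, zmod2_add_self, zero_add, add_comm]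
  · have : r + (j : ZMod 2) = s + 1 := by
      have key : ∀ a b : ZMod 2, a ≠ b → a = b + 1 := by decide
      exact key _ _ hs
    rw [this] at h1
    rw [LinearMap.comp_apply, LinearMap.comp_apply, hlam _ h1, zero_smul]
    exact zero_mem _

theorem hwMap_mem_homs (hq : ∀ n : ℕ, 0 < n → q ^ n ≠ 1) (hM : ∀ b : ℤ, n < b → M.e b = 0)
    (hlam : ∀ x ∈ M.gr.part (s + 1), lam x = 0) (hu : N.IsWt n t u) (hE : N.Et u = 0) :
    hwMap (s + t) n lam u ∈ homs M N := by
  have hM' : ∀ b : ℤ, b < -n → M.e b = 0 := fun b => e_eq_zero_of_lt_neg hq hM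
  have hEn : M.Et ∘ₗ M.e n = 0 := LinearMap.ext fun x => by
    have := e_Et (M.e_e_self n x)
    rw [LinearMap.comp_apply, ← this, hM _ (by omega)]
    rfl
  have hF : (N.Ft ^ (n + 1)) u = 0 := Ft_pow_eq_zero hq hu.1 hE
  have hsq := superSign_mul_self (k := k) (s + t)
  have hc : ∀ j : ℕ, j < n → hwCoeff q (n : ℤ) (j + 1) ≠ 0 := fun j hj =>
    hwCoeff_ne_zero hq (by omega) (by omega)
  refine mem_homs_of_wt (hwMap_mem hlam hu.2) M.IsWt (fun _ _ _ h => h)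
    (fun g h H => ext_wt H) ?_ ?_ ?_
  · intro a r x hx
    by_cases h : ∃ j : ℕ, j ≤ n ∧ a = n - 2 * j
    · obtain ⟨j, hj, rfl⟩ := h
      rw [hwMap_apply hj hx.1, map_smul, e_Ft_pow hu.1]
    · push Not at h
      rw [hwMap_eq_zero hx.1 h, map_zero]
  · intro a r x hx
    have hx' : M.e (a + 2) (M.E a x) = M.E a x := M.e_E a x
    by_cases h : ∃ j : ℕ, j ≤ n ∧ a = n - 2 * j
    · obtain ⟨j, hj, rfl⟩ := h
      rw [hwMap_apply hj hx.1, map_smul, ← Et_apply (e_Ft_pow hu.1 j)]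
      cases j with
      | zero =>
        have : M.E (n - 2 * (0 : ℕ)) x = 0 := by
          rw [← hx', hM _ (by push_cast; omega), LinearMap.zero_apply]
        rw [this, map_zero]
        simp [hE]
      | succ i =>
        have e1 : (n : ℤ) - 2 * ((i + 1 : ℕ) : ℤ) + 2 = n - 2 * i := by push_cast; ring
        rw [e1] at hx'
        rw [hwMap_apply (by omega) hx', Et_Ft_pow_succ hu.1 hE, ← Et_apply hx.1, smul_smul,
          smul_smul, Finset.prod_range_succ, pow_succ (superSign k (s + t)), pow_succ M.Et,
          Module.End.mul_apply, mul_inv]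
        congr 1
        have := hc i (by omega)
        field_simp
        linear_combination -(superSign k (s + t)) ^ i * lam ((M.Et ^ i) (M.Et x)) *
          (∏ i ∈ Finset.range i, hwCoeff q (n : ℤ) (i + 1))⁻¹ * hsq
    · push Not at h
      rw [hwMap_eq_zero hx.1 h, map_zero, smul_zero]
      by_cases h' : a = -n - 2
      · have : x = 0 := by rw [← hx.1, hM' _ (by omega), LinearMap.zero_apply]
        rw [this, map_zero, map_zero]
      · refine hwMap_eq_zero hx' fun j hj hj' => ?_
        have := h (j + 1)
        push_cast at this
        omega
  · intro a r x hx
    have hx' : M.e (a - 2) (M.F a x) = M.F a x := M.e_F a x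
    by_cases h : ∃ j : ℕ, j ≤ n ∧ a = n - 2 * j
    · obtain ⟨j, hj, rfl⟩ := h
      have e1 : (n : ℤ) - 2 * (j : ℤ) - 2 = n - 2 * (j + 1 : ℕ) := by push_cast; ring
      rw [hwMap_apply hj hx.1, map_smul, ← Ft_apply (e_Ft_pow hu.1 j), ← Module.End.mul_apply N.Ft,
        ← pow_succ']
      rw [e1] at hx'
      rcases Nat.lt_or_ge j n with hjn | hjn
      · rw [hwMap_apply (by omega) hx', ← Ft_apply hx.1, Et_pow_succ_Ft hEn j hx.1, map_smul,
          smul_smul, Finset.prod_range_succ, pow_succ (superSign k (s + t)), mul_inv]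
        congr 1
        have := hc j hjn
        rw [smul_eq_mul]
        field_simp
      · obtain rfl : j = n := by omega
        rw [hF, smul_zero, smul_zero]
        refine hwMap_eq_zero hx' fun i hi hi' => ?_
        push_cast at hi'
        omega
    · push Not at h
      rw [hwMap_eq_zero hx.1 h, map_zero, smul_zero]
      by_cases h' : a = n + 2
      · have : x = 0 := by rw [← hx.1, hM _ (by omega), LinearMap.zero_apply]
        rw [this, map_zero, map_zero]
      · refine hwMap_eq_zero hx' fun j hj hj' => ?_
        cases j with
        | zero => push_cast at hj'; omega
        | succ j =>
          have := h j (by omega)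
          push_cast at hj'
          omega

end HwMap

end OspMod

/-! ### Direct summands, parity shifts and finite direct sums of supermodules -/

namespace OspMod

variable {k : Type u} [Field k] {q : kˣ} {M N X Y : OspMod k q}

/-- A homogeneous linear map is a homomorphism if it supercommutes with the generators. -/
theorem mem_homs_of_ops {p : ZMod 2} {f : X.toSVec.carrier →ₗ[k] Y.toSVec.carrier}
    (hf : f ∈ (X.gr.hom Y.gr).part p) (he : ∀ n v, f (X.e n v) = Y.e n (f v))
    (hE : ∀ n v, f (X.E n v) = superSign k p • Y.E n (f v))
    (hF : ∀ n v, f (X.F n v) = superSign k p • Y.F n (f v)) : f ∈ homs X Y := by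
  refine mem_homs_of_gen hf fun x v => ?_
  cases x with
  | e n => rw [OspGen.parity, mul_zero, superSign_zero, one_smul]; exact he n v
  | E n => rw [OspGen.parity, mul_one]; exact hE n v
  | F n => rw [OspGen.parity, mul_one]; exact hF n v

section Homs

variable {p : ZMod 2} {f : X.toSVec.carrier →ₗ[k] Y.toSVec.carrier}

theorem homs_e (hf : f ∈ homs X Y) (n : ℤ) (v) : f (X.e n v) = Y.e n (f v) := by
  refine homs_induction (C := fun f => f (X.e n v) = Y.e n (f v)) (fun p f h h' => ?_)
    (fun f g h h' => ?_) hf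
  · have := homs_apply h' h (.gen (.e n)) v
    rw [OspGen.parity, mul_zero, superSign_zero, one_smul] at this
    exact this
  · rw [LinearMap.add_apply, LinearMap.add_apply, map_add, h, h']

theorem homs_E (hf : f ∈ homs X Y) (hp : f ∈ (X.gr.hom Y.gr).part p) (n : ℤ) (v) :
    f (X.E n v) = superSign k p • Y.E n (f v) := by
  have := homs_apply hf hp (.gen (.E n)) v
  rw [OspGen.parity, mul_one] at this
  exact this

theorem homs_F (hf : f ∈ homs X Y) (hp : f ∈ (X.gr.hom Y.gr).part p) (n : ℤ) (v) :
    f (X.F n v) = superSign k p • Y.F n (f v) := by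
  have := homs_apply hf hp (.gen (.F n)) v
  rw [OspGen.parity, mul_one] at this
  exact this

end Homs

section Ops

variable {V : SVec k} (A : OspOps k q V) (h : Module.Finite k V.carrier)

theorem toOspMod_e (n : ℤ) : (A.toOspMod h).e n = A.e n := A.act_gen _
theorem toOspMod_E (n : ℤ) : (A.toOspMod h).E n = A.E n := A.act_gen _
theorem toOspMod_F (n : ℤ) : (A.toOspMod h).F n = A.F n := A.act_gen _

theorem mem_iSup_range {V : Type*} [AddCommGroup V] [Module k V] {e : ℤ → Module.End k V}
    (g : X.toSVec.carrier →ₗ[k] V) (hg : ∀ n v, g (X.e n v) = e n (g v))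
    (v : X.toSVec.carrier) : g v ∈ ⨆ n : ℤ, LinearMap.range (e n) := by
  have hv : v ∈ ⨆ n : ℤ, LinearMap.range (X.e n) := X.locally_unital ▸ Submodule.mem_top
  refine Submodule.iSup_induction _ (motive := fun v => g v ∈ ⨆ n : ℤ, LinearMap.range (e n)) hv
    ?_ (by simp) ?_
  · rintro n _ ⟨v, rfl⟩
    rw [hg]
    exact Submodule.mem_iSup_of_mem n ⟨_, rfl⟩
  · intro v w hv hw
    rw [map_add]
    exact add_mem hv hw

end Ops

section Split

variable (f : Module.End k M.toSVec.carrier) (hf : f ∈ (M.gr.hom M.gr).part 0)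
    (hf' : ∀ v, f (f v) = f v)

/-- The range of an even idempotent, as a superspace. -/
noncomputable def rangeSVec : SVec k where
  carrier := LinearMap.range f
  grading := SuperGrading.ofProj (fun p => (M.gr.part p).comap (LinearMap.range f).subtype)
    (fun p => (M.gr.proj p).restrict (p := LinearMap.range f) (q := LinearMap.range f) (by
      rintro _ ⟨v, rfl⟩
      refine ⟨M.gr.proj p (f v), ?_⟩
      have h0 : ∀ r, f (M.gr.proj r (f v)) ∈ M.gr.part r := fun r =>
        SuperGrading.part_mem_cast (hf _ _ (M.gr.proj_mem r _)) (add_zero r)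
      have h1 : f (M.gr.proj 0 (f v)) + f (M.gr.proj 1 (f v)) = f v := by
        rw [← map_add, M.gr.proj_add_proj, hf']
      have h2 := congrArg (M.gr.proj p) h1
      rw [map_add, SuperGrading.proj_of_mem' _ p (h0 0), SuperGrading.proj_of_mem' _ p (h0 1)] at h2
      rw [← h2]
      rcases zmod2_cases p with rfl | rfl <;> simp [hf']))
    (fun p v => M.gr.proj_mem p v.1)
    (fun v => Subtype.ext (M.gr.proj_add_proj v.1))
    (fun p v hv => Subtype.ext (M.gr.proj_of_mem_ne hv
      ((by decide : ∀ p : ZMod 2, p + 1 ≠ p) p)))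

/-- The operators of a supermodule, restricted to the range of an even idempotent. -/
noncomputable def rangeOps (he : ∀ n v, f (M.e n v) = M.e n (f v))
    (hE : ∀ n v, f (M.E n v) = M.E n (f v)) (hF : ∀ n v, f (M.F n v) = M.F n (f v)) :
    OspOps k q (rangeSVec f hf hf') where
  e n := (M.e n).restrict (p := LinearMap.range f) (q := LinearMap.range f) (by
    rintro _ ⟨v, rfl⟩; exact ⟨_, he n v⟩)
  E n := (M.E n).restrict (p := LinearMap.range f) (q := LinearMap.range f) (by
    rintro _ ⟨v, rfl⟩; exact ⟨_, hE n v⟩)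
  F n := (M.F n).restrict (p := LinearMap.range f) (q := LinearMap.range f) (by
    rintro _ ⟨v, rfl⟩; exact ⟨_, hF n v⟩)
  e_mem n := fun p v hv => M.e_mem n p v.1 hv
  E_mem n := fun p v hv => M.E_mem n p v.1 hv
  F_mem n := fun p v hv => M.F_mem n p v.1 hv
  e_e_self n v := Subtype.ext (M.e_e_self n v.1)
  e_e m n v h := Subtype.ext (M.e_e h v.1)
  e_E n v := Subtype.ext (M.e_E n v.1)
  E_e n v := Subtype.ext (M.E_e n v.1)
  e_F n v := Subtype.ext (M.e_F n v.1)
  F_e n v := Subtype.ext (M.F_e n v.1)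
  E_F n v := Subtype.ext (M.E_F n v.1)
  locally_unital := by
    refine eq_top_iff.2 fun v _ => ?_
    obtain ⟨w, hw⟩ := v.2
    have : v = f.rangeRestrict w := Subtype.ext hw.symm
    rw [this]
    exact mem_iSup_range _ (fun n v => Subtype.ext (he n v)) w

/-- Even idempotents split. -/
theorem exists_split (f : M ⟶ M) (hf : HomParity k 0 f) (h : f ≫ f = f) :
    ∃ (N : OspMod k q) (i : N ⟶ M) (r : M ⟶ N), HomParity k 0 i ∧ HomParity k 0 r ∧
      i ≫ r = 𝟙 N ∧ r ≫ i = f ∧ 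
      Module.finrank k N.toSVec.carrier = Module.finrank k (LinearMap.range (lin f)) := by
  have := M.finite
  have hf0 := parity_iff.1 hf
  have hff : ∀ v, lin f (lin f v) = lin f v := fun v => LinearMap.congr_fun (congrArg lin h) v
  have hE : ∀ n v, lin f (M.E n v) = M.E n (lin f v) := fun n v => by
    rw [homs_E (lin_mem f) hf0, superSign_zero, one_smul]
  have hF : ∀ n v, lin f (M.F n v) = M.F n (lin f v) := fun n v => by
    rw [homs_F (lin_mem f) hf0, superSign_zero, one_smul]
  let A := rangeOps (lin f) hf0 hff (homs_e f.2) hE hF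
  have hfin : Module.Finite k (rangeSVec (lin f) hf0 hff).carrier :=
    inferInstanceAs (Module.Finite k (LinearMap.range (lin f)))
  have hi : (LinearMap.range (lin f)).subtype ∈ ((A.toOspMod hfin).gr.hom M.gr).part 0 :=
    fun p v hv => SuperGrading.part_mem_cast hv (add_zero p).symm
  have hr : (lin f).rangeRestrict ∈ (M.gr.hom (A.toOspMod hfin).gr).part 0 :=
    fun p v hv => hf0 p v hv
  refine ⟨A.toOspMod hfin, ofLin (LinearMap.range (lin f)).subtype (mem_homs_of_ops hi ?_ ?_ ?_),
    ofLin (lin f).rangeRestrict (mem_homs_of_ops hr ?_ ?_ ?_), parity_iff.2 hi, parity_iff.2 hr,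
    hom_ext (LinearMap.ext ?_), hom_ext (LinearMap.ext fun v => rfl), rfl⟩
  · intro n v; rw [toOspMod_e]; rfl
  · intro n v; rw [toOspMod_E, superSign_zero, one_smul]; rfl
  · intro n v; rw [toOspMod_F, superSign_zero, one_smul]; rfl
  · intro n v; rw [toOspMod_e]; exact Subtype.ext (homs_e f.2 n v)
  · intro n v; rw [toOspMod_E, superSign_zero, one_smul]; exact Subtype.ext (hE n v)
  · intro n v; rw [toOspMod_F, superSign_zero, one_smul]; exact Subtype.ext (hF n v)
  · rintro ⟨_, v, rfl⟩
    exact Subtype.ext (hff v)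

instance : IsIdempotentComplete (Underlying k (OspMod k q)) where
  idempotents_split X p hp := by
    obtain ⟨N, i, r, hi, hr, h1, h2, -⟩ := exists_split (Underlying.val p) (Underlying.val_even p)
      (congrArg Underlying.val hp)
    exact ⟨⟨N⟩, Underlying.mk' i hi, Underlying.mk' r hr, Underlying.hom_ext h1,
      Underlying.hom_ext h2⟩

end Split

section Shift

variable (X)

/-- The superspace underlying a supermodule, with the parity shifted by `a`. -/
def shiftSVec (a : ZMod 2) : SVec k where
  carrier := X.toSVec.carrier
  grading :=
    { part := fun p => X.gr.part (p + a)
      isCompl := by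
        rcases zmod2_cases a with rfl | rfl
        · exact X.gr.isCompl
        · exact X.gr.isCompl.symm }

/-- The operators of a supermodule on its parity shift: odd operators are multiplied
by `(-1)^a`. -/
noncomputable def shiftOps (a : ZMod 2) : OspOps k q (X.shiftSVec a) where
  e n := X.e n
  E n := superSign k a • X.E n
  F n := superSign k a • X.F n
  e_mem n := fun p v hv => SuperGrading.part_mem_cast (G := X.gr) (X.e_mem n (p + a) v hv) (by abel)
  E_mem n := Submodule.smul_mem _ _
    fun p v hv => SuperGrading.part_mem_cast (G := X.gr) (X.E_mem n (p + a) v hv) (by abel)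
  F_mem n := Submodule.smul_mem _ _
    fun p v hv => SuperGrading.part_mem_cast (G := X.gr) (X.F_mem n (p + a) v hv) (by abel)
  e_e_self := X.e_e_self
  e_e m n v h := X.e_e h v
  e_E n v := by
    exact (map_smul (X.e (n + 2)) _ _).trans (congrArg (superSign k a • ·) (X.e_E n v))
  E_e n v := congrArg (superSign k a • ·) (X.E_e n v)
  e_F n v := by
    exact (map_smul (X.e (n - 2)) _ _).trans (congrArg (superSign k a • ·) (X.e_F n v))
  F_e n v := congrArg (superSign k a • ·) (X.F_e n v)
  E_F n v := by
    change superSign k a • X.E _ (superSign k a • X.F n v) +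
      superSign k a • X.F _ (superSign k a • X.E n v) = _
    rw [map_smul, map_smul, smul_smul, smul_smul, superSign_mul_self, one_smul, one_smul]
    exact X.E_F n v
  locally_unital := X.locally_unital

/-- The parity shift `Π^a X`. -/
noncomputable def shift (a : ZMod 2) : OspMod k q := (X.shiftOps a).toOspMod X.finite

theorem id_mem_homs_shift (a : ZMod 2) :
    (LinearMap.id : X.toSVec.carrier →ₗ[k] X.toSVec.carrier) ∈ homs X (X.shift a) := by
  refine mem_homs_of_ops (p := a) (fun p v hv => SuperGrading.part_mem_cast (G := X.gr) hv
    (by rw [add_assoc, zmod2_add_self, add_zero])) (fun n v => ?_) (fun n v => ?_) (fun n v => ?_)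
  · exact (LinearMap.congr_fun (toOspMod_e (X.shiftOps a) X.finite n) v).symm
  all_goals
    refine Eq.trans ?_ (congrArg (superSign k a • ·)
      (LinearMap.congr_fun (OspOps.act_gen (X.shiftOps a) _) v).symm)
    refine (Eq.trans (smul_smul _ _ _) ?_).symm
    rw [superSign_mul_self]
    exact one_smul k _

theorem id_mem_homs_shift' (a : ZMod 2) :
    (LinearMap.id : X.toSVec.carrier →ₗ[k] X.toSVec.carrier) ∈ homs (X.shift a) X := by
  refine mem_homs_of_ops (p := a) (fun p v hv => hv) (fun n v => ?_) (fun n v => ?_) (fun n v => ?_)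
  all_goals exact LinearMap.congr_fun (OspOps.act_gen (X.shiftOps a) _) v

/-- The identity map `X → Π^a X`, an isomorphism of parity `a`. -/
noncomputable def shiftIso (a : ZMod 2) : X ≅ X.shift a where
  hom := ofLin LinearMap.id (X.id_mem_homs_shift a)
  inv := ofLin LinearMap.id (X.id_mem_homs_shift' a)
  hom_inv_id := rfl
  inv_hom_id := rfl

theorem shiftIso_parity (a : ZMod 2) : HomParity k a (X.shiftIso a).hom :=
  parity_iff.2 fun p v hv =>
    SuperGrading.part_mem_cast (G := X.gr) hv (by rw [add_assoc, zmod2_add_self, add_zero])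

theorem shiftIso_inv_parity (a : ZMod 2) : HomParity k a (X.shiftIso a).inv :=
  parity_iff.2 fun _ _ hv => hv

end Shift

section Pi

variable {n : ℕ} (f : Fin n → OspMod k q)

/-- The product of finitely many superspaces. -/
noncomputable def piSVec : SVec k where
  carrier := ∀ j, (f j).toSVec.carrier
  grading := SuperGrading.ofProj (fun p => Submodule.pi Set.univ fun j => (f j).gr.part p)
    (fun p => LinearMap.pi fun j => (f j).gr.proj p ∘ₗ LinearMap.proj j)
    (fun p m j _ => (f j).gr.proj_mem p _)
    (fun m => funext fun j => (f j).gr.proj_add_proj _)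
    (fun p m hm => funext fun j => (f j).gr.proj_of_mem_ne (hm j trivial)
      ((by decide : ∀ p : ZMod 2, p + 1 ≠ p) p))

theorem single_apply_comp (j : Fin n) (T : ∀ j, Module.End k (f j).toSVec.carrier)
    (v : (f j).toSVec.carrier) : LinearMap.single k (fun j => (f j).toSVec.carrier) j (T j v) =
      LinearMap.pi (fun j => T j ∘ₗ LinearMap.proj j)
        (LinearMap.single k (fun j => (f j).toSVec.carrier) j v) := by
  funext i
  by_cases h : i = j
  · subst h; simp
  · simp [h]

/-- The operators of a product of supermodules. -/
noncomputable def piOps : OspOps k q (piSVec f) where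
  e n := LinearMap.pi fun j => (f j).e n ∘ₗ LinearMap.proj j
  E n := LinearMap.pi fun j => (f j).E n ∘ₗ LinearMap.proj j
  F n := LinearMap.pi fun j => (f j).F n ∘ₗ LinearMap.proj j
  e_mem n := fun p v hv j _ => (f j).e_mem n p _ (hv j trivial)
  E_mem n := fun p v hv j _ => (f j).E_mem n p _ (hv j trivial)
  F_mem n := fun p v hv j _ => (f j).F_mem n p _ (hv j trivial)
  e_e_self n v := funext fun j => (f j).e_e_self n _
  e_e m n v h := funext fun j => (f j).e_e h _
  e_E n v := funext fun j => (f j).e_E n _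
  E_e n v := funext fun j => (f j).E_e n _
  e_F n v := funext fun j => (f j).e_F n _
  F_e n v := funext fun j => (f j).F_e n _
  E_F n v := funext fun j => (f j).E_F n _
  locally_unital := by
    classical
    refine eq_top_iff.2 fun v _ => ?_
    have : v = ∑ j, LinearMap.single k (fun j => (f j).toSVec.carrier) j (v j) :=
      (LinearMap.sum_single_apply (fun j => (f j).toSVec.carrier) v).symm
    rw [this]
    exact sum_mem fun j _ => mem_iSup_range (LinearMap.single k (fun j => (f j).toSVec.carrier) j)
      (fun n x => single_apply_comp f j (fun j => (f j).e n) x) (v j)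

/-- The direct sum of finitely many supermodules. -/
noncomputable def piMod : OspMod k q :=
  (piOps f).toOspMod <| by
    have := fun j => (f j).finite
    exact inferInstanceAs (Module.Finite k (∀ j, (f j).toSVec.carrier))

theorem proj_mem_hom (j : Fin n) :
    (LinearMap.proj j : (∀ j, (f j).toSVec.carrier) →ₗ[k] (f j).toSVec.carrier) ∈
      ((piMod f).gr.hom (f j).gr).part 0 := fun p _ hv =>
  SuperGrading.part_mem_cast (hv j trivial) (add_zero p).symm

theorem single_mem_hom (j : Fin n) :
    LinearMap.single k (fun j => (f j).toSVec.carrier) j ∈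
      ((f j).gr.hom (piMod f).gr).part 0 := fun p v hv i _ => by
  change Pi.single (M := fun j => (f j).toSVec.carrier) j v i ∈ (f i).gr.part (p + 0)
  rw [add_zero]
  by_cases h : i = j
  · subst h; rwa [Pi.single_eq_same]
  · rw [Pi.single_eq_of_ne h]; exact zero_mem _

theorem piMod_e (m : ℤ) : (piMod f).e m = (piOps f).e m := toOspMod_e _ _ _
theorem piMod_E (m : ℤ) : (piMod f).E m = (piOps f).E m := toOspMod_E _ _ _
theorem piMod_F (m : ℤ) : (piMod f).F m = (piOps f).F m := toOspMod_F _ _ _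

theorem proj_mem_homs_pi (j : Fin n) :
    (LinearMap.proj j : (∀ j, (f j).toSVec.carrier) →ₗ[k] (f j).toSVec.carrier) ∈
      homs (piMod f) (f j) := by
  refine mem_homs_of_ops (proj_mem_hom f j) (fun n v => ?_) (fun n v => ?_) (fun n v => ?_)
  · rw [piMod_e]; rfl
  · rw [piMod_E, superSign_zero, one_smul]; rfl
  · rw [piMod_F, superSign_zero, one_smul]; rfl

theorem single_mem_homs_pi (j : Fin n) :
    LinearMap.single k (fun j => (f j).toSVec.carrier) j ∈ homs (f j) (piMod f) := by
  refine mem_homs_of_ops (single_mem_hom f j) (fun n v => ?_) (fun n v => ?_) (fun n v => ?_)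
  · rw [piMod_e]; exact single_apply_comp f j (fun j => (f j).e n) v
  · rw [piMod_E, superSign_zero, one_smul]
    exact single_apply_comp f j (fun j => (f j).E n) v
  · rw [piMod_F, superSign_zero, one_smul]
    exact single_apply_comp f j (fun j => (f j).F n) v

theorem lin_val_sum {ι : Type*} (S : Finset ι) {X Y : Underlying k (OspMod k q)} (g : ι → (X ⟶ Y)) :
    lin (Underlying.val (∑ i ∈ S, g i)) = ∑ i ∈ S, lin (Underlying.val (g i)) := by
  classical
  induction S using Finset.induction_on with
  | empty => rfl
  | insert a S ha ih =>
    rw [Finset.sum_insert ha, Finset.sum_insert ha, ← ih]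
    rfl

instance : Limits.HasFiniteBiproducts (Underlying k (OspMod k q)) where
  out n := by
    refine ⟨fun F => ?_⟩
    let f : Fin n → OspMod k q := fun j => (F j).of
    let b : Limits.Bicone F :=
      { pt := ⟨piMod f⟩
        π := fun j => Underlying.mk' (ofLin _ (proj_mem_homs_pi f j))
          (parity_iff.2 (proj_mem_hom f j))
        ι := fun j => Underlying.mk' (ofLin _ (single_mem_homs_pi f j))
          (parity_iff.2 (single_mem_hom f j))
        ι_π := fun i j => by
          by_cases h : i = j
          · subst h
            refine Underlying.hom_ext (hom_ext (LinearMap.ext fun v => ?_))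
            rw [dif_pos rfl]
            exact Pi.single_eq_same (M := fun j => (f j).toSVec.carrier) i v
          · refine Underlying.hom_ext (hom_ext (LinearMap.ext fun v => ?_))
            rw [dif_neg h]
            exact Pi.single_eq_of_ne' (M := fun j => (f j).toSVec.carrier) h v }
    refine Limits.hasBiproduct_of_total b (Underlying.hom_ext (hom_ext ?_))
    rw [lin_val_sum]
    refine LinearMap.ext fun v => (LinearMap.sum_apply _ _ _).trans ?_
    exact LinearMap.sum_single_apply (fun j => (f j).toSVec.carrier) v

end Pi

end OspMod

/-! ### Complete reducibility -/

namespace OspMod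

variable {k : Type u} [Field k] {q : kˣ} {M : OspMod k q}

/-- A nonzero supermodule has a highest weight vector of maximal weight. -/
theorem exists_highest (hq : ∀ n : ℕ, 0 < n → q ^ n ≠ 1) (hM : ∃ v : M.toSVec.carrier, v ≠ 0) :
    ∃ (n : ℕ) (s : ZMod 2) (v : M.toSVec.carrier), v ≠ 0 ∧ M.IsWt n s v ∧ M.Et v = 0 ∧
      ∀ b : ℤ, n < b → M.e b = 0 := by
  have hne : {n : ℤ | M.e n ≠ 0}.Nonempty := by
    by_contra h
    rw [Set.not_nonempty_iff_eq_empty] at h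
    obtain ⟨v, hv⟩ := hM
    have h0 : (LinearMap.id : Module.End k M.toSVec.carrier) = 0 := ext_wt fun a s v hv => by
      have : M.e a = 0 := by
        by_contra h1
        exact (Set.ext_iff.1 h a).1 h1
      rw [LinearMap.id_apply, ← hv.1, this, LinearMap.zero_apply, LinearMap.zero_apply]
    exact hv (LinearMap.congr_fun h0 v)
  obtain ⟨a, ha, hmax⟩ := M.finite_wt.exists_maximal hne
  have hmax' : ∀ b : ℤ, a < b → M.e b = 0 := fun b hb => by
    by_contra h
    have := hmax h hb.le
    omega
  obtain ⟨w, hw⟩ : ∃ w, M.e a w ≠ 0 := by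
    by_contra! h
    exact ha (LinearMap.ext h)
  obtain ⟨s, v, hv0, hv⟩ : ∃ s v, v ≠ 0 ∧ M.IsWt a s v := by
    by_contra! h
    have h1 : ∀ s, M.e a (M.gr.proj s w) = 0 := fun s => by
      by_contra h0
      exact h s _ h0 ⟨M.e_e_self _ _,
        SuperGrading.part_mem_cast (M.e_mem _ _ _ (M.gr.proj_mem s w)) (add_zero s)⟩
    exact hw (by rw [← M.gr.proj_add_proj w, map_add, h1, h1, add_zero])
  have hE : M.Et v = 0 := by
    rw [← e_Et hv.1, hmax' _ (by omega), LinearMap.zero_apply]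
  obtain ⟨n, rfl⟩ := Int.eq_ofNat_of_zero_le (highest_weight_nonneg hq hv.1 hE hv0)
  exact ⟨n, s, v, hv0, hv, hE, hmax'⟩

/-- A nonzero homogeneous vector is detected by a functional of the same parity. -/
theorem exists_functional {s : ZMod 2} {v : M.toSVec.carrier} (hv : v ∈ M.gr.part s) (h0 : v ≠ 0) :
    ∃ lam : M.toSVec.carrier →ₗ[k] k, lam v = 1 ∧ ∀ x ∈ M.gr.part (s + 1), lam x = 0 := by
  obtain ⟨f, hf⟩ := Module.Projective.exists_dual_eq_one k h0
  refine ⟨f ∘ₗ M.gr.proj s, by rw [LinearMap.comp_apply, M.gr.proj_of_mem hv, hf], fun x hx => ?_⟩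
  rw [LinearMap.comp_apply, M.gr.proj_of_mem_ne hx
    ((by decide : ∀ s : ZMod 2, s ≠ s + 1) s), map_zero]

theorem homs_Ft_pow_of_even {f : M ⟶ M} (hf : HomParity k 0 f) {a : ℤ} {v : M.toSVec.carrier}
    (hv : M.e a v = v) (hfv : lin f v = v) (j : ℕ) : lin f ((M.Ft ^ j) v) = (M.Ft ^ j) v := by
  induction j with
  | zero => simpa using hfv
  | succ j ih =>
    rw [pow_succ', Module.End.mul_apply, Ft_apply (e_Ft_pow hv j),
      homs_F (lin_mem f) (parity_iff.1 hf), ih, superSign_zero, one_smul]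

variable {W : ℕ → OspMod k q} {h : ∀ n, (W n).toSVec.carrier}

/-- A nonzero supermodule has a nonzero direct summand which is a direct summand of one of the
modules `W n`, where `W n` is any module of highest weight `n`. -/
theorem exists_summand (hq : ∀ n : ℕ, 0 < n → q ^ n ≠ 1) (hwt : ∀ n, (W n).IsWt n 0 (h n))
    (h0 : ∀ n, h n ≠ 0) (hmax : ∀ (n : ℕ) (b : ℤ), n < b → (W n).e b = 0)
    (hM : ∃ v : M.toSVec.carrier, v ≠ 0) :
    ∃ (n : ℕ) (s : ZMod 2) (a : M ⟶ W n) (b : W n ⟶ M), HomParity k s a ∧ HomParity k s b ∧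
      (a ≫ b) ≫ (a ≫ b) = a ≫ b ∧ ∃ v, v ≠ 0 ∧ lin (a ≫ b) v = v := by
  obtain ⟨n, s, v, hv0, hv, hE, hmaxM⟩ := exists_highest hq hM
  have hEh : (W n).Et (h n) = 0 := by
    rw [← e_Et (hwt n).1, hmax _ _ (by omega), LinearMap.zero_apply]
  obtain ⟨lam, hlam, hlam'⟩ := exists_functional hv.2 hv0
  obtain ⟨mu, hmu, hmu'⟩ := exists_functional (hwt n).2 (h0 n)
  have hf := hwMap_mem (p := s + 0) (n := n) hlam' (hwt n).2
  have hg := hwMap_mem (p := 0 + s) (n := n) hmu' hv.2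
  let a : M ⟶ W n := ofLin _ (hwMap_mem_homs hq hmaxM hlam' (hwt n) hEh)
  let b : W n ⟶ M := ofLin _ (hwMap_mem_homs hq (hmax n) hmu' hv hE)
  have ha : HomParity k s a := HomParity.cast (parity_iff.2 hf) (add_zero s)
  have hb : HomParity k s b := HomParity.cast (parity_iff.2 hg) (zero_add s)
  have hav : lin a v = h n := by
    have := hwMap_apply (N := W n) (p := s + 0) (lam := lam) (u := h n) (Nat.zero_le n) (x := v)
      (by simpa using hv.1)
    refine Eq.trans (b := hwMap (s + 0) n lam (h n) v) rfl ?_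
    rw [this]
    simp [hlam]
  have hbh : lin b (h n) = v := by
    have := hwMap_apply (N := M) (p := 0 + s) (lam := mu) (u := v) (Nat.zero_le n) (x := h n)
      (by simpa using (hwt n).1)
    refine Eq.trans (b := hwMap (0 + s) n mu v (h n)) rfl ?_
    rw [this]
    simp [hmu]
  have hba : HomParity k 0 (b ≫ a) := HomParity.cast (HomParity.comp hb ha) (zmod2_add_self s)
  -- `b ≫ a` fixes the submodule generated by the highest weight vector, which contains the
  -- image of `a`.
  have key : ∀ x, lin (b ≫ a) (lin a x) = lin a x := fun x => by
    have h1 : lin a x = ∑ j ∈ Finset.range (n + 1), _ := LinearMap.sum_apply _ _ x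
    rw [h1, map_sum]
    refine Finset.sum_congr rfl fun j _ => ?_
    rw [LinearMap.smul_apply, LinearMap.smulRight_apply, map_smul, map_smul,
      homs_Ft_pow_of_even hba (hwt n).1 ((congrArg (lin a) hbh).trans hav)]
  refine ⟨n, s, a, b, ha, hb, hom_ext (LinearMap.ext fun x => ?_), v, hv0, ?_⟩
  · exact congrArg (lin b) (key x)
  · exact (congrArg (lin b) hav).trans hbh

/-- The identity of a supermodule is a sum of maps which factor through the modules `W n`. -/
theorem exists_sum_comp_eq_id (hq : ∀ n : ℕ, 0 < n → q ^ n ≠ 1)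
    (hwt : ∀ n, (W n).IsWt n 0 (h n))
    (h0 : ∀ n, h n ≠ 0) (hmax : ∀ (n : ℕ) (b : ℤ), n < b → (W n).e b = 0) (M : OspMod k q) :
    ∃ (ι : Type) (_ : Fintype ι) (c : ι → ℕ) (s : ι → ZMod 2) (a : ∀ i, M ⟶ W (c i))
      (b : ∀ i, W (c i) ⟶ M), (∀ i, HomParity k (s i) (a i)) ∧ (∀ i, HomParity k (s i) (b i)) ∧
      ∑ i, a i ≫ b i = 𝟙 M := by
  induction hd : Module.finrank k M.toSVec.carrier using Nat.strong_induction_on generalizing M with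
  | _ d ih =>
  subst hd
  have := M.finite
  by_cases hM : ∃ v : M.toSVec.carrier, v ≠ 0
  swap
  · push Not at hM
    exact ⟨Empty, inferInstance, Empty.elim, Empty.elim, fun i => i.elim, fun i => i.elim,
      fun i => i.elim, fun i => i.elim, hom_ext (LinearMap.ext fun v => by
        rw [hM v, map_zero, map_zero])⟩
  obtain ⟨n, s, a, b, ha, hb, hab, v, hv, habv⟩ := exists_summand hq hwt h0 hmax hM
  have hab0 : HomParity k 0 (a ≫ b) := HomParity.cast (HomParity.comp ha hb) (zmod2_add_self s)
  obtain ⟨N, i, r, hi, hr, -, hri, hN⟩ := exists_split (𝟙 M - a ≫ b)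
    (sub_mem (HomParity.id M) hab0) (by
      rw [Preadditive.sub_comp, Preadditive.comp_sub, Preadditive.comp_sub, Category.id_comp,
        Category.comp_id, Category.id_comp, hab, sub_self, sub_zero])
  have hlt : Module.finrank k N.toSVec.carrier < Module.finrank k M.toSVec.carrier := by
    rw [hN, ← LinearMap.finrank_range_add_finrank_ker (lin (𝟙 M - a ≫ b))]
    refine Nat.lt_add_of_pos_right (Module.finrank_pos_iff_exists_ne_zero.2 ⟨⟨v, ?_⟩, fun h => ?_⟩)
    · change v - lin (a ≫ b) v = 0
      rw [habv, sub_self]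
    · exact hv (congrArg Subtype.val h)
  obtain ⟨ι, _, c, s', a', b', ha', hb', hsum⟩ := ih _ hlt N rfl
  refine ⟨Option ι, inferInstance, fun o => o.elim n c, fun o => o.elim s s',
    fun o => match o with
      | none => a
      | some j => r ≫ a' j,
    fun o => match o with
      | none => b
      | some j => b' j ≫ i, ?_, ?_, ?_⟩
  · rintro (_ | j)
    · exact ha
    · exact HomParity.cast (HomParity.comp hr (ha' j)) (zero_add _)
  · rintro (_ | j)
    · exact hb
    · exact HomParity.cast (HomParity.comp (hb' j) hi) (add_zero _)
  · rw [Fintype.sum_option]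
    have h1 : ∑ j, (r ≫ a' j) ≫ b' j ≫ i = r ≫ (∑ j, a' j ≫ b' j) ≫ i := by
      rw [Preadditive.sum_comp, Preadditive.comp_sum]
      exact Finset.sum_congr rfl fun j _ => by simp
    exact (congrArg (a ≫ b + ·) h1).trans (by rw [hsum, Category.id_comp, hri, add_sub_cancel])

end OspMod

/-! ### The functor to supermodules -/

namespace OspMod

variable {k : Type u} [Field k] (q : kˣ)

/-- The vector `v₁` of `V(1)`. -/
def vp : (V1 q).toSVec.carrier := ((1, 0) : k × k)

/-- The vector `v₋₁` of `V(1)`. -/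
def vm : (V1 q).toSVec.carrier := ((0, 1) : k × k)

theorem V1_e (n : ℤ) : (V1 q).e n = eV k n := toOspMod_e _ _ _
theorem V1_E (n : ℤ) : (V1 q).E n = EV q n := toOspMod_E _ _ _
theorem V1_F (n : ℤ) : (V1 q).F n = FV q n := toOspMod_F _ _ _

theorem vp_wt : (V1 q).IsWt 1 0 (vp q) := by
  have h : eV k 1 ((1, 0) : k × k) = (1, 0) := by ext <;> simp [eV_apply]
  exact ⟨(LinearMap.congr_fun (V1_e q 1) _).trans h, v_one_mem⟩

theorem vm_wt : (V1 q).IsWt (-1) 1 (vm q) := by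
  have h : eV k (-1) ((0, 1) : k × k) = (0, 1) := by ext <;> simp [eV_apply]
  exact ⟨(LinearMap.congr_fun (V1_e q (-1)) _).trans h, v_neg_one_mem⟩

theorem E_vp (n : ℤ) : (V1 q).E n (vp q) = 0 := by
  have h : EV q n ((1, 0) : k × k) = 0 := by ext <;> simp [EV_apply]
  exact (LinearMap.congr_fun (V1_E q n) _).trans h

theorem E_vm : (V1 q).E (-1) (vm q) = qInt q 1 • vp q := by
  have h : EV q (-1) ((0, 1) : k × k) = qInt q 1 • ((1, 0) : k × k) := by
    ext <;> simp [EV_apply]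
  exact (LinearMap.congr_fun (V1_E q (-1)) _).trans h

theorem F_vp : (V1 q).F 1 (vp q) = qInt q 1 • vm q := by
  have h : FV q 1 ((1, 0) : k × k) = qInt q 1 • ((0, 1) : k × k) := by
    ext <;> simp [FV_apply]
  exact (LinearMap.congr_fun (V1_F q 1) _).trans h

theorem F_vm (n : ℤ) : (V1 q).F n (vm q) = 0 := by
  have h : FV q n ((0, 1) : k × k) = 0 := by ext <;> simp [FV_apply]
  exact (LinearMap.congr_fun (V1_F q n) _).trans h

/-- The coordinate functions on `V(1)`. -/
def coord (i : ZMod 2) : (V1 q).toSVec.carrier →ₗ[k] k :=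
  if i = 0 then LinearMap.fst k k k else LinearMap.snd k k k

theorem coord_zero_vp : coord q 0 (vp q) = 1 := rfl
theorem coord_zero_vm : coord q 0 (vm q) = 0 := rfl
theorem coord_one_vp : coord q 1 (vp q) = 0 := rfl
theorem coord_one_vm : coord q 1 (vm q) = 1 := rfl

theorem eq_coord (v : (V1 q).toSVec.carrier) : v = coord q 0 v • vp q + coord q 1 v • vm q := by
  have h : ∀ v : k × k, v = v.1 • ((1, 0) : k × k) + v.2 • ((0, 1) : k × k) := fun v => by
    ext <;> simp
  exact h v

theorem V1_ext {N : Type*} [AddCommGroup N] [Module k N]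
    {f g : (V1 q).toSVec.carrier →ₗ[k] N} (h1 : f (vp q) = g (vp q)) (h2 : f (vm q) = g (vm q)) :
    f = g := by
  refine LinearMap.ext fun v => ?_
  rw [eq_coord q v, map_add, map_add, map_smul, map_smul, map_smul, map_smul, h1, h2]

theorem mem_homs_cup {f : (unit k q).toSVec.carrier →ₗ[k] (tensor (V1 q) (V1 q)).toSVec.carrier}
    (hf : f ∈ ((unit k q).gr.hom (tensor (V1 q) (V1 q)).gr).part 1)
    (hc : ∀ c, f c = unitScalar c • (tm (vm q) (vp q) - (q : k) • tm (vp q) (vm q))) :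
    f ∈ homs (unit k q) (tensor (V1 q) (V1 q)) := by
  have hmp := tm_wt (vm_wt q) (vp_wt q)
  have hpm := tm_wt (vp_wt q) (vm_wt q)
  rw [show (-1 + 1 : ℤ) = 0 by norm_num] at hmp
  rw [show (1 + -1 : ℤ) = 0 by norm_num] at hpm
  have hEmp := tm_E (vm_wt q) (vp_wt q)
  have hEpm := tm_E (vp_wt q) (vm_wt q)
  have hFmp := tm_F (vm_wt q) (vp_wt q)
  have hFpm := tm_F (vp_wt q) (vm_wt q)
  rw [show (-1 + 1 : ℤ) = 0 by norm_num, E_vp, E_vm, tm_zero, smul_zero, add_zero, smul_tm] at hEmp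
  rw [show (1 + -1 : ℤ) = 0 by norm_num, E_vp, E_vm, zero_tm, zero_add, tm_smul] at hEpm
  rw [show (-1 + 1 : ℤ) = 0 by norm_num, F_vp, F_vm, zero_tm, smul_zero, add_zero, tm_smul] at hFmp
  rw [show (1 + -1 : ℤ) = 0 by norm_num, F_vp, F_vm, tm_zero, smul_zero, zero_add, smul_tm] at hFpm
  refine mem_homs_of_wt hf (fun a s _ => a = 0 ∧ s = 0) ?_ ?_ ?_ ?_ ?_
  · rintro _ _ v ⟨rfl, rfl⟩
    exact unit_wt v
  · intro g h H
    exact LinearMap.ext fun v => H 0 0 v ⟨rfl, rfl⟩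
  · rintro _ _ v ⟨rfl, rfl⟩
    rw [hc, map_smul, map_sub, map_smul, hmp.1, hpm.1]
  · rintro _ _ v ⟨rfl, rfl⟩
    rw [unit_E_apply, map_zero, hc, map_smul, map_sub, map_smul, hEmp, hEpm]
    match_scalars
    simp
  · rintro _ _ v ⟨rfl, rfl⟩
    rw [unit_F_apply, map_zero, hc, map_smul, map_sub, map_smul, hFmp, hFpm]
    match_scalars
    simp

theorem mem_homs_cap {f : (tensor (V1 q) (V1 q)).toSVec.carrier →ₗ[k] (unit k q).toSVec.carrier}
    (hf : f ∈ ((tensor (V1 q) (V1 q)).gr.hom (unit k q).gr).part 1)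
    (cmp : f (tm (vm q) (vp q)) = ((q⁻¹ : kˣ) : k) • f (tm (vp q) (vm q)))
    (cpp : f (tm (vp q) (vp q)) = 0) (cmm : f (tm (vm q) (vm q)) = 0) :
    f ∈ homs (tensor (V1 q) (V1 q)) (unit k q) := by
  have hmp := tm_wt (vm_wt q) (vp_wt q)
  have hpm := tm_wt (vp_wt q) (vm_wt q)
  have hpp := tm_wt (vp_wt q) (vp_wt q)
  have hmm := tm_wt (vm_wt q) (vm_wt q)
  refine mem_homs_of_wt hf (fun a s v =>
    (a = -1 + 1 ∧ s = 1 + 0 ∧ v = tm (vm q) (vp q)) ∨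
    (a = 1 + -1 ∧ s = 0 + 1 ∧ v = tm (vp q) (vm q)) ∨
    (a = 1 + 1 ∧ s = 0 + 0 ∧ v = tm (vp q) (vp q)) ∨
    (a = -1 + -1 ∧ s = 1 + 1 ∧ v = tm (vm q) (vm q))) ?_ ?_ ?_ ?_ ?_
  · rintro _ _ _ (⟨rfl, rfl, rfl⟩ | ⟨rfl, rfl, rfl⟩ | ⟨rfl, rfl, rfl⟩ | ⟨rfl, rfl, rfl⟩) <;>
      assumption
  · intro g h H
    refine TensorProduct.ext (V1_ext q (V1_ext q ?_ ?_) (V1_ext q ?_ ?_))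
    · exact H (1 + 1) (0 + 0) _ (.inr (.inr (.inl ⟨rfl, rfl, rfl⟩)))
    · exact H (1 + -1) (0 + 1) _ (.inr (.inl ⟨rfl, rfl, rfl⟩))
    · exact H (-1 + 1) (1 + 0) _ (.inl ⟨rfl, rfl, rfl⟩)
    · exact H (-1 + -1) (1 + 1) _ (.inr (.inr (.inr ⟨rfl, rfl, rfl⟩)))
  · rintro _ _ _ (⟨rfl, rfl, rfl⟩ | ⟨rfl, rfl, rfl⟩ | ⟨rfl, rfl, rfl⟩ | ⟨rfl, rfl, rfl⟩)
    · exact (unit_wt _).1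
    · exact (unit_wt _).1
    · rw [cpp, map_zero]
    · rw [cmm, map_zero]
  · rintro _ _ _ (⟨rfl, rfl, rfl⟩ | ⟨rfl, rfl, rfl⟩ | ⟨rfl, rfl, rfl⟩ | ⟨rfl, rfl, rfl⟩)
    all_goals
      rw [unit_E_apply, smul_zero]
    · rw [tm_E (vm_wt q) (vp_wt q), E_vm, E_vp, smul_tm, tm_zero, map_add, map_smul, map_smul, cpp,
        map_zero, smul_zero, smul_zero, add_zero]
    · rw [tm_E (vp_wt q) (vm_wt q), E_vm, E_vp, tm_smul, zero_tm, map_add, map_smul, map_smul, cpp,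
        map_zero, smul_zero, smul_zero, add_zero]
    · rw [tm_E (vp_wt q) (vp_wt q), E_vp, tm_zero, zero_tm, smul_zero, add_zero, map_zero]
    · rw [tm_E (vm_wt q) (vm_wt q), E_vm, smul_tm, tm_smul, map_add, map_smul, map_smul, map_smul,
        cmp]
      match_scalars
      simp
      rw [mul_left_comm]
      simp
  · rintro _ _ _ (⟨rfl, rfl, rfl⟩ | ⟨rfl, rfl, rfl⟩ | ⟨rfl, rfl, rfl⟩ | ⟨rfl, rfl, rfl⟩)
    all_goals
      rw [unit_F_apply, smul_zero]
    · rw [tm_F (vm_wt q) (vp_wt q), F_vm, F_vp, tm_smul, zero_tm, smul_zero, map_add, map_smul,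
        map_smul, cmm, map_zero, smul_zero, smul_zero, add_zero]
    · rw [tm_F (vp_wt q) (vm_wt q), F_vm, F_vp, smul_tm, tm_zero, smul_zero, map_add, map_smul,
        map_smul, cmm, map_zero, smul_zero, smul_zero, add_zero]
    · rw [tm_F (vp_wt q) (vp_wt q), F_vp, smul_tm, tm_smul, map_add, map_smul, map_smul, map_smul,
        map_smul, cmp]
      match_scalars
      simp
      rw [mul_left_comm]
      simp
    · rw [tm_F (vm_wt q) (vm_wt q), F_vm, tm_zero, zero_tm, smul_zero, smul_zero, add_zero,
        map_zero]

theorem cupV_mem_homs : (cupV q : (unit k q).toSVec.carrier →ₗ[k]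
    (tensor (V1 q) (V1 q)).toSVec.carrier) ∈ homs (unit k q) (tensor (V1 q) (V1 q)) :=
  mem_homs_cup q (cupV_mem q) (cupV_apply q)

theorem capV_mem_homs : (capV q : (tensor (V1 q) (V1 q)).toSVec.carrier →ₗ[k]
    (unit k q).toSVec.carrier) ∈ homs (tensor (V1 q) (V1 q)) (unit k q) := by
  have h1 : capV q (((0, 1) : k × k) ⊗ₜ ((1, 0) : k × k)) =
      ((q⁻¹ : kˣ) : k) • capV q (((1, 0) : k × k) ⊗ₜ ((0, 1) : k × k)) := by
    rw [capV_tmul, capV_tmul]; simp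
  have h2 : capV q (((1, 0) : k × k) ⊗ₜ ((1, 0) : k × k)) = 0 := by rw [capV_tmul]; simp
  have h3 : capV q (((0, 1) : k × k) ⊗ₜ ((0, 1) : k × k)) = 0 := by rw [capV_tmul]; simp
  exact mem_homs_cap q (capV_mem q) h1 h2 h3

/-- The supermodule `V(1)` with the homomorphisms `cup` and `cap`. -/
noncomputable def ospRep : STLRep (stlParam q) (OspMod k q) where
  X := V1 q
  cup := ofLin _ (cupV_mem_homs q)
  cap := ofLin _ (capV_mem_homs q)
  cup_odd := parity_iff.2 (cupV_mem q)
  cap_odd := parity_iff.2 (capV_mem q)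
  zigzag := hom_ext (LinearMap.ext (zigzag_V q))
  zigzag' := hom_ext (LinearMap.ext (zigzag_V' q))
  bubble := hom_ext (stlRepV q).bubble

end OspMod

/-! ### The action of diagrams on tensor powers -/

namespace OspMod

variable {k : Type u} [Field k] (q : kˣ)

/-- The monoidal superfunctor `STL(δ) → C` with `1 ↦ V(1)`. -/
noncomputable abbrev stlF : MonoidalSuperfunctor k (STL k (stlParam q)) (OspMod k q) :=
  (ospRep q).functor

/-- The supermodule `V(1)^{⊗ n}`. -/
noncomputable abbrev W (n : ℕ) : OspMod k q := (ospRep q).pow n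

variable {q}

/-- The linear map by which a morphism of `STL(δ)` acts. -/
noncomputable def actL {m n : ℕ} (f : STL.H (stlParam q) m n) :
    (W q m).toSVec.carrier →ₗ[k] (W q n).toSVec.carrier := lin ((stlF q).map f)

theorem actL_mem {m n : ℕ} (f : STL.H (stlParam q) m n) : actL f ∈ homs (W q m) (W q n) := lin_mem _

theorem actL_comp {l m n : ℕ} (f : STL.H (stlParam q) l m) (g : STL.H (stlParam q) m n) (x) :
    actL (f ≫ g) x = actL g (actL f x) := by
  unfold actL; rw [(stlF q).map_comp]; rfl

theorem actL_add {m n : ℕ} (f g : STL.H (stlParam q) m n) : actL (f + g) = actL f + actL g := by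
  unfold actL; rw [(stlF q).map_add]; rfl

theorem actL_smul {m n : ℕ} (c : k) (f : STL.H (stlParam q) m n) : actL (c • f) = c • actL f := by
  unfold actL; rw [(stlF q).map_smul]; rfl

theorem actL_parity {m n : ℕ} {p : ZMod 2} {f : STL.H (stlParam q) m n} (hf : HomParity k p f) :
    actL f ∈ ((W q m).gr.hom (W q n).gr).part p := parity_iff.1 ((stlF q).map_parity hf)

variable (q) in
/-- The canonical map `V^{⊗ n} ⊗ V → V^{⊗ (n + 1)}`. -/
noncomputable def mulOne (n : ℕ) : (tensor (W q n) (V1 q)).toSVec.carrier →ₗ[k]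
    (W q (n + 1)).toSVec.carrier := lin ((stlF q).μ ⟨n⟩ ⟨1⟩).hom

variable (q) in
/-- The canonical map `V^{⊗ n} ⊗ (V ⊗ V) → V^{⊗ (n + 2)}`. -/
noncomputable def mulTwo (n : ℕ) : (tensor (W q n) (tensor (V1 q) (V1 q))).toSVec.carrier →ₗ[k]
    (W q (n + 2)).toSVec.carrier := lin ((stlF q).μ ⟨n⟩ ⟨2⟩).hom

theorem mulOne_mem (n : ℕ) : mulOne q n ∈ homs (tensor (W q n) (V1 q)) (W q (n + 1)) :=
  lin_mem ((stlF q).μ ⟨n⟩ ⟨1⟩).hom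

theorem mulOne_even (n : ℕ) :
    mulOne q n ∈ ((tensor (W q n) (V1 q)).gr.hom (W q (n + 1)).gr).part 0 :=
  parity_iff.1 ((stlF q).μ_even ⟨n⟩ ⟨1⟩)

/-- The product `V^{⊗ n} × V → V^{⊗ (n + 1)}`. -/
noncomputable def mul {n : ℕ} (p : (W q n).toSVec.carrier) (v : (V1 q).toSVec.carrier) :
    (W q (n + 1)).toSVec.carrier := mulOne q n (tm p v)

section Mul

variable {n m : ℕ} {p : (W q n).toSVec.carrier} {v : (V1 q).toSVec.carrier} {a b : ℤ} {s t : ZMod 2}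

theorem add_mul (p p' : (W q n).toSVec.carrier) (v) : mul (p + p') v = mul p v + mul p' v := by
  rw [mul, add_tm, map_add, mul, mul]
theorem smul_mul (c : k) (p : (W q n).toSVec.carrier) (v) : mul (c • p) v = c • mul p v := by
  rw [mul, smul_tm, map_smul, mul]
theorem mul_smul (c : k) (p : (W q n).toSVec.carrier) (v) : mul p (c • v) = c • mul p v := by
  rw [mul, tm_smul, map_smul, mul]
theorem zero_mul (v) : mul (0 : (W q n).toSVec.carrier) v = 0 := by
  rw [mul, zero_tm, map_zero]
theorem mul_zero (p : (W q n).toSVec.carrier) : mul p 0 = 0 := by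
  rw [mul, tm_zero, map_zero]

theorem mul_wt (hp : (W q n).IsWt a s p) (hv : (V1 q).IsWt b t v) :
    (W q (n + 1)).IsWt (a + b) (s + t) (mul p v) := by
  have h := tm_wt hp hv
  refine ⟨?_, SuperGrading.part_mem_cast (mulOne_even n _ _ h.2) (add_zero _)⟩
  rw [mul, ← homs_e (mulOne_mem n), h.1]

theorem E_mul (hp : (W q n).IsWt a s p) (hv : (V1 q).IsWt b t v) :
    (W q (n + 1)).E (a + b) (mul p v) =
      mul ((W q n).E a p) v + (((q ^ (-a) : kˣ) : k) * superSign k s) • mul p ((V1 q).E b v) := by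
  have h := homs_E (mulOne_mem n) (mulOne_even n) (a + b) (tm p v)
  rw [superSign_zero, one_smul] at h
  rw [mul, ← h, tm_E hp hv, map_add, map_smul, mul, mul]

theorem actL_addR (g : STL.H (stlParam q) n m) :
    actL (STL.addR g) (mul p v) = mul (actL g p) v := by
  have h := LinearMap.congr_fun (congrArg lin ((stlF q).μ_natural g (𝟙 (⟨1⟩ : STL k (stlParam q)))))
    (tm p v)
  refine Eq.trans h.symm ?_
  refine congrArg (mulOne q m) ?_
  rw [(stlF q).map_id]
  exact SuperGrading.superMap_tmul_even _ ((V1 q).gr.id_mem_hom) _ _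

/-- `V^{⊗ n} ⊗ (V ⊗ V) → V^{⊗ (n + 2)}` maps `p ⊗ (v ⊗ w)` to `(p v) w`. -/
theorem mulTwo_tm (p : (W q n).toSVec.carrier) (v w : (V1 q).toSVec.carrier) :
    mulTwo q n (tm p (tm v w)) = mul (mul p v) w := by
  have h := LinearMap.congr_fun (congrArg lin ((ospRep q).add_assoc n 1 1)) (tm (tm p v) w)
  have h1 : (ospRep q).add 1 1 = Iso.refl _ := Iso.ext (congrArg Underlying.val
    (TensorPower.add_one_one (X := (⟨(ospRep q).X⟩ : Underlying k (OspMod k q)))))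
  rw [h1] at h
  have h2 : lin ((𝟙 ((ospRep q).pow n)) ⊗ₘ (𝟙 ((ospRep q).X ⊗ (ospRep q).X))) (tm p (tm v w)) =
      tm p (tm v w) := by
    rw [MonoidalSupercategory.id_tensor_id k]; rfl
  refine (congrArg (mulTwo q n) h2).symm.trans (Eq.trans h.symm ?_)
  refine congrArg (mulOne q (n + 1)) ?_
  exact SuperGrading.superMap_tmul_even _ ((V1 q).gr.id_mem_hom) _ _

theorem actL_cupAt (hp : p ∈ (W q n).gr.part s) :
    actL (STL.cupAt (stlParam q) n) p =
      superSign k s • (mul (mul p (vm q)) (vp q) - (q : k) • mul (mul p (vp q)) (vm q)) := by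
  have h := LinearMap.congr_fun (congrArg lin ((stlF q).μ_natural (𝟙 (⟨n⟩ : STL k (stlParam q)))
    (STL.hmk STLPre.cup))) (tm p ((1 : k) : (unit k q).toSVec.carrier))
  have h1 : lin ((stlF q).μ ⟨n⟩ ⟨0⟩).hom (tm p ((1 : k) : (unit k q).toSVec.carrier)) = p :=
    one_smul k p
  refine (congrArg (actL (STL.cupAt (stlParam q) n)) h1).symm.trans (Eq.trans h.symm ?_)
  have h2 : lin ((stlF q).map (𝟙 (⟨n⟩ : STL k (stlParam q))) ⊗ₘ
      (stlF q).map (X := ⟨0⟩) (Y := ⟨2⟩) (STL.hmk STLPre.cup))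
      (tm p ((1 : k) : (unit k q).toSVec.carrier)) =
      superSign k (1 * s) • tm p ((1 : k) • (tm (vm q) (vp q) - (q : k) • tm (vp q) (vm q))) := by
    rw [(stlF q).map_id]
    exact SuperGrading.superMap_tmul (H := (unit k q).gr) (H' := (tensor (V1 q) (V1 q)).gr) _
      (cupV_mem q) hp _
  refine (congrArg (mulTwo q n) h2).trans ?_
  have h3 : tm p (tm (vm q) (vp q) - (q : k) • tm (vp q) (vm q)) =
      tm p (tm (vm q) (vp q)) - (q : k) • tm p (tm (vp q) (vm q)) := by
    rw [sub_eq_add_neg, tm_add, ← neg_smul, tm_smul, neg_smul, ← sub_eq_add_neg]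
  rw [one_smul, h3, map_smul, one_mul, map_sub, map_smul, mulTwo_tm, mulTwo_tm]

theorem actL_capAt (hp : p ∈ (W q n).gr.part s) (w : (V1 q).toSVec.carrier) :
    actL (STL.capAt (stlParam q) n) (mul (mul p v) w) =
      (superSign k s * capV q (v ⊗ₜ w)) • p := by
  have h := LinearMap.congr_fun (congrArg lin ((stlF q).μ_natural (𝟙 (⟨n⟩ : STL k (stlParam q)))
    (STL.hmk STLPre.cap))) (tm p (tm v w))
  rw [← mulTwo_tm]
  refine Eq.trans h.symm ?_
  have h2 : lin ((stlF q).map (𝟙 (⟨n⟩ : STL k (stlParam q))) ⊗ₘ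
      (stlF q).map (X := ⟨2⟩) (Y := ⟨0⟩) (STL.hmk STLPre.cap))
      (tm p (tm v w)) = superSign k (1 * s) • tm p (capV q (v ⊗ₜ w) : (unit k q).toSVec.carrier) := by
    rw [(stlF q).map_id]
    exact SuperGrading.superMap_tmul (H := (tensor (V1 q) (V1 q)).gr) (H' := (unit k q).gr) _
      (capV_mem q) hp _
  refine (congrArg (lin ((stlF q).μ ⟨n⟩ ⟨0⟩).hom) h2).trans ?_
  refine (map_smul (lin ((stlF q).μ ⟨n⟩ ⟨0⟩).hom) _ _).trans ?_
  rw [one_mul, SemigroupAction.mul_smul]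
  rfl

end Mul

end OspMod

/-! ### Coordinates on tensor powers -/

namespace OspMod

variable {k : Type u} [Field k] {q : kˣ} {n m : ℕ}

variable (q) in
/-- The inverse of `mulOne`. -/
noncomputable def unmulOne (n : ℕ) : (W q (n + 1)).toSVec.carrier →ₗ[k]
    (tensor (W q n) (V1 q)).toSVec.carrier := lin ((stlF q).μ ⟨n⟩ ⟨1⟩).inv

theorem unmulOne_mulOne (x) : unmulOne q n (mulOne q n x) = x :=
  LinearMap.congr_fun (congrArg lin ((stlF q).μ ⟨n⟩ ⟨1⟩).hom_inv_id) x

theorem mulOne_unmulOne (x) : mulOne q n (unmulOne q n x) = x :=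
  LinearMap.congr_fun (congrArg lin ((stlF q).μ ⟨n⟩ ⟨1⟩).inv_hom_id) x

/-- Contraction of the last tensor factor with a coordinate function. -/
noncomputable def contract (M : OspMod k q) (i : ZMod 2) :
    (tensor M (V1 q)).toSVec.carrier →ₗ[k] M.toSVec.carrier :=
  (TensorProduct.rid k M.toSVec.carrier).toLinearMap ∘ₗ
    LinearMap.lTensor M.toSVec.carrier (coord q i)

theorem contract_tm (M : OspMod k q) (i : ZMod 2) (p : M.toSVec.carrier)
    (v : (V1 q).toSVec.carrier) : contract M i (tm p v) = coord q i v • p := rfl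

/-- The coordinates of an element of `V^{⊗ (n + 1)}` with respect to the basis of the last tensor
factor. -/
noncomputable def coef (i : ZMod 2) : (W q (n + 1)).toSVec.carrier →ₗ[k] (W q n).toSVec.carrier :=
  contract (W q n) i ∘ₗ unmulOne q n

theorem coef_mul (i : ZMod 2) (p : (W q n).toSVec.carrier) (v) :
    coef i (mul p v) = coord q i v • p := by
  rw [coef, LinearMap.comp_apply, mul, unmulOne_mulOne, contract_tm]

theorem coef_zero_mul_vp (p : (W q n).toSVec.carrier) : coef 0 (mul p (vp q)) = p := by
  rw [coef_mul, coord_zero_vp, one_smul]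
theorem coef_zero_mul_vm (p : (W q n).toSVec.carrier) : coef 0 (mul p (vm q)) = 0 := by
  rw [coef_mul, coord_zero_vm, zero_smul]
theorem coef_one_mul_vp (p : (W q n).toSVec.carrier) : coef 1 (mul p (vp q)) = 0 := by
  rw [coef_mul, coord_one_vp, zero_smul]
theorem coef_one_mul_vm (p : (W q n).toSVec.carrier) : coef 1 (mul p (vm q)) = p := by
  rw [coef_mul, coord_one_vm, one_smul]

theorem W_succ_ext {N : Type*} [AddCommGroup N] [Module k N]
    {f g : (W q (n + 1)).toSVec.carrier →ₗ[k] N}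
    (h : ∀ a s p, (W q n).IsWt a s p → f (mul p (vp q)) = g (mul p (vp q)) ∧
      f (mul p (vm q)) = g (mul p (vm q))) : f = g := by
  have h1 : f ∘ₗ mulOne q n = g ∘ₗ mulOne q n := by
    refine TensorProduct.ext (ext_wt fun a s p hp => V1_ext q ?_ ?_)
    · exact (h a s p hp).1
    · exact (h a s p hp).2
  refine LinearMap.ext fun x => ?_
  rw [← mulOne_unmulOne x]
  exact LinearMap.congr_fun h1 _

theorem mul_coef (z : (W q (n + 1)).toSVec.carrier) :
    mul (coef 0 z) (vp q) + mul (coef 1 z) (vm q) = z := by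
  let T : (W q (n + 1)).toSVec.carrier →ₗ[k] (W q (n + 1)).toSVec.carrier :=
    { toFun := fun z => mul (coef 0 z) (vp q) + mul (coef 1 z) (vm q)
      map_add' := fun z w => by
        rw [map_add, map_add, add_mul, add_mul, add_add_add_comm]
      map_smul' := fun c z => by
        rw [map_smul, map_smul, smul_mul, smul_mul, ← smul_add, RingHom.id_apply] }
  have hT : T = LinearMap.id := W_succ_ext fun a s p _ => by
    constructor
    · change mul (coef 0 (mul p (vp q))) (vp q) + mul (coef 1 (mul p (vp q))) (vm q) = mul p (vp q)
      rw [coef_zero_mul_vp, coef_one_mul_vp, zero_mul, add_zero]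
    · change mul (coef 0 (mul p (vm q))) (vp q) + mul (coef 1 (mul p (vm q))) (vm q) = mul p (vm q)
      rw [coef_zero_mul_vm, coef_one_mul_vm, zero_mul, zero_add]
  exact LinearMap.congr_fun hT z

theorem coef_zero_e (a : ℤ) (z : (W q (n + 1)).toSVec.carrier) :
    coef 0 ((W q (n + 1)).e a z) = (W q n).e (a - 1) (coef 0 z) := by
  refine LinearMap.congr_fun (W_succ_ext (f := coef 0 ∘ₗ (W q (n + 1)).e a)
    (g := (W q n).e (a - 1) ∘ₗ coef 0) fun b s p hp => ⟨?_, ?_⟩) z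
  · rw [LinearMap.comp_apply, LinearMap.comp_apply, (mul_wt hp (vp_wt q)).e, coef_zero_mul_vp, hp.e]
    by_cases h : a = b + 1
    · rw [if_pos h, if_pos (by omega), coef_zero_mul_vp]
    · rw [if_neg h, if_neg (by omega), map_zero]
  · rw [LinearMap.comp_apply, LinearMap.comp_apply, (mul_wt hp (vm_wt q)).e, coef_zero_mul_vm,
      map_zero]
    split_ifs
    · rw [coef_zero_mul_vm]
    · rw [map_zero]

theorem coef_one_e (a : ℤ) (z : (W q (n + 1)).toSVec.carrier) :
    coef 1 ((W q (n + 1)).e a z) = (W q n).e (a + 1) (coef 1 z) := by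
  refine LinearMap.congr_fun (W_succ_ext (f := coef 1 ∘ₗ (W q (n + 1)).e a)
    (g := (W q n).e (a + 1) ∘ₗ coef 1) fun b s p hp => ⟨?_, ?_⟩) z
  · rw [LinearMap.comp_apply, LinearMap.comp_apply, (mul_wt hp (vp_wt q)).e, coef_one_mul_vp,
      map_zero]
    split_ifs
    · rw [coef_one_mul_vp]
    · rw [map_zero]
  · rw [LinearMap.comp_apply, LinearMap.comp_apply, (mul_wt hp (vm_wt q)).e, coef_one_mul_vm, hp.e]
    by_cases h : a = b + -1
    · rw [if_pos h, if_pos (by omega), coef_one_mul_vm]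
    · rw [if_neg h, if_neg (by omega), map_zero]

theorem coef_one_E (a : ℤ) (z : (W q (n + 1)).toSVec.carrier) :
    coef 1 ((W q (n + 1)).E a z) = (W q n).E (a + 1) (coef 1 z) := by
  refine LinearMap.congr_fun (W_succ_ext (f := coef 1 ∘ₗ (W q (n + 1)).E a)
    (g := (W q n).E (a + 1) ∘ₗ coef 1) fun b s p hp => ⟨?_, ?_⟩) z
  · rw [LinearMap.comp_apply, LinearMap.comp_apply, (mul_wt hp (vp_wt q)).E, coef_one_mul_vp,
      map_zero]
    split_ifs
    · rw [E_mul hp (vp_wt q), E_vp, mul_zero, smul_zero, add_zero, coef_one_mul_vp]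
    · rw [map_zero]
  · rw [LinearMap.comp_apply, LinearMap.comp_apply, (mul_wt hp (vm_wt q)).E, coef_one_mul_vm, hp.E]
    by_cases h : a = b + -1
    · rw [if_pos h, if_pos (by omega), E_mul hp (vm_wt q), E_vm, mul_smul, map_add, map_smul,
        map_smul, coef_one_mul_vm, coef_one_mul_vp, smul_zero, smul_zero, add_zero]
    · rw [if_neg h, if_neg (by omega), map_zero]

theorem E_mul_vp (a : ℤ) (p : (W q n).toSVec.carrier) :
    (W q (n + 1)).E a (mul p (vp q)) = mul ((W q n).E (a - 1) p) (vp q) := by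
  let T : (W q n).toSVec.carrier →ₗ[k] (W q (n + 1)).toSVec.carrier :=
    { toFun := fun p => mul p (vp q)
      map_add' := fun p p' => add_mul p p' _
      map_smul' := fun c p => smul_mul c p _ }
  refine LinearMap.congr_fun (ext_wt (f := (W q (n + 1)).E a ∘ₗ T)
    (g := T ∘ₗ (W q n).E (a - 1)) fun b s p hp => ?_) p
  change (W q (n + 1)).E a (mul p (vp q)) = mul ((W q n).E (a - 1) p) (vp q)
  rw [(mul_wt hp (vp_wt q)).E, hp.E]
  by_cases h : a = b + 1
  · rw [if_pos h, if_pos (by omega), E_mul hp (vp_wt q), E_vp, mul_zero, smul_zero, add_zero]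
  · rw [if_neg h, if_neg (by omega), zero_mul]

theorem actL_zero : actL (0 : STL.H (stlParam q) m n) = 0 := by
  have := actL_smul (0 : k) (0 : STL.H (stlParam q) m n)
  rwa [zero_smul, zero_smul] at this

theorem W_e_eq_zero (b : ℤ) (hb : n < b) : (W q n).e b = 0 := by
  induction n generalizing b with
  | zero =>
    refine (unit_e (k := k) (q := q) b).trans (if_neg ?_)
    push_cast at hb
    omega
  | succ n ih =>
    push_cast at hb
    refine LinearMap.ext fun z => ?_
    rw [← mul_coef ((W q (n + 1)).e b z), coef_zero_e, coef_one_e, ih _ (by omega),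
      ih _ (by omega), LinearMap.zero_apply, LinearMap.zero_apply, zero_mul, zero_mul, add_zero,
      LinearMap.zero_apply]

variable (q) in
/-- The highest weight vector `v₁^{⊗ n}` of `V^{⊗ n}`. -/
noncomputable def hvec : ∀ n : ℕ, (W q n).toSVec.carrier
  | 0 => (1 : k)
  | n + 1 => mul (hvec n) (vp q)

theorem hvec_wt (n : ℕ) : (W q n).IsWt n 0 (hvec q n) := by
  induction n with
  | zero => exact unit_wt _
  | succ n ih =>
    have := mul_wt ih (vp_wt q)
    rw [add_zero] at this
    push_cast
    exact this

theorem hvec_ne_zero (n : ℕ) : hvec q n ≠ 0 := by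
  induction n with
  | zero => exact one_ne_zero (α := k)
  | succ n ih =>
    intro h
    have := congrArg (coef 0) h
    rw [hvec, coef_zero_mul_vp, map_zero] at this
    exact ih this

theorem E_hvec (n : ℕ) : (W q n).E n (hvec q n) = 0 := by
  rw [← (W q n).e_E, W_e_eq_zero _ (by omega), LinearMap.zero_apply]

end OspMod

/-! ### Full faithfulness -/

namespace OspMod

open STL

variable {k : Type u} [Field k] {q : kˣ} {n m w : ℕ}

theorem E_apply_eq_zero {X Y : OspMod k q} {f : X.toSVec.carrier →ₗ[k] Y.toSVec.carrier}
    (hf : f ∈ homs X Y) {a : ℤ} {x : X.toSVec.carrier} (hx : X.E a x = 0) : Y.E a (f x) = 0 := by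
  refine homs_induction (C := fun f => Y.E a (f x) = 0) (fun p f h h' => ?_) (fun f g h h' => ?_) hf
  · have := homs_E h' h a x
    rw [hx, map_zero, eq_comm] at this
    rw [← one_smul k (Y.E a (f x)), ← superSign_mul_self p, SemigroupAction.mul_smul, this,
      smul_zero]
  · rw [LinearMap.add_apply, map_add, h, h', add_zero]

theorem actL_cupAt_addR_hvec (g : H (stlParam q) (w + 1) n) :
    actL (cupAt (stlParam q) w ≫ addR g) (hvec q w) =
      mul (actL g (mul (hvec q w) (vm q))) (vp q) -
        (q : k) • mul (actL g (hvec q (w + 1))) (vm q) := by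
  rw [actL_comp, actL_cupAt (hvec_wt w).2, superSign_zero, one_smul, map_sub, map_smul, actL_addR,
    actL_addR]
  rfl

/-- Every highest weight vector of weight `w` of `V^{⊗ n}` is the image of `v₁^{⊗ w}` under a
morphism of `STL(δ)`. -/
theorem exists_actL_hvec_eq (hq : ∀ n : ℕ, 0 < n → q ^ n ≠ 1) (w : ℕ)
    {x : (W q n).toSVec.carrier} (hx : (W q n).e w x = x) (hE : (W q n).E w x = 0) :
    ∃ f : H (stlParam q) w n, actL f (hvec q w) = x := by
  induction n generalizing w with
  | zero =>
    cases w with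
    | zero =>
      refine ⟨(show k from x) • 𝟙 (⟨0⟩ : STL k (stlParam q)), ?_⟩
      rw [actL_smul]
      exact mul_one (show k from x)
    | succ w =>
      refine ⟨0, ?_⟩
      rw [actL_zero, LinearMap.zero_apply, ← hx, W_e_eq_zero _ (by push_cast; omega),
        LinearMap.zero_apply]
  | succ n ih =>
    have hy : (W q n).e ((w + 1 : ℕ) : ℤ) (coef 1 x) = coef 1 x := by
      push_cast
      rw [← coef_one_e, hx]
    have hEy : (W q n).E ((w + 1 : ℕ) : ℤ) (coef 1 x) = 0 := by
      push_cast
      rw [← coef_one_E, hE, map_zero]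
    obtain ⟨g, hg⟩ := ih (w + 1) hy hEy
    have hu := actL_cupAt_addR_hvec g
    rw [hg] at hu
    set u := actL (cupAt (stlParam q) w ≫ addR g) (hvec q w) with hu'
    have heu : (W q (n + 1)).e w u = u := by
      rw [hu', ← homs_e (actL_mem _), (hvec_wt w).1]
    have hEu : (W q (n + 1)).E w u = 0 := E_apply_eq_zero (actL_mem _) (E_hvec w)
    -- The `v₋₁`-coordinate of `z` vanishes.
    set z := x + ((q⁻¹ : kˣ) : k) • u with hz
    have hez : (W q (n + 1)).e w z = z := by rw [hz, map_add, map_smul, hx, heu]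
    have hEz : (W q (n + 1)).E w z = 0 := by rw [hz, map_add, map_smul, hE, hEu]; simp
    have hz1 : coef 1 z = 0 := by
      rw [hz, hu, map_add, map_smul, map_sub, map_smul, coef_one_mul_vp, coef_one_mul_vm, zero_sub,
        smul_neg, smul_smul, Units.inv_mul, one_smul, add_neg_cancel]
    have hz0 : mul (coef 0 z) (vp q) = z := by
      have := mul_coef z
      rwa [hz1, zero_mul, add_zero] at this
    have hez0 : (W q n).e ((w : ℤ) - 1) (coef 0 z) = coef 0 z := by rw [← coef_zero_e, hez]
    have hEz0 : (W q n).E ((w : ℤ) - 1) (coef 0 z) = 0 := by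
      have h1 := E_mul_vp (w : ℤ) (coef 0 z)
      rw [hz0, hEz] at h1
      rw [← coef_zero_mul_vp ((W q n).E ((w : ℤ) - 1) (coef 0 z)), ← h1, map_zero]
    obtain ⟨f, hf⟩ : ∃ f : H (stlParam q) w (n + 1), actL f (hvec q w) = z := by
      cases w with
      | zero =>
        refine ⟨0, ?_⟩
        have : coef 0 z = 0 := by
          by_contra h0
          have := highest_weight_nonneg hq hez0 (by rw [Et_apply hez0, hEz0]) h0
          omega
        rw [actL_zero, LinearMap.zero_apply, ← hz0, this, zero_mul]
      | succ w =>
        push_cast at hez0 hEz0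
        rw [add_sub_cancel_right] at hez0 hEz0
        obtain ⟨h, hh⟩ := ih w hez0 hEz0
        refine ⟨addR h, ?_⟩
        rw [hvec, actL_addR, hh, hz0]
    refine ⟨f + (-((q⁻¹ : kˣ) : k)) • (cupAt (stlParam q) w ≫ addR g), ?_⟩
    rw [actL_add, actL_smul, LinearMap.add_apply, LinearMap.smul_apply, hf, ← hu', hz, neg_smul,
      add_neg_cancel_right]

theorem actL_isCap_hvec {c : H (stlParam q) m n} (hc : IsCap c) : actL c (hvec q m) = 0 := by
  induction hc with
  | base i =>
    have := actL_capAt (v := vp q) (hvec_wt (q := q) i).2 (vp q)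
    have h1 : capV q (vp q ⊗ₜ vp q) = 0 := (capV_tmul q _ _).trans (by simp [vp])
    rw [h1] at this
    refine Eq.trans this ?_
    simp
  | addR _ ih => rw [hvec, actL_addR, ih, zero_mul]

theorem actL_capIdeal_hvec {f : H (stlParam q) m n} (hf : f ∈ capIdeal (stlParam q) m n) :
    actL f (hvec q m) = 0 := by
  induction hf using Submodule.span_induction with
  | mem f hf =>
    obtain ⟨l, c, g, hc, rfl⟩ := hf
    rw [actL_comp, actL_isCap_hvec hc, map_zero]
  | zero => rw [actL_zero, LinearMap.zero_apply]
  | add f g _ _ hf hg => rw [actL_add, LinearMap.add_apply, hf, hg, add_zero]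
  | smul c f _ hf => rw [actL_smul, LinearMap.smul_apply, hf, smul_zero]

/-- A morphism of `STL(δ)` which kills `v₁^{⊗ w}` is a linear combination of diagrams which have
a cap at the bottom. -/
theorem mem_capIdeal_of_actL_hvec {f : H (stlParam q) w n} (hf : actL f (hvec q w) = 0) :
    f ∈ capIdeal (stlParam q) w n := by
  induction n generalizing w with
  | zero =>
    cases w with
    | zero =>
      obtain ⟨a, rfl⟩ := exists_eq_smul_id f
      rw [actL_smul] at hf
      have ha : a = 0 := (mul_one a).symm.trans hf
      rw [ha, zero_smul]
      exact zero_mem _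
    | succ w => exact mem_capIdeal_of_unit f
  | succ n ih =>
    obtain ⟨g, rfl⟩ := exists_eq_cupAt_comp f
    have h1 : actL g (hvec q (w + 1)) = 0 := by
      have := congrArg (coef 1) (actL_cupAt_addR_hvec g)
      rw [hf, map_zero, map_sub, map_smul, coef_one_mul_vp, coef_one_mul_vm, zero_sub, eq_comm,
        neg_eq_zero] at this
      exact (smul_eq_zero.1 this).resolve_left (Units.ne_zero q)
    have hg := ih h1
    cases w with
    | zero =>
      rw [eq_zero_of_mem_capIdeal (by omega) hg, addR_zero, Limits.comp_zero]
      exact zero_mem _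
    | succ w =>
      obtain ⟨ν, g', hν, hg'⟩ := exists_cupAt_comp_addR_eq hg
      rw [hg'] at hf ⊢
      rw [actL_add, LinearMap.add_apply, actL_capIdeal_hvec hν, zero_add, hvec, actL_addR] at hf
      have h2 := congrArg (coef 0) hf
      rw [coef_zero_mul_vp, map_zero] at h2
      exact add_mem hν (addR_mem_capIdeal (ih h2))

theorem actL_addR_eq_zero {f : H (stlParam q) m n} (hf : actL f = 0) : actL (addR f) = 0 :=
  W_succ_ext fun a s p _ => by
    rw [actL_addR, actL_addR, hf, LinearMap.zero_apply, LinearMap.zero_apply, zero_mul, zero_mul,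
      LinearMap.zero_apply]
    exact ⟨rfl, rfl⟩

/-- Faithfulness. The morphism `f : m + 1 → n` is recovered, up to a sign, from the bent morphism
`cupAt m ≫ addR f : m → n + 1`, which is zero by induction. -/
theorem eq_zero_of_actL {f : H (stlParam q) m n} (hf : actL f = 0) : f = 0 := by
  induction m generalizing n with
  | zero =>
    exact eq_zero_of_mem_capIdeal (by omega)
      (mem_capIdeal_of_actL_hvec (by rw [hf, LinearMap.zero_apply]))
  | succ m ih =>
    have key : ∀ (p : ZMod 2) (f : H (stlParam q) (m + 1) n), HomParity k p f → actL f = 0 →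
        f = 0 := fun p f hp hf => by
      have h1 : cupAt (stlParam q) m ≫ addR f = 0 := ih (LinearMap.ext fun x => by
        rw [actL_comp, actL_addR_eq_zero hf]; rfl)
      have h2 := addR_cupAt_comp_addR_comp_capAt hp
      rw [h1, addR_zero, Limits.zero_comp, eq_comm] at h2
      refine (smul_eq_zero.1 h2).resolve_left fun h3 => ?_
      have h4 := superSign_mul_self (k := k) p
      rcases mul_eq_zero.1 h3 with h3 | h3
      · rw [h3] at h4; simp at h4
      · simp at h3
    obtain ⟨f₀, f₁, h₀, h₁, rfl⟩ := exists_add_parity f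
    have e₀ := (((W q (m + 1)).gr.hom (W q n).gr).proj_of_mem (actL_parity h₀))
    have e₁ := (((W q (m + 1)).gr.hom (W q n).gr).proj_of_mem_ne (actL_parity h₁)
      (r := 0) (by decide))
    have e : actL f₀ = 0 := by
      have := congrArg (((W q (m + 1)).gr.hom (W q n).gr).proj 0) hf
      rwa [actL_add, map_add, e₀, e₁, add_zero, map_zero] at this
    have e' : actL f₁ = 0 := by rwa [actL_add, e, zero_add] at hf
    rw [key 0 f₀ h₀ e, key 1 f₁ h₁ e', add_zero]

/-- Fullness. For `φ : V^{⊗ (m + 1)} → V^{⊗ n}`, the bent map `V^{⊗ m} → V^{⊗ (n + 1)}`, which is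
the cup followed by `φ ⊗ id`, is given by a morphism `g` of `STL(δ)` by induction; bending the
strand of `g` back gives `φ` up to a sign. -/
theorem exists_actL_eq (hq : ∀ n : ℕ, 0 < n → q ^ n ≠ 1)
    {φ : (W q m).toSVec.carrier →ₗ[k] (W q n).toSVec.carrier} (hφ : φ ∈ homs (W q m) (W q n)) :
    ∃ f : H (stlParam q) m n, actL f = φ := by
  induction m generalizing n with
  | zero =>
    have h1 : (W q n).e (0 : ℕ) (φ (hvec q 0)) = φ (hvec q 0) := by
      rw [← homs_e hφ, (hvec_wt (q := q) 0).1]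
    obtain ⟨f, hf⟩ := exists_actL_hvec_eq hq 0 h1 (E_apply_eq_zero hφ (E_hvec 0))
    exact ⟨f, LinearMap.ext_ring hf⟩
  | succ m ih =>
    refine homs_induction (C := fun φ => ∃ f : H (stlParam q) (m + 1) n, actL f = φ)
      (fun r φ h h' => ?_) ?_ hφ
    · let Φ : W q (m + 1) ⟶ W q n := ofLin φ h'
      have hΦ : HomParity k r Φ := parity_iff.2 h
      let Ψ : W q (m + 1 + 1) ⟶ W q (n + 1) := ((stlF q).μ ⟨m + 1⟩ ⟨1⟩).inv ≫ (Φ ⊗ₘ 𝟙 (V1 q)) ≫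
        ((stlF q).μ ⟨n⟩ ⟨1⟩).hom
      have hΨ : ∀ (p : (W q (m + 1)).toSVec.carrier) (v : (V1 q).toSVec.carrier),
          lin Ψ (mul p v) = mul (φ p) v := fun p v => by
        refine (congrArg (fun x => lin (((Φ ⊗ₘ 𝟙 (V1 q)) ≫ ((stlF q).μ ⟨n⟩ ⟨1⟩).hom)) x)
          (unmulOne_mulOne (tm p v))).trans ?_
        refine congrArg (mulOne q n) ?_
        exact SuperGrading.superMap_tmul_even _ ((V1 q).gr.id_mem_hom) _ _
      obtain ⟨g, hg⟩ := ih (lin_mem ((stlF q).map (cupAt (stlParam q) m) ≫ Ψ))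
      refine ⟨(-superSign k r) • (addR g ≫ capAt (stlParam q) n), ?_⟩
      refine W_succ_ext fun a s p hp => ?_
      have hgp : actL g p = superSign k s • (mul (φ (mul p (vm q))) (vp q) -
          (q : k) • mul (φ (mul p (vp q))) (vm q)) := by
        rw [hg]
        refine (congrArg (lin Ψ) (actL_cupAt hp.2)).trans ?_
        rw [map_smul, map_sub, map_smul, hΨ, hΨ]
      have hpm := h _ _ (mul_wt hp (vm_wt q)).2
      have hpp := h _ _ (mul_wt hp (vp_wt q)).2
      have c1 : capV q (vp q ⊗ₜ vp q) = 0 := (capV_tmul q _ _).trans (by simp [vp])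
      have c2 : capV q (vm q ⊗ₜ vm q) = 0 := (capV_tmul q _ _).trans (by simp [vm])
      have c3 : capV q (vp q ⊗ₜ vm q) = 1 := (capV_tmul q _ _).trans (by simp [vp, vm])
      have c4 : capV q (vm q ⊗ₜ vp q) = ((q⁻¹ : kˣ) : k) :=
        (capV_tmul q _ _).trans (by simp [vp, vm])
      have hq1 := mul_inv_cancel₀ (Units.ne_zero q)
      have hs := superSign_mul_self (k := k) s
      have hr := superSign_mul_self (k := k) r
      constructor
      · rw [actL_smul, LinearMap.smul_apply, actL_comp, actL_addR, hgp, smul_mul, map_smul,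
          sub_eq_add_neg, ← neg_smul, add_mul, smul_mul, map_add, map_smul, actL_capAt hpm,
          actL_capAt hpp, c1, c4]
        simp only [superSign_add, superSign_zero, superSign_one]
        match_scalars
        · ring
        · linear_combination (superSign k s * superSign k s * superSign k r * superSign k r) * hq1 + (superSign k s * superSign k s) * hr + hs
      · rw [actL_smul, LinearMap.smul_apply, actL_comp, actL_addR, hgp, smul_mul, map_smul,
          sub_eq_add_neg, ← neg_smul, add_mul, smul_mul, map_add, map_smul, actL_capAt hpm,
          actL_capAt hpp, c2, c3]
        simp only [superSign_add, superSign_zero, superSign_one]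
        match_scalars
        · linear_combination (superSign k s * superSign k s) * hr + hs
        · ring
    · rintro _ _ ⟨f, rfl⟩ ⟨g, rfl⟩
      exact ⟨f + g, actL_add f g⟩

theorem stlF_full (hq : ∀ n : ℕ, 0 < n → q ^ n ≠ 1) {X Y : STL k (stlParam q)}
    (φ : (stlF q).obj X ⟶ (stlF q).obj Y) : ∃ f : X ⟶ Y, (stlF q).map f = φ := by
  obtain ⟨f, hf⟩ := exists_actL_eq hq (lin_mem φ)
  exact ⟨f, hom_ext hf⟩

theorem stlF_faithful {X Y : STL k (stlParam q)} {f g : X ⟶ Y}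
    (h : (stlF q).map f = (stlF q).map g) : f = g := by
  rw [← sub_eq_zero]
  refine eq_zero_of_actL (m := X.n) (n := Y.n) ?_
  have h1 : actL (m := X.n) (n := Y.n) f = actL (m := X.n) (n := Y.n) g := congrArg lin h
  rw [sub_eq_add_neg, ← neg_one_smul k g, actL_add, actL_smul, h1, neg_one_smul, add_neg_cancel]

end OspMod

/-! ### Extending a monoidal superfunctor to the `Π`-envelope -/

section HomogeneousIso

variable {k : Type u} [Field k]
variable {A : Type w} [Category.{v} A] [Preadditive A] [Linear k A] [Supercategory k A]
  [MonoidalCategoryStruct A] [MonoidalSupercategory k A]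

/-- The tensor product of homogeneous isomorphisms; by the super interchange law the inverse
carries a sign. -/
noncomputable def MonoidalSupercategory.tensorIso {X Y X' Y' : A} (p r : ZMod 2)
    (e : X ≅ Y) (e' : X' ≅ Y') (h : HomParity k p e.hom) (h' : HomParity k p e.inv)
    (g : HomParity k r e'.hom) (g' : HomParity k r e'.inv) : X ⊗ X' ≅ Y ⊗ Y' where
  hom := e.hom ⊗ₘ e'.hom
  inv := superSign k (r * p) • (e.inv ⊗ₘ e'.inv)
  hom_inv_id := by
    rw [Linear.comp_smul, interchange (k := k) _ _ _ _ g' h, smul_smul,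
      OspMod.superSign_mul_self, one_smul, e.hom_inv_id, e'.hom_inv_id, id_tensor_id k]
  inv_hom_id := by
    rw [Linear.smul_comp, interchange (k := k) _ _ _ _ g h', smul_smul,
      OspMod.superSign_mul_self, one_smul, e.inv_hom_id, e'.inv_hom_id, id_tensor_id k]

end HomogeneousIso

namespace MonoidalSuperfunctor

variable {k : Type u} [Field k]
variable {A : Type w} [Category.{v} A] [Preadditive A] [Linear k A] [Supercategory k A]
  [MonoidalCategoryStruct A]
variable {B : Type w'} [Category.{v'} B] [Preadditive B] [Linear k B] [Supercategory k B]
  [MonoidalCategoryStruct B]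

/-- A choice, for all objects `Y` and parities `a`, of an object `Π^a Y` and an isomorphism
`Y ≅ Π^a Y` of parity `a`. -/
structure ParityShift (k : Type u) [Field k] (B : Type w') [Category.{v'} B] [Preadditive B]
    [Linear k B] [Supercategory k B] where
  obj : B → ZMod 2 → B
  iso : ∀ Y a, Y ≅ obj Y a
  parity : ∀ Y a, HomParity k a (iso Y a).hom
  parity_inv : ∀ Y a, HomParity k a (iso Y a).inv

variable (S : ParityShift k B) (F : MonoidalSuperfunctor k A B)

/-- The isomorphism `F X ≅ Π^a (F X)`, for the object `Π^a X` of the `Π`-envelope. -/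
def shiftIso (X : PiEnv k A) : F.obj X.base ≅ S.obj (F.obj X.base) X.par := S.iso _ _

theorem shiftIso_parity (X : PiEnv k A) : HomParity k X.par (F.shiftIso S X).hom := S.parity _ _

theorem shiftIso_inv_parity (X : PiEnv k A) : HomParity k X.par (F.shiftIso S X).inv :=
  S.parity_inv _ _

/-- The value of the extension of `F` to the `Π`-envelope on morphisms. -/
def shiftMap {X Y : PiEnv k A} (f : X ⟶ Y) :
    S.obj (F.obj X.base) X.par ⟶ S.obj (F.obj Y.base) Y.par :=
  (F.shiftIso S X).inv ≫ F.map (PiEnv.val f) ≫ (F.shiftIso S Y).hom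

theorem shiftIso_hom_shiftMap {X Y : PiEnv k A} (f : X ⟶ Y) :
    (F.shiftIso S X).hom ≫ F.shiftMap S f = F.map (PiEnv.val f) ≫ (F.shiftIso S Y).hom := by
  rw [shiftMap, Iso.hom_inv_id_assoc]

theorem shiftMap_parity {X Y : PiEnv k A} {p : ZMod 2} {f : X ⟶ Y} (h : HomParity k p f) :
    HomParity k p (F.shiftMap S f) := by
  refine ((F.shiftIso_inv_parity S X).comp
    ((F.map_parity (PiEnv.homParity_val h)).comp (F.shiftIso_parity S Y))).cast ?_
  linear_combination zmod2_add_self X.par + zmod2_add_self Y.par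

/-- A faithful superfunctor reflects the parity of morphisms. -/
theorem homParity_of_map (hF : ∀ {X Y : A} {f g : X ⟶ Y}, F.map f = F.map g → f = g)
    {X Y : A} {p : ZMod 2} {f : X ⟶ Y} (h : HomParity k p (F.map f)) : HomParity k p f := by
  have e : ∀ g : X ⟶ Y, F.map ((Supercategory.gr (k := k) X Y).proj p g) =
      (Supercategory.gr (k := k) (F.obj X) (F.obj Y)).proj p (F.map g) := by
    refine (Supercategory.gr (k := k) X Y).induction (fun r g hg => ?_) (fun g g' hg hg' => ?_)
    · rw [SuperGrading.proj_of_mem' _ p hg, SuperGrading.proj_of_mem' _ p (F.map_parity hg)]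
      split_ifs
      · rfl
      · simpa using F.map_smul (0 : k) g
    · rw [LinearMap.map_add, F.map_add, hg, hg', F.map_add, LinearMap.map_add]
  rw [← hF ((e f).trans (SuperGrading.proj_of_mem _ h))]
  exact SuperGrading.proj_mem _ _ _

variable [MonoidalSupercategory k B]

/-- The tensor product of the isomorphisms `F X ≅ Π^a (F X)`. -/
noncomputable def shiftTensorIso (X Y : PiEnv k A) : F.obj X.base ⊗ F.obj Y.base ≅
    S.obj (F.obj X.base) X.par ⊗ S.obj (F.obj Y.base) Y.par :=
  MonoidalSupercategory.tensorIso X.par Y.par (F.shiftIso S X) (F.shiftIso S Y)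
    (F.shiftIso_parity S X) (F.shiftIso_inv_parity S X) (F.shiftIso_parity S Y)
    (F.shiftIso_inv_parity S Y)

/-- The multiplicative coherence isomorphism of the extension of `F` to the `Π`-envelope. -/
noncomputable def shiftMu (X Y : PiEnv k A) :
    S.obj (F.obj X.base) X.par ⊗ S.obj (F.obj Y.base) Y.par ≅
      S.obj (F.obj (X ⊗ Y).base) (X ⊗ Y).par :=
  (F.shiftTensorIso S X Y).symm ≪≫ F.μ X.base Y.base ≪≫ F.shiftIso S (X ⊗ Y)

theorem tensor_shiftMu (X Y : PiEnv k A) :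
    ((F.shiftIso S X).hom ⊗ₘ (F.shiftIso S Y).hom) ≫ (F.shiftMu S X Y).hom =
      (F.μ X.base Y.base).hom ≫ (F.shiftIso S (X ⊗ Y)).hom :=
  (F.shiftTensorIso S X Y).hom_inv_id_assoc _

theorem tensor_shiftMu_assoc (X Y : PiEnv k A) {Z : B}
    (f : S.obj (F.obj (X ⊗ Y).base) (X ⊗ Y).par ⟶ Z) :
    ((F.shiftIso S X).hom ⊗ₘ (F.shiftIso S Y).hom) ≫ (F.shiftMu S X Y).hom ≫ f =
      (F.μ X.base Y.base).hom ≫ (F.shiftIso S (X ⊗ Y)).hom ≫ f := by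
  rw [← Category.assoc, tensor_shiftMu, Category.assoc]

theorem shiftMu_even (X Y : PiEnv k A) : HomParity k 0 (F.shiftMu S X Y).hom := by
  refine HomParity.cast (HomParity.comp (p := X.par + Y.par) (Submodule.smul_mem _ _
    (MonoidalSupercategory.tensor_parity (F.shiftIso_inv_parity S X) (F.shiftIso_inv_parity S Y)))
    ((F.μ_even _ _).comp (F.shiftIso_parity S (X ⊗ Y)))) ?_
  change X.par + Y.par + (0 + (X.par + Y.par)) = 0
  rw [zero_add, zmod2_add_self]

theorem shiftMu_inv_even (X Y : PiEnv k A) : HomParity k 0 (F.shiftMu S X Y).inv := by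
  refine HomParity.cast (HomParity.comp (r := X.par + Y.par)
    ((F.shiftIso_inv_parity S (X ⊗ Y)).comp (F.μ_inv_even _ _))
    (MonoidalSupercategory.tensor_parity (F.shiftIso_parity S X) (F.shiftIso_parity S Y))) ?_
  change X.par + Y.par + 0 + (X.par + Y.par) = 0
  rw [add_zero, zmod2_add_self]

variable [MonoidalSupercategory k A]

/-- Naturality of the coherence isomorphisms. After composition with the odd or even isomorphisms
`Y ≅ Π^a Y`, the signs from the super interchange law cancel those in the tensor product of the
`Π`-envelope. -/
theorem shiftMu_natural {X₁ Y₁ X₂ Y₂ : PiEnv k A} (f : X₁ ⟶ Y₁) (g : X₂ ⟶ Y₂) :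
    (F.shiftMap S f ⊗ₘ F.shiftMap S g) ≫ (F.shiftMu S Y₁ Y₂).hom =
      (F.shiftMu S X₁ X₂).hom ≫ F.shiftMap S (f ⊗ₘ g) := by
  have hadd : ∀ {X Y : PiEnv k A} (f f' : X ⟶ Y),
      F.shiftMap S (f + f') = F.shiftMap S f + F.shiftMap S f' := fun f f' => by
    simp only [shiftMap, PiEnv.val_add, F.map_add, Preadditive.add_comp, Preadditive.comp_add]
  revert f
  refine PiEnv.hom_induction (k := k) (fun p f hf => ?_) (fun f f' e e' => ?_)
  swap
  · rw [hadd, MonoidalSupercategory.add_tensor k, Preadditive.add_comp, e, e',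
      PiEnv.add_tensor', hadd, Preadditive.comp_add]
  revert g
  refine PiEnv.hom_induction (k := k) (fun r g hg => ?_) (fun g g' e e' => ?_)
  swap
  · rw [hadd, MonoidalSupercategory.tensor_add k, Preadditive.add_comp, e, e',
      PiEnv.tensor_add', hadd, Preadditive.comp_add]
  rw [← cancel_epi (F.shiftTensorIso S X₁ X₂).hom]
  change ((F.shiftIso S X₁).hom ⊗ₘ (F.shiftIso S X₂).hom) ≫ _ ≫ _ =
    ((F.shiftIso S X₁).hom ⊗ₘ (F.shiftIso S X₂).hom) ≫ _ ≫ _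
  rw [tensor_shiftMu_assoc, shiftIso_hom_shiftMap, PiEnv.val_tensor_eq hf hg, ← Category.assoc,
    MonoidalSupercategory.interchange (k := k) _ _ _ _
      (F.shiftMap_parity S (PiEnv.homParity_iff'.2 hg)) (F.shiftIso_parity S X₁),
    shiftIso_hom_shiftMap, shiftIso_hom_shiftMap, F.map_smul, Linear.smul_comp, Linear.smul_comp,
    Linear.comp_smul, ← Category.assoc, ← F.μ_natural, Category.assoc, ← tensor_shiftMu,
    ← Category.assoc,
    MonoidalSupercategory.interchange (k := k) _ _ _ _ (F.shiftIso_parity S Y₂) (F.map_parity hf),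
    Linear.smul_comp, smul_smul, ← superSign_add]
  congr 2
  have h2 : (2 : ZMod 2) = 0 := by decide
  linear_combination (- Y₂.par * p) * h2

/-- The extension of a monoidal superfunctor to the `Π`-envelope, for a target category which has
parity shifts. -/
noncomputable def piLift : MonoidalSuperfunctor k (PiEnv k A) B where
  obj X := S.obj (F.obj X.base) X.par
  map f := F.shiftMap S f
  map_id X := by simp [shiftMap]
  map_comp f g := by simp [shiftMap]
  map_add f g := by
    simp only [shiftMap, PiEnv.val_add, F.map_add, Preadditive.add_comp, Preadditive.comp_add]
  map_smul c f := by
    simp only [shiftMap, PiEnv.val_smul, F.map_smul, Linear.smul_comp, Linear.comp_smul]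
  map_parity h := F.shiftMap_parity S h
  μ X Y := F.shiftMu S X Y
  ε := F.ε ≪≫ F.shiftIso S (𝟙_ (PiEnv k A))
  μ_even X Y := F.shiftMu_even S X Y
  μ_inv_even X Y := F.shiftMu_inv_even S X Y
  ε_even := F.ε_even.comp0 (F.shiftIso_parity S (𝟙_ (PiEnv k A)))
  ε_inv_even := (F.shiftIso_inv_parity S (𝟙_ (PiEnv k A))).comp0 F.ε_inv_even
  μ_natural f g := F.shiftMu_natural S f g
  associativity X Y Z := by
    let ζ := MonoidalSupercategory.tensorIso (X.par + Y.par) Z.par (F.shiftTensorIso S X Y)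
      (F.shiftIso S Z) (MonoidalSupercategory.tensor_parity (F.shiftIso_parity S X)
        (F.shiftIso_parity S Y)) (Submodule.smul_mem _ _ (MonoidalSupercategory.tensor_parity
        (F.shiftIso_inv_parity S X) (F.shiftIso_inv_parity S Y)))
      (F.shiftIso_parity S Z) (F.shiftIso_inv_parity S Z)
    rw [← cancel_epi ζ.hom]
    change (((F.shiftIso S X).hom ⊗ₘ (F.shiftIso S Y).hom) ⊗ₘ (F.shiftIso S Z).hom) ≫ _ ≫ _ ≫ _ =
      (((F.shiftIso S X).hom ⊗ₘ (F.shiftIso S Y).hom) ⊗ₘ (F.shiftIso S Z).hom) ≫ _ ≫ _ ≫ _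
    rw [← Category.assoc, ← Category.assoc _ (α_ _ _ _).hom,
      MonoidalSupercategory.associator_natural k,
      tensor_comp_of_right (k := k) _ _ _ (HomParity.id _), tensor_shiftMu, Category.comp_id,
      ← Category.id_comp (F.shiftIso S Z).hom,
      ← tensor_comp_of_left (k := k) _ _ _ (F.μ_even _ _), Category.assoc, tensor_shiftMu_assoc,
      shiftIso_hom_shiftMap, Category.assoc, ← Category.assoc (_ ⊗ₘ (_ ⊗ₘ _)),
      tensor_comp_of_right (k := k) _ _ _ (F.shiftMu_even S _ _), Category.id_comp,
      tensor_shiftMu, Category.comp_id]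
    conv_rhs => rw [← Category.id_comp (F.shiftIso S X).hom]
    rw [← tensor_comp_of_left (k := k) _ _ _ (HomParity.id _), Category.assoc, tensor_shiftMu,
      PiEnv.val_associator_hom]
    have h := F.associativity X.base Y.base Z.base =≫ (F.shiftIso S (X ⊗ Y ⊗ Z)).hom
    simp only [Category.assoc] at h
    exact h
  left_unitality X := by
    let ζ := MonoidalSupercategory.tensorIso 0 X.par (Iso.refl (𝟙_ B)) (F.shiftIso S X)
      (HomParity.id _) (HomParity.id _) (F.shiftIso_parity S X) (F.shiftIso_inv_parity S X)
    rw [← cancel_epi ζ.hom]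
    change (𝟙 _ ⊗ₘ (F.shiftIso S X).hom) ≫ _ = (𝟙 _ ⊗ₘ (F.shiftIso S X).hom) ≫ _ ≫ _ ≫ _
    rw [MonoidalSupercategory.leftUnitor_natural k, ← Category.assoc,
      tensor_comp_of_left (k := k) _ _ _ (HomParity.id _), Category.id_comp, Category.comp_id]
    conv_rhs => rw [← Category.id_comp (F.shiftIso S X).hom]
    rw [Iso.trans_hom, ← tensor_comp_of_left (k := k) _ _ _ F.ε_even, Category.assoc,
      tensor_shiftMu_assoc, shiftIso_hom_shiftMap, PiEnv.val_leftUnitor_hom]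
    have h := F.left_unitality X.base =≫ (F.shiftIso S X).hom
    simp only [Category.assoc] at h
    exact h
  right_unitality X := by
    let ζ := MonoidalSupercategory.tensorIso X.par 0 (F.shiftIso S X) (Iso.refl (𝟙_ B))
      (F.shiftIso_parity S X) (F.shiftIso_inv_parity S X) (HomParity.id _) (HomParity.id _)
    rw [← cancel_epi ζ.hom]
    change ((F.shiftIso S X).hom ⊗ₘ 𝟙 _) ≫ _ = ((F.shiftIso S X).hom ⊗ₘ 𝟙 _) ≫ _ ≫ _ ≫ _
    rw [MonoidalSupercategory.rightUnitor_natural k, ← Category.assoc,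
      tensor_comp_of_right (k := k) _ _ _ (g := (F.ε ≪≫ F.shiftIso S (𝟙_ (PiEnv k A))).hom)
        (F.ε_even.comp0 (F.shiftIso_parity S (𝟙_ (PiEnv k A)))), Category.id_comp,
      Category.comp_id]
    conv_rhs => rw [← Category.id_comp (F.shiftIso S X).hom]
    rw [Iso.trans_hom, ← tensor_comp_of_left (k := k) _ _ _ (HomParity.id _), Category.assoc,
      tensor_shiftMu_assoc, shiftIso_hom_shiftMap, PiEnv.val_rightUnitor_hom]
    have h := F.right_unitality X.base =≫ (F.shiftIso S X).hom
    simp only [Category.assoc] at h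
    exact h

/-- The isomorphism is inverse to `F X ≅ Π^0 (F X)`. -/
theorem incl_comp_piLift_isoTo : ((PiEnv.incl k A).comp (F.piLift S)).IsoTo F := by
  refine ⟨fun X => (F.shiftIso S ⟨X, 0⟩).symm, fun X => F.shiftIso_inv_parity S ⟨X, 0⟩,
    fun {X Y} f => ?_, fun X Y => ?_, ?_⟩
  · change F.shiftMap S (PiEnv.mk' f : (⟨X, 0⟩ : PiEnv k A) ⟶ ⟨Y, 0⟩) ≫
      (F.shiftIso S ⟨Y, 0⟩).inv = (F.shiftIso S ⟨X, 0⟩).inv ≫ F.map f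
    rw [shiftMap, Category.assoc, Category.assoc, Iso.hom_inv_id, Category.comp_id, PiEnv.val_mk']
  · change ((F.shiftMu S ⟨X, 0⟩ ⟨Y, 0⟩).hom ≫ F.shiftMap S
        (PiEnv.mk' (𝟙 (X ⊗ Y)) : (⟨X, 0⟩ ⊗ ⟨Y, 0⟩ : PiEnv k A) ⟶ ⟨X ⊗ Y, 0⟩)) ≫
      (F.shiftIso S ⟨X ⊗ Y, 0⟩).inv =
      ((F.shiftIso S ⟨X, 0⟩).inv ⊗ₘ (F.shiftIso S ⟨Y, 0⟩).inv) ≫ (F.μ X Y).hom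
    rw [← cancel_epi (F.shiftTensorIso S ⟨X, 0⟩ ⟨Y, 0⟩).hom]
    change ((F.shiftIso S ⟨X, 0⟩).hom ⊗ₘ (F.shiftIso S ⟨Y, 0⟩).hom) ≫ _ =
      ((F.shiftIso S ⟨X, 0⟩).hom ⊗ₘ (F.shiftIso S ⟨Y, 0⟩).hom) ≫ _
    rw [Category.assoc, tensor_shiftMu_assoc, ← Category.assoc (F.shiftIso S _).hom,
      shiftIso_hom_shiftMap, PiEnv.val_mk', Category.assoc, Iso.hom_inv_id,
      Category.comp_id, ← Category.assoc (_ ⊗ₘ _),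
      tensor_comp_of_left (k := k) _ _ _ (F.shiftIso_parity S ⟨X, 0⟩), Iso.hom_inv_id,
      Iso.hom_inv_id, MonoidalSupercategory.id_tensor_id k, Category.id_comp]
    exact (congrArg _ (F.map_id _)).trans (Category.comp_id _)
  · change ((F.ε.hom ≫ (F.shiftIso S ⟨𝟙_ A, 0⟩).hom) ≫ F.shiftMap S
        (PiEnv.mk' (𝟙 (𝟙_ A)) : (⟨𝟙_ A, 0⟩ : PiEnv k A) ⟶ ⟨𝟙_ A, 0⟩)) ≫
      (F.shiftIso S ⟨𝟙_ A, 0⟩).inv = F.ε.hom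
    rw [Category.assoc, Category.assoc, ← Category.assoc (F.shiftIso S _).hom,
      shiftIso_hom_shiftMap, PiEnv.val_mk', F.map_id, Category.id_comp, Iso.hom_inv_id,
      Category.comp_id]

instance piLift_additive : (F.piLift S).underlying.Additive where
  map_add := Underlying.hom_ext ((F.piLift S).map_add _ _)

theorem piLift_underlying_faithful (hF : ∀ {X Y : A} {f g : X ⟶ Y}, F.map f = F.map g → f = g) :
    (F.piLift S).underlying.Faithful where
  map_injective {X Y f g} h := by
    have h' : F.shiftMap S (Underlying.val f) = F.shiftMap S (Underlying.val g) :=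
      congrArg Underlying.val h
    have e : ∀ (f : X.of ⟶ Y.of), F.map (PiEnv.val f) =
        (F.shiftIso S X.of).hom ≫ F.shiftMap S f ≫ (F.shiftIso S Y.of).inv := fun f => by
      simp [shiftMap]
    refine Underlying.hom_ext (PiEnv.hom_ext (hF ?_))
    rw [e, e, h']

theorem piLift_underlying_full (hF : ∀ {X Y : A} {f g : X ⟶ Y}, F.map f = F.map g → f = g)
    (hF' : ∀ {X Y : A} (φ : F.obj X ⟶ F.obj Y), ∃ f, F.map f = φ) :
    (F.piLift S).underlying.Full where
  map_surjective {X Y} φ := by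
    obtain ⟨f, hf⟩ := hF' ((F.shiftIso S X.of).hom ≫ Underlying.val φ ≫ (F.shiftIso S Y.of).inv)
    have hp : HomParity k (X.of.par + (0 + Y.of.par)) (F.map f) := by
      rw [hf]
      exact (F.shiftIso_parity S X.of).comp
        ((Underlying.val_even φ).comp (F.shiftIso_inv_parity S Y.of))
    refine ⟨Underlying.mk' (PiEnv.mk' f : X.of ⟶ Y.of) ?_, Underlying.hom_ext ?_⟩
    · rw [PiEnv.homParity_iff]
      exact (F.homParity_of_map hF hp).cast (by ring)
    · change F.shiftMap S (PiEnv.mk' f : X.of ⟶ Y.of) = Underlying.val φ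
      have e : ∀ φ : S.obj (F.obj X.of.base) X.of.par ⟶ S.obj (F.obj Y.of.base) Y.of.par,
          (F.shiftIso S X.of).inv ≫ ((F.shiftIso S X.of).hom ≫ φ ≫ (F.shiftIso S Y.of).inv) ≫
            (F.shiftIso S Y.of).hom = φ := fun φ => by simp
      rw [shiftMap, PiEnv.val_mk', hf]
      exact e _

end MonoidalSuperfunctor

/-! ### Equality of monoidal superfunctors -/

section Transport

variable {k : Type u} [Field k]
variable {A : Type w} [Category.{v} A] [Preadditive A] [Linear k A] [Supercategory k A]
  [MonoidalCategoryStruct A]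
variable {B : Type w'} [Category.{v'} B] [Preadditive B] [Linear k B] [Supercategory k B]

theorem homParity_eqToHom {X Y : B} (h : X = Y) : HomParity k 0 (eqToHom h) := by
  subst h; exact HomParity.id _

theorem eqToHom_tensor (k : Type u) [Field k] {B : Type w'} [Category.{v'} B] [Preadditive B]
    [Linear k B] [Supercategory k B] [MonoidalCategoryStruct B] [MonoidalSupercategory k B]
    {X Y X' Y' : B} (h : X = Y) (h' : X' = Y') :
    eqToHom h ⊗ₘ eqToHom h' = eqToHom (congrArg₂ (· ⊗ ·) h h') := by
  subst h; subst h'; exact MonoidalSupercategory.id_tensor_id k _ _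

variable [MonoidalCategoryStruct B]

namespace MonoidalSuperfunctor

theorem map_of_eq {F G : MonoidalSuperfunctor k A B} (h : F = G) {X Y : A} (f : X ⟶ Y) :
    F.map f ≫ eqToHom (congrArg (fun H => H.obj Y) h) =
      eqToHom (congrArg (fun H => H.obj X) h) ≫ G.map f := by
  subst h; simp

theorem epsilon_of_eq {F G : MonoidalSuperfunctor k A B} (h : F = G) :
    F.ε.hom ≫ eqToHom (congrArg (fun H => H.obj (𝟙_ A)) h) = G.ε.hom := by
  subst h; simp

variable [MonoidalSupercategory k B]

/-- A monoidal natural isomorphism all of whose components are identities is an equality. -/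
theorem eq_of_eqToHom {F G : MonoidalSuperfunctor k A B} (h : ∀ X, F.obj X = G.obj X)
    (hmap : ∀ {X Y : A} (f : X ⟶ Y), F.map f ≫ eqToHom (h Y) = eqToHom (h X) ≫ G.map f)
    (hμ : ∀ X Y, (F.μ X Y).hom ≫ eqToHom (h (X ⊗ Y)) =
      (eqToHom (h X) ⊗ₘ eqToHom (h Y)) ≫ (G.μ X Y).hom)
    (hε : F.ε.hom ≫ eqToHom (h (𝟙_ A)) = G.ε.hom) : F = G := by
  obtain ⟨⟨o, m, i, c⟩, a, s, p, μ, ε, e1, e2, e3, e4, e5, e6, e7, e8⟩ := F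
  obtain ⟨⟨o', m', i', c'⟩, a', s', p', μ', ε', e1', e2', e3', e4', e5', e6', e7', e8'⟩ := G
  obtain rfl : o = o' := funext h
  have hm : ∀ {X Y : A} (f : X ⟶ Y), m f = m' f := fun {X Y} f => by
    have := hmap f
    simpa using this
  obtain rfl : @m = @m' := by
    funext X Y f
    exact hm f
  obtain rfl : μ = μ' := by
    funext X Y
    refine Iso.ext ?_
    have := hμ X Y
    rw [eqToHom_refl, eqToHom_refl, eqToHom_refl, MonoidalSupercategory.id_tensor_id k,
      Category.id_comp] at this
    exact (Category.comp_id _).symm.trans this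
  obtain rfl : ε = ε' := Iso.ext ((Category.comp_id _).symm.trans hε)
  rfl

theorem mu_of_eq {F G : MonoidalSuperfunctor k A B} (h : F = G) (X Y : A) :
    (F.μ X Y).hom ≫ eqToHom (congrArg (fun H => H.obj (X ⊗ Y)) h) =
      (eqToHom (congrArg (fun H => H.obj X) h) ⊗ₘ eqToHom (congrArg (fun H => H.obj Y) h)) ≫
        (G.μ X Y).hom := by
  subst h; simp [MonoidalSupercategory.id_tensor_id k]

end MonoidalSuperfunctor

end Transport

namespace STL

open MonoidalSupercategory

variable {k : Type u} [Field k] {δ : k}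
variable {B : Type w'} [Category.{v'} B] [Preadditive B] [Linear k B] [Supercategory k B]
  [MonoidalCategoryStruct B]

theorem map_rightUnitor (F : MonoidalSuperfunctor k (STL k δ) B) (m : ℕ) :
    (ρ_ (F.obj ⟨m⟩)).hom = (𝟙 (F.obj ⟨m⟩) ⊗ₘ F.ε.hom) ≫ (F.μ ⟨m⟩ ⟨0⟩).hom :=
  (F.right_unitality ⟨m⟩).trans
    (congrArg _ ((congrArg _ (F.map_id (⟨m⟩ : STL k δ))).trans (Category.comp_id _)))

theorem map_associator (F : MonoidalSuperfunctor k (STL k δ) B) (m n : ℕ) :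
    ((F.μ ⟨m⟩ ⟨n⟩).hom ⊗ₘ 𝟙 (F.obj ⟨1⟩)) ≫ (F.μ ⟨m + n⟩ ⟨1⟩).hom =
      (α_ (F.obj ⟨m⟩) (F.obj ⟨n⟩) (F.obj ⟨1⟩)).hom ≫ (𝟙 (F.obj ⟨m⟩) ⊗ₘ (F.μ ⟨n⟩ ⟨1⟩).hom) ≫
        (F.μ ⟨m⟩ ⟨n + 1⟩).hom :=
  (congrArg _ ((congrArg _ (F.map_id (⟨m + n + 1⟩ : STL k δ))).trans (Category.comp_id _))).symm.trans
    (F.associativity ⟨m⟩ ⟨n⟩ ⟨1⟩)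

variable [MonoidalSupercategory k B] {F G : MonoidalSuperfunctor k (STL k δ) B}

/-- An even family of morphisms which is compatible with the coherence isomorphisms of the unit
object and of the tensor products with the generating object is compatible with all of them. -/
theorem mu_natural_of_generator (x : ∀ X, F.obj X ⟶ G.obj X) (hx : ∀ X, HomParity k 0 (x X))
    (hε : F.ε.hom ≫ x ⟨0⟩ = G.ε.hom)
    (hμ : ∀ n : ℕ, (F.μ ⟨n⟩ ⟨1⟩).hom ≫ x ⟨n + 1⟩ = (x ⟨n⟩ ⊗ₘ x ⟨1⟩) ≫ (G.μ ⟨n⟩ ⟨1⟩).hom)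
    (m n : ℕ) :
    (F.μ ⟨m⟩ ⟨n⟩).hom ≫ x ⟨m + n⟩ = (x ⟨m⟩ ⊗ₘ x ⟨n⟩) ≫ (G.μ ⟨m⟩ ⟨n⟩).hom := by
  induction n with
  | zero =>
    let e := tensorIso (k := k) 0 0 (Iso.refl (F.obj ⟨m⟩)) F.ε (HomParity.id _) (HomParity.id _)
      F.ε_even F.ε_inv_even
    rw [← cancel_epi e.hom]
    change (𝟙 _ ⊗ₘ F.ε.hom) ≫ (F.μ ⟨m⟩ ⟨0⟩).hom ≫ x ⟨m⟩ = (𝟙 _ ⊗ₘ F.ε.hom) ≫ _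
    rw [← Category.assoc, ← map_rightUnitor, ← Category.assoc,
      tensor_comp_of_left (k := k) _ _ _ (HomParity.id _), hε, Category.id_comp]
    refine (rightUnitor_natural k (x ⟨m⟩)).symm.trans ?_
    rw [map_rightUnitor, ← Category.assoc,
      tensor_comp_of_left (k := k) _ _ _ (hx _), Category.comp_id]
    exact congrArg (fun f => (x ⟨m⟩ ⊗ₘ f) ≫ (G.μ ⟨m⟩ ⟨0⟩).hom) (Category.id_comp _)
  | succ n ih =>
    let e := tensorIso (k := k) 0 0 (Iso.refl (F.obj ⟨m⟩)) (F.μ ⟨n⟩ ⟨1⟩) (HomParity.id _)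
      (HomParity.id _) (F.μ_even _ _) (F.μ_inv_even _ _)
    rw [← cancel_epi e.hom, ← cancel_epi (α_ (F.obj ⟨m⟩) (F.obj ⟨n⟩) (F.obj ⟨1⟩)).hom]
    change (α_ _ _ _).hom ≫ (𝟙 _ ⊗ₘ (F.μ ⟨n⟩ ⟨1⟩).hom) ≫ (F.μ ⟨m⟩ ⟨n + 1⟩).hom ≫ x ⟨m + n + 1⟩ =
      (α_ _ _ _).hom ≫ (𝟙 _ ⊗ₘ (F.μ ⟨n⟩ ⟨1⟩).hom) ≫ (x ⟨m⟩ ⊗ₘ x ⟨n + 1⟩) ≫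
        (G.μ ⟨m⟩ ⟨n + 1⟩).hom
    have h1 : (α_ _ _ _).hom ≫ (𝟙 _ ⊗ₘ (F.μ ⟨n⟩ ⟨1⟩).hom) ≫ (F.μ ⟨m⟩ ⟨n + 1⟩).hom ≫
        x ⟨m + n + 1⟩ = ((F.μ ⟨m⟩ ⟨n⟩).hom ⊗ₘ 𝟙 (F.obj ⟨1⟩)) ≫ (F.μ ⟨m + n⟩ ⟨1⟩).hom ≫
        x ⟨m + n + 1⟩ := by
      have := map_associator F m n =≫ x ⟨m + n + 1⟩
      simp only [Category.assoc] at this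
      exact this.symm
    rw [h1, hμ, ← Category.assoc, tensor_comp_of_left (k := k) _ _ _ (F.μ_even _ _),
      Category.id_comp]
    have h2 : ((F.μ ⟨m⟩ ⟨n⟩).hom ≫ x ⟨m + n⟩) ⊗ₘ x ⟨1⟩ =
        ((x ⟨m⟩ ⊗ₘ x ⟨n⟩) ⊗ₘ x ⟨1⟩) ≫ ((G.μ ⟨m⟩ ⟨n⟩).hom ⊗ₘ 𝟙 (G.obj ⟨1⟩)) := by
      rw [ih, tensor_comp_of_right (k := k) _ _ _ (HomParity.id _), Category.comp_id]
    refine (congrArg (· ≫ (G.μ ⟨m + n⟩ ⟨1⟩).hom) h2).trans ?_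
    change (_ ≫ _) ≫ _ = _
    rw [Category.assoc, map_associator, ← Category.assoc, associator_natural k, Category.assoc,
      ← Category.assoc (x ⟨m⟩ ⊗ₘ _), tensor_comp_of_left (k := k) _ _ _ (hx _), Category.comp_id,
      ← hμ, ← Category.assoc (𝟙 _ ⊗ₘ _), tensor_comp_of_left (k := k) _ _ _ (HomParity.id _),
      Category.id_comp]

/-- An even family of morphisms which is compatible with the coherence isomorphisms, with the cup
and with the cap is natural. -/
theorem natural_of_generator (x : ∀ X, F.obj X ⟶ G.obj X) (hx : ∀ X, HomParity k 0 (x X))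
    (hε : F.ε.hom ≫ x ⟨0⟩ = G.ε.hom)
    (hμ : ∀ n : ℕ, (F.μ ⟨n⟩ ⟨1⟩).hom ≫ x ⟨n + 1⟩ = (x ⟨n⟩ ⊗ₘ x ⟨1⟩) ≫ (G.μ ⟨n⟩ ⟨1⟩).hom)
    (hcup : F.map (hmk .cup : (⟨0⟩ : STL k δ) ⟶ ⟨2⟩) ≫ x ⟨2⟩ = x ⟨0⟩ ≫ G.map (hmk .cup))
    (hcap : F.map (hmk .cap : (⟨2⟩ : STL k δ) ⟶ ⟨0⟩) ≫ x ⟨0⟩ = x ⟨2⟩ ≫ G.map (hmk .cap))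
    {m n : ℕ} (f : STLPre k m n) :
    F.map (hmk f : (⟨m⟩ : STL k δ) ⟶ ⟨n⟩) ≫ x ⟨n⟩ = x ⟨m⟩ ≫ G.map (hmk f) := by
  induction f with
  | cup => exact hcup
  | cap => exact hcap
  | id n =>
    change F.map (𝟙 _) ≫ _ = _ ≫ G.map (𝟙 _)
    rw [F.map_id, G.map_id, Category.id_comp, Category.comp_id]
  | @comp l m n f g hf hg =>
    change F.map ((hmk f : (⟨l⟩ : STL k δ) ⟶ ⟨m⟩) ≫ (hmk g : _ ⟶ ⟨n⟩)) ≫ _ =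
      _ ≫ G.map ((hmk f : (⟨l⟩ : STL k δ) ⟶ ⟨m⟩) ≫ (hmk g : _ ⟶ ⟨n⟩))
    rw [F.map_comp, G.map_comp, Category.assoc, hg, ← Category.assoc, hf, Category.assoc]
  | @tensor m n m' n' f g hf hg =>
    rw [← cancel_epi (F.μ ⟨m⟩ ⟨m'⟩).hom]
    change _ ≫ F.map ((hmk f : (⟨m⟩ : STL k δ) ⟶ ⟨n⟩) ⊗ₘ (hmk g : ⟨m'⟩ ⟶ ⟨n'⟩)) ≫ x ⟨n + n'⟩ =
      (F.μ ⟨m⟩ ⟨m'⟩).hom ≫ x ⟨m + m'⟩ ≫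
        G.map ((hmk f : (⟨m⟩ : STL k δ) ⟶ ⟨n⟩) ⊗ₘ (hmk g : ⟨m'⟩ ⟶ ⟨n'⟩))
    have h1 := mu_natural_of_generator x hx hε hμ
    rw [← Category.assoc, ← F.μ_natural, Category.assoc]
    refine (congrArg _ (h1 n n')).trans ?_
    rw [← Category.assoc, tensor_comp_of_right (k := k) _ _ _ (hx _), hf, hg,
      ← tensor_comp_of_left (k := k) _ _ _ (hx _), Category.assoc, G.μ_natural,
      ← Category.assoc, ← Category.assoc]
    exact congrArg (· ≫ _) (h1 m m').symm
  | zero m n =>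
    have e : ∀ H : MonoidalSuperfunctor k (STL k δ) B,
        H.map (0 : (⟨m⟩ : STL k δ) ⟶ ⟨n⟩) = 0 := fun H => by
      simpa using H.map_smul (0 : k) (0 : (⟨m⟩ : STL k δ) ⟶ ⟨n⟩)
    change F.map 0 ≫ _ = _ ≫ G.map 0
    rw [e, e, Limits.zero_comp, Limits.comp_zero]
  | @add m n f g hf hg =>
    change F.map ((hmk f : (⟨m⟩ : STL k δ) ⟶ ⟨n⟩) + hmk g) ≫ _ =
      _ ≫ G.map ((hmk f : (⟨m⟩ : STL k δ) ⟶ ⟨n⟩) + hmk g)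
    rw [F.map_add, G.map_add, Preadditive.add_comp, Preadditive.comp_add, hf, hg]
  | @smul m n c f hf =>
    change F.map (c • (hmk f : (⟨m⟩ : STL k δ) ⟶ ⟨n⟩)) ≫ _ =
      _ ≫ G.map (c • (hmk f : (⟨m⟩ : STL k δ) ⟶ ⟨n⟩))
    rw [F.map_smul, G.map_smul, Linear.smul_comp, Linear.comp_smul, hf]

/-- Monoidal superfunctors on `STL(δ)` are equal if they agree on objects, on the coherence
isomorphisms involving the generating object and on the generating morphisms. -/
theorem monoidalSuperfunctor_ext (h : ∀ X, F.obj X = G.obj X)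
    (hε : F.ε.hom ≫ eqToHom (h ⟨0⟩) = G.ε.hom)
    (hμ : ∀ n : ℕ, (F.μ ⟨n⟩ ⟨1⟩).hom ≫ eqToHom (h ⟨n + 1⟩) =
      (eqToHom (h ⟨n⟩) ⊗ₘ eqToHom (h ⟨1⟩)) ≫ (G.μ ⟨n⟩ ⟨1⟩).hom)
    (hcup : F.map (hmk .cup : (⟨0⟩ : STL k δ) ⟶ ⟨2⟩) ≫ eqToHom (h ⟨2⟩) =
      eqToHom (h ⟨0⟩) ≫ G.map (hmk .cup))
    (hcap : F.map (hmk .cap : (⟨2⟩ : STL k δ) ⟶ ⟨0⟩) ≫ eqToHom (h ⟨0⟩) =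
      eqToHom (h ⟨2⟩) ≫ G.map (hmk .cap)) : F = G := by
  have hx : ∀ X, HomParity k 0 (eqToHom (h X)) := fun X => homParity_eqToHom _
  refine MonoidalSuperfunctor.eq_of_eqToHom h (fun {X Y} f => ?_) (fun X Y => ?_) hε
  · obtain ⟨f, rfl⟩ := hmk_surj f
    exact natural_of_generator _ hx hε hμ hcup hcap f
  · exact mu_natural_of_generator _ hx hε hμ X.n Y.n

end STL

namespace STLRep

variable {k : Type u} [Field k] {δ : k}
variable {B : Type w'} [Category.{v'} B] [Preadditive B] [Linear k B] [Supercategory k B]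
  [MonoidalCategoryStruct B] [MonoidalSupercategory k B]

theorem add_succ_one (R : STLRep δ B) (n : ℕ) :
    (R.add (n + 1) 1).hom = 𝟙 (R.pow (n + 1) ⊗ R.X) := by
  refine congrArg (Underlying.val (k := k)) (?_ : (TensorPower.add (⟨R.X⟩ : Underlying k B) (n + 1) 1).hom = 𝟙 _)
  change TensorPower.pow (⟨R.X⟩ : Underlying k B) (n + 1) ◁ (λ_ _).inv ≫ (α_ _ (𝟙_ _) _).inv ≫
    (ρ_ _).hom ▷ _ ≫ 𝟙 _ = _
  simp

theorem add_zero_one_hom (R : STLRep δ B) : (R.add 0 1).hom = (λ_ R.X).hom :=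
  congrArg Iso.hom R.add_zero_one

end STLRep

namespace OspMod

variable {k : Type u} [Field k] {q : kˣ}

theorem W_toSVec (n : ℕ) : (W q n).toSVec = (stlRepV q).pow n := by
  induction n with
  | zero => rfl
  | succ n ih =>
    cases n with
    | zero => rfl
    | succ n => exact congrArg (· ⊗ SVec.V k) ih

/-- The objects agree by induction; a superfunctor from `STL(δ)` is then determined by the cup, the
cap, the unit isomorphism and the coherence isomorphisms for `n` and `1`. -/
theorem stlF_comp_forget (q : kˣ) : (stlF q).comp (forget k q) = stlG q := by
  refine STL.monoidalSuperfunctor_ext (fun X => W_toSVec X.n) ?_ ?_ ?_ ?_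
  · rfl
  · intro n
    cases n with
    | zero =>
      change (𝟙 _ ≫ (forget k q).map ((ospRep q).add 0 1).hom) ≫ 𝟙 (SVec.V k) =
        (𝟙 (𝟙_ (SVec k)) ⊗ₘ 𝟙 (SVec.V k)) ≫ ((stlRepV q).add 0 1).hom
      rw [STLRep.add_zero_one_hom, STLRep.add_zero_one_hom,
        MonoidalSupercategory.id_tensor_id k]
      rfl
    | succ n =>
      change (𝟙 _ ≫ (forget k q).map ((ospRep q).add (n + 1) 1).hom) ≫
        eqToHom (congrArg (· ⊗ SVec.V k) (W_toSVec (n + 1))) =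
        (eqToHom (W_toSVec (n + 1)) ⊗ₘ eqToHom (rfl : SVec.V k = SVec.V k)) ≫
          ((stlRepV q).add (n + 1) 1).hom
      rw [STLRep.add_succ_one, STLRep.add_succ_one, eqToHom_tensor k]
      refine Eq.trans ?_ (Category.comp_id _).symm
      exact Category.id_comp _
  · rfl
  · rfl

/-- A supermodule structure on a superspace `Y` is determined by an even isomorphism of superspaces
`X ≅ Y` which is a homomorphism from a given supermodule `X`. -/
theorem eq_of_iso {X Y Y' : OspMod k q} (e : X ≅ Y) (e' : X ≅ Y') (he : HomParity k 0 e.hom)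
    (he' : HomParity k 0 e'.hom) (h : Y.toSVec = Y'.toSVec)
    (H : (forget k q).map e.hom ≫ eqToHom h = (forget k q).map e'.hom) : Y = Y' := by
  have key : ∀ (x : OspGen) (v : X.toSVec.carrier),
      lin e.hom (X.act (UqOsp.gen q x) v) = Y.act (UqOsp.gen q x) (lin e.hom v) := fun x v => by
    have := homs_apply (lin_mem e.hom) (parity_iff.1 he) (.gen x) v
    rwa [MulZeroClass.zero_mul, superSign_zero, one_smul] at this
  have key' : ∀ (x : OspGen) (v : X.toSVec.carrier),
      lin e'.hom (X.act (UqOsp.gen q x) v) = Y'.act (UqOsp.gen q x) (lin e'.hom v) := fun x v => by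
    have := homs_apply (lin_mem e'.hom) (parity_iff.1 he') (.gen x) v
    rwa [MulZeroClass.zero_mul, superSign_zero, one_smul] at this
  have hsurj : ∀ y, ∃ v, lin e.hom v = y := fun y =>
    ⟨lin e.inv y, LinearMap.congr_fun (congrArg lin e.inv_hom_id) y⟩
  have hlin : ∀ v, SVec.lin (eqToHom h) (lin e.hom v) = lin e'.hom v := fun v =>
    LinearMap.congr_fun (congrArg SVec.lin H) v
  generalize lin e.hom = f at *
  generalize lin e'.hom = f' at *
  clear H he he' e e'
  obtain ⟨V, _, act, _, _⟩ := Y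
  obtain ⟨V', _, act', _, _⟩ := Y'
  obtain rfl : V = V' := h
  obtain rfl : act = act' := by
    refine RingQuot.ringQuot_ext' _ _ _ (FreeAlgebra.hom_ext (funext fun x => ?_))
    refine LinearMap.ext fun y => ?_
    obtain ⟨v, rfl⟩ := hsurj y
    have e1 := key x v
    have e2 := key' x v
    rw [← hlin, ← hlin] at e2
    exact e1.symm.trans e2
  rfl

/-- The superfunctor `F` is determined by the object `F(1)` and the fibre functor: the
coherence isomorphisms determine the action of `U` on all objects `F(n)`. -/
theorem eq_of_comp_forget {F G : MonoidalSuperfunctor k (STL k (stlParam q)) (OspMod k q)}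
    (h1 : F.obj ⟨1⟩ = G.obj ⟨1⟩) (h : F.comp (forget k q) = G.comp (forget k q)) : F = G := by
  have hV : ∀ X, (F.obj X).toSVec = (G.obj X).toSVec := fun X =>
    congrArg (fun H : MonoidalSuperfunctor k (STL k (stlParam q)) (SVec k) => H.obj X) h
  have hε : (forget k q).map F.ε.hom ≫ eqToHom (hV ⟨0⟩) = (forget k q).map G.ε.hom :=
    MonoidalSuperfunctor.epsilon_of_eq h
  have hμ : ∀ X Y, (forget k q).map (F.μ X Y).hom ≫ eqToHom (hV (X ⊗ Y)) =
      (eqToHom (hV X) ⊗ₘ eqToHom (hV Y)) ≫ (forget k q).map (G.μ X Y).hom :=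
    MonoidalSuperfunctor.mu_of_eq h
  have hobj : ∀ n : ℕ, F.obj ⟨n⟩ = G.obj ⟨n⟩ := by
    intro n
    induction n with
    | zero => exact eq_of_iso F.ε G.ε F.ε_even G.ε_even (hV ⟨0⟩) hε
    | succ n ih =>
      refine eq_of_iso (F.μ ⟨n⟩ ⟨1⟩) (eqToIso (congrArg₂ (· ⊗ ·) ih h1) ≪≫ G.μ ⟨n⟩ ⟨1⟩)
        (F.μ_even _ _) ((homParity_eqToHom (congrArg₂ (· ⊗ ·) ih h1)).comp0 (G.μ_even _ _)) (hV ⟨n + 1⟩) ?_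
      refine (hμ ⟨n⟩ ⟨1⟩).trans ?_
      rw [Iso.trans_hom, Functor.map_comp, eqToIso.hom, eqToHom_map, eqToHom_tensor k]
      rfl
  have inj : ∀ {X Y : OspMod k q} {f g : X ⟶ Y}, (forget k q).map f = (forget k q).map g → f = g :=
    fun h => hom_ext (congrArg SVec.lin h)
  refine MonoidalSuperfunctor.eq_of_eqToHom (fun X => hobj X.n) (fun {X Y} f => inj ?_)
    (fun X Y => inj ?_) (inj ?_)
  · rw [Functor.map_comp, Functor.map_comp, eqToHom_map, eqToHom_map]
    exact MonoidalSuperfunctor.map_of_eq h f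
  · rw [Functor.map_comp, Functor.map_comp, eqToHom_map, eqToHom_tensor k, eqToHom_map]
    refine (hμ X Y).trans ?_
    rw [eqToHom_tensor k]
    rfl
  · rw [Functor.map_comp, eqToHom_map]
    exact hε

end OspMod

/-! ### The equivalence -/

namespace OspMod

variable {k : Type u} [Field k] {q : kˣ}

/-- The parity shifts of `U`-supermodules. -/
noncomputable def parityShift (k : Type u) [Field k] (q : kˣ) :
    MonoidalSuperfunctor.ParityShift k (OspMod k q) where
  obj X a := X.shift a
  iso X a := X.shiftIso a
  parity := shiftIso_parity
  parity_inv := shiftIso_inv_parity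

end OspMod

theorem mainTheorem5 {k : Type u} [Field k] [CharZero k] (q : kˣ)
    (hq : ∀ n : ℕ, 0 < n → q ^ n ≠ 1) :
    (∃! F : MonoidalSuperfunctor k (STL k (stlParam q)) (OspMod k q),
      F.obj ⟨1⟩ = OspMod.V1 q ∧ F.comp (OspMod.forget k q) = stlG q) ∧
    ∀ F : MonoidalSuperfunctor k (STL k (stlParam q)) (OspMod k q),
      F.obj ⟨1⟩ = OspMod.V1 q → F.comp (OspMod.forget k q) = stlG q →
      ∃ (F' : MonoidalSuperfunctor k (PiEnv k (STL k (stlParam q))) (OspMod k q))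
        (F'' : SKar k (STL k (stlParam q)) ⥤ Underlying k (OspMod k q)) (_ : F''.Monoidal),
        ((PiEnv.incl k (STL k (stlParam q))).comp F').IsoTo F ∧
        (∃ θ : toSKar k (STL k (stlParam q)) ⋙ F'' ≅ F'.underlying, NatTrans.IsMonoidal θ.hom) ∧
        F''.Additive ∧ F''.IsEquivalence := by
  have hF : ∀ F : MonoidalSuperfunctor k (STL k (stlParam q)) (OspMod k q),
      F.obj ⟨1⟩ = OspMod.V1 q ∧ F.comp (OspMod.forget k q) = stlG q → F = OspMod.stlF q :=
    fun F h => OspMod.eq_of_comp_forget h.1 (h.2.trans (OspMod.stlF_comp_forget q).symm)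
  refine ⟨⟨OspMod.stlF q, ⟨rfl, OspMod.stlF_comp_forget q⟩, hF⟩, fun F h1 h2 => ?_⟩
  obtain rfl := hF F ⟨h1, h2⟩
  let S := OspMod.parityShift k q
  have hfaith : ∀ {X Y : STL k (stlParam q)} {f g : X ⟶ Y},
      (OspMod.stlF q).map f = (OspMod.stlF q).map g → f = g := OspMod.stlF_faithful
  have := (OspMod.stlF q).piLift_underlying_faithful S hfaith
  have := (OspMod.stlF q).piLift_underlying_full S hfaith (OspMod.stlF_full hq)
  obtain ⟨F'', hm, hθ, hadd, heq⟩ := AdditiveKaroubi.exists_monoidal_equivalence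
    ((OspMod.stlF q).piLift S).underlying (fun X => by
      obtain ⟨ι, _, c, s, a, b, ha, hb, hab⟩ := OspMod.exists_sum_comp_eq_id hq
        (W := OspMod.W q) (h := OspMod.hvec q) OspMod.hvec_wt OspMod.hvec_ne_zero
        (fun _ b hb => OspMod.W_e_eq_zero b hb) X.of
      let e := (Fintype.equivFin ι).symm
      refine ⟨Fintype.card ι, fun i => ⟨⟨⟨c (e i)⟩, s (e i)⟩⟩,
        fun i => Underlying.mk' (a (e i) ≫ (S.iso _ (s (e i))).hom)
          (((ha _).comp (S.parity _ _)).cast (zmod2_add_self _)),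
        fun i => Underlying.mk' ((S.iso _ (s (e i))).inv ≫ b (e i))
          (((S.parity_inv _ _).comp (hb _)).cast (zmod2_add_self _)), Underlying.hom_ext ?_⟩
      refine Eq.trans (map_sum (AddMonoidHom.mk' Underlying.val fun _ _ => rfl) _ _) ?_
      refine Eq.trans ?_ hab
      rw [← Equiv.sum_comp e]
      refine Finset.sum_congr rfl fun i _ => ?_
      change (a (e i) ≫ (S.iso _ (s (e i))).hom) ≫ (S.iso _ (s (e i))).inv ≫ b (e i) = _
      rw [Category.assoc, Iso.hom_inv_id_assoc])
  exact ⟨(OspMod.stlF q).piLift S, F'', hm, (OspMod.stlF q).incl_comp_piLift_isoTo S, hθ, hadd,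
    heq⟩
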